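/- Consider on $\mathbb R^4$ with $\Omega=dx_1\wedge dy_1+dx_2\wedge dy_2$ the champagne bottle Hamiltonian $H=\tfrac12(y_1^2+y_2^2)-(x_1^2+x_2^2)+(x_1^2+x_2^2)^2$ with second integral $J_2=x_1y_2-x_2y_1$. On the level $H=h$, $J_2=j$ let $I_1(h,j)=\frac1{2\pi}\oint p_r\,dr$ be the action over the curve $\tfrac12(p_r^2+j^2/r^2)+r^4-r^2=h$, and $I_2=j$. Scale $\tilde I_1=\sqrt2 I_1$, $\tilde j_2=\sqrt2 j$ and drop the tildes. The rotation number and the twist are $W(h,j_2)=-\partial I_1/\partial j_2$ and $\mathcal T(h,j_2)=\partial W/\partial j_2$, both at constant $h$; $W$ is defined up to integers (it jumps by $1$ across $j_2=0$, $h>0$), and $\mathcal T$ is understood there by continuous extension. All statements concern a neighbourhood of the focus-focus value $(h,j_2)=(0,0)$. 1. For $j_2\ne0$ the functions $I_1(h,\cdot)$ and $W(h,\cdot)$ are differentiable at $j_2$, and $\mathcal T$ is continuous at every value $\neq(0,0)$ near $(0,0)$. 2. Let $\mathcal J(h,j_2)=\frac{\sqrt2}{2\pi i}\oint_\alpha\frac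 wz\,dz$ with $w^2=-2z^3+2z^2+2hz-\tfrac12 j_2^2$, where $\alpha$ encircles $z=0$ and the two small roots and $w$ is the branch on $|z|=\frac12$ near $\sqrt2\,z\sqrt{1-z}$. There is a real-analytic $\bar H(j_1,j_2)$ near $0$ with $\bar H(\mathcal J(h,j_2),j_2)=h$, and every convergent Birkhoff normal form of $H$ at the origin (the function $K$ such that $H$, after the linear symplectic change $x=2^{-1/4}(q-p)/\sqrt2$, $y=2^{1/4}(q+p)/\sqrt2$ and a real-analytic near-identity symplectic change preserving $J_2$, equals $K(\sqrt2\,(q_1p_1+q_2p_2),\sqrt2\,(q_1p_2-q_2p_1))$) coincides with $\bar H$ near $0$. Use $j=(j_1,j_2)$, $h=\bar H(j)$, as coordinates, write $\mathcal T(j)=\mathcal T(\bar H(j),j_2)$, $W(j)=W(\bar H(j),j_2)$, $|j|^2=j_1^2+j_2^2$, and $A=\partial_{j_2}\bar H/\partial_{j_1}\bar H$. Then, near $0$: (a) $A(j)=\frac{j_2}4-\frac{15}{32}j_1j_2+\frac{j_2(135j_1^2+10j_2^2)}{128}+O(|j|^4)$; (b) for $j_2\neq0$, $W$ is differentiable at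 $j$ and $\mathcal T=-A\,\partial W/\partial j_1+\partial W/\partial j_2$; (c) for $j\ne0$, $$2\pi\mathcal T(j)=\frac{j_1(A^2-1)}{|j|^2}-\frac{2j_2A}{|j|^2}+R_1(j)+R_2(j)\ln\frac{16}{|j|},$$ where $R_1=-\frac38+\frac{77}{64}j_1+O(|j|^2)$ and $R_2=\frac14-\frac{15}{32}j_1+O(|j|^2)$ are real-analytic at $0$; (d) $\tilde{\mathcal T}(j)=|j|^2\,2\pi\mathcal T(j)$ (with $\tilde{\mathcal T}(0)=0$) is $C^1$ near $0$ and $\partial\tilde{\mathcal T}/\partial j_1(0)=-1$, $\partial\tilde{\mathcal T}/\partial j_2(0)=0$; (e) near $0$, the zero set of $\mathcal T$ together with the origin is a $C^1$ curve $j_1=g(j_2)$ with $g(0)=g'(0)=0$; that is, it passes through the focus-focus value and is tangent there to $j_1=0$. 3. In the $(h,j_2)$-plane the zero set of $\mathcal T$ near the origin, together with the origin, is likewise a $C^1$ curve $h=c(j_2)$ with $c(0)=c'(0)=0$. 4. At every value $\neq(0,0)$ near $(0,0)$ the Hamiltonian is locally a smooth function of smooth local actions $(I_1+kI_2,\,I_2)$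 ($k$ a locally chosen integer), and, for any such choice, the iso-energetic non-degeneracy condition $$\det\begin{pmatrix}\partial^2H/\partial I^2&\partial H/\partial I\\ \partial H/\partial I&0\end{pmatrix}\ne0$$ fails there if and only if $\mathcal T=0$. Hence it is violated exactly along that curve (away from the origin itself, where actions do not exist). -/

import Mathlib

open Filter Topology Asymptotics
open scoped ContDiff

namespace ChampagneBottle

noncomputable section

/-- Partial derivative in the first variable of a function on the plane. -/
def pd1 (f : ℝ × ℝ → ℝ) (p : ℝ × ℝ) : ℝ := fderiv ℝ f p (1, 0)

/-- Partial derivative in the second variable of a function on the plane. -/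
def pd2 (f : ℝ × ℝ → ℝ) (p : ℝ × ℝ) : ℝ := fderiv ℝ f p (0, 1)

/-! ### The system on the phase space -/

/-- The phase space `ℝ⁴`; a point is (positions, momenta). -/
abbrev Phase : Type := (Fin 2 → ℝ) × (Fin 2 → ℝ)

/-- The standard symplectic form `dx₁ ∧ dy₁ + dx₂ ∧ dy₂`. -/
def sympl (u v : Phase) : ℝ :=
  ∑ i, (u.1 i * v.2 i - u.2 i * v.1 i)

/-- The Hamiltonian `(y₁² + y₂²)/2 - (x₁² + x₂²) + (x₁² + x₂²)²`. -/
def hamiltonian (m : Phase) : ℝ :=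
  (m.2 0 ^ 2 + m.2 1 ^ 2) / 2 - (m.1 0 ^ 2 + m.1 1 ^ 2) + (m.1 0 ^ 2 + m.1 1 ^ 2) ^ 2

/-- The angular momentum `x₁ y₂ - x₂ y₁`. -/
def J₂ (m : Phase) : ℝ := m.1 0 * m.2 1 - m.1 1 * m.2 0

/-- The quadratic form `q₁ p₁ + q₂ p₂`. -/
def J₁ (m : Phase) : ℝ := m.1 0 * m.2 0 + m.1 1 * m.2 1

/-- The linear symplectic map `(q, p) ↦ (x, y)` with
`x = 2^(-1/4) (q - p)/√2`, `y = 2^(1/4) (q + p)/√2`. It carries the quadratic part of the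
Hamiltonian to `√2 J₁` and preserves `J₂`. -/
def williamson (m : Phase) : Phase :=
  (fun i => (2 : ℝ) ^ (-(1 / 4) : ℝ) * ((m.1 i - m.2 i) / √2),
   fun i => (2 : ℝ) ^ (1 / 4 : ℝ) * ((m.1 i + m.2 i) / √2))

/-- `K` is a (convergent) Birkhoff normal form of the Hamiltonian at the origin: some
real-analytic, near-identity, symplectic change of coordinates `Φ` that preserves `J₂` turns the
Hamiltonian into `K (√2 J₁, √2 J₂)`. The factors `√2` are the scaling `j̃ = √2 j` that is used
throughout. -/
def IsBirkhoffNormalForm (K : ℝ × ℝ → ℝ) : Prop :=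
  AnalyticAt ℝ K 0 ∧
  ∃ Φ : Phase → Phase,
    AnalyticAt ℝ Φ 0 ∧ Φ 0 = 0 ∧ fderiv ℝ Φ 0 = ContinuousLinearMap.id ℝ Phase ∧
    (∀ᶠ m in 𝓝 (0 : Phase), ∀ u v : Phase,
      sympl (fderiv ℝ Φ m u) (fderiv ℝ Φ m v) = sympl u v) ∧
    (∀ᶠ m in 𝓝 (0 : Phase), J₂ (Φ m) = J₂ m) ∧
    (∀ᶠ m in 𝓝 (0 : Phase),
      hamiltonian (williamson (Φ m)) = K (√2 * J₁ m, √2 * J₂ m))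

/-! ### The actions -/

/-- The radial momentum `p_r ≥ 0` on the curve `(p_r² + j²/r²)/2 + r⁴ - r² = h`. `Real.sqrt` makes
it `0` for those `r > 0` that are not on the projection of the curve. -/
def radialMomentum (h j r : ℝ) : ℝ :=
  √(2 * (h + r ^ 2 - r ^ 4) - j ^ 2 / r ^ 2)

/-- The nontrivial action `I₁ = (1/2π) ∮ p_r dr`; the closed curve runs twice over the interval
on which `p_r` is real, once with each sign of `p_r`. -/
def radialAction (h j : ℝ) : ℝ :=
  (1 / (2 * Real.pi)) * (2 * ∫ r in Set.Ioi (0 : ℝ), radialMomentum h j r)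

/-- The scaled action `Ĩ₁ = √2 I₁` as a function of `h` and of the scaled `j̃₂ = √2 j₂`. -/
def scaledAction (h j : ℝ) : ℝ := √2 * radialAction h (j / √2)

/-- The branch of `w = √(P z)`, `P z = -2z³ + 2z² + 2hz - j²/2`, that is near `√2 z √(1 - z)`
on the circle `|z| = 1/2`, for small `h` and `j`. -/
def wBranch (h j : ℝ) (z : ℂ) : ℂ :=
  (√2 : ℂ) * z * (1 - z + h / z - (j : ℂ) ^ 2 / (4 * z ^ 2)) ^ (1 / 2 : ℂ)

theorem wBranch_sq (h j : ℝ) {z : ℂ} (hz : z ≠ 0) :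
    wBranch h j z ^ 2 = -2 * z ^ 3 + 2 * z ^ 2 + 2 * h * z - (j : ℂ) ^ 2 / 2 := by
  have h2 : ((√2 : ℝ) : ℂ) ^ 2 = 2 := by
    rw [← Complex.ofReal_pow, Real.sq_sqrt (by norm_num)]; norm_num
  have hc : ∀ c : ℂ, (c ^ (1 / 2 : ℂ)) ^ 2 = c := fun c => by
    rw [one_div]
    exact_mod_cast Complex.cpow_nat_inv_pow c (n := 2) (by norm_num)
  rw [wBranch, mul_pow, mul_pow, hc, h2]
  field_simp
  ring

/-- The action along the vanishing cycle, `(√2 / 2πi) ∮_α (w/z) dz`: for small `h, j` the circle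
`|z| = 1/2` encloses the two small roots of `P` and `0`, and not the root near `1`.
The integral is real; `re` only changes the type. -/
def vanishingAction (h j : ℝ) : ℝ :=
  ((√2 : ℂ) / (2 * Real.pi * Complex.I) * ∮ z in C(0, 1 / 2), wBranch h j z / z).re

/-! ### Rotation number and twist -/

/-- The rotation number `W = -∂I₁/∂j₂` at constant `h`, in scaled variables. The derivative is
taken from the right, which matters only at `j₂ = 0`: for `h > 0` the value of `W` jumps there by
`1`, because the cycle that defines `I₁` does; elsewhere the function is differentiable. -/
def rotationNumber (h j : ℝ) : ℝ :=
  -derivWithin (fun s => scaledAction h s) (Set.Ici j) j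

/-- The twist `𝒯 = ∂W/∂j₂` at constant `h` (from the right, which again matters only at
`j₂ = 0`, where it gives the continuous extension). -/
def twist (h j : ℝ) : ℝ :=
  derivWithin (fun s => rotationNumber h s) (Set.Ici j) j

/-- The rotation number in the coordinates `(j₁, j₂)`, where `h = H̄(j₁, j₂)`. -/
def rotationNF (Hbar : ℝ × ℝ → ℝ) (j : ℝ × ℝ) : ℝ := rotationNumber (Hbar j) j.2

/-- The twist in the coordinates `(j₁, j₂)`, where `h = H̄(j₁, j₂)`. -/
def twistNF (Hbar : ℝ × ℝ → ℝ) (j : ℝ × ℝ) : ℝ := twist (Hbar j) j.2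

/-- `A = ∂_{j₂} H̄ / ∂_{j₁} H̄`. -/
def slope (Hbar : ℝ × ℝ → ℝ) (j : ℝ × ℝ) : ℝ := pd2 Hbar j / pd1 Hbar j

/-- `|j|² · 2π𝒯(j)`. -/
def twistTilde (Hbar : ℝ × ℝ → ℝ) (j : ℝ × ℝ) : ℝ :=
  (j.1 ^ 2 + j.2 ^ 2) * (2 * Real.pi * twistNF Hbar j)

/-! ### The iso-energetic non-degeneracy condition (in the unscaled actions) -/

/-- `A` is a smooth local action near the value `p = (h, j₂)` that completes `I₂ = j₂` to a
system of actions: it is `I₁` up to the choice of the cycle, i.e. up to integer multiples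
of `I₂`. -/
def IsLocalAction (A : ℝ × ℝ → ℝ) (p : ℝ × ℝ) : Prop :=
  ContDiffAt ℝ ∞ A p ∧ ∀ᶠ q in 𝓝 p, ∃ k : ℤ, A q = radialAction q.1 q.2 + k * q.2

/-- `F` is the Hamiltonian as a function of the actions `(I₁, I₂) = (A, j₂)` near
the value `p = (h, j₂)`. -/
def IsActionHamiltonian (A F : ℝ × ℝ → ℝ) (p : ℝ × ℝ) : Prop :=
  IsLocalAction A p ∧ ContDiffAt ℝ ∞ F (A p, p.2) ∧ ∀ᶠ q in 𝓝 p, F (A q, q.2) = q.1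

/-- The bordered Hessian determinant of `F`; the iso-energetic non-degeneracy condition is that it
does not vanish. -/
def isoenergeticDet (F : ℝ × ℝ → ℝ) (I : ℝ × ℝ) : ℝ :=
  Matrix.det !![pd1 (pd1 F) I, pd2 (pd1 F) I, pd1 F I;
                pd1 (pd2 F) I, pd2 (pd2 F) I, pd2 F I;
                pd1 F I, pd2 F I, 0]

end

end ChampagneBottle

/-! The action is a period of the curve `w² = P z`, two of whose branch points collide near `z = 0`
at the focus-focus value. It is therefore analytic there up to a term dictated by monodromy. With
`J` the vanishing action, `2π I₁ = U - J log √(J² + j₂²) - |j₂| (π/2 + arctan (J / |j₂|))`, where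
`U` is analytic at the origin (`exists_scaledAction_eq`). To prove this uniformly, the cubic is
parametrised by its roots through `h = b (1 + b) + s²`, `j₂ = 2 s √(1 + b)`, and the colliding pair
is unfolded by `z = ξ + d/ξ - b/2` with `16 d = b² + 4 s²`. Apart from an elementary pole term, the
transformed integrand is invariant under `ξ ↦ d/ξ` and its Laurent coefficients are analytic in `(b,
d)`: the constant one gives the logarithm with coefficient `J`, the others integrate to an analytic
function (`integral_psi_div`).

Differentiating twice in `j₂` gives `2π𝒯` in closed form (`twistFormula`). The differentials of `J
log ρ` and of the angular term combine to multiples of `dJ`, so rational terms enter only with the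
second derivative. In coordinates with `J = j₁` one has `A = -∂J/∂j₂`, and `R₁`, `R₂` come from the
second derivatives of `U` and `J`. The Taylor coefficients of `J`, hence those of `A` and `R₂`, are
residues (`moment_one_zero`, `moment_zero_succ`). `U` is not given by residues: its contribution is
read off on the half-axis `j₂ = 0`, `h < 0`, where `𝒯` is a complete elliptic integral with a known
logarithmic expansion (`tendsto_twist_axis`). Evenness in `j₂` makes this sufficient to first order.

Since `|j|² log |j|²` is `C¹`, so is `|j|² 2π𝒯`, with gradient `(-1, 0)` at the origin; the implicit
function theorem gives the curve, and `H̄` carries it to the plane of values.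

A Birkhoff normal form conjugates the fibres to those of a linear flow that is `2πi`-periodic in
imaginary time. The complexified orbits are loops to which the vanishing action can be compared, and
symplectic maps change the Liouville form by an exact form only, so `J (K j, j₂) = j₁`
(`IsConjugation.vanishingAction_eq`); this determines `K`.

Finally, differentiating `F (A (h, j₂), j₂) = h` twice shows that the bordered determinant is
`(∂F/∂I₁)³ ∂²A/∂j₂²`, and integer multiples of `j₂` do not affect the second derivative. -/

section AnalyticIntegral

/-! ### Analytic dependence of integrals on a parameter -/

@[fun_prop]
theorem AnalyticAt.comp_fst {𝕜 X Y Z : Type*} [NontriviallyNormedField 𝕜]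
    [NormedAddCommGroup X] [NormedSpace 𝕜 X] [NormedAddCommGroup Y] [NormedSpace 𝕜 Y]
    [NormedAddCommGroup Z] [NormedSpace 𝕜 Z] {f : X → Y × Z} {x : X} (hf : AnalyticAt 𝕜 f x) :
    AnalyticAt 𝕜 (fun x => (f x).1) x :=
  analyticAt_fst.comp hf

@[fun_prop]
theorem AnalyticAt.comp_snd {𝕜 X Y Z : Type*} [NontriviallyNormedField 𝕜]
    [NormedAddCommGroup X] [NormedSpace 𝕜 X] [NormedAddCommGroup Y] [NormedSpace 𝕜 Y]
    [NormedAddCommGroup Z] [NormedSpace 𝕜 Z] {f : X → Y × Z} {x : X} (hf : AnalyticAt 𝕜 f x) :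
    AnalyticAt 𝕜 (fun x => (f x).2) x :=
  analyticAt_snd.comp hf

variable {E F : Type*} [NormedAddCommGroup E] [NormedSpace ℝ E]
  [NormedAddCommGroup F] [NormedSpace ℝ F]

/-- The double series of the expansion of `p (x + y)` converges absolutely for shift and argument
both of size `r`; its total sum bounds every recentred coefficient, whatever the new centre. -/
theorem FormalMultilinearSeries.exists_norm_changeOrigin_mul_pow_le
    (p : FormalMultilinearSeries ℝ E F) {r : NNReal} (hr : (r + r : ENNReal) < p.radius) :
    ∃ C : ℝ, ∀ x : E, ‖x‖₊ ≤ r → ∀ k, ‖p.changeOrigin x k‖ * (r : ℝ) ^ k ≤ C := by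
  have hs := p.changeOriginSeries_summable_aux₁ hr
  have hs2 := NNReal.summable_sigma.1 hs
  refine ⟨((∑' k : ℕ, ∑' s : Σ l : ℕ, { s : Finset (Fin (k + l)) // s.card = l },
    ‖p (k + s.1)‖₊ * r ^ s.1 * r ^ k : NNReal) : ℝ), fun x hx k => ?_⟩
  have hx' : (‖x‖₊ : ENNReal) < p.radius :=
    lt_of_le_of_lt (le_trans (by exact_mod_cast hx) (le_add_right le_rfl)) hr
  have hr' : (r : ENNReal) < p.radius := lt_of_le_of_lt (le_add_right le_rfl) hr
  have h1 := p.nnnorm_changeOrigin_le k hx'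
  have h2 : ∑' s : Σ l : ℕ, { s : Finset (Fin (k + l)) // s.card = l }, ‖p (k + s.1)‖₊ * ‖x‖₊ ^ s.1
      ≤ ∑' s : Σ l : ℕ, { s : Finset (Fin (k + l)) // s.card = l }, ‖p (k + s.1)‖₊ * r ^ s.1 := by
    refine Summable.tsum_le_tsum (fun s => ?_) (p.changeOriginSeries_summable_aux₂ hx' k)
      (p.changeOriginSeries_summable_aux₂ hr' k)
    gcongr
  have h3 : ‖p.changeOrigin x k‖₊ * r ^ k ≤
      ∑' k : ℕ, ∑' s : Σ l : ℕ, { s : Finset (Fin (k + l)) // s.card = l },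
        ‖p (k + s.1)‖₊ * r ^ s.1 * r ^ k := by
    refine le_trans ?_ (hs2.2.le_tsum k (fun _ _ => zero_le))
    calc ‖p.changeOrigin x k‖₊ * r ^ k ≤ (∑' s : Σ l : ℕ, { s : Finset (Fin (k + l)) // s.card = l },
          ‖p (k + s.1)‖₊ * r ^ s.1) * r ^ k := by gcongr; exact h1.trans h2
      _ = _ := (NNReal.tsum_mul_right _ _).symm
  exact_mod_cast h3

/-- Recentring the joint series at `(0, t - t₀)` and restricting it to `E` leaves a power series in
the parameter alone. Its coefficients are continuous in `t` with bounds uniform in `t`, which is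
what termwise integration needs. -/
theorem AnalyticAt.exists_parametric_series [CompleteSpace F] {f : E × ℝ → F} {x₀ : E} {t₀ : ℝ}
    (hf : AnalyticAt ℝ f (x₀, t₀)) :
    ∃ (q : ℝ → FormalMultilinearSeries ℝ E F) (C : ℝ) (r : NNReal), 0 < r ∧
      (∀ n, ContinuousOn (fun t => q t n) (Metric.ball t₀ r)) ∧
      (∀ t ∈ Metric.ball t₀ (r : ℝ), ∀ n, ‖q t n‖ * (r : ℝ) ^ n ≤ C) ∧
      ∀ t ∈ Metric.ball t₀ (r : ℝ), ∀ y, ‖y‖ < r →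
        HasSum (fun n => q t n fun _ => y) (f (x₀ + y, t)) := by
  obtain ⟨p, R, hp⟩ := hf
  have hp0 : 0 < R := hp.r_pos
  obtain ⟨R', hR'0, hR'⟩ : ∃ R' : NNReal, 0 < R' ∧ (R' : ENNReal) < R := by
    obtain ⟨a, ha, ha'⟩ := ENNReal.lt_iff_exists_nnreal_btwn.1 hp0
    exact ⟨a, by exact_mod_cast ha, ha'⟩
  -- Half of the radius is spent on moving the centre, half on the new variable.
  set r : NNReal := R' / 2 with hr
  have hr0 : 0 < r := by positivity
  have hrr : (r + r : ENNReal) < R := by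
    have : r + r = R' := by rw [hr]; exact add_halves R'
    rw [← ENNReal.coe_add, this]; exact hR'
  have hrad : (r + r : ENNReal) < p.radius := hrr.trans_le hp.r_le
  obtain ⟨C, hC⟩ := p.exists_norm_changeOrigin_mul_pow_le hrad
  have hC0 : 0 ≤ C := le_trans (by positivity) (hC 0 (by simp) 0)
  set ι : E →L[ℝ] E × ℝ := ContinuousLinearMap.inl ℝ E ℝ
  have hι : ‖ι‖ ≤ 1 := ContinuousLinearMap.norm_inl_le_one ℝ E ℝ
  have hnorm : ∀ t ∈ Metric.ball t₀ (r : ℝ), ‖((0 : E), t - t₀)‖₊ < r := by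
    intro t ht
    have : ‖((0 : E), t - t₀)‖ < r := by
      simpa [Prod.norm_def, hr0, ← Real.dist_eq] using ht
    exact_mod_cast this
  refine ⟨fun t => (p.changeOrigin (0, t - t₀)).compContinuousLinearMap ι, C, r, hr0, ?_, ?_, ?_⟩
  · intro n
    have h1 : ContinuousOn (fun x => p.changeOrigin x n) (Metric.eball 0 p.radius) :=
      (p.hasFPowerSeriesOnBall_changeOrigin n (hp0.trans_le hp.r_le)).continuousOn
    have h2 : ContinuousOn (fun t : ℝ => p.changeOrigin ((0 : E), t - t₀) n)
        (Metric.ball t₀ r) := by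
      refine h1.comp (by fun_prop) fun t ht => ?_
      rw [mem_eball_zero_iff, enorm_eq_nnnorm]
      exact lt_trans (by exact_mod_cast hnorm t ht) (lt_of_le_of_lt (le_add_right le_rfl) hrad)
    exact ((ContinuousMultilinearMap.compContinuousLinearMapL
      (fun _ : Fin n => ι)).continuous.comp_continuousOn h2)
  · intro t ht n
    refine le_trans ?_ (hC _ (hnorm t ht).le n)
    gcongr
    refine ((p.changeOrigin _ n).norm_compContinuousLinearMap_le _).trans ?_
    refine mul_le_of_le_one_right (norm_nonneg _) ?_
    simp only [Finset.prod_const]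
    exact pow_le_one₀ (norm_nonneg _) hι
  · intro t ht y hy
    have h1 := hp.changeOrigin (y := ((0 : E), t - t₀))
      (lt_trans (by exact_mod_cast hnorm t ht) (lt_of_le_of_lt (le_add_right le_rfl) hrr))
    have h2 := h1.hasSum (y := (y, 0)) (by
      rw [mem_eball_zero_iff, enorm_eq_nnnorm, lt_tsub_iff_right]
      refine lt_of_lt_of_le ?_ hrr.le
      have hy' : ‖(y, (0:ℝ))‖₊ < r := by
        have : ‖(y, (0:ℝ))‖ < r := by simpa [Prod.norm_def, hr0] using hy
        exact_mod_cast this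
      exact ENNReal.add_lt_add (by exact_mod_cast hy') (by exact_mod_cast hnorm t ht))
    have h3 : (x₀, t₀) + ((0 : E), t - t₀) + (y, (0 : ℝ)) = (x₀ + y, t) := by simp
    rw [h3] at h2
    exact h2

/-- The parametric series is integrated term by term; its geometric bounds give both the radius of
the integrated series and the domination. -/
theorem AnalyticAt.exists_ball_analyticAt_intervalIntegral [CompleteSpace F] {f : E × ℝ → F}
    {x₀ : E} {t₀ : ℝ} (hf : AnalyticAt ℝ f (x₀, t₀)) :
    ∃ δ > 0, ∀ a ∈ Metric.ball t₀ δ, ∀ b ∈ Metric.ball t₀ δ,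
      AnalyticAt ℝ (fun x => ∫ t in a..b, f (x, t)) x₀ := by
  obtain ⟨q, C, r, hr, hq, hC, hsum⟩ := hf.exists_parametric_series
  refine ⟨r, hr, fun a ha b hb => ?_⟩
  have hsub : Set.uIcc a b ⊆ Metric.ball t₀ r := by
    rw [Real.ball_eq_Ioo] at *
    exact Set.OrdConnected.uIcc_subset Set.ordConnected_Ioo ha hb
  have hsub' : Set.uIoc a b ⊆ Metric.ball t₀ r := Set.uIoc_subset_uIcc.trans hsub
  have hint : ∀ n, IntervalIntegrable (fun t => q t n) MeasureTheory.volume a b := fun n =>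
    ((hq n).mono hsub).intervalIntegrable
  have hr' : (0 : ℝ) < r := hr
  have hbd : ∀ t ∈ Set.uIoc a b, ∀ n, ‖q t n‖ ≤ C / (r : ℝ) ^ n := fun t ht n => by
    rw [le_div_iff₀ (by positivity)]; exact hC t (hsub' ht) n
  have hC0 : 0 ≤ C := le_trans (by positivity) (hC t₀ (Metric.mem_ball_self hr') 0)
  refine ⟨fun n => ∫ t in a..b, q t n, r, ?_, by exact_mod_cast hr, ?_⟩
  · refine FormalMultilinearSeries.le_radius_of_bound _ (C * |b - a|) fun n => ?_
    have := intervalIntegral.norm_integral_le_of_norm_le_const (fun t ht => hbd t ht n)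
    calc _ ≤ C / (r : ℝ) ^ n * |b - a| * (r : ℝ) ^ n := by gcongr
      _ = _ := by field_simp
  · intro y hy
    rw [mem_eball_zero_iff, enorm_eq_nnnorm] at hy
    have hy' : ‖y‖ < r := by exact_mod_cast hy
    have happ : ∀ n, (∫ t in a..b, q t n) (fun _ => y) = ∫ t in a..b, q t n (fun _ => y) := by
      intro n
      exact ((ContinuousMultilinearMap.apply ℝ (fun _ : Fin n => E) F
        (fun _ => y)).intervalIntegral_comp_comm (hint n)).symm
    simp only [happ]
    refine intervalIntegral.hasSum_integral_of_dominated_convergence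
      (fun n _ => C * (‖y‖ / r) ^ n) ?_ ?_ ?_ ?_ ?_
    · intro n
      have hc : ContinuousOn (fun t => q t n fun _ => y) (Set.uIcc a b) :=
        (ContinuousMultilinearMap.apply ℝ (fun _ : Fin n => E) F
          (fun _ => y)).continuous.comp_continuousOn ((hq n).mono hsub)
      exact (hc.mono Set.uIoc_subset_uIcc).aestronglyMeasurable measurableSet_uIoc
    · intro n
      filter_upwards with t ht
      refine ((q t n).le_opNorm _).trans ?_
      simp only [Finset.prod_const, Finset.card_univ, Fintype.card_fin]
      calc _ ≤ C / (r : ℝ) ^ n * ‖y‖ ^ n := by gcongr; exact hbd t ht n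
        _ = _ := by rw [div_pow]; ring
    · filter_upwards with t ht
      exact (summable_geometric_of_lt_one (by positivity) ((div_lt_one hr').2 hy')).mul_left _
    · simp
    · filter_upwards with t ht
      exact hsum t (hsub' ht) y hy'

theorem AnalyticAt.intervalIntegrable_eventually [CompleteSpace F] {f : E × ℝ → F} {x₀ : E}
    {a b : ℝ} (hf : ∀ t ∈ Set.uIcc a b, AnalyticAt ℝ f (x₀, t)) :
    ∀ᶠ x in 𝓝 x₀, ContinuousOn (fun t => f (x, t)) (Set.uIcc a b) := by
  have h := isCompact_uIcc.eventually_forall_of_forall_eventually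
    (x₀ := x₀) (P := fun x t => ContinuousAt f (x, t)) (K := Set.uIcc a b) (fun t ht => by
      filter_upwards [(hf t ht).eventually_analyticAt] with p hp using hp.continuousAt)
  filter_upwards [h] with x hx t ht
  exact ((hx t ht).comp (f := fun t => (x, t)) (by fun_prop)).continuousWithinAt

/-- The integral of a jointly analytic function over a compact interval depends analytically on the
parameter. -/
theorem AnalyticAt.intervalIntegral [CompleteSpace F] {f : E × ℝ → F} {x₀ : E} {a b : ℝ}
    (hf : ∀ t ∈ Set.uIcc a b, AnalyticAt ℝ f (x₀, t)) :
    AnalyticAt ℝ (fun x => ∫ t in a..b, f (x, t)) x₀ := by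
  wlog hab : a ≤ b generalizing a b
  · have := this (a := b) (b := a) (by rwa [Set.uIcc_comm]) (le_of_not_ge hab)
    simp_rw [intervalIntegral.integral_symm b a]
    exact this.neg
  rw [Set.uIcc_of_le hab] at hf
  -- The local result is propagated along the interval: the set of admissible upper limits is closed
  -- and open to the right.
  set S : Set ℝ := {s | AnalyticAt ℝ (fun x => ∫ t in a..s, f (x, t)) x₀}
  have step : ∀ t ∈ Set.Icc a b, ∃ δ > 0, ∀ c ∈ Metric.ball t δ ∩ Set.Icc a b,
      ∀ d ∈ Metric.ball t δ ∩ Set.Icc a b, c ∈ S → d ∈ S := by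
    intro t ht
    obtain ⟨δ, hδ, h⟩ := (hf t ht).exists_ball_analyticAt_intervalIntegral
    refine ⟨δ, hδ, fun c hc d hd hcS => ?_⟩
    have h2 := h c hc.1 d hd.1
    refine (AnalyticAt.add hcS h2).congr ?_
    have hev := AnalyticAt.intervalIntegrable_eventually (a := a) (b := b)
      (by rwa [Set.uIcc_of_le hab])
    filter_upwards [hev] with x hx
    rw [Set.uIcc_of_le hab] at hx
    refine intervalIntegral.integral_add_adjacent_intervals ?_ ?_
    · refine (hx.mono ?_).intervalIntegrable
      rw [Set.uIcc_of_le hc.2.1]; exact Set.Icc_subset_Icc le_rfl hc.2.2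
    · refine (hx.mono ?_).intervalIntegrable
      exact Set.OrdConnected.uIcc_subset Set.ordConnected_Icc hc.2 hd.2
  have hcl : IsClosed (S ∩ Set.Icc a b) := by
    rw [← isSeqClosed_iff_isClosed]
    intro u t hu hut
    have ht : t ∈ Set.Icc a b := isClosed_Icc.mem_of_tendsto hut (.of_forall fun n => (hu n).2)
    obtain ⟨δ, hδ, h⟩ := step t ht
    obtain ⟨n, hn⟩ := (hut.eventually (Metric.ball_mem_nhds t hδ)).exists
    exact ⟨h (u n) ⟨hn, (hu n).2⟩ t ⟨Metric.mem_ball_self hδ, ht⟩ (hu n).1, ht⟩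
  have haS : a ∈ S := by
    simp only [S, Set.mem_ofPred_eq, intervalIntegral.integral_same]
    exact analyticAt_const
  have := hcl.Icc_subset_of_forall_mem_nhdsWithin haS (fun t ht => by
    obtain ⟨δ, hδ, h⟩ := step t ⟨ht.2.1, ht.2.2.le⟩
    have h1 : Metric.ball t δ ∈ 𝓝[>] t := mem_nhdsWithin_of_mem_nhds (Metric.ball_mem_nhds t hδ)
    have h2 : Set.Ioc t b ∈ 𝓝[>] t := Ioc_mem_nhdsGT ht.2.2
    filter_upwards [h1, h2] with d hd hd'
    exact h t ⟨Metric.mem_ball_self hδ, ht.2.1, ht.2.2.le⟩ d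
      ⟨hd, ht.2.1.trans hd'.1.le, hd'.2⟩ ht.1)
  exact this ⟨hab, le_rfl⟩

end AnalyticIntegral

/-! ### Differentiation under the integral sign and Hadamard's lemma -/

section ParametricDerivative

variable {E F : Type*} [NormedAddCommGroup E] [NormedSpace ℝ E]
  [NormedAddCommGroup F] [NormedSpace ℝ F] [CompleteSpace F]

theorem hasFDerivAt_intervalIntegral_of_analyticAt {f : E × ℝ → F} {x₀ : E} {a b : ℝ}
    (hf : ∀ t ∈ Set.uIcc a b, AnalyticAt ℝ f (x₀, t)) :
    HasFDerivAt (fun x => ∫ t in a..b, f (x, t))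
      (∫ t in a..b, (fderiv ℝ f (x₀, t)).comp (ContinuousLinearMap.inl ℝ E ℝ)) x₀ := by
  have hc : ContinuousOn (fun t => fderiv ℝ f (x₀, t)) (Set.uIcc a b) := fun t ht =>
    ((hf t ht).fderiv.continuousAt.comp (f := fun t => (x₀, t)) (by fun_prop)).continuousWithinAt
  obtain ⟨C, hC⟩ := isCompact_uIcc.exists_bound_of_continuousOn hc
  -- By compactness one neighbourhood of `x₀` serves all `t`; there `C + 1` is the majorant of the
  -- derivative.
  have hev := isCompact_uIcc.eventually_forall_of_forall_eventually
    (x₀ := x₀) (P := fun x t => AnalyticAt ℝ f (x, t) ∧ ‖fderiv ℝ f (x, t)‖ < C + 1)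
    (K := Set.uIcc a b) (fun t ht => by
      have h1 := (hf t ht).eventually_analyticAt
      have h2 := (hf t ht).fderiv.continuousAt.norm.eventually_lt
        (continuousAt_const (y := C + 1)) (by linarith [hC t ht])
      filter_upwards [h1, h2] with p hp hp' using ⟨hp, hp'⟩)
  have hcx : ∀ x, (∀ t ∈ Set.uIcc a b, AnalyticAt ℝ f (x, t) ∧ ‖fderiv ℝ f (x, t)‖ < C + 1) →
      ContinuousOn (fun t => f (x, t)) (Set.uIcc a b) := fun x hx t ht =>
    ((hx t ht).1.continuousAt.comp (f := fun t => (x, t)) (by fun_prop)).continuousWithinAt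
  refine intervalIntegral.hasFDerivAt_integral_of_dominated_of_fderiv_le (𝕜 := ℝ)
    (F' := fun x t => (fderiv ℝ f (x, t)).comp (ContinuousLinearMap.inl ℝ E ℝ))
    (bound := fun _ => C + 1) hev ?_ ?_ ?_ ?_ ?_ ?_
  · filter_upwards [hev] with x hx
    exact ((hcx x hx).mono Set.uIoc_subset_uIcc).aestronglyMeasurable measurableSet_uIoc
  · exact (hcx x₀ hev.self_of_nhds).intervalIntegrable
  · have : ContinuousOn (fun t => (fderiv ℝ f (x₀, t)).comp (ContinuousLinearMap.inl ℝ E ℝ))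
        (Set.uIcc a b) := hc.clm_comp continuousOn_const
    exact (this.mono Set.uIoc_subset_uIcc).aestronglyMeasurable measurableSet_uIoc
  · filter_upwards with t ht x hx
    have h := hx t (Set.uIoc_subset_uIcc ht)
    refine (ContinuousLinearMap.opNorm_comp_le _ _).trans ?_
    have h1 := ContinuousLinearMap.norm_inl_le_one ℝ E ℝ
    have h2 := norm_nonneg (fderiv ℝ f (x, t))
    nlinarith [h.2]
  · simp
  · filter_upwards with t ht x hx
    have h := hx t (Set.uIoc_subset_uIcc ht)
    exact h.1.differentiableAt.hasFDerivAt.comp (f := fun x => (x, t)) x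
      (hasFDerivAt_prodMk_left x t)

/-- Hadamard's lemma for analytic functions. -/
theorem AnalyticAt.exists_eq_smul {f : E × ℝ → F} {x₀ : E}
    (hf : AnalyticAt ℝ f (x₀, 0)) (h0 : ∀ᶠ x in 𝓝 x₀, f (x, 0) = 0) :
    ∃ g : E × ℝ → F, AnalyticAt ℝ g (x₀, 0) ∧
      ∀ᶠ p in 𝓝 ((x₀, 0) : E × ℝ), f p = p.2 • g p := by
  refine ⟨fun p => ∫ t in (0 : ℝ)..1, fderiv ℝ f (p.1, t * p.2) (0, 1), ?_, ?_⟩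
  · refine AnalyticAt.intervalIntegral
      (f := fun q : (E × ℝ) × ℝ => fderiv ℝ f (q.1.1, q.2 * q.1.2) (0, 1)) fun t _ => ?_
    have h1 : AnalyticAt ℝ (fun q : (E × ℝ) × ℝ => (q.1.1, q.2 * q.1.2)) ((x₀, 0), t) := by
      fun_prop
    have h2 : AnalyticAt ℝ (fderiv ℝ f) ((fun q : (E × ℝ) × ℝ => (q.1.1, q.2 * q.1.2))
        ((x₀, 0), t)) := by simpa using hf.fderiv
    have h3 := AnalyticAt.comp (f := fun q : (E × ℝ) × ℝ => (q.1.1, q.2 * q.1.2)) h2 h1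
    exact ((ContinuousLinearMap.apply ℝ F ((0 : E), (1 : ℝ))).analyticAt _).comp h3
  · obtain ⟨r, hr, han⟩ := hf.exists_ball_analyticOnNhd
    have hb : ∀ᶠ p in 𝓝 ((x₀, 0) : E × ℝ), p ∈ Metric.ball ((x₀, 0) : E × ℝ) r :=
      Metric.ball_mem_nhds _ hr
    have h0' : ∀ᶠ p in 𝓝 ((x₀, 0) : E × ℝ), f (p.1, 0) = 0 :=
      (continuousAt_fst (p := ((x₀, 0) : E × ℝ))).eventually h0
    filter_upwards [hb, h0'] with p hp hp0
    have hmem : ∀ t ∈ Set.uIcc (0 : ℝ) 1, (p.1, t * p.2) ∈ Metric.ball ((x₀, 0) : E × ℝ) r := by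
      intro t ht
      rw [Set.uIcc_of_le zero_le_one] at ht
      rw [Metric.mem_ball, Prod.dist_eq, max_lt_iff] at hp ⊢
      refine ⟨hp.1, lt_of_le_of_lt ?_ hp.2⟩
      simp only [Real.dist_eq, sub_zero, abs_mul, abs_of_nonneg ht.1]
      exact mul_le_of_le_one_left (abs_nonneg _) ht.2
    have hder : ∀ t ∈ Set.uIcc (0 : ℝ) 1, HasDerivAt (fun t : ℝ => f (p.1, t * p.2))
        (p.2 • fderiv ℝ f (p.1, t * p.2) (0, 1)) t := by
      intro t ht
      have h1 := (han _ (hmem t ht)).differentiableAt.hasFDerivAt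
      have h2 : HasDerivAt (fun t : ℝ => (p.1, t * p.2)) ((0 : E), p.2) t := by
        have := (hasDerivAt_id t).mul_const p.2
        simpa using (hasDerivAt_const t p.1).prodMk this
      have h3 := h1.comp_hasDerivAt t h2
      have : ((0 : E), p.2) = p.2 • ((0 : E), (1 : ℝ)) := by simp
      rw [this, map_smul] at h3
      exact h3
    have hcont : ContinuousOn (fun t : ℝ => p.2 • fderiv ℝ f (p.1, t * p.2) (0, 1))
        (Set.uIcc 0 1) := by
      intro t ht
      have h1 : ContinuousAt (fun t : ℝ => fderiv ℝ f (p.1, t * p.2)) t :=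
        (han _ (hmem t ht)).fderiv.continuousAt.comp (f := fun t : ℝ => (p.1, t * p.2))
          (by fun_prop)
      exact (continuousAt_const.smul (h1.clm_apply continuousAt_const)).continuousWithinAt
    have := intervalIntegral.integral_eq_sub_of_hasDerivAt hder hcont.intervalIntegrable
    rw [intervalIntegral.integral_smul] at this
    simp only [one_mul, zero_mul, hp0, sub_zero] at this
    exact this.symm

end ParametricDerivative

/-! ### Contour integrals on annuli -/

section ComplexLoops

open Complex

/-- The principal root inverts squaring on the right half-plane. An explicit root found along a loop
is identified with the chosen branch in this way. -/
theorem Complex.cpow_half_eq_of_sq_eq {u v : ℂ} (h : u ^ 2 = v) (hu : 0 < u.re) :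
    v ^ (1 / 2 : ℂ) = u := by
  have h2 : (1 / 2 : ℂ) = ((2 : ℕ) : ℂ)⁻¹ := by norm_num
  have hargs := Complex.abs_arg_lt_pi_div_two_iff.2 (Or.inl hu)
  rw [abs_lt] at hargs
  rw [← h, h2, Complex.pow_cpow_nat_inv two_ne_zero]
  · push_cast; linarith [hargs.1]
  · push_cast; linarith [hargs.2]

/-- A closed loop in an annulus, given by a lift through the exponential. -/
theorem integral_exp_lift_eq_circleIntegral {f : ℂ → ℂ} {r₁ r₂ R : ℝ} (h₁ : 0 < r₁)
    (hR₁ : r₁ < R) (hR₂ : R < r₂)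
    (hf : ∀ z : ℂ, r₁ < ‖z‖ → ‖z‖ < r₂ → DifferentiableAt ℂ f z)
    {s s' : ℝ → ℂ} (hs : ∀ t, HasDerivAt s (s' t) t) (hs' : Continuous s')
    (hmem : ∀ t, r₁ < ‖exp (s t)‖ ∧ ‖exp (s t)‖ < r₂) (n : ℕ)
    (hper : s (2 * Real.pi) = s 0 + n * (2 * Real.pi * I)) :
    ∫ t in (0 : ℝ)..2 * Real.pi, f (exp (s t)) * (exp (s t) * s' t)
      = n * ∮ z in C(0, R), f z := by
  set S : Set ℂ := {w | Real.log r₁ < w.re} ∩ {w | w.re < Real.log r₂} with hS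
  have hr₂ : 0 < r₂ := by linarith
  have hSo : IsOpen S := (isOpen_lt continuous_const continuous_re).inter
    (isOpen_lt continuous_re continuous_const)
  have hSc : Convex ℝ S := (convex_halfSpace_re_gt _).inter (convex_halfSpace_re_lt _)
  have hSmem : ∀ w : ℂ, w ∈ S ↔ r₁ < ‖exp w‖ ∧ ‖exp w‖ < r₂ := by
    intro w
    rw [norm_exp]
    show (_ ∧ _) ↔ _
    exact and_congr (Real.log_lt_iff_lt_exp h₁) (Real.lt_log_iff_exp_lt hr₂)
  -- `f` need not have a primitive on the annulus, but `f (exp w) * exp w` has one on the convex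
  -- strip of logarithms.
  obtain ⟨G, hG⟩ := hSc.exists_forall_hasDerivWithinAt (𝕜 := ℂ)
    (f := fun w => f (exp w) * exp w) (fun w hw => by
      have := hf (exp w) ((hSmem w).1 hw).1 ((hSmem w).1 hw).2
      exact ((this.comp w differentiableAt_exp).mul differentiableAt_exp).differentiableWithinAt)
  have hG' : ∀ w ∈ S, HasDerivAt G (f (exp w) * exp w) w := fun w hw =>
    (hG w hw).hasDerivAt (hSo.mem_nhds hw)
  have hFTC : ∀ (u u' : ℝ → ℂ), (∀ t, HasDerivAt u (u' t) t) → Continuous u' →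
      (∀ t, u t ∈ S) →
      ∫ t in (0 : ℝ)..2 * Real.pi, f (exp (u t)) * (exp (u t) * u' t) =
        G (u (2 * Real.pi)) - G (u 0) := by
    intro u u' hu hu' huS
    have huc : Continuous u := continuous_iff_continuousAt.2 fun t => (hu t).continuousAt
    refine intervalIntegral.integral_eq_sub_of_hasDerivAt (f := fun t => G (u t)) (fun t _ => ?_) ?_
    · have := (hG' _ (huS t)).comp t (hu t)
      simpa [Function.comp_def, mul_assoc] using this
    · refine Continuous.intervalIntegrable ?_ _ _
      refine Continuous.mul ?_ ((continuous_exp.comp huc).mul hu')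
      rw [continuous_iff_continuousAt]
      intro t
      have := hf (exp (u t)) ((hSmem _).1 (huS t)).1 ((hSmem _).1 (huS t)).2
      exact this.continuousAt.comp (f := fun t => exp (u t)) (continuous_exp.comp huc).continuousAt
  have hR0 : 0 < R := h₁.trans hR₁
  have hTS : ∀ w ∈ S, w + 2 * Real.pi * I ∈ S := by
    intro w hw
    rw [hSmem, Complex.exp_periodic w, ← hSmem]; exact hw
  -- The increment of `G` over one period does not depend on the base point; evaluated on `|z| = R`
  -- it is the circle integral.
  have hconst : ∀ w ∈ S, ∀ w' ∈ S, G (w + 2 * Real.pi * I) - G w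
      = G (w' + 2 * Real.pi * I) - G w' := by
    have hd : ∀ w ∈ S, HasDerivAt (fun w => G (w + 2 * Real.pi * I) - G w) 0 w := by
      intro w hw
      have h1 := (hG' _ (hTS w hw)).comp_add_const w (2 * Real.pi * I)
      have h2 := h1.sub (hG' w hw)
      rw [Complex.exp_periodic w, sub_self] at h2
      exact h2
    intro w hw w' hw'
    exact hSo.is_const_of_deriv_eq_zero hSc.isPreconnected
      (fun w hw => (hd w hw).differentiableAt.differentiableWithinAt)
      (fun w hw => (hd w hw).deriv) hw hw'
  have hlogR : ∀ t : ℝ, (Real.log R : ℂ) + t * I ∈ S := by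
    intro t
    rw [hSmem, norm_exp]
    simp [Real.exp_log hR0, hR₁, hR₂]
  have hcirc : ∮ z in C(0, R), f z =
      G (Real.log R + 2 * Real.pi * I) - G (Real.log R) := by
    have := hFTC (fun t : ℝ => (Real.log R : ℂ) + t * I) (fun _ => I) (fun t => by
      have := (hasDerivAt_id t).ofReal_comp.mul_const I
      simpa using this.const_add (Real.log R : ℂ)) continuous_const hlogR
    simp only [ofReal_zero, zero_mul, add_zero] at this
    push_cast at this
    rw [← this, circleIntegral]
    refine intervalIntegral.integral_congr fun t _ => ?_
    have hexp : exp ((Real.log R : ℂ) + t * I) = circleMap 0 R t := by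
      rw [exp_add, ← ofReal_exp, Real.exp_log hR0, circleMap_zero]
    simp only [deriv_circleMap, smul_eq_mul]
    rw [hexp]
    ring
  have hstep : ∀ (k : ℕ), ∀ w ∈ S, w + k * (2 * Real.pi * I) ∈ S ∧
      G (w + k * (2 * Real.pi * I)) - G w = k * ∮ z in C(0, R), f z := by
    intro k
    induction k with
    | zero => intro w hw; simpa using hw
    | succ k ih =>
      intro w hw
      obtain ⟨h1, h2⟩ := ih w hw
      have e : w + ((k + 1 : ℕ) : ℂ) * (2 * Real.pi * I)
          = (w + k * (2 * Real.pi * I)) + 2 * Real.pi * I := by push_cast; ring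
      refine ⟨by rw [e]; exact hTS _ h1, ?_⟩
      have h3 := hconst _ h1 (Real.log R : ℂ) (by simpa using hlogR 0)
      rw [e, hcirc]
      rw [hcirc] at h2
      push_cast
      linear_combination h2 + h3
  have hsS : ∀ t, s t ∈ S := fun t => (hSmem _).2 (hmem t)
  rw [hFTC s s' hs hs' hsS, hper]
  exact (hstep n _ (hsS 0)).2

/-- The inversion `z ↦ d / z` exchanges the two circles and reverses their orientation; the minus
sign of its differential compensates the reversal. -/
theorem circleIntegral_comp_div {F : ℂ → ℂ} {r R d : ℝ} (hR : 0 < R)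
    (hd : r * R = d) :
    ∮ z in C(0, r), F z = ∮ z in C(0, R), F (d / z) * (d / z ^ 2) := by
  have h2 : ∀ h : ℝ → ℂ, ∫ t in (0 : ℝ)..2 * Real.pi, h (2 * Real.pi - t)
      = ∫ t in (0 : ℝ)..2 * Real.pi, h t := fun h => by
    rw [intervalIntegral.integral_comp_sub_left]; simp
  simp only [circleIntegral]
  rw [← h2]
  refine intervalIntegral.integral_congr fun t _ => ?_
  have hne : exp (t * I) ≠ 0 := exp_ne_zero _
  have hR' : (R : ℂ) ≠ 0 := by exact_mod_cast hR.ne'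
  have e : circleMap 0 r (2 * Real.pi - t) = d / circleMap 0 R t := by
    simp only [circleMap_zero]
    push_cast
    rw [sub_mul, exp_sub, exp_two_pi_mul_I, ← hd]
    push_cast
    field_simp
  simp only [deriv_circleMap, smul_eq_mul]
  rw [e]
  have hc : circleMap 0 R t ≠ 0 := by
    rw [circleMap_zero]; exact mul_ne_zero hR' hne
  field_simp

/-- Laurent splitting of a function on an annulus that is invariant under `z ↦ d / z`. -/
theorem laurent_split_of_invariant {f : ℂ → ℂ} {R d : ℝ} (hR : 0 < R) (hd : 0 < d)
    (hf : ∀ z : ℂ, d / R ≤ ‖z‖ → ‖z‖ ≤ R → DifferentiableAt ℂ f z)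
    (hinv : ∀ z : ℂ, z ≠ 0 → f (d / z) = f z) {x : ℂ} (hx₁ : d / R < ‖x‖) (hx₂ : ‖x‖ < R) :
    2 * Real.pi * I * f x = (∮ z in C(0, R), f z / z) +
      x * (∮ z in C(0, R), f z / (z * (z - x))) +
      d / x * (∮ z in C(0, R), f z / (z * (z - d / x))) := by
  have hr0 : 0 < d / R := by positivity
  set r := d / R with hr
  have hrR : r * R = d := by rw [hr]; field_simp
  have hx0 : x ≠ 0 := norm_pos_iff.1 (hr0.trans hx₁)
  set A : Set ℂ := Metric.closedBall 0 R \ Metric.ball 0 r with hA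
  have hAmem : ∀ z, z ∈ A ↔ ‖z‖ ≤ R ∧ r ≤ ‖z‖ := by intro z; simp [hA]
  have hxn : A ∈ 𝓝 x := by
    filter_upwards [continuous_norm.continuousAt.eventually_lt continuousAt_const hx₂,
      continuousAt_const.eventually_lt continuous_norm.continuousAt hx₁] with z h1 h2
    exact (hAmem z).2 ⟨h1.le, h2.le⟩
  have hfc : ContinuousOn f A := fun z hz =>
    (hf z ((hAmem z).1 hz).2 ((hAmem z).1 hz).1).continuousAt.continuousWithinAt
  -- `dslope f x` has no pole at `x`, so its integrals over the two boundary circles agree; this is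
  -- Cauchy's formula for the annulus.
  have h1 : (∮ z in C(0, R), dslope f x z) = ∮ z in C(0, r), dslope f x z := by
    refine Complex.circleIntegral_eq_of_differentiable_on_annulus_off_countable hr0
      (hx₁.trans hx₂).le (Set.countable_singleton x) ?_ ?_
    · exact (continuousOn_dslope hxn).2 ⟨hfc, hf x hx₁.le hx₂.le⟩
    · intro z hz
      have hzx : z ≠ x := by simpa using hz.2
      refine (differentiableAt_dslope_of_ne hzx).2 (hf z ?_ ?_)
      · have := hz.1.2; simp only [Metric.mem_closedBall, dist_zero_right, not_le] at this
        exact this.le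
      · have := hz.1.1; simp only [Metric.mem_ball, dist_zero_right] at this
        exact this.le
  have hne1 : ∀ z ∈ Metric.sphere (0 : ℂ) R, z ≠ x := by
    intro z hz h; rw [mem_sphere_zero_iff_norm, h] at hz; linarith
  have hne2 : ∀ z ∈ Metric.sphere (0 : ℂ) r, z ≠ x := by
    intro z hz h; rw [mem_sphere_zero_iff_norm, h] at hz; linarith
  have hne0 : ∀ {ρ : ℝ}, 0 < ρ → ∀ z ∈ Metric.sphere (0 : ℂ) ρ, z ≠ 0 := by
    intro ρ hρ z hz h; rw [mem_sphere_zero_iff_norm, h, norm_zero] at hz; linarith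
  have hsub1 : Metric.sphere (0 : ℂ) R ⊆ A := fun z hz => by
    rw [mem_sphere_zero_iff_norm] at hz; exact (hAmem z).2 ⟨hz.le, by rw [hz]; linarith⟩
  have hsub2 : Metric.sphere (0 : ℂ) r ⊆ A := fun z hz => by
    rw [mem_sphere_zero_iff_norm] at hz; exact (hAmem z).2 ⟨by rw [hz]; linarith, hz.ge⟩
  have split : ∀ ρ : ℝ, 0 < ρ → (∀ z ∈ Metric.sphere (0 : ℂ) ρ, z ≠ x) →
      Metric.sphere (0 : ℂ) ρ ⊆ A →
      (∮ z in C(0, ρ), dslope f x z) =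
        (∮ z in C(0, ρ), f z / (z - x)) - f x * ∮ z in C(0, ρ), (z - x)⁻¹ := by
    intro ρ hρ hne hsub
    have hinv' : ContinuousOn (fun z : ℂ => (z - x)⁻¹) (Metric.sphere 0 ρ) :=
      (continuousOn_id.sub continuousOn_const).inv₀ fun z hz => sub_ne_zero.2 (hne z hz)
    have i1 : CircleIntegrable (fun z => f z / (z - x)) 0 ρ := by
      refine ContinuousOn.circleIntegrable hρ.le ?_
      simpa only [div_eq_mul_inv] using! (hfc.mono hsub).mul hinv'
    have i2 : CircleIntegrable (fun z => f x * (z - x)⁻¹) 0 ρ :=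
      (continuousOn_const.mul hinv').circleIntegrable hρ.le
    rw [← circleIntegral.integral_const_mul, ← circleIntegral.integral_sub i1 i2]
    refine circleIntegral.integral_congr hρ.le fun z hz => ?_
    rw [dslope_of_ne _ (hne z hz), slope_def_field]
    have := sub_ne_zero.2 (hne z hz)
    field_simp
  rw [split R hR hne1 hsub1, split r hr0 hne2 hsub2,
    circleIntegral.integral_sub_inv_of_mem_ball (by simpa using hx₂)] at h1
  have h0 : ∮ z in C(0, r), (z - x)⁻¹ = 0 := by
    refine Complex.circleIntegral_eq_zero_of_differentiable_on_off_countable hr0.le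
      Set.countable_empty ?_ ?_
    · refine (continuousOn_id.sub continuousOn_const).inv₀ fun z hz => sub_ne_zero.2 ?_
      intro h
      rw [Metric.mem_closedBall, dist_zero_right, show z = x from h] at hz
      linarith
    · intro z hz
      refine DifferentiableAt.inv (by fun_prop) (sub_ne_zero.2 ?_)
      rintro rfl
      have := hz.1
      simp at this; linarith
  -- The inner circle carries the negative powers. By invariance it becomes the outer circle, with
  -- `d / x` in the place of `x`.
  rw [h0, mul_zero, sub_zero, circleIntegral_comp_div hR hrR] at h1
  have hdx : ‖(d : ℂ) / x‖ < R := by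
    rw [norm_div, norm_real, Real.norm_of_nonneg hd.le, div_lt_iff₀ (hr0.trans hx₁)]
    rw [hr, div_lt_iff₀ hR] at hx₁; linarith
  have hne3 : ∀ z ∈ Metric.sphere (0 : ℂ) R, z ≠ d / x := by
    intro z hz h; rw [mem_sphere_zero_iff_norm, h] at hz; linarith
  have hfR : ContinuousOn f (Metric.sphere 0 R) := hfc.mono hsub1
  have c0 : ContinuousOn (fun z => f z / z) (Metric.sphere 0 R) :=
    hfR.div continuousOn_id (hne0 hR)
  have c1 : ContinuousOn (fun z => x * (f z / (z * (z - x)))) (Metric.sphere 0 R) :=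
    continuousOn_const.mul (hfR.div (by fun_prop) fun z hz =>
      mul_ne_zero (hne0 hR z hz) (sub_ne_zero.2 (hne1 z hz)))
  have c2 : ContinuousOn (fun z => (d / x : ℂ) * (f z / (z * (z - d / x)))) (Metric.sphere 0 R) :=
    continuousOn_const.mul (hfR.div (by fun_prop) fun z hz =>
      mul_ne_zero (hne0 hR z hz) (sub_ne_zero.2 (hne3 z hz)))
  have e1 : (∮ z in C(0, R), f z / (z - x)) = (∮ z in C(0, R), f z / z) +
      x * (∮ z in C(0, R), f z / (z * (z - x))) := by
    rw [← circleIntegral.integral_const_mul, ← circleIntegral.integral_add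
      (c0.circleIntegrable hR.le) (c1.circleIntegrable hR.le)]
    refine circleIntegral.integral_congr hR.le fun z hz => ?_
    have := sub_ne_zero.2 (hne1 z hz)
    have := hne0 hR z hz
    field_simp
    ring
  have e2 : (∮ z in C(0, R), f (d / z) / (d / z - x) * (d / z ^ 2)) =
      -(d / x * ∮ z in C(0, R), f z / (z * (z - d / x))) := by
    rw [← circleIntegral.integral_const_mul, ← neg_one_mul, ← circleIntegral.integral_const_mul]
    refine circleIntegral.integral_congr hR.le fun z hz => ?_
    have h3 := sub_ne_zero.2 (hne3 z hz)
    have h4 := hne0 hR z hz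
    have h5 : (d : ℂ) / z - x ≠ 0 := by
      intro h; apply h3; field_simp at h ⊢; linear_combination -h
    have h6 : (d : ℂ) - z * x ≠ 0 := by
      intro h; apply h5; rw [div_sub' h4, h, zero_div]
    have h7 : z * x - d ≠ 0 := by intro h; apply h6; linear_combination -h
    simp only [hinv z h4]
    have a1 : (d : ℂ) / z - x = (d - z * x) / z := by field_simp
    have a2 : z - (d : ℂ) / x = (z * x - d) / x := by field_simp
    rw [a1, a2]
    field_simp
    ring
  rw [e1, e2] at h1
  linear_combination -h1

end ComplexLoops

/-! ### Analyticity of roots, logarithms and circle integrals -/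

section AnalyticHelpers

variable {E : Type*} [NormedAddCommGroup E] [NormedSpace ℝ E]

@[fun_prop]
theorem AnalyticAt.complex_ofReal {f : E → ℝ} {x : E} (hf : AnalyticAt ℝ f x) :
    AnalyticAt ℝ (fun x => (f x : ℂ)) x :=
  (Complex.ofRealCLM.analyticAt _).comp hf

@[fun_prop]
theorem AnalyticAt.complex_re {f : E → ℂ} {x : E} (hf : AnalyticAt ℝ f x) :
    AnalyticAt ℝ (fun x => (f x).re) x :=
  (Complex.reCLM.analyticAt _).comp hf

theorem AnalyticAt.cpow_half {f : E → ℂ} {x : E} (hf : AnalyticAt ℝ f x)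
    (h : f x ∈ Complex.slitPlane) : AnalyticAt ℝ (fun x => f x ^ (1 / 2 : ℂ)) x := by
  have h1 : AnalyticAt ℂ (fun z : ℂ => z ^ (1 / 2 : ℂ)) (f x) :=
    analyticAt_id.cpow analyticAt_const h
  exact (h1.restrictScalars (𝕜 := ℝ)).comp hf

theorem AnalyticAt.sqrt {f : E → ℝ} {x : E} (hf : AnalyticAt ℝ f x) (h : f x ≠ 0) :
    AnalyticAt ℝ (fun x => √(f x)) x :=
  AnalyticAt.comp (g := fun y => √y) (Real.contDiffAt_sqrt (n := ω) h).analyticAt hf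

@[fun_prop]
theorem AnalyticAt.arctan {f : E → ℝ} {x : E} (hf : AnalyticAt ℝ f x) :
    AnalyticAt ℝ (fun x => Real.arctan (f x)) x :=
  AnalyticAt.comp (g := fun y => Real.arctan y)
    (Real.contDiff_arctan (n := ω)).contDiffAt.analyticAt hf

theorem AnalyticAt.real_log {f : E → ℝ} {x : E} (hf : AnalyticAt ℝ f x) (h : f x ≠ 0) :
    AnalyticAt ℝ (fun x => Real.log (f x)) x :=
  AnalyticAt.comp (g := fun y => Real.log y) (Real.contDiffAt_log (n := ω).2 h).analyticAt hf

theorem AnalyticAt.circleIntegral {f : E × ℂ → ℂ} {x₀ : E} {R : ℝ} (hR : 0 ≤ R)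
    (hf : ∀ z ∈ Metric.sphere (0 : ℂ) R, AnalyticAt ℝ f (x₀, z)) :
    AnalyticAt ℝ (fun x => ∮ z in C(0, R), f (x, z)) x₀ := by
  simp only [_root_.circleIntegral]
  refine AnalyticAt.intervalIntegral
    (f := fun q : E × ℝ => deriv (circleMap 0 R) q.2 • f (q.1, circleMap 0 R q.2)) fun t _ => ?_
  have h1 : AnalyticAt ℝ (fun q : E × ℝ => circleMap 0 R q.2) (x₀, t) :=
    AnalyticAt.fun_comp (g := circleMap 0 R) (f := fun q : E × ℝ => q.2)
      (analyticOnNhd_circleMap 0 R t trivial) analyticAt_snd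
  simp only [deriv_circleMap]
  have h2 : AnalyticAt ℝ (fun q : E × ℝ => f (q.1, circleMap 0 R q.2)) (x₀, t) :=
    AnalyticAt.fun_comp (g := f) (f := fun q : E × ℝ => (q.1, circleMap 0 R q.2))
      (hf _ (by simp [abs_of_nonneg hR])) (by fun_prop)
  exact AnalyticAt.fun_smul (by fun_prop) h2

/-- The principal argument is halved, hence lies in `(-π/2, π/2)`. This keeps denominators of the
form `√(1 + b) + (…) ^ (1 / 2)` away from zero. -/
theorem Complex.re_cpow_half_pos {z : ℂ} (hz : z ∈ Complex.slitPlane) :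
    0 < (z ^ (1 / 2 : ℂ)).re := by
  have hz0 := Complex.slitPlane_ne_zero hz
  have harg := Complex.mem_slitPlane_iff_arg.1 hz
  have h1 := Complex.neg_pi_lt_arg z
  have h2 : Complex.arg z < Real.pi := lt_of_le_of_ne (Complex.arg_le_pi z) harg.1
  rw [Complex.cpow_def_of_ne_zero hz0, Complex.exp_re]
  refine mul_pos (Real.exp_pos _) (Real.cos_pos_of_mem_Ioo ?_)
  have : (Complex.log z * (1 / 2)).im = Complex.arg z / 2 := by
    rw [show (1 / 2 : ℂ) = ((1 / 2 : ℝ) : ℂ) by push_cast; rfl, Complex.im_mul_ofReal,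
      Complex.log_im]; ring
  rw [this]
  constructor <;> linarith

theorem Complex.cpow_half_sq (z : ℂ) : (z ^ (1 / 2 : ℂ)) ^ 2 = z := by
  rw [one_div]
  exact_mod_cast Complex.cpow_nat_inv_pow z (n := 2) (by norm_num)

theorem Complex.ofReal_cpow_half {x : ℝ} (hx : 0 < x) :
    (x : ℂ) ^ (1 / 2 : ℂ) = (√x : ℝ) := by
  refine Complex.cpow_half_eq_of_sq_eq ?_ ?_
  · rw [← Complex.ofReal_pow, Real.sq_sqrt hx.le]
  · simpa using Real.sqrt_pos.2 hx

end AnalyticHelpers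

/-! ### The vanishing action and the unfolded integrand -/

namespace ChampagneBottle

open Complex

/-- The radicand `1 - z + h/z - j²/(4z²)`. -/
noncomputable def radicand (h j : ℝ) (z : ℂ) : ℂ := 1 - z + h / z - (j : ℂ) ^ 2 / (4 * z ^ 2)

/-- For `|z| ≤ 3/5` the real part of `1 - z` is at least `2/5`, and the terms with `h` and `j` are
small away from `z = 0`. The principal root is therefore holomorphic on an annulus that, for `r <
1/2`, leaves room on both sides of `|z| = 1/2`. -/
theorem eventually_re_radicand_pos {r : ℝ} (hr : 0 < r) :
    ∀ᶠ p in 𝓝 (0 : ℝ × ℝ), ∀ z : ℂ, r ≤ ‖z‖ → ‖z‖ ≤ 3 / 5 → 0 < (radicand p.1 p.2 z).re := by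
  have h1 : ∀ᶠ p in 𝓝 (0 : ℝ × ℝ), |p.1| / r + p.2 ^ 2 / (4 * r ^ 2) < 1 / 5 := by
    have : ContinuousAt (fun p : ℝ × ℝ => |p.1| / r + p.2 ^ 2 / (4 * r ^ 2)) 0 := by fun_prop
    exact this.eventually_lt continuousAt_const (by norm_num)
  filter_upwards [h1] with p hp z hz1 hz2
  have hz0 : 0 < ‖z‖ := hr.trans_le hz1
  have e1 : -(|p.1| / r) ≤ ((p.1 : ℂ) / z).re := by
    have h2 : ‖(p.1 : ℂ) / z‖ ≤ |p.1| / r := by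
      rw [norm_div, norm_real, Real.norm_eq_abs]; gcongr
    have := (abs_le.1 (abs_re_le_norm ((p.1 : ℂ) / z))).1
    linarith
  have e2 : ((p.2 : ℂ) ^ 2 / (4 * z ^ 2)).re ≤ p.2 ^ 2 / (4 * r ^ 2) := by
    have h2 : ‖(p.2 : ℂ) ^ 2 / (4 * z ^ 2)‖ ≤ p.2 ^ 2 / (4 * r ^ 2) := by
      rw [norm_div, norm_pow, norm_real, Real.norm_eq_abs, sq_abs, norm_mul, norm_pow]
      norm_num
      gcongr
    exact (re_le_norm _).trans h2
  have e3 : z.re ≤ 3 / 5 := (re_le_norm z).trans hz2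
  simp only [radicand, sub_re, add_re, one_re]
  linarith

/-- `wBranch h j z / z` is `√2` times the root of `radicand`, so the two factors `√2` turn `1 /
(2πi)` into `1 / (πi)`. -/
theorem vanishingAction_eq (h j : ℝ) :
    vanishingAction h j =
      ((Real.pi * I : ℂ)⁻¹ * ∮ z in C(0, 1 / 2), radicand h j z ^ (1 / 2 : ℂ)).re := by
  have hs : ((√2 : ℝ) : ℂ) * ((√2 : ℝ) : ℂ) = 2 := by
    rw [← ofReal_mul, Real.mul_self_sqrt (by norm_num)]; norm_num
  have hpi : (Real.pi : ℂ) ≠ 0 := by exact_mod_cast Real.pi_ne_zero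
  have e : (∮ z in C(0, 1 / 2), wBranch h j z / z) =
      (√2 : ℝ) * ∮ z in C(0, 1 / 2), radicand h j z ^ (1 / 2 : ℂ) := by
    rw [← circleIntegral.integral_const_mul]
    refine circleIntegral.integral_congr (by norm_num) fun z hz => ?_
    have hz0 : z ≠ 0 := by
      rintro rfl; simp at hz
    simp only [wBranch, radicand]
    field_simp
  rw [vanishingAction, e]
  congr 1
  have hI := I_ne_zero
  rw [← mul_assoc, div_mul_eq_mul_div, hs]
  field_simp

/-- The integrand `[q √(e - z) + √e s²] / z` with `z = ξ + d/ξ - b/2`, `q = (ξ - d/ξ)²`. -/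
noncomputable def psi (b d : ℝ) (ξ : ℂ) : ℂ :=
  (√(1 + b) : ℝ) * (ξ + d / ξ + b / 2) -
    (ξ - d / ξ) ^ 2 / ((√(1 + b) : ℝ) + (1 + 3 * b / 2 - ξ - d / ξ) ^ (1 / 2 : ℂ))

/-- `psi` depends on `ξ` only through `ξ + d/ξ` and `(ξ - d/ξ)²`. -/
theorem psi_inv {b d : ℝ} (hd : d ≠ 0) {ξ : ℂ} (hξ : ξ ≠ 0) :
    psi b d (d / ξ) = psi b d ξ := by
  have hd' : (d : ℂ) ≠ 0 := by exact_mod_cast hd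
  have e : (d : ℂ) / (d / ξ) = ξ := by field_simp
  simp only [psi, e]
  congr 1
  · ring
  · congr 1
    · ring
    · congr 2; ring

theorem analyticAt_psi {E : Type*} [NormedAddCommGroup E] [NormedSpace ℝ E] {b d : E → ℝ}
    {ξ : E → ℂ} {x : E} (hb : AnalyticAt ℝ b x) (hd : AnalyticAt ℝ d x) (hξ : AnalyticAt ℝ ξ x)
    (h0 : ξ x ≠ 0) (hb0 : -1 < b x)
    (hw : 1 + 3 * (b x : ℂ) / 2 - ξ x - d x / ξ x ∈ slitPlane) :
    AnalyticAt ℝ (fun x => psi (b x) (d x) (ξ x)) x := by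
  have h1 : AnalyticAt ℝ (fun x => √(1 + b x)) x := AnalyticAt.sqrt (f := fun x => 1 + b x) (by fun_prop) (by linarith)
  have h2 : AnalyticAt ℝ (fun x => (d x : ℂ) / ξ x) x := hd.complex_ofReal.div hξ h0
  have h3 : AnalyticAt ℝ (fun x => (1 + 3 * (b x : ℂ) / 2 - ξ x - d x / ξ x) ^ (1 / 2 : ℂ)) x :=
    AnalyticAt.cpow_half (by fun_prop (disch := norm_num)) hw
  unfold psi
  refine AnalyticAt.sub (by fun_prop (disch := norm_num)) (AnalyticAt.div (by fun_prop)
    (by fun_prop) ?_)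
  intro h
  have h4 := re_cpow_half_pos hw
  have h5 := Real.sqrt_nonneg (1 + b x)
  have := congrArg re h
  simp only [add_re, ofReal_re, zero_re] at this
  linarith

theorem one_sub_mem_slitPlane {z : ℂ} (hz : ‖z‖ < 1) : 1 - z ∈ slitPlane := by
  left
  have := re_le_norm z
  simp; linarith

theorem analyticAt_psi_zero {ξ : ℂ} (h0 : ξ ≠ 0) (h1 : ‖ξ‖ < 1) :
    AnalyticAt ℝ (fun p : (ℝ × ℝ) × ℂ => psi p.1.1 p.1.2 p.2) ((0, 0), ξ) := by
  refine analyticAt_psi (by fun_prop) (by fun_prop) (by fun_prop) h0 (by simp) ?_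
  simpa using one_sub_mem_slitPlane h1

/-- The vanishing action in the coordinates `(b, d)`. -/
noncomputable def vanishingPeriod (p : ℝ × ℝ) : ℝ :=
  ((Real.pi * I : ℂ)⁻¹ * ∮ ξ in C(0, 1 / 4), psi p.1 p.2 ξ / ξ).re

theorem sphere_quarter_ne_zero {ξ : ℂ} (hξ : ξ ∈ Metric.sphere (0 : ℂ) (1 / 4)) :
    ξ ≠ 0 ∧ ‖ξ‖ = 1 / 4 := by
  rw [mem_sphere_zero_iff_norm] at hξ
  exact ⟨norm_pos_iff.1 (by rw [hξ]; norm_num), hξ⟩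

theorem analyticAt_vanishingPeriod : AnalyticAt ℝ vanishingPeriod (0, 0) := by
  refine AnalyticAt.complex_re (AnalyticAt.mul analyticAt_const ?_)
  refine AnalyticAt.circleIntegral (f := fun q : (ℝ × ℝ) × ℂ => psi q.1.1 q.1.2 q.2 / q.2)
    (by norm_num) fun ξ hξ => ?_
  obtain ⟨h0, h1⟩ := sphere_quarter_ne_zero hξ
  exact (analyticAt_psi_zero h0 (by rw [h1]; norm_num)).div (by fun_prop) h0

/-- At `d = 0` the integrand `psi b 0 ξ / ξ` has a single simple pole, at `ξ = 0`, with residue `√(1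
+ b) b / 2`. This exact value later ties `log d` to the logarithm of `J² + j₂²`. -/
theorem vanishingPeriod_zero_right :
    ∀ᶠ b in 𝓝 (0 : ℝ), vanishingPeriod (b, 0) = √(1 + b) * b := by
  have hb : ∀ᶠ b in 𝓝 (0 : ℝ), |b| < 1 / 10 := by
    have : ContinuousAt (fun b : ℝ => |b|) 0 := by fun_prop
    exact this.eventually_lt continuousAt_const (by norm_num)
  filter_upwards [hb] with b hb
  rw [abs_lt] at hb
  set r : ℝ := √(1 + b) with hr
  have hr0 : 0 < r := Real.sqrt_pos.2 (by linarith [hb.1])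
  have hslit : ∀ z ∈ Metric.closedBall (0 : ℂ) (1 / 4), 1 + 3 * (b : ℂ) / 2 - z ∈ slitPlane := by
    intro z hz
    left
    have h1 := re_le_norm z
    rw [mem_closedBall_zero_iff] at hz
    have : ((3 : ℂ) * b / 2).re = 3 * b / 2 := by
      rw [show (3 : ℂ) * b / 2 = ((3 * b / 2 : ℝ) : ℂ) by push_cast; ring, ofReal_re]
    simp only [sub_re, add_re, one_re, this]
    linarith
  have hden : ∀ z ∈ Metric.closedBall (0 : ℂ) (1 / 4),
      (r : ℂ) + (1 + 3 * b / 2 - z) ^ (1 / 2 : ℂ) ≠ 0 := by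
    intro z hz h
    have h4 := re_cpow_half_pos (hslit z hz)
    have := congrArg re h
    simp only [add_re, ofReal_re, zero_re] at this
    linarith
  have hdiff : ∀ z ∈ Metric.closedBall (0 : ℂ) (1 / 4), DifferentiableAt ℂ
      (fun z : ℂ => (r : ℂ) - z / (r + (1 + 3 * b / 2 - z) ^ (1 / 2 : ℂ))) z := by
    intro z hz
    have : DifferentiableAt ℂ (fun z : ℂ => (1 + 3 * (b : ℂ) / 2 - z) ^ (1 / 2 : ℂ)) z :=
      DifferentiableAt.cpow_const (by fun_prop) (hslit z hz)
    exact DifferentiableAt.sub (by fun_prop)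
      (DifferentiableAt.div (by fun_prop) (by fun_prop) (hden z hz))
  have h0 : ∮ z in C(0, 1 / 4), ((r : ℂ) - z / (r + (1 + 3 * b / 2 - z) ^ (1 / 2 : ℂ))) = 0 := by
    refine circleIntegral_eq_zero_of_differentiable_on_off_countable (by norm_num)
      Set.countable_empty (fun z hz => (hdiff z hz).continuousAt.continuousWithinAt) ?_
    intro z hz
    exact hdiff z (Metric.ball_subset_closedBall hz.1)
  have h1 : ∮ z in C(0, 1 / 4), (r * (b / 2) : ℂ) * (z - 0)⁻¹ = r * (b / 2) * (2 * Real.pi * I) := by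
    rw [circleIntegral.integral_const_mul, circleIntegral.integral_sub_inv_of_mem_ball]
    simp
  have h2 : (∮ ξ in C(0, 1 / 4), psi b 0 ξ / ξ) = r * (b / 2) * (2 * Real.pi * I) := by
    have i1 : CircleIntegrable (fun z : ℂ => (r * (b / 2) : ℂ) * (z - 0)⁻¹) 0 (1 / 4) := by
      refine ContinuousOn.circleIntegrable (by norm_num) ?_
      refine continuousOn_const.mul (ContinuousOn.inv₀ (by fun_prop) fun z hz => ?_)
      simpa using (sphere_quarter_ne_zero hz).1
    have i2 : CircleIntegrable (fun z : ℂ => (r : ℂ) - z / (r + (1 + 3 * b / 2 - z) ^ (1 / 2 : ℂ)))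
        0 (1 / 4) := by
      refine ContinuousOn.circleIntegrable (by norm_num) fun z hz => ?_
      exact (hdiff z (Metric.sphere_subset_closedBall hz)).continuousAt.continuousWithinAt
    have h3 := circleIntegral.integral_add i1 i2
    rw [h0, h1, add_zero] at h3
    rw [← h3]
    refine circleIntegral.integral_congr (by norm_num) fun z hz => ?_
    have hz0 := (sphere_quarter_ne_zero hz).1
    have := hden z (Metric.sphere_subset_closedBall hz)
    simp only [psi, ofReal_zero, zero_div, sub_zero, add_zero, ← hr]
    field_simp
    ring
  have hpi : (Real.pi : ℂ) ≠ 0 := by exact_mod_cast Real.pi_ne_zero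
  have hI := I_ne_zero
  rw [vanishingPeriod]
  simp only [h2]
  have : (Real.pi * I : ℂ)⁻¹ * (r * (b / 2) * (2 * Real.pi * I)) = ((r * b : ℝ) : ℂ) := by
    push_cast; field_simp
  rw [this, ofReal_re]

end ChampagneBottle

/-! ### The change of variable `z = ξ + d/ξ - b/2` on the vanishing cycle -/

namespace ChampagneBottle

open Complex

/-- Since `r² - w² = Z`, one has `(r - w) / Z = 1 / (r + w)`: replacing `w` by `r` splits off the
pole at `Z = 0`. What remains is `psi`; the pole term `r s² / Z` is integrated by hand. -/
theorem integrand_identity {k : Type*} [Field k] {b s r w Z q : k} (hr : r ^ 2 = 1 + b)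
    (hw : w ^ 2 = 1 + b - Z) (hq : q = Z ^ 2 + b * Z - s ^ 2) (hZ : Z ≠ 0) (hrw : r + w ≠ 0) :
    q * w / Z = r * (Z + b) - q / (r + w) - r * s ^ 2 / Z := by
  field_simp
  linear_combination q * hw - q * hr + r * (r + w) * hq

/-- The poles `b/4 ± i s/2` both lie inside the circle and their residues cancel. -/
theorem circleIntegral_inv_quadratic_eq_zero {b s R : ℝ} (hs : s ≠ 0)
    (hR : |b| / 4 + |s| / 2 < R) :
    ∮ z in C(0, R), ((z : ℂ) ^ 2 - b / 2 * z + (b ^ 2 + 4 * s ^ 2) / 16)⁻¹ = 0 := by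
  have hR0 : 0 < R := lt_of_le_of_lt (by positivity) hR
  set u : ℂ := b / 4 + s / 2 * I with hu
  set v : ℂ := b / 4 - s / 2 * I with hv
  have hb : ‖(b : ℂ) / 4‖ = |b| / 4 := by
    rw [norm_div, norm_real, Real.norm_eq_abs]; norm_num
  have hsn : ‖(s : ℂ) / 2 * I‖ = |s| / 2 := by
    rw [norm_mul, norm_div, norm_real, Real.norm_eq_abs, norm_I]; norm_num
  have hun : u ∈ Metric.ball (0 : ℂ) R := by
    rw [mem_ball_zero_iff]
    refine lt_of_le_of_lt (norm_add_le _ _) ?_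
    rwa [hb, hsn]
  have hvn : v ∈ Metric.ball (0 : ℂ) R := by
    rw [mem_ball_zero_iff]
    refine lt_of_le_of_lt (norm_sub_le _ _) ?_
    rwa [hb, hsn]
  have hne : ∀ a ∈ Metric.ball (0 : ℂ) R, ∀ z ∈ Metric.sphere (0 : ℂ) R, z - a ≠ 0 := by
    intro a ha z hz h
    rw [sub_eq_zero.1 h, mem_sphere_zero_iff_norm] at hz
    rw [mem_ball_zero_iff, hz] at ha
    exact lt_irrefl _ ha
  have hci : ∀ a ∈ Metric.ball (0 : ℂ) R, CircleIntegrable (fun z : ℂ => (z - a)⁻¹) 0 R :=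
    fun a ha => ContinuousOn.circleIntegrable hR0.le
      (ContinuousOn.inv₀ (by fun_prop) (hne a ha))
  have hsc : (s : ℂ) ≠ 0 := by exact_mod_cast hs
  have hI := I_ne_zero
  have e : (∮ z in C(0, R), ((z : ℂ) ^ 2 - b / 2 * z + (b ^ 2 + 4 * s ^ 2) / 16)⁻¹) =
      ∮ z in C(0, R), (s * I : ℂ)⁻¹ * ((z - u)⁻¹ - (z - v)⁻¹) := by
    refine circleIntegral.integral_congr hR0.le fun z hz => ?_
    have h1 := hne u hun z hz
    have h2 := hne v hvn z hz
    have h3 : (z : ℂ) ^ 2 - b / 2 * z + (b ^ 2 + 4 * s ^ 2) / 16 = (z - u) * (z - v) := by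
      rw [hu, hv]; ring_nf; rw [I_sq]; ring
    simp only [h3]
    rw [inv_sub_inv h1 h2, show z - v - (z - u) = s * I by rw [hu, hv]; ring]
    field_simp
  rw [e, circleIntegral.integral_const_mul, circleIntegral.integral_sub (hci u hun) (hci v hvn),
    circleIntegral.integral_sub_inv_of_mem_ball hun, circleIntegral.integral_sub_inv_of_mem_ball hvn,
    sub_self, mul_zero]

/-- At `(b, d) = (0, 0)` the conditions read `0 < 1/2`, `1 - ξ ∈ slitPlane` and `0 < Re √(1 - ξ)`;
they persist by compactness of the circle. They keep the image loop near the circle, make the root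
in `psi` holomorphic, and select the branch of the root of the radicand. -/
theorem eventually_circle_conditions :
    ∀ᶠ p in 𝓝 ((0, 0) : ℝ × ℝ), ∀ ξ ∈ Metric.sphere (0 : ℂ) (1 / 4),
      ‖-(p.1 : ℂ) / (2 * ξ) + p.2 / ξ ^ 2‖ < 1 / 2 ∧
      1 + 3 * (p.1 : ℂ) / 2 - ξ - p.2 / ξ ∈ slitPlane ∧
      0 < ((ξ - p.2 / ξ) * (1 + 3 * (p.1 : ℂ) / 2 - ξ - p.2 / ξ) ^ (1 / 2 : ℂ) /
        (ξ - p.1 / 2 + p.2 / ξ)).re := by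
  refine (isCompact_sphere (0 : ℂ) (1 / 4)).eventually_forall_of_forall_eventually
    fun ξ hξ => ?_
  obtain ⟨h0, h1⟩ := sphere_quarter_ne_zero hξ
  have hsl : 1 - ξ ∈ slitPlane := one_sub_mem_slitPlane (by rw [h1]; norm_num)
  have c1 : ContinuousAt (fun q : (ℝ × ℝ) × ℂ =>
      ‖-(q.1.1 : ℂ) / (2 * q.2) + q.1.2 / q.2 ^ 2‖) ((0, 0), ξ) := by
    fun_prop (disch := simp [h0])
  have c2 : ContinuousAt (fun q : (ℝ × ℝ) × ℂ =>
      1 + 3 * (q.1.1 : ℂ) / 2 - q.2 - q.1.2 / q.2) ((0, 0), ξ) := by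
    fun_prop (disch := simp)
  have c3 : ContinuousAt (fun q : (ℝ × ℝ) × ℂ =>
      (1 + 3 * (q.1.1 : ℂ) / 2 - q.2 - q.1.2 / q.2) ^ (1 / 2 : ℂ)) ((0, 0), ξ) :=
    c2.cpow continuousAt_const (by simpa using hsl)
  have c4 : ContinuousAt (fun q : (ℝ × ℝ) × ℂ =>
      ((q.2 - q.1.2 / q.2) * (1 + 3 * (q.1.1 : ℂ) / 2 - q.2 - q.1.2 / q.2) ^ (1 / 2 : ℂ) /
        (q.2 - q.1.1 / 2 + q.1.2 / q.2)).re) ((0, 0), ξ) := by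
    refine continuous_re.continuousAt.comp' (ContinuousAt.div (ContinuousAt.mul ?_ c3) ?_ ?_)
    · fun_prop (disch := simp [h0])
    · fun_prop (disch := simp)
    · simpa using h0
  have e1 := c1.eventually_lt (continuousAt_const (y := (1 / 2 : ℝ))) (by simp)
  have e2 := c2.eventually (isOpen_slitPlane.mem_nhds (by simpa using hsl))
  have e3 := (continuousAt_const (y := (0 : ℝ))).eventually_lt c4 (by
    have := re_cpow_half_pos hsl
    simp only [ofReal_zero, zero_div, mul_zero, add_zero, sub_zero]
    rwa [mul_div_assoc, mul_comm, div_mul_cancel₀ _ h0])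
  filter_upwards [e1, e2, e3] with q h1 h2 h3 using ⟨h1, h2, h3⟩

/-- The substitution maps `|ξ| = 1/4` to a loop that winds once around `0` in the annulus where the
root is holomorphic, so it may replace `|z| = 1/2`. The pole term contributes nothing over a full
loop. -/
theorem eventually_radicand_circleIntegral :
    ∀ᶠ p in 𝓝 (0 : ℝ × ℝ),
      (∮ z in C(0, 1 / 2), radicand (p.1 * (1 + p.1) + p.2 ^ 2) (2 * p.2 * √(1 + p.1)) z ^ (1 / 2 : ℂ))
        = ∮ ξ in C(0, 1 / 4), psi p.1 ((p.1 ^ 2 + 4 * p.2 ^ 2) / 16) ξ / ξ := by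
  have t1 : Tendsto (fun p : ℝ × ℝ => (p.1, (p.1 ^ 2 + 4 * p.2 ^ 2) / 16)) (𝓝 0) (𝓝 (0, 0)) := by
    have : Continuous (fun p : ℝ × ℝ => (p.1, (p.1 ^ 2 + 4 * p.2 ^ 2) / 16)) := by fun_prop
    exact this.tendsto' _ _ (by simp)
  have t2 : Tendsto (fun p : ℝ × ℝ => (p.1 * (1 + p.1) + p.2 ^ 2, 2 * p.2 * √(1 + p.1)))
      (𝓝 0) (𝓝 0) := by
    have : Continuous (fun p : ℝ × ℝ => (p.1 * (1 + p.1) + p.2 ^ 2, 2 * p.2 * √(1 + p.1))) := by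
      fun_prop
    exact this.tendsto' _ _ (by simp)
  have t3 : ∀ᶠ p in 𝓝 (0 : ℝ × ℝ), |p.1| / 4 + |p.2| / 2 < 1 / 40 := by
    have : ContinuousAt (fun p : ℝ × ℝ => |p.1| / 4 + |p.2| / 2) 0 := by fun_prop
    exact this.eventually_lt continuousAt_const (by norm_num)
  filter_upwards [t1.eventually eventually_circle_conditions,
    t2.eventually (eventually_re_radicand_pos (r := 1 / 8) (by norm_num)), t3] with p hc hrad h3
  obtain ⟨b, s⟩ := p
  simp only at hc hrad h3 ⊢
  set d : ℝ := (b ^ 2 + 4 * s ^ 2) / 16 with hd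
  set h : ℝ := b * (1 + b) + s ^ 2
  set j : ℝ := 2 * s * √(1 + b)
  have hb : |b| < 1 / 10 := by linarith [abs_nonneg s, abs_nonneg b]
  rw [abs_lt] at hb
  have hr2 : (√(1 + b) : ℝ) ^ 2 = 1 + b := Real.sq_sqrt (by linarith [hb.1])
  set r : ℝ := √(1 + b) with hr
  have hr0 : 0 < r := Real.sqrt_pos.2 (by linarith [hb.1])
  have hr2c : (r : ℂ) ^ 2 = 1 + b := by rw [← ofReal_pow, hr2]; push_cast; rfl
  have hdc : (d : ℂ) = (b ^ 2 + 4 * s ^ 2) / 16 := by rw [hd]; push_cast; rfl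
  -- `z = ξ η(ξ)` with `|η - 1| < 1/2`: hence `1/8 < |z| < 3/5`, and the principal logarithm of `η`
  -- gives a lift of the loop through the exponential.
  set η : ℂ → ℂ := fun ξ => 1 + (-(b : ℂ) / (2 * ξ) + d / ξ ^ 2) with hη
  set ξ : ℝ → ℂ := circleMap 0 (1 / 4) with hξ
  have hξs : ∀ t, ξ t ∈ Metric.sphere (0 : ℂ) (1 / 4) := fun t =>
    circleMap_mem_sphere _ (by norm_num) _
  have hξ0 : ∀ t, ξ t ≠ 0 := fun t => (sphere_quarter_ne_zero (hξs t)).1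
  have hξn : ∀ t, ‖ξ t‖ = 1 / 4 := fun t => (sphere_quarter_ne_zero (hξs t)).2
  have hξd : ∀ t, HasDerivAt ξ (ξ t * I) t := fun t => hasDerivAt_circleMap 0 (1 / 4) t
  have hξc : Continuous ξ := continuous_circleMap _ _
  have hηsl : ∀ t, η (ξ t) ∈ slitPlane := fun t => by
    left
    have h1 := (hc (ξ t) (hξs t)).1
    have h2 := (abs_le.1 (abs_re_le_norm (-(b : ℂ) / (2 * ξ t) + d / ξ t ^ 2))).1
    simp only [hη, add_re, one_re] at h2 ⊢
    linarith
  have hη0 : ∀ t, η (ξ t) ≠ 0 := fun t => slitPlane_ne_zero (hηsl t)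
  set L : ℝ → ℂ := fun t => Real.log (1 / 4) + t * I + log (η (ξ t)) with hL
  set L' : ℝ → ℂ := fun t => I +
    ((b : ℂ) / (2 * ξ t ^ 2) - 2 * d / ξ t ^ 3) * (ξ t * I) / η (ξ t) with hL'
  have hLd : ∀ t, HasDerivAt L (L' t) t := by
    intro t
    have h1 : HasDerivAt η ((b : ℂ) / (2 * ξ t ^ 2) - 2 * d / ξ t ^ 3) (ξ t) := by
      have a1 := (hasDerivAt_inv (hξ0 t)).const_mul (-(b : ℂ) / 2)
      have a2 := ((hasDerivAt_inv (hξ0 t)).pow 2).const_mul (d : ℂ)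
      have a3 := (a1.add a2).const_add 1
      have hx0 := hξ0 t
      refine (a3.congr_deriv ?_).congr_of_eventuallyEq (Eventually.of_forall fun z => ?_)
      · simp; field_simp; ring
      · simp only [hη, Pi.add_apply, Pi.pow_apply]; ring
    have h2 : HasDerivAt (fun t => η (ξ t))
        (((b : ℂ) / (2 * ξ t ^ 2) - 2 * d / ξ t ^ 3) * (ξ t * I)) t :=
      h1.comp t (hξd t)
    have h3 := h2.clog_real (hηsl t)
    have h4 : HasDerivAt (fun t : ℝ => (Real.log (1 / 4) : ℂ) + t * I) I t := by
      have := (hasDerivAt_id t).ofReal_comp.mul_const I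
      simpa using this.const_add (Real.log (1 / 4) : ℂ)
    exact h4.add h3
  have hηc : Continuous fun t => η (ξ t) := by
    refine continuous_const.add (Continuous.add ?_ ?_)
    · exact continuous_const.div (continuous_const.mul hξc) fun t => by simp [hξ0 t]
    · exact continuous_const.div (hξc.pow 2) fun t => by simp [hξ0 t]
  have hL'c : Continuous L' := by
    refine continuous_const.add (Continuous.div (Continuous.mul (Continuous.sub ?_ ?_) ?_) hηc hη0)
    · exact continuous_const.div (continuous_const.mul (hξc.pow 2)) fun t => by simp [hξ0 t]
    · exact continuous_const.div (hξc.pow 3) fun t => by simp [hξ0 t]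
    · exact hξc.mul continuous_const
  have hexp : ∀ t, exp (L t) = ξ t * η (ξ t) := by
    intro t
    rw [hL, exp_add, exp_add, exp_log (hη0 t), ← ofReal_exp, Real.exp_log (by norm_num),
      hξ, circleMap_zero]
  have hnorm : ∀ t, 1 / 8 < ‖exp (L t)‖ ∧ ‖exp (L t)‖ < 3 / 5 := by
    intro t
    have h1 := (hc (ξ t) (hξs t)).1
    rw [hexp, norm_mul, hξn]
    have h2 : ‖η (ξ t)‖ ≤ 1 + ‖-(b : ℂ) / (2 * ξ t) + d / ξ t ^ 2‖ := by
      simpa using norm_add_le (1 : ℂ) (-(b : ℂ) / (2 * ξ t) + d / ξ t ^ 2)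
    have h3 : 1 - ‖-(b : ℂ) / (2 * ξ t) + d / ξ t ^ 2‖ ≤ ‖η (ξ t)‖ := by
      have := norm_sub_le_norm_add (1 : ℂ) (-(b : ℂ) / (2 * ξ t) + d / ξ t ^ 2)
      simpa using this
    constructor <;> linarith
  have hper : L (2 * Real.pi) = L 0 + (1 : ℕ) * (2 * Real.pi * I) := by
    have : ξ (2 * Real.pi) = ξ 0 := by
      have := periodic_circleMap 0 (1 / 4) 0
      rwa [zero_add] at this
    simp only [hL, this]
    push_cast
    ring
  have key := integral_exp_lift_eq_circleIntegral
    (f := fun z => radicand h j z ^ (1 / 2 : ℂ)) (r₁ := 1 / 8) (r₂ := 3 / 5) (R := 1 / 2)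
    (by norm_num) (by norm_num) (by norm_num) (fun z hz1 hz2 => by
      have hz0 : z ≠ 0 := norm_pos_iff.1 (lt_trans (by norm_num) hz1)
      refine DifferentiableAt.cpow_const ?_ (Or.inl (hrad z hz1.le hz2.le))
      unfold radicand
      fun_prop (disch := simp [hz0])) hLd hL'c hnorm 1 hper
  rw [Nat.cast_one, one_mul] at key
  have hcr : ∀ z ∈ Metric.sphere (0 : ℂ) (1 / 4), z - b / 2 + d / z ≠ 0 := by
    intro z hz h
    have := (hc z hz).2.2
    rw [h, div_zero, zero_re] at this
    exact lt_irrefl _ this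
  have hrw : ∀ z ∈ Metric.sphere (0 : ℂ) (1 / 4),
      (r : ℂ) + (1 + 3 * (b : ℂ) / 2 - z - d / z) ^ (1 / 2 : ℂ) ≠ 0 := by
    intro z hz h
    have h4 := re_cpow_half_pos (hc z hz).2.1
    have := congrArg re h
    simp only [add_re, ofReal_re, zero_re] at this
    linarith
  have hident : ∀ z ∈ Metric.sphere (0 : ℂ) (1 / 4),
      (z - d / z) ^ 2 * (1 + 3 * (b : ℂ) / 2 - z - d / z) ^ (1 / 2 : ℂ) / (z - b / 2 + d / z) =
        psi b d z - r * s ^ 2 / (z - b / 2 + d / z) := by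
    intro z hz
    have hz0 := (sphere_quarter_ne_zero hz).1
    have := integrand_identity (b := (b : ℂ)) (s := s) (r := r)
      (w := (1 + 3 * (b : ℂ) / 2 - z - d / z) ^ (1 / 2 : ℂ)) (Z := z - b / 2 + d / z)
      (q := (z - d / z) ^ 2) hr2c (by rw [cpow_half_sq]; ring)
      (by rw [hdc]; field_simp; ring) (hcr z hz) (hrw z hz)
    rw [this, psi]
    congr 2
    ring
  have hsplit : (∮ z in C(0, 1 / 2), radicand h j z ^ (1 / 2 : ℂ)) =
      ∮ z in C(0, 1 / 4), (psi b d z / z -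
        (r * s ^ 2) * ((z : ℂ) ^ 2 - b / 2 * z + (b ^ 2 + 4 * s ^ 2) / 16)⁻¹) := by
    rw [← key, circleIntegral]
    refine intervalIntegral.integral_congr fun t _ => ?_
    have hz := hξs t
    have hz0 := hξ0 t
    have hsq : radicand h j (exp (L t)) ^ (1 / 2 : ℂ) =
        (ξ t - d / ξ t) * (1 + 3 * (b : ℂ) / 2 - ξ t - d / ξ t) ^ (1 / 2 : ℂ) /
          (ξ t - b / 2 + d / ξ t) := by
      refine cpow_half_eq_of_sq_eq ?_ (hc (ξ t) hz).2.2
      have hZ : exp (L t) = ξ t - b / 2 + d / ξ t := by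
        rw [hexp, hη]; field_simp; ring
      have hne := hcr (ξ t) hz
      have hq : (ξ t - d / ξ t) ^ 2 = (ξ t - b / 2 + d / ξ t) ^ 2 + b * (ξ t - b / 2 + d / ξ t)
          - s ^ 2 := by rw [hdc]; field_simp; ring
      rw [div_pow, mul_pow, cpow_half_sq, hq, hZ, radicand]
      have hh : (h : ℂ) = b * (1 + b) + s ^ 2 := by simp [h]
      have hj : (j : ℂ) ^ 2 = 4 * s ^ 2 * (1 + b) := by
        simp only [j]; push_cast; rw [mul_pow, hr2c]; ring
      rw [hh, hj, show 1 + 3 * (b : ℂ) / 2 - ξ t - d / ξ t = 1 + b - (ξ t - b / 2 + d / ξ t) by ring]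
      generalize ξ t - b / 2 + d / ξ t = Z at hne
      field_simp
      ring
    -- This is `dz = (ξ - d/ξ) dξ/ξ`. Its factor meets the factor `ξ - d/ξ` of the root and produces
    -- the rational square `q`.
    have hder : exp (L t) * L' t = I * (ξ t - d / ξ t) := by
      have := hη0 t
      rw [hexp, hL']
      field_simp
      rw [hη]
      field_simp
      ring
    have hden : (ξ t) ^ 2 - b / 2 * ξ t + (b ^ 2 + 4 * s ^ 2) / 16 =
        ξ t * (ξ t - b / 2 + d / ξ t) := by rw [hdc]; field_simp
    have hi := hident (ξ t) hz
    have hne := hcr (ξ t) hz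
    simp only [hsq, hder, deriv_circleMap, smul_eq_mul]
    rw [← hξ, hden]
    have : psi b d (ξ t) / ξ t - r * s ^ 2 * (ξ t * (ξ t - b / 2 + d / ξ t))⁻¹ =
        (psi b d (ξ t) - r * s ^ 2 / (ξ t - b / 2 + d / ξ t)) / ξ t := by field_simp
    rw [this, ← hi]
    field_simp
  rw [hsplit]
  -- For `s = 0` the pole term has coefficient zero; the cancellation of residues needs two distinct
  -- poles.
  by_cases hs0 : s = 0
  · simp [hs0]
  · have i1 : CircleIntegrable (fun z => psi b d z / z) 0 (1 / 4) := by
      refine ContinuousOn.circleIntegrable (by norm_num) fun z hz => ?_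
      have hz0 := (sphere_quarter_ne_zero hz).1
      have := (analyticAt_psi (E := ℂ) (b := fun _ => b) (d := fun _ => d) (ξ := fun z => z) (x := z)
        analyticAt_const analyticAt_const analyticAt_id hz0 (by linarith [hb.1]) (hc z hz).2.1)
      exact (this.continuousAt.div continuousAt_id hz0).continuousWithinAt
    have i2 : CircleIntegrable (fun z : ℂ => (r * s ^ 2 : ℂ) *
        (z ^ 2 - b / 2 * z + (b ^ 2 + 4 * s ^ 2) / 16)⁻¹) 0 (1 / 4) := by
      refine ContinuousOn.circleIntegrable (by norm_num) ?_
      refine continuousOn_const.mul (ContinuousOn.inv₀ (by fun_prop) fun z hz => ?_)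
      have hz0 := (sphere_quarter_ne_zero hz).1
      rw [show z ^ 2 - (b : ℂ) / 2 * z + (b ^ 2 + 4 * s ^ 2) / 16 =
        z * (z - b / 2 + d / z) by rw [hdc]; field_simp]
      exact mul_ne_zero hz0 (hcr z hz)
    rw [circleIntegral.integral_sub i1 i2, circleIntegral.integral_const_mul,
      circleIntegral_inv_quadratic_eq_zero hs0 (by linarith), mul_zero, sub_zero]

theorem eventually_vanishingAction_eq :
    ∀ᶠ p in 𝓝 (0 : ℝ × ℝ),
      vanishingAction (p.1 * (1 + p.1) + p.2 ^ 2) (2 * p.2 * √(1 + p.1))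
        = vanishingPeriod (p.1, (p.1 ^ 2 + 4 * p.2 ^ 2) / 16) := by
  filter_upwards [eventually_radicand_circleIntegral] with p hp
  rw [vanishingAction_eq, hp, vanishingPeriod]

end ChampagneBottle

/-! ### The action as a real integral and the origin of its logarithm -/

namespace ChampagneBottle

open Complex MeasureTheory

/-- With `z = r²`, the radial momentum is `√2 r` times the root of the radicand; the remaining `√2`
is absorbed by the scaling of the action. -/
theorem two_pi_mul_scaledAction (h j : ℝ) :
    2 * Real.pi * scaledAction h j =
      2 * ∫ z in Set.Ioi (0 : ℝ), √(1 - z + h / z - j ^ 2 / (4 * z ^ 2)) := by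
  have h1 := integral_comp_rpow_Ioi_of_pos (p := 2) (by norm_num)
    (g := fun z : ℝ => √(1 - z + h / z - j ^ 2 / (4 * z ^ 2)))
  have h2 : ∀ r ∈ Set.Ioi (0 : ℝ), radialMomentum h (j / √2) r =
      √2 / 2 * ((2 * r ^ ((2 : ℝ) - 1)) •
        √(1 - r ^ (2 : ℝ) + h / r ^ (2 : ℝ) - j ^ 2 / (4 * (r ^ (2 : ℝ)) ^ 2))) := by
    intro r hr
    have hr : 0 < r := hr
    have e1 : r ^ (2 : ℝ) = r ^ 2 := by exact_mod_cast Real.rpow_natCast r 2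
    have e2 : r ^ ((2 : ℝ) - 1) = r := by norm_num
    rw [e1, e2, radialMomentum, div_pow, Real.sq_sqrt (by norm_num), smul_eq_mul]
    have e3 : 2 * (h + r ^ 2 - r ^ 4) - j ^ 2 / 2 / r ^ 2 =
        (√2 * r) ^ 2 * (1 - r ^ 2 + h / r ^ 2 - j ^ 2 / (4 * (r ^ 2) ^ 2)) := by
      rw [mul_pow, Real.sq_sqrt (by norm_num)]; field_simp; ring
    rw [e3, Real.sqrt_mul (by positivity), Real.sqrt_sq (by positivity)]
    ring
  have h3 : ∫ r in Set.Ioi (0 : ℝ), radialMomentum h (j / √2) r =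
      √2 / 2 * ∫ z in Set.Ioi (0 : ℝ), √(1 - z + h / z - j ^ 2 / (4 * z ^ 2)) := by
    rw [← h1, ← integral_const_mul]
    exact setIntegral_congr_fun measurableSet_Ioi h2
  have h4 : √2 * √2 = (2 : ℝ) := Real.mul_self_sqrt (by norm_num)
  rw [scaledAction, radialAction, h3]
  have := Real.pi_ne_zero
  generalize ∫ z in Set.Ioi (0 : ℝ), √(1 - z + h / z - j ^ 2 / (4 * z ^ 2)) = w
  field_simp
  linear_combination w * h4

/-- The part of the Laurent series of `psi` in positive powers, divided by `x`. -/
noncomputable def laurentPart (b d x : ℝ) : ℝ :=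
  ((2 * Real.pi * I : ℂ)⁻¹ * ∮ ξ in C(0, 1 / 4), psi b d ξ / (ξ * (ξ - x))).re

theorem analyticAt_laurentPart {b d x : ℝ} (hb : -1 < b) (hx : |x| < 1 / 4)
    (hw : ∀ ξ ∈ Metric.sphere (0 : ℂ) (1 / 4), 1 + 3 * (b : ℂ) / 2 - ξ - d / ξ ∈ slitPlane) :
    AnalyticAt ℝ (fun q : (ℝ × ℝ) × ℝ => laurentPart q.1.1 q.1.2 q.2) ((b, d), x) := by
  refine AnalyticAt.complex_re (AnalyticAt.mul analyticAt_const ?_)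
  refine AnalyticAt.circleIntegral (f := fun q : ((ℝ × ℝ) × ℝ) × ℂ =>
    psi q.1.1.1 q.1.1.2 q.2 / (q.2 * (q.2 - q.1.2))) (by norm_num) fun ξ hξ => ?_
  obtain ⟨h0, h1⟩ := sphere_quarter_ne_zero hξ
  have hne : ξ - x ≠ 0 := by
    intro h
    rw [sub_eq_zero.1 h, norm_real, Real.norm_eq_abs] at h1
    linarith
  have h2 : AnalyticAt ℝ (fun q : ((ℝ × ℝ) × ℝ) × ℂ => psi q.1.1.1 q.1.1.2 q.2) (((b, d), x), ξ) :=
    analyticAt_psi (by fun_prop) (by fun_prop) (by fun_prop) h0 hb (hw ξ hξ)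
  exact h2.div (by fun_prop) (mul_ne_zero h0 hne)

/-- The integral of `laurentPart` over `[8d, 1/8]`. -/
noncomputable def laurentIntegral (p : ℝ × ℝ) : ℝ :=
  ∫ t in (0 : ℝ)..1, (1 / 8 - 8 * p.2) * laurentPart p.1 p.2 (8 * p.2 + t * (1 / 8 - 8 * p.2))

theorem analyticAt_laurentIntegral : AnalyticAt ℝ laurentIntegral (0, 0) := by
  refine AnalyticAt.intervalIntegral (f := fun q : (ℝ × ℝ) × ℝ =>
    (1 / 8 - 8 * q.1.2) * laurentPart q.1.1 q.1.2 (8 * q.1.2 + q.2 * (1 / 8 - 8 * q.1.2)))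
    fun t ht => ?_
  rw [Set.uIcc_of_le zero_le_one] at ht
  have h1 : AnalyticAt ℝ (fun q : (ℝ × ℝ) × ℝ => laurentPart q.1.1 q.1.2 q.2)
      ((fun q : (ℝ × ℝ) × ℝ => (q.1, 8 * q.1.2 + q.2 * (1 / 8 - 8 * q.1.2))) ((0, 0), t)) := by
    refine analyticAt_laurentPart (by norm_num) ?_ fun ξ hξ => ?_
    · simp only [mul_zero, zero_add, sub_zero]
      rw [abs_of_nonneg (by linarith [ht.1])]
      linarith [ht.2]
    · simpa using one_sub_mem_slitPlane (z := ξ)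
        (by rw [(sphere_quarter_ne_zero hξ).2]; norm_num)
  have h2 := h1.fun_comp (f := fun q : (ℝ × ℝ) × ℝ =>
    (q.1, 8 * q.1.2 + q.2 * (1 / 8 - 8 * q.1.2))) (by fun_prop)
  exact AnalyticAt.mul (by fun_prop) h2

/-- On `4 d ≤ |z| ≤ 1/4` both `z` and `d / z` have norm at most `1/4`. The bound on `b` holds
uniformly as `d → 0`, while the annulus grows to a punctured disc. -/
theorem slit_of_annulus {b d : ℝ} (hb : |b| < 1 / 10) (hd : 0 < d) {z : ℂ}
    (h1 : d / (1 / 4) ≤ ‖z‖) (h2 : ‖z‖ ≤ 1 / 4) :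
    1 + 3 * (b : ℂ) / 2 - z - d / z ∈ slitPlane := by
  left
  have hz : 0 < ‖z‖ := lt_of_lt_of_le (by positivity) h1
  have e1 := (re_le_norm z).trans h2
  have e2 : ((d : ℂ) / z).re ≤ 1 / 4 := by
    refine (re_le_norm _).trans ?_
    rw [norm_div, norm_real, Real.norm_of_nonneg hd.le, div_le_iff₀ hz]
    linarith
  have e3 : ((3 : ℂ) * b / 2).re = 3 * b / 2 := by
    rw [show (3 : ℂ) * b / 2 = ((3 * b / 2 : ℝ) : ℂ) by push_cast; ring, ofReal_re]
  rw [abs_lt] at hb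
  simp only [sub_re, add_re, one_re, e3]
  linarith

/-- Laurent splitting on the annulus `4 d ≤ |ξ| ≤ 1/4`: by invariance the negative powers of `x`
have the coefficients of the positive powers, in the variable `d / x`. The constant term is half of
`vanishingPeriod` because the latter is normalised by `1 / (πi)`. -/
theorem psi_re_eq {b d x : ℝ} (hb : |b| < 1 / 10) (hd : 0 < d) (hx1 : 4 * d < x) (hx2 : x < 1 / 4) :
    (psi b d x).re = vanishingPeriod (b, d) / 2 + x * laurentPart b d x +
      d / x * laurentPart b d (d / x) := by
  have hx0 : 0 < x := by linarith
  have hb' := abs_lt.1 hb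
  have hr0 : 0 ≤ √(1 + b) := Real.sqrt_nonneg _
  have key := laurent_split_of_invariant (f := psi b d) (R := 1 / 4) (d := d) (by norm_num) hd
    (fun z hz1 hz2 => by
      have hsl := slit_of_annulus hb hd hz1 hz2
      have hz0 : z ≠ 0 := norm_pos_iff.1 (lt_of_lt_of_le (by positivity) hz1)
      have hw : DifferentiableAt ℂ
          (fun z : ℂ => (1 + 3 * (b : ℂ) / 2 - z - d / z) ^ (1 / 2 : ℂ)) z :=
        DifferentiableAt.cpow_const (by fun_prop (disch := simp [hz0])) hsl
      unfold psi
      refine DifferentiableAt.sub (by fun_prop (disch := simp [hz0]))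
        (DifferentiableAt.div (by fun_prop (disch := simp [hz0])) (by fun_prop) ?_)
      intro h
      have h4 := re_cpow_half_pos hsl
      have := congrArg re h
      simp only [add_re, ofReal_re, zero_re] at this
      linarith)
    (fun z hz => psi_inv hd.ne' hz) (x := x)
    (by rw [norm_real, Real.norm_of_nonneg hx0.le]; linarith)
    (by rw [norm_real, Real.norm_of_nonneg hx0.le]; linarith)
  have hpi : (Real.pi : ℂ) ≠ 0 := by exact_mod_cast Real.pi_ne_zero
  have hI := I_ne_zero
  have e1 : psi b d x = (2 * Real.pi * I : ℂ)⁻¹ * (2 * Real.pi * I * psi b d x) := by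
    field_simp
  have e2 : (2 * Real.pi * I : ℂ)⁻¹ = ((1 / 2 : ℝ) : ℂ) * (Real.pi * I : ℂ)⁻¹ := by
    push_cast; field_simp
  rw [e1, key, mul_add, mul_add, add_re, add_re]
  congr 1
  · congr 1
    · rw [e2, mul_assoc, re_ofReal_mul, vanishingPeriod]; ring
    · rw [mul_left_comm, re_ofReal_mul, laurentPart]
  · rw [mul_left_comm, ← ofReal_div, re_ofReal_mul, laurentPart]

/-- The constant Laurent term gives the logarithm. Under `x ↦ d / x` the negative powers on `[√d,
1/8]` become the positive powers on `[8 d, √d]`, so the two pieces join to one integral over `[8 d,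
1/8]`. The point `√d` disappears from its limits, and with it the only obstruction to analyticity at
`d = 0`. -/
theorem integral_psi_div {b d : ℝ} (hb : |b| < 1 / 10) (hd : 0 < d) (hd' : d < 1 / 1000) :
    ∫ x in √d..(1 / 8), (psi b d x).re / x =
      vanishingPeriod (b, d) / 2 * Real.log (1 / 8 / √d) + laurentIntegral (b, d) := by
  have hsd : 0 < √d := Real.sqrt_pos.2 hd
  have hsd' : √d < 1 / 8 := by rw [Real.sqrt_lt' (by norm_num)]; linarith
  have hdd : √d * √d = d := Real.mul_self_sqrt hd.le
  have hlt : 4 * d < √d := by nlinarith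
  have hb' := abs_lt.1 hb
  have hslit : ∀ ξ ∈ Metric.sphere (0 : ℂ) (1 / 4),
      1 + 3 * (b : ℂ) / 2 - ξ - d / ξ ∈ slitPlane := fun ξ hξ => by
    have h1 := (sphere_quarter_ne_zero hξ).2
    exact slit_of_annulus hb hd (by rw [h1]; linarith) h1.le
  have hcont : ∀ x : ℝ, |x| < 1 / 4 → ContinuousAt (laurentPart b d) x := fun x hx =>
    ((analyticAt_laurentPart (by linarith) hx hslit).continuousAt).comp
      (f := fun x : ℝ => ((b, d), x)) (by fun_prop)
  have e0 : ∀ x ∈ Set.uIcc (√d) (1 / 8), (psi b d x).re / x =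
      vanishingPeriod (b, d) / 2 * x⁻¹ + laurentPart b d x -
        laurentPart b d (d / x) * (-d / x ^ 2) := by
    intro x hx
    rw [Set.uIcc_of_le hsd'.le] at hx
    have hx0 : 0 < x := hsd.trans_le hx.1
    rw [psi_re_eq hb hd (by linarith [hx.1]) (by linarith [hx.2])]
    field_simp
    ring
  have hpos : ∀ x ∈ Set.uIcc (√d) (1 / 8), 0 < x ∧ x ≤ 1 / 8 ∧ √d ≤ x := by
    intro x hx
    rw [Set.uIcc_of_le hsd'.le] at hx
    exact ⟨hsd.trans_le hx.1, hx.2, hx.1⟩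
  have c1 : ContinuousOn (fun x : ℝ => vanishingPeriod (b, d) / 2 * x⁻¹) (Set.uIcc (√d) (1 / 8)) :=
    continuousOn_const.mul (continuousOn_id.inv₀ fun x hx => (hpos x hx).1.ne')
  have c2 : ContinuousOn (laurentPart b d) (Set.uIcc (√d) (1 / 8)) := fun x hx =>
    (hcont x (by rw [abs_of_pos (hpos x hx).1]; linarith [(hpos x hx).2.1])).continuousWithinAt
  have hdx : ∀ x ∈ Set.uIcc (√d) (1 / 8), 0 < d / x ∧ d / x < 1 / 4 := by
    intro x hx
    refine ⟨div_pos hd (hpos x hx).1, ?_⟩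
    rw [div_lt_iff₀ (hpos x hx).1]
    linarith [(hpos x hx).2.2]
  have c4 : ContinuousOn (fun x : ℝ => -d / x ^ 2) (Set.uIcc (√d) (1 / 8)) :=
    continuousOn_const.div (by fun_prop) fun x hx => (pow_pos (hpos x hx).1 2).ne'
  have cdx : ContinuousOn (fun x : ℝ => d / x) (Set.uIcc (√d) (1 / 8)) :=
    continuousOn_const.div continuousOn_id fun x hx => (hpos x hx).1.ne'
  have c3 : ContinuousOn (fun x : ℝ => laurentPart b d (d / x)) (Set.uIcc (√d) (1 / 8)) := by
    intro x hx
    have h1 := hcont (d / x) (by rw [abs_of_pos (hdx x hx).1]; exact (hdx x hx).2)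
    exact ContinuousAt.comp_continuousWithinAt (f := fun x => d / x) h1 (cdx x hx)
  have hsub := intervalIntegral.integral_comp_mul_deriv'' (f := fun x : ℝ => d / x)
    (f' := fun x => -d / x ^ 2) (g := laurentPart b d) (a := √d) (b := 1 / 8) cdx
    (fun x hx => by
      rw [min_eq_left hsd'.le, max_eq_right hsd'.le] at hx
      have hx0 : x ≠ 0 := (hsd.trans hx.1).ne'
      have := (hasDerivAt_inv hx0).const_mul d
      refine (this.congr_deriv (by field_simp)).hasDerivWithinAt) c4 (by
      rintro _ ⟨x, hx, rfl⟩
      exact (hcont _ (by rw [abs_of_pos (hdx x hx).1]; exact (hdx x hx).2)).continuousWithinAt)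
  have e1 : d / √d = √d := by rw [div_eq_iff hsd.ne']; exact hdd.symm
  simp only [e1, Function.comp_def] at hsub
  have i1 : IntervalIntegrable (fun x : ℝ => vanishingPeriod (b, d) / 2 * x⁻¹ + laurentPart b d x)
      volume (√d) (1 / 8) := (c1.add c2).intervalIntegrable
  have i2 : IntervalIntegrable (fun x : ℝ => laurentPart b d (d / x) * (-d / x ^ 2))
      volume (√d) (1 / 8) := (c3.mul c4).intervalIntegrable
  rw [intervalIntegral.integral_congr e0, intervalIntegral.integral_sub i1 i2,
    intervalIntegral.integral_add c1.intervalIntegrable c2.intervalIntegrable, hsub,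
    intervalIntegral.integral_const_mul, integral_inv_of_pos hsd (by norm_num)]
  have hL : laurentIntegral (b, d) = ∫ x in (8 * d)..(1 / 8), laurentPart b d x := by
    have hk : (1 / 8 - 8 * d) ≠ 0 := by linarith
    simp only [laurentIntegral]
    have := intervalIntegral.integral_comp_mul_deriv'' (f := fun t : ℝ => 8 * d + t * (1 / 8 - 8 * d))
      (f' := fun _ => 1 / 8 - 8 * d) (g := laurentPart b d) (a := 0) (b := 1) (by fun_prop)
      (fun t _ => by
        have := ((hasDerivAt_id t).mul_const (1 / 8 - 8 * d)).const_add (8 * d)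
        exact (this.congr_deriv (one_mul _)).hasDerivWithinAt) continuousOn_const (by
        rintro _ ⟨t, ht, rfl⟩
        rw [Set.uIcc_of_le zero_le_one] at ht
        refine (hcont _ ?_).continuousWithinAt
        have : 0 ≤ t * (1 / 8 - 8 * d) := mul_nonneg ht.1 (by linarith)
        have : t * (1 / 8 - 8 * d) ≤ 1 * (1 / 8 - 8 * d) :=
          mul_le_mul_of_nonneg_right ht.2 (by linarith)
        rw [abs_of_nonneg (by linarith)]
        linarith)
    simp only [Function.comp_def, zero_mul, add_zero, one_mul] at this
    rw [show 8 * d + (1 / 8 - 8 * d) = 1 / 8 by ring] at this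
    rw [← this]
    exact intervalIntegral.integral_congr fun t _ => mul_comm _ _
  have e8 : d / (1 / 8) = 8 * d := by ring
  have hi : ∀ u v : ℝ, u ∈ Set.Icc (8 * d) (1 / 8) → v ∈ Set.Icc (8 * d) (1 / 8) →
      IntervalIntegrable (laurentPart b d) volume u v := by
    intro u v hu hv
    refine ContinuousOn.intervalIntegrable fun x hx => (hcont x ?_).continuousWithinAt
    have := Set.OrdConnected.uIcc_subset Set.ordConnected_Icc hu hv hx
    rw [abs_of_nonneg (by linarith [this.1])]
    linarith [this.2]
  have hm : √d ∈ Set.Icc (8 * d) (1 / 8) := ⟨by nlinarith, hsd'.le⟩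
  have h8 : 8 * d ∈ Set.Icc (8 * d) (1 / 8) := ⟨le_rfl, by linarith⟩
  have h9 : (1 / 8 : ℝ) ∈ Set.Icc (8 * d) (1 / 8) := ⟨by linarith, le_rfl⟩
  rw [e8, hL, ← intervalIntegral.integral_add_adjacent_intervals (hi _ _ h8 hm) (hi _ _ hm h9),
    intervalIntegral.integral_symm (8 * d) (√d)]
  ring

end ChampagneBottle

/-! ### Outer and inner parts of the action integral -/

namespace ChampagneBottle

open Complex MeasureTheory

/-- The outer part of the action integral, with `z = e - c t²`. -/
noncomputable def outerIntegral (p : ℝ × ℝ) : ℝ :=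
  ∫ t in (0 : ℝ)..1, 2 * (7 / 8 + 3 * p.1 / 2 - (p.1 ^ 2 + 4 * p.2 ^ 2) / 2) *
    √(7 / 8 + 3 * p.1 / 2 - (p.1 ^ 2 + 4 * p.2 ^ 2) / 2) * t ^ 2 *
    (√((1 + p.1 - (7 / 8 + 3 * p.1 / 2 - (p.1 ^ 2 + 4 * p.2 ^ 2) / 2) * t ^ 2) ^ 2 +
      p.1 * (1 + p.1 - (7 / 8 + 3 * p.1 / 2 - (p.1 ^ 2 + 4 * p.2 ^ 2) / 2) * t ^ 2) - p.2 ^ 2) /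
      (1 + p.1 - (7 / 8 + 3 * p.1 / 2 - (p.1 ^ 2 + 4 * p.2 ^ 2) / 2) * t ^ 2))

theorem analyticAt_outerIntegral : AnalyticAt ℝ outerIntegral 0 := by
  refine AnalyticAt.intervalIntegral (f := fun q : (ℝ × ℝ) × ℝ =>
    2 * (7 / 8 + 3 * q.1.1 / 2 - (q.1.1 ^ 2 + 4 * q.1.2 ^ 2) / 2) *
    √(7 / 8 + 3 * q.1.1 / 2 - (q.1.1 ^ 2 + 4 * q.1.2 ^ 2) / 2) * q.2 ^ 2 *
    (√((1 + q.1.1 - (7 / 8 + 3 * q.1.1 / 2 - (q.1.1 ^ 2 + 4 * q.1.2 ^ 2) / 2) * q.2 ^ 2) ^ 2 +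
      q.1.1 * (1 + q.1.1 - (7 / 8 + 3 * q.1.1 / 2 - (q.1.1 ^ 2 + 4 * q.1.2 ^ 2) / 2) * q.2 ^ 2)
        - q.1.2 ^ 2) /
      (1 + q.1.1 - (7 / 8 + 3 * q.1.1 / 2 - (q.1.1 ^ 2 + 4 * q.1.2 ^ 2) / 2) * q.2 ^ 2)))
    fun t ht => ?_
  rw [Set.uIcc_of_le zero_le_one] at ht
  have ht2 : t ^ 2 ≤ 1 := pow_le_one₀ ht.1 ht.2
  have hz : (0 : ℝ) < 1 - 7 / 8 * t ^ 2 := by linarith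
  refine AnalyticAt.mul (AnalyticAt.mul (AnalyticAt.mul (by fun_prop (disch := norm_num))
    (AnalyticAt.sqrt (by fun_prop (disch := norm_num)) (by norm_num))) (by fun_prop))
    (AnalyticAt.div (AnalyticAt.sqrt (by fun_prop (disch := norm_num)) ?_)
      (by fun_prop (disch := norm_num)) ?_)
  · simp only [Prod.fst_zero, Prod.snd_zero]
    norm_num
    nlinarith
  · simp only [Prod.fst_zero, Prod.snd_zero]
    norm_num
    linarith

/-- This is the purpose of the coordinates `(b, s)`: the large root is `1 + b`, and the colliding
pair are the roots of `z² + b z - s²`. -/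
theorem radicand_factor {b s r z : ℝ} (hr : r ^ 2 = 1 + b) (hz : z ≠ 0) :
    1 - z + (b * (1 + b) + s ^ 2) / z - (2 * s * r) ^ 2 / (4 * z ^ 2) =
      (z ^ 2 + b * z - s ^ 2) * (1 + b - z) / z ^ 2 := by
  rw [mul_pow, hr]; field_simp; ring

/-- The substitution `z = 1 + b - c t²` removes the square root singularity at the large root, so
that the integrand is analytic in the parameters up to the end. The constant `c` puts `t = 1` at the
image of `ξ = 1/8`, where the inner part ends. -/
theorem outer_eq {b s : ℝ} (hb : |b| < 1 / 100) (hs : |s| < 1 / 100) :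
    ∫ z in (-b / 2 + 1 / 8 + (b ^ 2 + 4 * s ^ 2) / 2)..(1 + b),
      √((z ^ 2 + b * z - s ^ 2) * (1 + b - z) / z ^ 2) = outerIntegral (b, s) := by
  have hb' := abs_lt.1 hb
  have hs' := abs_lt.1 hs
  have hb2 : b ^ 2 < 1 / 1000 := by nlinarith
  have hs2 : s ^ 2 < 1 / 1000 := by nlinarith
  set c := 7 / 8 + 3 * b / 2 - (b ^ 2 + 4 * s ^ 2) / 2 with hc
  have hc0 : 0 < c := by nlinarith
  have hpos : ∀ t ∈ Set.Icc (0 : ℝ) 1, 1 / 10 < 1 + b - c * t ^ 2 := by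
    intro t ht
    have ht2 : t ^ 2 ≤ 1 := pow_le_one₀ ht.1 ht.2
    nlinarith [sq_nonneg b, sq_nonneg s]
  have hsub := intervalIntegral.integral_comp_mul_deriv'' (f := fun t : ℝ => 1 + b - c * t ^ 2)
    (f' := fun t => -(2 * c * t))
    (g := fun z => √((z ^ 2 + b * z - s ^ 2) * (1 + b - z) / z ^ 2)) (a := 0) (b := 1)
    (by fun_prop)
    (fun t _ => by
      have := (((hasDerivAt_id t).pow 2).const_mul c).const_sub (1 + b)
      refine (this.congr_deriv ?_).hasDerivWithinAt
      simp; ring) (by fun_prop) (by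
      rintro _ ⟨t, ht, rfl⟩
      rw [Set.uIcc_of_le zero_le_one] at ht
      have h1 := hpos t ht
      refine ContinuousAt.continuousWithinAt ?_
      refine Real.continuous_sqrt.continuousAt.comp' (ContinuousAt.div (by fun_prop) (by fun_prop) ?_)
      positivity)
  have e1 : 1 + b - c * 1 ^ 2 = -b / 2 + 1 / 8 + (b ^ 2 + 4 * s ^ 2) / 2 := by rw [hc]; ring
  have e0 : 1 + b - c * 0 ^ 2 = 1 + b := by ring
  simp only [e0, e1, Function.comp_def] at hsub
  rw [intervalIntegral.integral_symm, ← hsub, ← intervalIntegral.integral_neg, outerIntegral]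
  refine intervalIntegral.integral_congr fun t ht => ?_
  rw [Set.uIcc_of_le zero_le_one] at ht
  have h1 := hpos t ht
  simp only [← hc]
  obtain ⟨z, hz⟩ : ∃ z, z = 1 + b - c * t ^ 2 := ⟨_, rfl⟩
  rw [← hz] at h1 ⊢
  have hct : 1 + b - z = c * t ^ 2 := by rw [hz]; ring
  rw [hct, Real.sqrt_div' _ (sq_nonneg z), Real.sqrt_sq (by linarith),
    mul_comm (z ^ 2 + b * z - s ^ 2), Real.sqrt_mul (by positivity), Real.sqrt_mul hc0.le,
    Real.sqrt_sq ht.1]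
  ring

/-- The pole term, which vanishes over the closed loop, contributes arctangents on the real segment.
-/
theorem integral_arctan_part {b s u v : ℝ} (r : ℝ) (h0 : s ≠ 0) :
    ∫ x in u..v, r * s ^ 2 / ((x - b / 4) ^ 2 + s ^ 2 / 4) =
      2 * r * s * (Real.arctan (2 * (v - b / 4) / s) - Real.arctan (2 * (u - b / 4) / s)) := by
  have hd : ∀ x : ℝ, HasDerivAt (fun x => 2 * r * s * Real.arctan (2 * (x - b / 4) / s))
      (r * s ^ 2 / ((x - b / 4) ^ 2 + s ^ 2 / 4)) x := by
    intro x
    have h1 := ((((hasDerivAt_id x).sub_const (b / 4)).const_mul 2).div_const s).arctan.const_mul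
      (2 * r * s)
    refine h1.congr_deriv ?_
    have : (x - b / 4) ^ 2 + s ^ 2 / 4 ≠ 0 := by positivity
    have h2 : 1 + (2 * (x - b / 4) / s) ^ 2 ≠ 0 := by positivity
    simp only [id]
    field_simp
    ring
  have hc : Continuous (fun x : ℝ => r * s ^ 2 / ((x - b / 4) ^ 2 + s ^ 2 / 4)) :=
    continuous_const.div (by fun_prop) fun x => by positivity
  rw [intervalIntegral.integral_eq_sub_of_hasDerivAt (fun x _ => hd x) (hc.intervalIntegrable _ _)]
  ring

theorem psi_ofReal_re {b d x : ℝ} (hw : 0 < 1 + 3 * b / 2 - x - d / x) :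
    (psi b d x).re = √(1 + b) * (x + d / x + b / 2) -
      (x - d / x) ^ 2 / (√(1 + b) + √(1 + 3 * b / 2 - x - d / x)) := by
  have : psi b d x = ((√(1 + b) * (x + d / x + b / 2) -
      (x - d / x) ^ 2 / (√(1 + b) + √(1 + 3 * b / 2 - x - d / x)) : ℝ) : ℂ) := by
    rw [psi]
    push_cast
    rw [← ofReal_cpow_half hw]
    push_cast
    rfl
  rw [this, ofReal_re]

-- `x ↦ x + d/x - b/2` maps `[√d, 1/8]` monotonically onto the inner interval. Its critical point
-- `√d` goes to the turning point, so the square root singularity there is cancelled by the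
-- vanishing of the derivative.
set_option maxHeartbeats 1000000 in
theorem inner_eq {b s : ℝ} (hb : |b| < 1 / 100) (hs : |s| < 1 / 100) (h0 : (b, s) ≠ 0) :
    IntegrableOn (fun z => √((z ^ 2 + b * z - s ^ 2) * (1 + b - z) / z ^ 2))
      (Set.Ioo ((√(b ^ 2 + 4 * s ^ 2) - b) / 2) (-b / 2 + 1 / 8 + (b ^ 2 + 4 * s ^ 2) / 2)) ∧
    ∫ z in Set.Ioo ((√(b ^ 2 + 4 * s ^ 2) - b) / 2) (-b / 2 + 1 / 8 + (b ^ 2 + 4 * s ^ 2) / 2),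
      √((z ^ 2 + b * z - s ^ 2) * (1 + b - z) / z ^ 2) =
      vanishingPeriod (b, (b ^ 2 + 4 * s ^ 2) / 16) / 2 *
        Real.log (1 / 8 / √((b ^ 2 + 4 * s ^ 2) / 16)) +
      laurentIntegral (b, (b ^ 2 + 4 * s ^ 2) / 16) -
      2 * √(1 + b) * s * (Real.arctan ((1 / 4 - b / 2) / s) -
        Real.arctan ((√(b ^ 2 + 4 * s ^ 2) - b) / (2 * s))) := by
  have hb' := abs_lt.1 hb
  have hs' := abs_lt.1 hs
  have hb2 : b ^ 2 < 1 / 1000 := by nlinarith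
  have hs2 : s ^ 2 < 1 / 1000 := by nlinarith
  have hq0 : 0 < b ^ 2 + 4 * s ^ 2 := by
    by_contra h
    have h1 : b ^ 2 = 0 := by nlinarith [sq_nonneg b, sq_nonneg s]
    have h2 : s ^ 2 = 0 := by nlinarith [sq_nonneg b, sq_nonneg s]
    exact h0 (by rw [pow_eq_zero_iff two_ne_zero] at h1 h2; rw [h1, h2]; rfl)
  set d := (b ^ 2 + 4 * s ^ 2) / 16 with hd
  have hd0 : 0 < d := by positivity
  have hd1 : d < 1 / 1000 := by linarith
  set y := √d with hy
  have hy0 : 0 < y := Real.sqrt_pos.2 hd0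
  have hyy : y ^ 2 = d := Real.sq_sqrt hd0.le
  have hy1 : y < 1 / 8 := by rw [hy, Real.sqrt_lt' (by norm_num)]; linarith
  have hρ : √(b ^ 2 + 4 * s ^ 2) = 4 * y := by
    rw [Real.sqrt_eq_iff_mul_self_eq hq0.le (by positivity)]
    linarith
  rw [hρ]
  set Z : ℝ → ℝ := fun x => -b / 2 + x + d / x with hZ
  have hZy : Z y = (4 * y - b) / 2 := by
    have : d / y = y := by rw [div_eq_iff hy0.ne', ← hyy]; ring
    simp only [hZ, this]; ring
  have hZ8 : Z (1 / 8) = -b / 2 + 1 / 8 + (b ^ 2 + 4 * s ^ 2) / 2 := by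
    simp only [hZ, hd]; ring
  have hmono : StrictMonoOn Z (Set.Icc y (1 / 8)) := by
    intro u hu v hv huv
    have hu0 : 0 < u := hy0.trans_le hu.1
    have hv0 : 0 < v := hu0.trans huv
    have huv' : d < u * v := by nlinarith [hu.1]
    have : Z v - Z u = (v - u) * (1 - d / (u * v)) := by
      simp only [hZ]; field_simp; ring
    have h3 : d / (u * v) < 1 := by rw [div_lt_one (by positivity)]; exact huv'
    nlinarith [mul_pos (sub_pos.2 huv) (sub_pos.2 h3)]
  have hcont : ContinuousOn Z (Set.Icc y (1 / 8)) := by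
    refine ContinuousOn.add (by fun_prop) (continuousOn_const.div continuousOn_id fun x hx => ?_)
    exact (hy0.trans_le hx.1).ne'
  have himg : Z '' Set.Ioo y (1 / 8) =
      Set.Ioo ((4 * y - b) / 2) (-b / 2 + 1 / 8 + (b ^ 2 + 4 * s ^ 2) / 2) := by
    rw [← hZy, ← hZ8]
    refine Set.Subset.antisymm ?_ (intermediate_value_Ioo hy1.le hcont)
    rintro _ ⟨x, hx, rfl⟩
    exact ⟨hmono ⟨le_rfl, hy1.le⟩ ⟨hx.1.le, hx.2.le⟩ hx.1,
      hmono ⟨hx.1.le, hx.2.le⟩ ⟨hy1.le, le_rfl⟩ hx.2⟩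
  have hder : ∀ x ∈ Set.Ioo y (1 / 8), HasDerivWithinAt Z (1 - d / x ^ 2) (Set.Ioo y (1 / 8)) x := by
    intro x hx
    have hx0 : x ≠ 0 := (hy0.trans hx.1).ne'
    have := ((hasDerivAt_id x).const_add (-b / 2)).add ((hasDerivAt_inv hx0).const_mul d)
    exact (this.congr_deriv (by field_simp; ring)).hasDerivWithinAt
  have hinj : Set.InjOn Z (Set.Ioo y (1 / 8)) := (hmono.mono Set.Ioo_subset_Icc_self).injOn
  have hr2 : √(1 + b) ^ 2 = 1 + b := Real.sq_sqrt (by linarith)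
  have hr0 : 0 < √(1 + b) := Real.sqrt_pos.2 (by linarith)
  have hxz : ∀ x : ℝ, x ≠ 0 → x * Z x = (x - b / 4) ^ 2 + s ^ 2 / 4 := by
    intro x hx
    simp only [hZ, hd]; field_simp; ring
  have hkey : ∀ x ∈ Set.Ioo y (1 / 8), |1 - d / x ^ 2| •
      √((Z x ^ 2 + b * Z x - s ^ 2) * (1 + b - Z x) / Z x ^ 2) =
      (psi b d x).re / x - √(1 + b) * s ^ 2 / ((x - b / 4) ^ 2 + s ^ 2 / 4) := by
    intro x hx
    have hx0 : 0 < x := hy0.trans hx.1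
    have hdx : d / x < x := by rw [div_lt_iff₀ hx0]; nlinarith [hx.1]
    have hdx0 : 0 < d / x := by positivity
    have hqx : Z x ^ 2 + b * Z x - s ^ 2 = (x - d / x) ^ 2 := by
      simp only [hZ, hd]; field_simp; ring
    have hZe : 1 + b - Z x = 1 + 3 * b / 2 - x - d / x := by simp only [hZ]; ring
    have hwpos : 0 < 1 + 3 * b / 2 - x - d / x := by linarith [hx.2]
    have hZ0 : 0 < Z x := by
      have h1 : 0 ≤ (x - b / 4) ^ 2 + s ^ 2 / 4 := by positivity
      rw [← hxz x hx0.ne'] at h1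
      have h2 : Z y < Z x := hmono ⟨le_rfl, hy1.le⟩ ⟨hx.1.le, hx.2.le⟩ hx.1
      have h3 : b ≤ 4 * y := by
        refine (abs_le_of_sq_le_sq' (a := b) ?_ (by positivity)).2
        nlinarith [sq_nonneg s]
      rw [hZy] at h2
      linarith
    rw [psi_ofReal_re hwpos, hqx, hZe, Real.sqrt_div' _ (sq_nonneg _), Real.sqrt_sq hZ0.le,
      Real.sqrt_mul (sq_nonneg _), Real.sqrt_sq (by linarith), ← hxz x hx0.ne', smul_eq_mul]
    set w := √(1 + 3 * b / 2 - x - d / x) with hw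
    have hw0 : 0 < w := Real.sqrt_pos.2 hwpos
    have hw2 : w ^ 2 = 1 + b - Z x := by rw [hw, Real.sq_sqrt hwpos.le, hZe]
    have hid := integrand_identity hr2 hw2 hqx.symm hZ0.ne' (by positivity)
    have hab : |1 - d / x ^ 2| = (x - d / x) / x := by
      have e : 1 - d / x ^ 2 = (x - d / x) / x := by field_simp
      rw [e, abs_of_pos (div_pos (by linarith) hx0)]
    have hZb : x + d / x + b / 2 = Z x + b := by simp only [hZ]; ring
    rw [hab, hZb]
    have : (x - d / x) / x * ((x - d / x) * w / Z x) = ((x - d / x) ^ 2 * w / Z x) / x := by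
      field_simp
    rw [this, hid, sub_div, div_div (√(1 + b) * s ^ 2),
      mul_comm (Z x)]
  -- continuity of the transformed integrand
  have hc1 : ContinuousOn (fun x : ℝ => (psi b d x).re / x) (Set.Icc y (1 / 8)) := by
    intro x hx
    have hx0 : 0 < x := hy0.trans_le hx.1
    have hsl := slit_of_annulus (b := b) (d := d) (z := (x : ℂ)) (by linarith) hd0
      (by rw [norm_real, Real.norm_of_nonneg hx0.le]; nlinarith [hx.1])
      (by rw [norm_real, Real.norm_of_nonneg hx0.le]; linarith [hx.2])
    have h1 := analyticAt_psi (E := ℝ) (b := fun _ => b) (d := fun _ => d) (ξ := fun x => (x : ℂ))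
      (x := x) analyticAt_const analyticAt_const (by fun_prop)
      (by exact_mod_cast hx0.ne') (by linarith) hsl
    exact ((continuous_re.continuousAt.comp' h1.continuousAt).div continuousAt_id
      hx0.ne').continuousWithinAt
  have hc2 : ContinuousOn (fun x : ℝ => √(1 + b) * s ^ 2 / ((x - b / 4) ^ 2 + s ^ 2 / 4))
      (Set.Icc y (1 / 8)) := by
    rcases eq_or_ne s 0 with h | h
    · simpa [h] using continuousOn_const
    · exact continuousOn_const.div (by fun_prop) fun x _ => by positivity
  have hci := hc1.sub hc2
  rw [← himg]
  constructor
  · rw [integrableOn_image_iff_integrableOn_abs_deriv_smul measurableSet_Ioo hder hinj,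
      integrableOn_congr_fun hkey measurableSet_Ioo]
    exact (hci.integrableOn_Icc).mono_set Set.Ioo_subset_Icc_self
  · rw [integral_image_eq_integral_abs_deriv_smul measurableSet_Ioo hder hinj,
      setIntegral_congr_fun measurableSet_Ioo hkey, ← integral_Ioc_eq_integral_Ioo,
      ← intervalIntegral.integral_of_le hy1.le]
    rw [intervalIntegral.integral_sub (by
        refine ContinuousOn.intervalIntegrable ?_; rwa [Set.uIcc_of_le hy1.le]) (by
        refine ContinuousOn.intervalIntegrable ?_; rwa [Set.uIcc_of_le hy1.le]),
      integral_psi_div (by linarith) hd0 hd1]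
    -- At `s = 0` the pole term carries `s²` and the arctangent term `s`, so neither contributes and
    -- the divisions by `s` are harmless.
    rcases eq_or_ne s 0 with h | h
    · simp [h, ← hy]
    · rw [integral_arctan_part _ h]
      congr 4
      · ring
      · rw [div_eq_div_iff h (by positivity)]; ring

/-- `Real.sqrt` vanishes outside the allowed interval, so the half-line may be replaced by `(a, 1 +
b)`, which is then cut at the image of `ξ = 1/8`. -/
theorem radial_integral_eq {b s : ℝ} (hb : |b| < 1 / 100) (hs : |s| < 1 / 100) (h0 : (b, s) ≠ 0) :
    ∫ z in Set.Ioi (0 : ℝ), √(1 - z + (b * (1 + b) + s ^ 2) / z -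
        (2 * s * √(1 + b)) ^ 2 / (4 * z ^ 2)) =
      outerIntegral (b, s) + vanishingPeriod (b, (b ^ 2 + 4 * s ^ 2) / 16) / 2 *
        Real.log (1 / 8 / √((b ^ 2 + 4 * s ^ 2) / 16)) +
      laurentIntegral (b, (b ^ 2 + 4 * s ^ 2) / 16) -
      2 * √(1 + b) * s * (Real.arctan ((1 / 4 - b / 2) / s) -
        Real.arctan ((√(b ^ 2 + 4 * s ^ 2) - b) / (2 * s))) := by
  obtain ⟨hint, hin⟩ := inner_eq hb hs h0
  have hout := outer_eq hb hs
  have hb' := abs_lt.1 hb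
  have hs' := abs_lt.1 hs
  have hb2 : b ^ 2 < 1 / 1000 := by nlinarith
  have hs2 : s ^ 2 < 1 / 1000 := by nlinarith
  have hr2 : √(1 + b) ^ 2 = 1 + b := Real.sq_sqrt (by linarith)
  set ρ := √(b ^ 2 + 4 * s ^ 2) with hρ
  have hρ2 : ρ ^ 2 = b ^ 2 + 4 * s ^ 2 := Real.sq_sqrt (by positivity)
  have hρ0 : 0 ≤ ρ := Real.sqrt_nonneg _
  have hbρ : |b| ≤ ρ := by
    refine abs_le_of_sq_le_sq ?_ hρ0
    nlinarith [sq_nonneg s]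
  have hbρ' := abs_le.1 hbρ
  have hρ1 : ρ < 1 / 10 := by nlinarith
  set a := (ρ - b) / 2 with ha
  set z0 := -b / 2 + 1 / 8 + (b ^ 2 + 4 * s ^ 2) / 2 with hz0
  have ha0 : 0 ≤ a := by linarith
  have haz : a < z0 := by nlinarith [sq_nonneg b, sq_nonneg s]
  have hze : z0 < 1 + b := by linarith
  -- The second small root `-(ρ + b)/2` is not positive, so for `z > 0` the sign of the radicand is
  -- that of `(z - a) (1 + b - z)`.
  have hfac : ∀ z : ℝ, z ^ 2 + b * z - s ^ 2 = (z - a) * (z + (ρ + b) / 2) := by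
    intro z; rw [ha]; nlinarith
  set f : ℝ → ℝ := fun z => √((z ^ 2 + b * z - s ^ 2) * (1 + b - z) / z ^ 2) with hf
  have e1 : ∫ z in Set.Ioi (0 : ℝ), √(1 - z + (b * (1 + b) + s ^ 2) / z -
        (2 * s * √(1 + b)) ^ 2 / (4 * z ^ 2)) = ∫ z in Set.Ioi (0 : ℝ), f z :=
    setIntegral_congr_fun measurableSet_Ioi fun z hz => by
      simp only [hf]; rw [radicand_factor hr2 (ne_of_gt hz)]
  have e2 : ∫ z in Set.Ioi (0 : ℝ), f z = ∫ z in Set.Ioo a (1 + b), f z := by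
    refine (setIntegral_eq_of_subset_of_forall_sdiff_eq_zero measurableSet_Ioi
      (fun z hz => lt_of_le_of_lt ha0 hz.1) fun z hz => ?_)
    have hz1 : 0 < z := hz.1
    refine Real.sqrt_eq_zero'.2 (div_nonpos_of_nonpos_of_nonneg ?_ (sq_nonneg z))
    rw [hfac]
    rcases le_or_gt z a with h | h
    · exact mul_nonpos_of_nonpos_of_nonneg
        (mul_nonpos_of_nonpos_of_nonneg (by linarith) (by linarith)) (by linarith)
    · have : 1 + b ≤ z := by
        by_contra h'
        exact hz.2 ⟨h, not_le.1 h'⟩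
      exact mul_nonpos_of_nonneg_of_nonpos (mul_nonneg (by linarith) (by linarith)) (by linarith)
  have hcf : ContinuousOn f (Set.Icc z0 (1 + b)) := by
    intro z hz
    have : 0 < z := by nlinarith [hz.1]
    exact (Real.continuous_sqrt.continuousAt.comp'
      (ContinuousAt.div (by fun_prop) (by fun_prop) (by positivity))).continuousWithinAt
  have hun : Set.Ioo a (1 + b) = Set.Ioo a z0 ∪ Set.Ico z0 (1 + b) :=
    (Set.Ioo_union_Ico_eq_Ioo haz hze.le).symm
  rw [e1, e2, hun, setIntegral_union (by
      rw [Set.disjoint_left]; intro z h1 h2; exact absurd h1.2 (not_lt.2 h2.1)) measurableSet_Ico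
    hint (hcf.integrableOn_Icc.mono_set Set.Ico_subset_Icc_self), hin, integral_Ico_eq_integral_Ioo,
    ← integral_Ioc_eq_integral_Ioo, ← intervalIntegral.integral_of_le hze.le, hout]
  ring

end ChampagneBottle

/-! ### The singular form of the action at the focus-focus value -/

theorem AnalyticAt.exists_inverse_of_hasFDerivAt_id {E : Type*} [NormedAddCommGroup E]
    [NormedSpace ℝ E] [CompleteSpace E] {f : E → E} (hf : AnalyticAt ℝ f 0) (h0 : f 0 = 0)
    (hf' : HasFDerivAt f (ContinuousLinearMap.id ℝ E) 0) :
    ∃ g : E → E, AnalyticAt ℝ g 0 ∧ g 0 = 0 ∧ (∀ᶠ y in 𝓝 0, f (g y) = y) ∧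
      ∀ᶠ y in 𝓝 0, g (f y) = y := by
  have hc : ContDiffAt ℝ ω f 0 := hf.contDiffAt
  have hs : HasStrictFDerivAt f ((ContinuousLinearEquiv.refl ℝ E : E ≃L[ℝ] E) : E →L[ℝ] E) 0 :=
    hc.hasStrictFDerivAt' hf' (by simp)
  refine ⟨hs.localInverse f _ 0, ?_, ?_, ?_, hs.eventually_left_inverse⟩
  · have := hc.to_localInverse (f' := ContinuousLinearEquiv.refl ℝ E) hf' (by simp)
    rw [h0] at this
    exact this.analyticAt
  · have := hs.localInverse_apply_image
    rwa [h0] at this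
  · have := hs.eventually_right_inverse
    rwa [h0] at this

/-- A half-angle formula: `(√(b² + 4 s²) - b) / (2 s)` is the tangent of half the angle whose
cotangent is `b / (2 s)`. -/
theorem Real.arctan_sqrt_sub_div {b s : ℝ} (hs : 0 < s) :
    Real.arctan ((√(b ^ 2 + 4 * s ^ 2) - b) / (2 * s)) =
      (Real.pi / 2 - Real.arctan (b / (2 * s))) / 2 := by
  set ρ := √(b ^ 2 + 4 * s ^ 2) with hρ
  have hρ2 : ρ ^ 2 = b ^ 2 + 4 * s ^ 2 := Real.sq_sqrt (by positivity)
  have hb : |b| < ρ := abs_lt_of_sq_lt_sq (by nlinarith [pow_pos hs 2]) (Real.sqrt_nonneg _)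
  have hb' := abs_lt.1 hb
  set y := (ρ - b) / (2 * s) with hy
  have hy0 : 0 < y := div_pos (by linarith) (by positivity)
  have h1 : 0 < Real.arctan y := Real.arctan_pos.2 hy0
  have h2 := Real.arctan_lt_pi_div_two y
  have h3 : Real.tan (Real.pi / 2 - 2 * Real.arctan y) = b / (2 * s) := by
    rw [Real.tan_pi_div_two_sub, Real.tan_two_mul, Real.tan_arctan, inv_div,
      div_eq_div_iff (by positivity) (by positivity), hy]
    field_simp
    linear_combination (-1) * hρ2
  have := Real.arctan_eq_of_tan_eq h3 ⟨by linarith, by linarith⟩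
  linarith

namespace ChampagneBottle

open MeasureTheory

/-- The trigonometric part of the action integral, for `P = r b + d G`. -/
theorem arctan_combination {b s r d G x : ℝ} (hs : s ≠ 0) (hr : 0 < r)
    (hd : 16 * d = b ^ 2 + 4 * s ^ 2) (hd0 : 0 < d) (hG : 0 < 16 * r + G * b) (hx : 0 < x) :
    4 * r * s * (Real.arctan (x / s) - Real.arctan ((√(b ^ 2 + 4 * s ^ 2) - b) / (2 * s))) =
      |2 * s * r| * (Real.pi / 2 + Real.arctan ((r * b + d * G) / |2 * s * r|)) -
      2 * s * r * (2 * Real.arctan (s / x) + Real.arctan (2 * s * G / (16 * r + G * b))) := by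
  -- Both sides are even in `s`.
  wlog hpos : 0 < s generalizing s
  · have hneg : 0 < -s := by
      rcases lt_or_gt_of_ne hs with h | h
      · linarith
      · exact absurd h hpos
    have := this (s := -s) (neg_ne_zero.2 hs) (by rw [neg_sq]; exact hd) hneg
    simp only [neg_sq, mul_neg, div_neg, neg_mul, Real.arctan_neg, abs_neg, neg_div] at this
    linarith
  have e1 : Real.arctan (x / s) = Real.pi / 2 - Real.arctan (s / x) := by
    rw [← Real.arctan_inv_of_pos (by positivity), inv_div]
  have e2 : Real.arctan ((r * b + d * G) / (2 * s * r)) =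
      Real.arctan (b / (2 * s)) + Real.arctan (2 * s * G / (16 * r + G * b)) := by
    -- This excludes a jump by `π` in the addition formula. The difference of the two sides is `d
    -- (16 r + G b)`, which is positive.
    have h1 : (r * b + d * G) * -b < 2 * s * r * (2 * s) := by
      nlinarith [mul_pos hd0 hG]
    have h2 : (r * b + d * G) / (2 * s * r) * (-b / (2 * s)) < 1 := by
      rw [div_mul_div_comm, div_lt_one (by positivity)]
      exact h1
    have h3 := Real.arctan_add h2
    rw [neg_div, Real.arctan_neg] at h3
    have h4 : ((r * b + d * G) / (2 * s * r) + -(b / (2 * s))) /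
        (1 - (r * b + d * G) / (2 * s * r) * -(b / (2 * s))) = 2 * s * G / (16 * r + G * b) := by
      have h5 : 1 - (r * b + d * G) / (2 * s * r) * -(b / (2 * s)) =
          d * (16 * r + G * b) / (4 * s ^ 2 * r) := by
        rw [eq_div_iff (by positivity)]
        field_simp
        linear_combination (-4 * r) * hd
      rw [h5]
      field_simp
      ring
    rw [h4] at h3
    linarith
  rw [abs_of_pos (by positivity), e1, Real.arctan_sqrt_sub_div hpos, e2]
  ring

theorem eventually_norm_lt (c : ℝ) (hc : 0 < c) :
    ∀ᶠ p in 𝓝 (0 : ℝ × ℝ), |p.1| < c ∧ |p.2| < c := by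
  filter_upwards [Metric.ball_mem_nhds (0 : ℝ × ℝ) hc] with p hp
  rw [mem_ball_zero_iff, Prod.norm_def, max_lt_iff] at hp
  exact hp

/-- The singular terms found so far involve `log d` and an angle in `(b, s)`. Since `P = √(1 + b) b
+ d G`, one gets `P² + j₂² = d M` with `M` analytic and nonzero; thus `log d` is the logarithm of
`P² + j₂²` up to an analytic function, and the angle of `(b, s)` is similarly that of `(P, j₂)`. All
singularity is then expressed through the vanishing action `P` and `j₂`. -/
theorem exists_scaledAction_coord :
    ∃ u : ℝ × ℝ → ℝ, AnalyticAt ℝ u 0 ∧ ∀ᶠ p in 𝓝 (0 : ℝ × ℝ), p ≠ 0 →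
      2 * Real.pi * scaledAction (p.1 * (1 + p.1) + p.2 ^ 2) (2 * p.2 * √(1 + p.1)) =
        u p - vanishingPeriod (p.1, (p.1 ^ 2 + 4 * p.2 ^ 2) / 16) *
          (Real.log (vanishingPeriod (p.1, (p.1 ^ 2 + 4 * p.2 ^ 2) / 16) ^ 2 +
            (2 * p.2 * √(1 + p.1)) ^ 2) / 2) -
          |2 * p.2 * √(1 + p.1)| * (Real.pi / 2 + Real.arctan
            (vanishingPeriod (p.1, (p.1 ^ 2 + 4 * p.2 ^ 2) / 16) / |2 * p.2 * √(1 + p.1)|)) := by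
  have hsqrt : AnalyticAt ℝ (fun q : ℝ × ℝ => √(1 + q.1) * q.1) (0, 0) :=
    AnalyticAt.mul (AnalyticAt.sqrt (f := fun q : ℝ × ℝ => 1 + q.1) (by fun_prop) (by norm_num))
      (by fun_prop)
  -- The Hadamard quotient of `vanishingPeriod` by `d`, available because its value at `d = 0` is
  -- explicit.
  obtain ⟨G, hGa, hG⟩ := AnalyticAt.exists_eq_smul
    (f := fun q : ℝ × ℝ => vanishingPeriod q - √(1 + q.1) * q.1) (x₀ := (0 : ℝ))
    (analyticAt_vanishingPeriod.sub hsqrt) (by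
      filter_upwards [vanishingPeriod_zero_right] with b hb
      rw [hb, sub_self])
  have hκ : AnalyticAt ℝ (fun p : ℝ × ℝ => (p.1, (p.1 ^ 2 + 4 * p.2 ^ 2) / 16)) 0 := by
    fun_prop (disch := norm_num)
  have hκ0 : ((0 : ℝ × ℝ).1, ((0 : ℝ × ℝ).1 ^ 2 + 4 * (0 : ℝ × ℝ).2 ^ 2) / 16) = ((0, 0) : ℝ × ℝ) := by
    simp
  have hg : AnalyticAt ℝ (fun p : ℝ × ℝ => G (p.1, (p.1 ^ 2 + 4 * p.2 ^ 2) / 16)) 0 :=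
    AnalyticAt.fun_comp (g := G) (f := fun p : ℝ × ℝ => (p.1, (p.1 ^ 2 + 4 * p.2 ^ 2) / 16))
      (by rw [hκ0]; exact hGa) hκ
  have hP : AnalyticAt ℝ (fun p : ℝ × ℝ => vanishingPeriod (p.1, (p.1 ^ 2 + 4 * p.2 ^ 2) / 16)) 0 :=
    AnalyticAt.fun_comp (g := vanishingPeriod)
      (f := fun p : ℝ × ℝ => (p.1, (p.1 ^ 2 + 4 * p.2 ^ 2) / 16))
      (by rw [hκ0]; exact analyticAt_vanishingPeriod) hκ
  have hL : AnalyticAt ℝ (fun p : ℝ × ℝ => laurentIntegral (p.1, (p.1 ^ 2 + 4 * p.2 ^ 2) / 16)) 0 :=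
    AnalyticAt.fun_comp (g := laurentIntegral)
      (f := fun p : ℝ × ℝ => (p.1, (p.1 ^ 2 + 4 * p.2 ^ 2) / 16))
      (by rw [hκ0]; exact analyticAt_laurentIntegral) hκ
  have hr : AnalyticAt ℝ (fun p : ℝ × ℝ => √(1 + p.1)) 0 :=
    AnalyticAt.sqrt (f := fun q : ℝ × ℝ => 1 + q.1) (by fun_prop) (by norm_num)
  set g := fun p : ℝ × ℝ => G (p.1, (p.1 ^ 2 + 4 * p.2 ^ 2) / 16) with hgdef
  set P := fun p : ℝ × ℝ => vanishingPeriod (p.1, (p.1 ^ 2 + 4 * p.2 ^ 2) / 16) with hPdef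
  set L := fun p : ℝ × ℝ => laurentIntegral (p.1, (p.1 ^ 2 + 4 * p.2 ^ 2) / 16) with hLdef
  set r := fun p : ℝ × ℝ => √(1 + p.1) with hrdef
  have hr00 : r 0 = 1 := by simp [hrdef]
  -- `M` is the cofactor in `P² + j₂² = d M`, and `N` below is the denominator in the correction of
  -- the angle; both equal `16` at the origin.
  set M := fun p : ℝ × ℝ => 16 * (1 + p.1) + 2 * r p * p.1 * g p +
    (p.1 ^ 2 + 4 * p.2 ^ 2) / 16 * g p ^ 2 with hMdef
  have hM : AnalyticAt ℝ M 0 := by fun_prop (disch := norm_num)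
  have hM0 : M 0 = 16 := by simp [hMdef]
  set N := fun p : ℝ × ℝ => 16 * r p + g p * p.1 with hNdef
  have hN : AnalyticAt ℝ N 0 := by fun_prop
  have hN0 : N 0 = 16 := by simp [hNdef, hr00]
  refine ⟨fun p => 2 * outerIntegral p + 2 * L p - P p * Real.log 8 + P p * (Real.log (M p) / 2) +
    2 * p.2 * r p * (2 * Real.arctan (p.2 / (1 / 4 - p.1 / 2)) +
      Real.arctan (2 * p.2 * g p / N p)), ?_, ?_⟩
  · have h1 := analyticAt_outerIntegral
    have h2 : AnalyticAt ℝ (fun p => Real.log (M p)) 0 := hM.real_log (by rw [hM0]; norm_num)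
    have h3 : AnalyticAt ℝ (fun p : ℝ × ℝ => Real.arctan (p.2 / (1 / 4 - p.1 / 2))) 0 :=
      AnalyticAt.arctan (by fun_prop (disch := norm_num))
    have h4 : AnalyticAt ℝ (fun p : ℝ × ℝ => Real.arctan (2 * p.2 * g p / N p)) 0 :=
      AnalyticAt.arctan (AnalyticAt.div (by fun_prop) hN (by rw [hN0]; norm_num))
    fun_prop (disch := norm_num)
  · have hG' : ∀ᶠ p in 𝓝 (0 : ℝ × ℝ), P p = r p * p.1 + (p.1 ^ 2 + 4 * p.2 ^ 2) / 16 * g p := by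
      have ht : Tendsto (fun p : ℝ × ℝ => (p.1, (p.1 ^ 2 + 4 * p.2 ^ 2) / 16)) (𝓝 0)
          (𝓝 ((0, 0) : ℝ × ℝ)) := by
        have := hκ.continuousAt.tendsto
        rwa [hκ0] at this
      filter_upwards [ht.eventually hG] with p hp
      simp only [smul_eq_mul] at hp
      simp only [hPdef, hgdef, hrdef]
      linarith
    have hMe : ∀ᶠ p in 𝓝 (0 : ℝ × ℝ), 0 < M p :=
      hM.continuousAt.eventually_const_lt (by rw [hM0]; norm_num)
    have hNe : ∀ᶠ p in 𝓝 (0 : ℝ × ℝ), 0 < N p :=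
      hN.continuousAt.eventually_const_lt (by rw [hN0]; norm_num)
    filter_upwards [hG', hMe, hNe, eventually_norm_lt (1 / 100) (by norm_num)]
      with p hp hMp hNp hsm hp0
    obtain ⟨b, s⟩ := p
    have hb' := abs_lt.1 hsm.1
    have hq0 : 0 < b ^ 2 + 4 * s ^ 2 := by
      by_contra h
      have h1 : b ^ 2 = 0 := by nlinarith [sq_nonneg b, sq_nonneg s]
      have h2 : s ^ 2 = 0 := by nlinarith [sq_nonneg b, sq_nonneg s]
      exact hp0 (by rw [pow_eq_zero_iff two_ne_zero] at h1 h2; rw [h1, h2]; rfl)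
    have hPp : vanishingPeriod (b, (b ^ 2 + 4 * s ^ 2) / 16) = P (b, s) := rfl
    have hLp : laurentIntegral (b, (b ^ 2 + 4 * s ^ 2) / 16) = L (b, s) := rfl
    have hrp : √(1 + b) = r (b, s) := rfl
    have hr2 : r (b, s) ^ 2 = 1 + b := Real.sq_sqrt (by simp only at hb'; linarith)
    have hrpos : 0 < r (b, s) := Real.sqrt_pos.2 (by simp only at hb' ⊢; linarith)
    simp only at hb' hsm ⊢
    rw [two_pi_mul_scaledAction, radial_integral_eq hsm.1 hsm.2 hp0, hPp, hLp, hrp]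
    have hd0 : 0 < (b ^ 2 + 4 * s ^ 2) / 16 := by positivity
    have hPM : P (b, s) ^ 2 + (2 * s * r (b, s)) ^ 2 = (b ^ 2 + 4 * s ^ 2) / 16 * M (b, s) := by
      rw [hp]
      simp only [hMdef]
      linear_combination (b ^ 2 + 4 * s ^ 2) * hr2
    rw [hPM, Real.log_mul hd0.ne' hMp.ne', Real.log_div (by norm_num) (Real.sqrt_pos.2 hd0).ne',
      Real.log_sqrt hd0.le, show (1 / 8 : ℝ) = 8⁻¹ by norm_num, Real.log_inv]
    have harc : 4 * r (b, s) * s * (Real.arctan ((1 / 4 - b / 2) / s) -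
        Real.arctan ((√(b ^ 2 + 4 * s ^ 2) - b) / (2 * s))) =
      |2 * s * r (b, s)| * (Real.pi / 2 + Real.arctan (P (b, s) / |2 * s * r (b, s)|)) -
      2 * s * r (b, s) * (2 * Real.arctan (s / (1 / 4 - b / 2)) +
        Real.arctan (2 * s * g (b, s) / N (b, s))) := by
      rcases eq_or_ne s 0 with h | h
      · simp [h]
      · rw [hp]
        exact arctan_combination h hrpos (by ring) hd0 hNp (by linarith)
    linear_combination (-1) * harc

theorem analyticAt_vanishingAction :
    AnalyticAt ℝ (fun q : ℝ × ℝ => vanishingAction q.1 q.2) 0 := by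
  simp only [vanishingAction_eq]
  refine AnalyticAt.complex_re (AnalyticAt.mul analyticAt_const ?_)
  refine AnalyticAt.circleIntegral (f := fun q : (ℝ × ℝ) × ℂ =>
    radicand q.1.1 q.1.2 q.2 ^ (1 / 2 : ℂ)) (by norm_num) fun z hz => ?_
  rw [mem_sphere_zero_iff_norm] at hz
  have h0 : z ≠ 0 := by rw [← norm_ne_zero_iff, hz]; norm_num
  refine AnalyticAt.cpow_half ?_ ?_
  · unfold radicand
    fun_prop (disch := simp [h0])
  · simpa [radicand] using one_sub_mem_slitPlane (z := z) (by rw [hz]; norm_num)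

/-- The action integral near the focus-focus value. -/
theorem exists_scaledAction_eq :
    ∃ U : ℝ × ℝ → ℝ, AnalyticAt ℝ U 0 ∧ ∀ᶠ q in 𝓝 (0 : ℝ × ℝ), q ≠ 0 →
      2 * Real.pi * scaledAction q.1 q.2 =
        U q - vanishingAction q.1 q.2 * (Real.log (vanishingAction q.1 q.2 ^ 2 + q.2 ^ 2) / 2) -
          |q.2| * (Real.pi / 2 + Real.arctan (vanishingAction q.1 q.2 / |q.2|)) := by
  obtain ⟨u, hu, hue⟩ := exists_scaledAction_coord
  have hr : AnalyticAt ℝ (fun p : ℝ × ℝ => √(1 + p.1)) 0 :=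
    AnalyticAt.sqrt (f := fun q : ℝ × ℝ => 1 + q.1) (by fun_prop) (by norm_num)
  -- The map `(b, s) ↦ (h, j₂)` with `s` halved, so that its derivative at the origin is the
  -- identity.
  set F : ℝ × ℝ → ℝ × ℝ := fun p => (p.1 * (1 + p.1) + (p.2 / 2) ^ 2, p.2 * √(1 + p.1)) with hF
  have hFa : AnalyticAt ℝ F 0 := AnalyticAt.prod (by fun_prop (disch := norm_num)) (by fun_prop)
  have hF0 : F 0 = 0 := by simp [hF]
  have hF' : HasFDerivAt F (ContinuousLinearMap.id ℝ (ℝ × ℝ)) 0 := by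
    have f1 : HasFDerivAt (fun p : ℝ × ℝ => p.1) (ContinuousLinearMap.fst ℝ ℝ ℝ) 0 := hasFDerivAt_fst
    have f2 : HasFDerivAt (fun p : ℝ × ℝ => p.2) (ContinuousLinearMap.snd ℝ ℝ ℝ) 0 := hasFDerivAt_snd
    have h1 := (f1.mul (f1.const_add 1)).add ((f2.mul_const (1 / 2)).pow 2)
    have h2 := f2.mul hr.differentiableAt.hasFDerivAt
    refine (h1.prodMk h2).congr_fderiv ?_ |>.congr_of_eventuallyEq ?_
    · ext <;> simp
    · filter_upwards with p
      simp [hF]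
      ring
  obtain ⟨g, hg, hg0, hFg, -⟩ := hFa.exists_inverse_of_hasFDerivAt_id hF0 hF'
  have ht : Tendsto (fun q => ((g q).1, (g q).2 / 2)) (𝓝 0) (𝓝 (0 : ℝ × ℝ)) := by
    have : ContinuousAt (fun q => ((g q).1, (g q).2 / 2)) 0 := by
      have := hg.continuousAt
      fun_prop
    have := this.tendsto
    rwa [hg0, Prod.fst_zero, Prod.snd_zero, zero_div] at this
  refine ⟨fun q => u ((g q).1, (g q).2 / 2), ?_, ?_⟩
  · refine AnalyticAt.fun_comp (g := u) (f := fun q => ((g q).1, (g q).2 / 2)) ?_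
      (by fun_prop (disch := norm_num))
    rw [hg0, Prod.fst_zero, Prod.snd_zero, zero_div]
    exact hu
  · filter_upwards [ht.eventually hue, ht.eventually eventually_vanishingAction_eq, hFg]
      with q h1 h2 h3 hq
    have e1 : (g q).1 * (1 + (g q).1) + ((g q).2 / 2) ^ 2 = q.1 := congrArg Prod.fst h3
    have e2 : (g q).2 * √(1 + (g q).1) = q.2 := congrArg Prod.snd h3
    have e3 : 2 * ((g q).2 / 2) * √(1 + (g q).1) = q.2 := by rw [← e2]; ring
    have hne : ((g q).1, (g q).2 / 2) ≠ (0 : ℝ × ℝ) := by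
      intro h
      have h4 : (g q).1 = 0 := congrArg Prod.fst h
      have h5 : (g q).2 / 2 = 0 := congrArg Prod.snd h
      refine hq (Prod.ext ?_ ?_)
      · rw [← e1, h4, h5]; simp
      · rw [← e3, h5]; simp
    have h4 := h1 hne
    simp only [e1, e3] at h2 h4
    rw [h4, h2]

end ChampagneBottle

/-! ### Periods along the vanishing cycle and their derivatives -/

theorem hasDerivAt_circleIntegral_of_analyticAt {f : ℝ × ℂ → ℂ} {f' : ℂ → ℂ} {t₀ R : ℝ}
    (hR : 0 ≤ R) (hf : ∀ z ∈ Metric.sphere (0 : ℂ) R, AnalyticAt ℝ f (t₀, z))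
    (hf' : ∀ z ∈ Metric.sphere (0 : ℂ) R, HasDerivAt (fun t => f (t, z)) (f' z) t₀) :
    HasDerivAt (fun t => ∮ z in C(0, R), f (t, z)) (∮ z in C(0, R), f' z) t₀ := by
  have hm : ∀ θ : ℝ, circleMap 0 R θ ∈ Metric.sphere (0 : ℂ) R := fun θ =>
    circleMap_mem_sphere 0 hR θ
  have hcm : ∀ θ : ℝ, AnalyticAt ℝ (circleMap 0 R) θ := fun θ =>
    ((contDiff_circleMap (n := ω) 0 R).contDiffAt).analyticAt
  have hda : ∀ θ : ℝ, AnalyticAt ℝ (deriv (circleMap 0 R)) θ := fun θ => (hcm θ).deriv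
  have hcomp : ∀ θ : ℝ, AnalyticAt ℝ (fun q : ℝ × ℝ => f (q.1, circleMap 0 R q.2)) (t₀, θ) :=
    fun θ => AnalyticAt.fun_comp (g := f) (f := fun q : ℝ × ℝ => (q.1, circleMap 0 R q.2))
      (hf _ (hm θ)) (analyticAt_fst.prod ((hcm θ).fun_comp (f := Prod.snd) (x := (t₀, θ)) analyticAt_snd))
  have hint : ∀ θ : ℝ, AnalyticAt ℝ (fun q : ℝ × ℝ =>
      deriv (circleMap 0 R) q.2 • f (q.1, circleMap 0 R q.2)) (t₀, θ) := fun θ =>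
    ((hda θ).fun_comp (f := Prod.snd) (x := (t₀, θ)) analyticAt_snd).fun_smul (hcomp θ)
  have key := (hasFDerivAt_intervalIntegral_of_analyticAt (a := 0) (b := 2 * Real.pi) (x₀ := t₀)
    (fun θ _ => hint θ)).hasDerivAt
  simp only [circleIntegral]
  refine key.congr_deriv ?_
  have hpt : ∀ θ : ℝ, (fderiv ℝ (fun q : ℝ × ℝ =>
      deriv (circleMap 0 R) q.2 • f (q.1, circleMap 0 R q.2)) (t₀, θ)).comp
      (ContinuousLinearMap.inl ℝ ℝ ℝ) 1 =
      deriv (circleMap 0 R) θ • f' (circleMap 0 R θ) := by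
    intro θ
    have h1 := ((hint θ).differentiableAt.hasFDerivAt.comp t₀
      (hasFDerivAt_prodMk_left (𝕜 := ℝ) t₀ θ)).hasDerivAt
    have h2 := (hf' _ (hm θ)).const_smul (deriv (circleMap 0 R) θ)
    exact h1.unique h2
  rw [ContinuousLinearMap.intervalIntegral_apply]
  · exact intervalIntegral.integral_congr fun θ _ => hpt θ
  · refine ContinuousOn.intervalIntegrable fun θ _ => ContinuousAt.continuousWithinAt ?_
    have h1 : ContinuousAt (fun θ : ℝ => fderiv ℝ (fun q : ℝ × ℝ =>
      deriv (circleMap 0 R) q.2 • f (q.1, circleMap 0 R q.2)) (t₀, θ)) θ :=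
      (hint θ).fderiv.continuousAt.comp' (by fun_prop)
    exact h1.clm_comp continuousAt_const

theorem Complex.hasDerivAt_cpow_half {w : ℂ} (hw : w ∈ Complex.slitPlane) :
    HasDerivAt (fun w : ℂ => w ^ (1 / 2 : ℂ)) (2 * w ^ (1 / 2 : ℂ))⁻¹ w := by
  have h1 : DifferentiableAt ℂ (fun w : ℂ => w ^ (1 / 2 : ℂ)) w :=
    DifferentiableAt.cpow_const differentiableAt_id hw
  have h2 := h1.hasDerivAt.pow 2
  have h3 : HasDerivAt ((fun w : ℂ => w ^ (1 / 2 : ℂ)) ^ 2) 1 w :=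
    (hasDerivAt_id w).congr_of_eventuallyEq
      (Eventually.of_forall fun z => Complex.cpow_half_sq z)
  have h4 := h2.unique h3
  have h5 : w ^ (1 / 2 : ℂ) ≠ 0 := fun h => by
    have := Complex.re_cpow_half_pos hw
    rw [h, Complex.zero_re] at this
    exact lt_irrefl _ this
  refine h1.hasDerivAt.congr_deriv ?_
  refine eq_inv_of_mul_eq_one_left ?_
  simp only [Nat.cast_ofNat, Nat.reduceSub, pow_one] at h4
  linear_combination h4

namespace ChampagneBottle

open Complex

/-- The periods `(2πi)⁻¹ ∮ R^(-k/2) z^(-n) dz` along the vanishing cycle. -/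
noncomputable def moment (k n : ℕ) (p : ℝ × ℝ) : ℝ :=
  ((2 * Real.pi * I : ℂ)⁻¹ *
    ∮ z in C(0, 1 / 2), ((radicand p.1 p.2 z ^ (1 / 2 : ℂ)) ^ k)⁻¹ * (z ^ n)⁻¹).re

theorem sphere_half_ne_zero {z : ℂ} (hz : z ∈ Metric.sphere (0 : ℂ) (1 / 2)) :
    z ≠ 0 ∧ ‖z‖ = 1 / 2 := by
  rw [mem_sphere_zero_iff_norm] at hz
  exact ⟨by rw [← norm_ne_zero_iff, hz]; norm_num, hz⟩

theorem cpow_half_ne_zero {w : ℂ} (hw : w ∈ slitPlane) : w ^ (1 / 2 : ℂ) ≠ 0 := fun h => by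
  have := re_cpow_half_pos hw
  rw [h, zero_re] at this
  exact lt_irrefl _ this

theorem analyticAt_moment_integrand (k n : ℕ) {E : Type*} [NormedAddCommGroup E]
    [NormedSpace ℝ E] {x : E} {h j : E → ℝ} {z : E → ℂ} (hh : AnalyticAt ℝ h x)
    (hj : AnalyticAt ℝ j x) (hz : AnalyticAt ℝ z x) (h0 : z x ≠ 0)
    (hsl : radicand (h x) (j x) (z x) ∈ slitPlane) :
    AnalyticAt ℝ (fun q => ((radicand (h q) (j q) (z q) ^ (1 / 2 : ℂ)) ^ k)⁻¹ * (z q ^ n)⁻¹) x := by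
  have h1 : AnalyticAt ℝ (fun q => radicand (h q) (j q) (z q) ^ (1 / 2 : ℂ)) x := by
    refine AnalyticAt.cpow_half ?_ hsl
    unfold radicand
    fun_prop (disch := simp [h0])
  exact ((h1.pow k).inv (pow_ne_zero _ (cpow_half_ne_zero hsl))).mul
    ((hz.pow n).inv (pow_ne_zero _ h0))

/-- The points where the periods are defined by the principal branch. -/
def IsRegular (p : ℝ × ℝ) : Prop :=
  ∀ z ∈ Metric.sphere (0 : ℂ) (1 / 2), radicand p.1 p.2 z ∈ slitPlane

theorem eventually_isRegular : ∀ᶠ p in 𝓝 (0 : ℝ × ℝ), IsRegular p := by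
  filter_upwards [eventually_re_radicand_pos (r := 1 / 2) (by norm_num)] with p hp z hz
  have h1 := (sphere_half_ne_zero hz).2
  exact Or.inl (hp z h1.ge (by rw [h1]; norm_num))

theorem isRegular_zero : IsRegular 0 := eventually_isRegular.self_of_nhds

theorem analyticAt_moment (k n : ℕ) {p : ℝ × ℝ} (hp : IsRegular p) :
    AnalyticAt ℝ (moment k n) p := by
  refine AnalyticAt.complex_re (AnalyticAt.mul analyticAt_const ?_)
  refine AnalyticAt.circleIntegral (f := fun q : (ℝ × ℝ) × ℂ =>
    ((radicand q.1.1 q.1.2 q.2 ^ (1 / 2 : ℂ)) ^ k)⁻¹ * (q.2 ^ n)⁻¹) (by norm_num) fun z hz => ?_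
  exact analyticAt_moment_integrand k n (by fun_prop) (by fun_prop) (by fun_prop)
    (sphere_half_ne_zero hz).1 (hp z hz)

theorem hasDerivAt_radicand_fst (h j : ℝ) {z : ℂ} :
    HasDerivAt (fun t : ℝ => radicand t j z) z⁻¹ h := by
  unfold radicand
  have := (((hasDerivAt_id h).ofReal_comp.div_const z).const_add (1 - z)).sub_const
    ((j : ℂ) ^ 2 / (4 * z ^ 2))
  exact this.congr_deriv (by simp)

theorem hasDerivAt_radicand_snd (h j : ℝ) {z : ℂ} :
    HasDerivAt (fun t : ℝ => radicand h t z) (-(j / 2) * (z ^ 2)⁻¹) j := by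
  unfold radicand
  have := (((hasDerivAt_id j).ofReal_comp.pow 2).div_const (4 * z ^ 2)).const_sub
    (1 - z + h / z)
  refine this.congr_deriv ?_
  rcases eq_or_ne z 0 with rfl | hz
  · simp
  · simp; field_simp; ring

theorem hasDerivAt_radicand_pow (k n : ℕ) {R : ℝ → ℂ} {R' z : ℂ} {t : ℝ} (hR : HasDerivAt R R' t)
    (hsl : R t ∈ slitPlane) :
    HasDerivAt (fun t => ((R t ^ (1 / 2 : ℂ)) ^ k)⁻¹ * (z ^ n)⁻¹)
      (-(k / 2 : ℝ) * R' * (((R t ^ (1 / 2 : ℂ)) ^ (k + 2))⁻¹ * (z ^ n)⁻¹)) t := by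
  have h1 := (hasDerivAt_cpow_half hsl).scomp t hR
  have h0 := cpow_half_ne_zero hsl
  simp only [Function.comp_def] at h1
  have h2 := ((h1.pow k).inv (pow_ne_zero _ h0)).mul_const (z ^ n)⁻¹
  refine h2.congr_deriv ?_
  simp only [smul_eq_mul, Pi.pow_apply]
  generalize (R t) ^ (1 / 2 : ℂ) = w at h0
  rcases k with _ | k
  · simp
  · push_cast
    generalize (z ^ n)⁻¹ = y
    field_simp
    ring

/-- The periods are closed under differentiation: the exponent `-k/2` drops by one, and the
derivatives `1/z` and `-j/(2 z²)` of the radicand raise `n` by one or two. All Taylor coefficients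
of the vanishing action are thus values of `moment` at the origin. -/
theorem hasDerivAt_moment_fst (k n : ℕ) {p : ℝ × ℝ} (hp : IsRegular p) :
    HasDerivAt (fun t => moment k n (t, p.2)) (-(k / 2) * moment (k + 2) (n + 1) p) p.1 := by
  have h1 := hasDerivAt_circleIntegral_of_analyticAt (t₀ := p.1) (R := 1 / 2)
    (f := fun q : ℝ × ℂ => ((radicand q.1 p.2 q.2 ^ (1 / 2 : ℂ)) ^ k)⁻¹ * (q.2 ^ n)⁻¹)
    (f' := fun z => ((-(k / 2) : ℝ) : ℂ) *
      (((radicand p.1 p.2 z ^ (1 / 2 : ℂ)) ^ (k + 2))⁻¹ * (z ^ (n + 1))⁻¹)) (by norm_num)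
    (fun z hz => analyticAt_moment_integrand k n (by fun_prop) (by fun_prop) (by fun_prop)
      (sphere_half_ne_zero hz).1 (hp z hz))
    (fun z hz => (hasDerivAt_radicand_pow k n (hasDerivAt_radicand_fst p.1 p.2)
      (hp z hz)).congr_deriv (by
        rw [pow_succ z n, mul_inv]; push_cast; ring))
  have h2 := (h1.const_mul (2 * Real.pi * I : ℂ)⁻¹)
  have h3 := (Complex.reCLM.hasFDerivAt.comp_hasDerivAt p.1 h2)
  refine h3.congr_deriv ?_
  rw [circleIntegral.integral_const_mul, mul_left_comm, reCLM_apply, re_ofReal_mul]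
  rfl

theorem hasDerivAt_moment_snd (k n : ℕ) {p : ℝ × ℝ} (hp : IsRegular p) :
    HasDerivAt (fun t => moment k n (p.1, t)) (k / 4 * p.2 * moment (k + 2) (n + 2) p) p.2 := by
  have h1 := hasDerivAt_circleIntegral_of_analyticAt (t₀ := p.2) (R := 1 / 2)
    (f := fun q : ℝ × ℂ => ((radicand p.1 q.1 q.2 ^ (1 / 2 : ℂ)) ^ k)⁻¹ * (q.2 ^ n)⁻¹)
    (f' := fun z => ((k / 4 * p.2 : ℝ) : ℂ) *
      (((radicand p.1 p.2 z ^ (1 / 2 : ℂ)) ^ (k + 2))⁻¹ * (z ^ (n + 2))⁻¹)) (by norm_num)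
    (fun z hz => analyticAt_moment_integrand k n (by fun_prop) (by fun_prop) (by fun_prop)
      (sphere_half_ne_zero hz).1 (hp z hz))
    (fun z hz => (hasDerivAt_radicand_pow k n (hasDerivAt_radicand_snd p.1 p.2)
      (hp z hz)).congr_deriv (by
        rw [pow_add z n 2, mul_inv]; push_cast; ring))
  have h2 := (h1.const_mul (2 * Real.pi * I : ℂ)⁻¹)
  have h3 := (Complex.reCLM.hasFDerivAt.comp_hasDerivAt p.2 h2)
  refine h3.congr_deriv ?_
  rw [circleIntegral.integral_const_mul, mul_left_comm, reCLM_apply, re_ofReal_mul]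
  rfl

theorem analyticAt_radicand_cpow_half {E : Type*} [NormedAddCommGroup E]
    [NormedSpace ℝ E] {x : E} {h j : E → ℝ} {z : E → ℂ} (hh : AnalyticAt ℝ h x)
    (hj : AnalyticAt ℝ j x) (hz : AnalyticAt ℝ z x) (h0 : z x ≠ 0)
    (hsl : radicand (h x) (j x) (z x) ∈ slitPlane) :
    AnalyticAt ℝ (fun q => radicand (h q) (j q) (z q) ^ (1 / 2 : ℂ)) x := by
  refine AnalyticAt.cpow_half ?_ hsl
  unfold radicand
  fun_prop (disch := simp [h0])

theorem hasDerivAt_cpow_half_comp {R : ℝ → ℂ} {R' : ℂ} {t : ℝ} (hR : HasDerivAt R R' t)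
    (hsl : R t ∈ slitPlane) :
    HasDerivAt (fun t => R t ^ (1 / 2 : ℂ)) (R' * (2 * R t ^ (1 / 2 : ℂ))⁻¹) t :=
  (hasDerivAt_cpow_half hsl).scomp t hR

theorem hasDerivAt_vanishingAction_fst {p : ℝ × ℝ} (hp : IsRegular p) :
    HasDerivAt (fun t => vanishingAction t p.2) (moment 1 1 p) p.1 := by
  simp only [vanishingAction_eq]
  have h1 := hasDerivAt_circleIntegral_of_analyticAt (t₀ := p.1) (R := 1 / 2)
    (f := fun q : ℝ × ℂ => radicand q.1 p.2 q.2 ^ (1 / 2 : ℂ))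
    (f' := fun z => ((1 / 2 : ℝ) : ℂ) *
      (((radicand p.1 p.2 z ^ (1 / 2 : ℂ)) ^ 1)⁻¹ * (z ^ 1)⁻¹)) (by norm_num)
    (fun z hz => analyticAt_radicand_cpow_half (by fun_prop) (by fun_prop) (by fun_prop)
      (sphere_half_ne_zero hz).1 (hp z hz))
    (fun z hz => (hasDerivAt_cpow_half_comp (hasDerivAt_radicand_fst p.1 p.2)
      (hp z hz)).congr_deriv (by rw [mul_inv]; push_cast; ring))
  have h2 := (h1.const_mul (Real.pi * I : ℂ)⁻¹)
  have h3 := (Complex.reCLM.hasFDerivAt.comp_hasDerivAt p.1 h2)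
  refine h3.congr_deriv ?_
  rw [circleIntegral.integral_const_mul, reCLM_apply, moment]
  congr 1
  rw [mul_assoc (2 : ℂ), mul_inv]
  push_cast
  ring

theorem hasDerivAt_vanishingAction_snd {p : ℝ × ℝ} (hp : IsRegular p) :
    HasDerivAt (fun t => vanishingAction p.1 t) (-(p.2 / 2) * moment 1 2 p) p.2 := by
  simp only [vanishingAction_eq]
  have h1 := hasDerivAt_circleIntegral_of_analyticAt (t₀ := p.2) (R := 1 / 2)
    (f := fun q : ℝ × ℂ => radicand p.1 q.1 q.2 ^ (1 / 2 : ℂ))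
    (f' := fun z => ((-(p.2 / 4) : ℝ) : ℂ) *
      (((radicand p.1 p.2 z ^ (1 / 2 : ℂ)) ^ 1)⁻¹ * (z ^ 2)⁻¹)) (by norm_num)
    (fun z hz => analyticAt_radicand_cpow_half (by fun_prop) (by fun_prop) (by fun_prop)
      (sphere_half_ne_zero hz).1 (hp z hz))
    (fun z hz => (hasDerivAt_cpow_half_comp (hasDerivAt_radicand_snd p.1 p.2)
      (hp z hz)).congr_deriv (by rw [mul_inv]; push_cast; ring))
  have h2 := (h1.const_mul (Real.pi * I : ℂ)⁻¹)
  have h3 := (Complex.reCLM.hasFDerivAt.comp_hasDerivAt p.2 h2)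
  refine h3.congr_deriv ?_
  rw [circleIntegral.integral_const_mul, reCLM_apply, moment, ← re_ofReal_mul]
  congr 1
  rw [mul_assoc (2 : ℂ), mul_inv]
  push_cast
  ring

theorem radicand_zero (z : ℂ) : radicand 0 0 z = 1 - z := by simp [radicand]

theorem one_sub_mem_slitPlane_of_mem_closedBall {z : ℂ} (hz : z ∈ Metric.closedBall (0 : ℂ) (1 / 2)) :
    1 - z ∈ slitPlane :=
  one_sub_mem_slitPlane (by rw [mem_closedBall_zero_iff] at hz; linarith)

theorem hasDerivAt_one_sub_pow (k : ℕ) {z : ℂ} (hz : 1 - z ∈ slitPlane) :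
    HasDerivAt (fun z : ℂ => (((1 - z) ^ (1 / 2 : ℂ)) ^ k)⁻¹)
      ((k / 2) * (((1 - z) ^ (1 / 2 : ℂ)) ^ (k + 2))⁻¹) z := by
  have h0 := cpow_half_ne_zero hz
  have h1 := (hasDerivAt_cpow_half hz).comp z ((hasDerivAt_id z).const_sub 1)
  simp only [Function.comp_def] at h1
  have h2 := (h1.pow k).inv (pow_ne_zero _ h0)
  refine h2.congr_deriv ?_
  simp only [Pi.pow_apply]
  generalize (1 - z) ^ (1 / 2 : ℂ) = w at h0
  rcases k with _ | k
  · simp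
  · push_cast
    field_simp
    ring

/-- At the origin the radicand is `1 - z`, whose powers are holomorphic in the disc; the residue at
`z = 0` is the value there. -/
theorem moment_one_zero (k : ℕ) : moment k 1 0 = 1 := by
  have h := circleIntegral_sub_inv_smul_of_differentiable_on_off_countable (R := 1 / 2)
    (c := (0 : ℂ)) (w := 0) (s := ∅) (f := fun z : ℂ => (((1 - z) ^ (1 / 2 : ℂ)) ^ k)⁻¹)
    Set.countable_empty (by simp)
    (fun z hz => (hasDerivAt_one_sub_pow k
      (one_sub_mem_slitPlane_of_mem_closedBall hz)).continuousAt.continuousWithinAt)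
    (fun z hz => (hasDerivAt_one_sub_pow k (one_sub_mem_slitPlane_of_mem_closedBall
      (Metric.ball_subset_closedBall hz.1))).differentiableAt)
  have e : (∮ z in C(0, 1 / 2), ((radicand (0 : ℝ × ℝ).1 (0 : ℝ × ℝ).2 z ^ (1 / 2 : ℂ)) ^ k)⁻¹ *
      (z ^ 1)⁻¹) = 2 * Real.pi * I := by
    simp only [Prod.fst_zero, Prod.snd_zero, radicand_zero]
    simp only [sub_zero, one_cpow, one_pow, inv_one, smul_eq_mul, mul_one] at h
    rw [← h]
    refine circleIntegral.integral_congr (by norm_num) fun z _ => ?_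
    simp only [pow_one]
    ring
  rw [moment, e, inv_mul_cancel₀ (by simp [Real.pi_ne_zero]), one_re]

/-- The derivative of `(1 - z) ^ (-k/2) z ^ (-n-1)` integrates to zero over the circle. Iterating
this reduces every period with `n ≥ 1` at the origin to `moment_one_zero`. -/
theorem moment_zero_succ (k n : ℕ) :
    moment k (n + 2) 0 = k / (2 * (n + 1)) * moment (k + 2) (n + 1) 0 := by
  have h1 : ∀ z ∈ Metric.sphere (0 : ℂ) (1 / 2), HasDerivWithinAt
      (fun z : ℂ => (((1 - z) ^ (1 / 2 : ℂ)) ^ k)⁻¹ * (z ^ (n + 1))⁻¹)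
      (((k / 2 : ℝ) : ℂ) * ((((1 - z) ^ (1 / 2 : ℂ)) ^ (k + 2))⁻¹ * (z ^ (n + 1))⁻¹) -
        ((n + 1 : ℝ) : ℂ) * ((((1 - z) ^ (1 / 2 : ℂ)) ^ k)⁻¹ * (z ^ (n + 2))⁻¹))
      (Metric.sphere (0 : ℂ) (1 / 2)) z := by
    intro z hz
    obtain ⟨h0, hn⟩ := sphere_half_ne_zero hz
    have h2 := ((hasDerivAt_id z).pow (n + 1)).inv (pow_ne_zero _ h0)
    have h3 := (hasDerivAt_one_sub_pow k (one_sub_mem_slitPlane (by rw [hn]; norm_num))).mul h2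
    refine (h3.congr_deriv ?_).hasDerivWithinAt
    generalize (((1 - z) ^ (1 / 2 : ℂ)) ^ k)⁻¹ = y
    simp only [id, Pi.pow_apply, Pi.inv_apply, Nat.add_sub_cancel]
    push_cast
    field_simp
    ring
  have h4 := circleIntegral.integral_eq_zero_of_hasDerivWithinAt (R := 1 / 2) (by norm_num) h1
  have hci : ∀ k n : ℕ, CircleIntegrable
      (fun z : ℂ => (((1 - z) ^ (1 / 2 : ℂ)) ^ k)⁻¹ * (z ^ n)⁻¹) 0 (1 / 2) := by
    intro k n
    refine ContinuousOn.circleIntegrable (by norm_num) fun z hz => ?_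
    obtain ⟨h0, hn⟩ := sphere_half_ne_zero hz
    have h3 := (hasDerivAt_one_sub_pow k
      (one_sub_mem_slitPlane (z := z) (by rw [hn]; norm_num))).continuousAt
    exact (h3.mul ((continuousAt_id.pow n).inv₀ (pow_ne_zero _ h0))).continuousWithinAt
  rw [circleIntegral.integral_sub, circleIntegral.integral_const_mul,
    circleIntegral.integral_const_mul, sub_eq_zero] at h4
  · have h5 : (k / 2 : ℝ) * moment (k + 2) (n + 1) 0 = (n + 1 : ℝ) * moment k (n + 2) 0 := by
      simp only [moment, Prod.fst_zero, Prod.snd_zero, radicand_zero]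
      rw [← re_ofReal_mul, ← re_ofReal_mul, mul_left_comm, h4, mul_left_comm]
    have : (n + 1 : ℝ) ≠ 0 := by positivity
    field_simp
    linarith
  · exact (hci _ _).const_fun_smul (a := ((k / 2 : ℝ) : ℂ))
  · exact (hci _ _).const_fun_smul (a := ((n + 1 : ℝ) : ℂ))

theorem vanishingAction_zero : vanishingAction 0 0 = 0 := by
  rw [vanishingAction_eq]
  have : (∮ z in C(0, 1 / 2), radicand 0 0 z ^ (1 / 2 : ℂ)) = 0 := by
    simp only [radicand_zero]
    have hd : ∀ z ∈ Metric.closedBall (0 : ℂ) (1 / 2),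
        DifferentiableAt ℂ (fun z : ℂ => (1 - z) ^ (1 / 2 : ℂ)) z := fun z hz =>
      DifferentiableAt.cpow_const (by fun_prop) (one_sub_mem_slitPlane_of_mem_closedBall hz)
    exact circleIntegral_eq_zero_of_differentiable_on_off_countable (by norm_num)
      Set.countable_empty (fun z hz => (hd z hz).continuousAt.continuousWithinAt)
      (fun z hz => hd z (Metric.ball_subset_closedBall hz.1))
  rw [this, mul_zero, zero_re]

end ChampagneBottle

/-! ### Taylor expansions and the normal-form Hamiltonian -/

theorem isBigO_fst_norm : (fun p : ℝ × ℝ => p.1) =O[𝓝 0] fun p => ‖p‖ :=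
  isBigO_of_le _ fun p => by rw [norm_norm]; exact norm_fst_le p

theorem isBigO_snd_norm : (fun p : ℝ × ℝ => p.2) =O[𝓝 0] fun p => ‖p‖ :=
  isBigO_of_le _ fun p => by rw [norm_norm]; exact norm_snd_le p

theorem isBigO_norm_pow_of_le {m n : ℕ} (h : m ≤ n) :
    (fun p : ℝ × ℝ => ‖p‖ ^ n) =O[𝓝 0] fun p => ‖p‖ ^ m := by
  have hc : ContinuousAt (fun p : ℝ × ℝ => ‖p‖ ^ (n - m)) 0 := by fun_prop
  have := (isBigO_refl (fun p : ℝ × ℝ => ‖p‖ ^ m) (𝓝 0)).mul (hc.isBigO_one ℝ)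
  refine this.congr (fun p => ?_) fun p => mul_one _
  rw [← pow_add, Nat.add_sub_cancel' h]

/-- Integration of an order of vanishing at the origin. -/
theorem AnalyticAt.isBigO_norm_pow_succ {f a b : ℝ × ℝ → ℝ} {n : ℕ} (hf : AnalyticAt ℝ f 0)
    (h0 : f 0 = 0) (ha : ∀ᶠ p in 𝓝 (0 : ℝ × ℝ), HasDerivAt (fun t => f (t, p.2)) (a p) p.1)
    (hb : ∀ᶠ p in 𝓝 (0 : ℝ × ℝ), HasDerivAt (fun t => f (p.1, t)) (b p) p.2)
    (hao : a =O[𝓝 0] fun p => ‖p‖ ^ n) (hbo : b =O[𝓝 0] fun p => ‖p‖ ^ n) :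
    f =O[𝓝 0] fun p => ‖p‖ ^ (n + 1) := by
  obtain ⟨C₁, h1⟩ := hao.bound
  obtain ⟨C₂, h2⟩ := hbo.bound
  obtain ⟨r, hr, hball⟩ := Metric.eventually_nhds_iff_ball.1
    ((hf.eventually_analyticAt.and (ha.and hb)).and (h1.and h2))
  refine IsBigO.of_bound (|C₁| + |C₂|) ?_
  filter_upwards [Metric.ball_mem_nhds (0 : ℝ × ℝ) hr] with p hp
  have hsub : Metric.closedBall (0 : ℝ × ℝ) ‖p‖ ⊆ Metric.ball 0 r :=
    Metric.closedBall_subset_ball (by simpa using hp)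
  have key := (convex_closedBall (0 : ℝ × ℝ) ‖p‖).norm_image_sub_le_of_norm_fderiv_le (f := f)
    (𝕜 := ℝ) (C := (|C₁| + |C₂|) * ‖p‖ ^ n) (x := 0) (y := p)
    (fun x hx => (hball x (hsub hx)).1.1.differentiableAt) (fun x hx => by
      obtain ⟨⟨hx1, hx2, hx3⟩, hx4, hx5⟩ := hball x (hsub hx)
      have hxp : ‖x‖ ≤ ‖p‖ := by simpa using hx
      have hF := hx1.differentiableAt.hasFDerivAt
      have e1 : fderiv ℝ f x (1, 0) = a x :=
        (hF.comp_hasDerivAt x.1 (f := fun t => (t, x.2))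
          ((hasDerivAt_id x.1).prodMk (hasDerivAt_const x.1 x.2))).unique hx2
      have e2 : fderiv ℝ f x (0, 1) = b x :=
        (hF.comp_hasDerivAt x.2 (f := fun t => (x.1, t))
          ((hasDerivAt_const x.2 x.1).prodMk (hasDerivAt_id x.2))).unique hx3
      have hpow : ‖x‖ ^ n ≤ ‖p‖ ^ n := pow_le_pow_left₀ (norm_nonneg _) hxp n
      rw [norm_pow, norm_norm] at hx4 hx5
      have b1 : ‖a x‖ ≤ |C₁| * ‖p‖ ^ n := hx4.trans (mul_le_mul (le_abs_self _) hpow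
        (by positivity) (abs_nonneg _))
      have b2 : ‖b x‖ ≤ |C₂| * ‖p‖ ^ n := hx5.trans (mul_le_mul (le_abs_self _) hpow
        (by positivity) (abs_nonneg _))
      refine ContinuousLinearMap.opNorm_le_bound _ (by positivity) fun v => ?_
      have ev : fderiv ℝ f x v = v.1 * a x + v.2 * b x := by
        rw [← e1, ← e2, ← smul_eq_mul, ← smul_eq_mul, ← map_smul, ← map_smul, ← map_add]
        congr 1
        ext <;> simp
      rw [ev]
      refine (norm_add_le _ _).trans ?_
      rw [norm_mul, norm_mul, add_mul, add_mul]
      refine add_le_add ?_ ?_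
      · rw [mul_comm]
        exact mul_le_mul b1 (norm_fst_le v) (norm_nonneg _) (by positivity)
      · rw [mul_comm]
        exact mul_le_mul b2 (norm_snd_le v) (norm_nonneg _) (by positivity))
    (by simp) (by simp)
  rw [h0, sub_zero, sub_zero] at key
  rw [norm_pow, norm_norm, pow_succ, ← mul_assoc]
  exact key

namespace ChampagneBottle

theorem moment_sub_isBigO (k n : ℕ) :
    (fun p => moment k n p - moment k n 0) =O[𝓝 0] fun p => ‖p‖ ^ 1 := by
  have := (analyticAt_moment k n isRegular_zero).differentiableAt.isBigO_sub
  simp only [sub_zero] at this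
  exact this.norm_right.congr_right fun p => (pow_one _).symm

theorem moment_isBigO_one (k n : ℕ) : moment k n =O[𝓝 0] fun _ => (1 : ℝ) :=
  (analyticAt_moment k n isRegular_zero).continuousAt.isBigO_one ℝ

/-- Each order of the expansion is integrated from the previous order of the two partial
derivatives, which are again periods. -/
theorem moment_sub_linear_isBigO (k n : ℕ) :
    (fun p => moment k n p - (moment k n 0 - k / 2 * moment (k + 2) (n + 1) 0 * p.1))
      =O[𝓝 0] fun p => ‖p‖ ^ 2 := by
  refine AnalyticAt.isBigO_norm_pow_succ (n := 1)
    (a := fun p => -(k / 2) * (moment (k + 2) (n + 1) p - moment (k + 2) (n + 1) 0))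
    (b := fun p => k / 4 * p.2 * moment (k + 2) (n + 2) p) ?_ (by simp) ?_ ?_ ?_ ?_
  · exact (analyticAt_moment k n isRegular_zero).sub (by fun_prop)
  · filter_upwards [eventually_isRegular] with p hp
    have := (hasDerivAt_moment_fst k n hp).sub (((hasDerivAt_id p.1).const_mul
      (k / 2 * moment (k + 2) (n + 1) 0)).const_sub (moment k n 0))
    refine this.congr_deriv ?_
    ring
  · filter_upwards [eventually_isRegular] with p hp
    exact ((hasDerivAt_moment_snd k n hp).sub_const _)
  · exact (moment_sub_isBigO _ _).const_mul_left _
  · have := ((isBigO_snd_norm.const_mul_left (k / 4 : ℝ)).mul (moment_isBigO_one (k + 2) (n + 2)))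
    exact this.congr_right fun p => by ring

theorem moment_sub_quadratic_isBigO (k n : ℕ) :
    (fun p => moment k n p - (moment k n 0 - k / 2 * moment (k + 2) (n + 1) 0 * p.1 +
      k * (k + 2) / 8 * moment (k + 4) (n + 2) 0 * p.1 ^ 2 +
      k / 8 * moment (k + 2) (n + 2) 0 * p.2 ^ 2)) =O[𝓝 0] fun p => ‖p‖ ^ 3 := by
  refine AnalyticAt.isBigO_norm_pow_succ (n := 2)
    (a := fun p => -(k / 2) * (moment (k + 2) (n + 1) p - (moment (k + 2) (n + 1) 0 -
      (k + 2 : ℕ) / 2 * moment (k + 2 + 2) (n + 1 + 1) 0 * p.1)))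
    (b := fun p => k / 4 * (p.2 * (moment (k + 2) (n + 2) p - moment (k + 2) (n + 2) 0)))
    ?_ (by simp) ?_ ?_ ?_ ?_
  · exact (analyticAt_moment k n isRegular_zero).sub (by fun_prop)
  · filter_upwards [eventually_isRegular] with p hp
    have := (hasDerivAt_moment_fst k n hp).sub (((((hasDerivAt_id p.1).const_mul
      (k / 2 * moment (k + 2) (n + 1) 0)).const_sub (moment k n 0)).add
      (((hasDerivAt_id p.1).pow 2).const_mul (k * (k + 2) / 8 * moment (k + 4) (n + 2) 0))).add_const
      (k / 8 * moment (k + 2) (n + 2) 0 * p.2 ^ 2))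
    refine this.congr_deriv ?_
    simp
    ring
  · filter_upwards [eventually_isRegular] with p hp
    have := (hasDerivAt_moment_snd k n hp).sub (((hasDerivAt_id p.2).pow 2).const_mul
      (k / 8 * moment (k + 2) (n + 2) 0) |>.const_add (moment k n 0 -
      k / 2 * moment (k + 2) (n + 1) 0 * p.1 +
      k * (k + 2) / 8 * moment (k + 4) (n + 2) 0 * p.1 ^ 2))
    refine this.congr_deriv ?_
    simp
    ring
  · exact (moment_sub_linear_isBigO _ _).const_mul_left _
  · refine (isBigO_snd_norm.mul (moment_sub_isBigO (k + 2) (n + 2))).const_mul_left _ |>.congr_right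
      fun p => by ring

/-- The partial derivatives are `moment 1 1` and `-(j/2) * moment 1 2`; their expansions to second
and first order are integrated once more, the numbers coming from `moment_zero_succ`. -/
theorem vanishingAction_isBigO :
    (fun p : ℝ × ℝ => vanishingAction p.1 p.2 - (p.1 - 3 / 8 * p.1 ^ 2 + 35 / 64 * p.1 ^ 3 +
      15 / 64 * p.1 * p.2 ^ 2 - p.2 ^ 2 / 8)) =O[𝓝 0] fun p => ‖p‖ ^ 4 := by
  refine AnalyticAt.isBigO_norm_pow_succ (n := 3)
    (a := fun p => moment 1 1 p - (1 - 3 / 4 * p.1 + 105 / 64 * p.1 ^ 2 + 15 / 64 * p.2 ^ 2))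
    (b := fun p => -(1 / 2) * (p.2 * (moment 1 2 p - (1 / 2 - 15 / 16 * p.1))))
    ?_ ?_ ?_ ?_ ?_ ?_
  · exact analyticAt_vanishingAction.sub (by fun_prop (disch := norm_num))
  · simp [vanishingAction_zero]
  · filter_upwards [eventually_isRegular] with p hp
    have := (hasDerivAt_vanishingAction_fst hp).sub (((((hasDerivAt_id p.1).sub
      (((hasDerivAt_id p.1).pow 2).const_mul (3 / 8))).add
      (((hasDerivAt_id p.1).pow 3).const_mul (35 / 64))).add
      (((hasDerivAt_id p.1).const_mul (15 / 64)).mul_const (p.2 ^ 2))).sub_const (p.2 ^ 2 / 8))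
    refine this.congr_deriv ?_
    simp
    ring
  · filter_upwards [eventually_isRegular] with p hp
    have := (hasDerivAt_vanishingAction_snd hp).sub (((((hasDerivAt_id p.2).pow 2).const_mul
      (15 / 64 * p.1)).const_add (p.1 - 3 / 8 * p.1 ^ 2 + 35 / 64 * p.1 ^ 3)).sub
      (((hasDerivAt_id p.2).pow 2).div_const 8))
    refine this.congr_deriv ?_
    simp
    ring
  · refine (moment_sub_quadratic_isBigO 1 1).congr_left fun p => ?_
    norm_num [moment_zero_succ, moment_one_zero]
  · have h := moment_sub_linear_isBigO 1 2
    norm_num [moment_zero_succ, moment_one_zero] at h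
    refine (isBigO_snd_norm.mul h).const_mul_left (-(1 / 2)) |>.congr (fun p => by ring_nf)
      fun p => by ring

theorem vanishingAction_hasFDerivAt {p : ℝ × ℝ} (hp : IsRegular p)
    (hd : DifferentiableAt ℝ (fun q : ℝ × ℝ => vanishingAction q.1 q.2) p) :
    HasFDerivAt (fun q : ℝ × ℝ => vanishingAction q.1 q.2)
      (moment 1 1 p • ContinuousLinearMap.fst ℝ ℝ ℝ +
        (-(p.2 / 2) * moment 1 2 p) • ContinuousLinearMap.snd ℝ ℝ ℝ) p := by
  have hF := hd.hasFDerivAt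
  have e1 := (hF.comp_hasDerivAt p.1 (f := fun t => (t, p.2))
          ((hasDerivAt_id p.1).prodMk (hasDerivAt_const p.1 p.2))).unique
          (hasDerivAt_vanishingAction_fst hp)
  have e2 := (hF.comp_hasDerivAt p.2 (f := fun t => (p.1, t))
          ((hasDerivAt_const p.2 p.1).prodMk (hasDerivAt_id p.2))).unique
          (hasDerivAt_vanishingAction_snd hp)
  refine hF.congr_fderiv ?_
  ext
  · simpa using e1
  · simpa using e2

/-- The inverse of the vanishing action at fixed second action. -/
structure IsNormalHamiltonian (Hbar : ℝ × ℝ → ℝ) : Prop where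
  analyticAt : AnalyticAt ℝ Hbar 0
  zero : Hbar 0 = 0
  left : ∀ᶠ p in 𝓝 (0 : ℝ × ℝ), Hbar (vanishingAction p.1 p.2, p.2) = p.1
  right : ∀ᶠ j in 𝓝 (0 : ℝ × ℝ), vanishingAction (Hbar j) j.2 = j.1

/-- The map `(h, j₂) ↦ (J, j₂)` has the identity as derivative at the origin, because `moment 1 1`
is `1` there and `∂J/∂j₂` carries a factor `j₂`. -/
theorem exists_isNormalHamiltonian : ∃ Hbar, IsNormalHamiltonian Hbar := by
  set F : ℝ × ℝ → ℝ × ℝ := fun p => (vanishingAction p.1 p.2, p.2) with hF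
  have hJ : HasFDerivAt (fun q : ℝ × ℝ => vanishingAction q.1 q.2)
      (ContinuousLinearMap.fst ℝ ℝ ℝ) 0 := by
    refine (vanishingAction_hasFDerivAt isRegular_zero
      analyticAt_vanishingAction.differentiableAt).congr_fderiv ?_
    simp [moment_one_zero]
  have hF' : HasFDerivAt F (ContinuousLinearMap.id ℝ (ℝ × ℝ)) 0 := by
    refine (hJ.prodMk hasFDerivAt_snd).congr_fderiv ?_
    ext <;> simp
  have hFa : AnalyticAt ℝ F 0 := analyticAt_vanishingAction.prod analyticAt_snd
  obtain ⟨g, hg, hg0, hFg, hgF⟩ := hFa.exists_inverse_of_hasFDerivAt_id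
    (by simp [hF, vanishingAction_zero]) hF'
  refine ⟨fun j => (g j).1, hg.comp_fst, by simp [hg0], ?_, ?_⟩
  · filter_upwards [hgF] with p hp
    exact congrArg Prod.fst hp
  · filter_upwards [hFg] with j hj
    have hj' : (vanishingAction (g j).1 (g j).2, (g j).2) = j := hj
    have h2 : (g j).2 = j.2 := (Prod.ext_iff.1 hj').2
    have h1 : vanishingAction (g j).1 (g j).2 = j.1 := (Prod.ext_iff.1 hj').1
    rwa [h2] at h1

/-- Injectivity of `(h, j₂) ↦ (J, j₂)`: the logarithm and the angle of `(J, j₂)` are singular at the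
focus-focus value only. -/
theorem eventually_action_ne_zero :
    ∀ᶠ p in 𝓝 (0 : ℝ × ℝ), p ≠ 0 → vanishingAction p.1 p.2 ≠ 0 ∨ p.2 ≠ 0 := by
  obtain ⟨Hbar, h⟩ := exists_isNormalHamiltonian
  filter_upwards [h.left] with p hp h0
  by_contra! hc
  refine h0 (Prod.ext ?_ hc.2)
  rw [← hp, hc.1, hc.2]
  exact h.zero

namespace IsNormalHamiltonian

theorem tendsto {Hbar : ℝ × ℝ → ℝ} (h : IsNormalHamiltonian Hbar) :
    Tendsto (fun j : ℝ × ℝ => (Hbar j, j.2)) (𝓝 0) (𝓝 0) := by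
  have : ContinuousAt (fun j : ℝ × ℝ => (Hbar j, j.2)) 0 :=
    h.analyticAt.continuousAt.prodMk continuousAt_snd
  have := this.tendsto
  rwa [h.zero] at this

theorem norm_isBigO {Hbar : ℝ × ℝ → ℝ} (h : IsNormalHamiltonian Hbar) :
    (fun j : ℝ × ℝ => ‖(Hbar j, j.2)‖) =O[𝓝 0] fun j => ‖j‖ := by
  have h1 := h.analyticAt.differentiableAt.isBigO_sub
  simp only [h.zero, sub_zero] at h1
  exact (h1.norm_right.prod_left isBigO_snd_norm).norm_left

/-- Implicit differentiation of `J (H̄ j, j₂) = j₁`. -/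
theorem eventually_pd {Hbar : ℝ × ℝ → ℝ} (h : IsNormalHamiltonian Hbar) :
    ∀ᶠ j in 𝓝 (0 : ℝ × ℝ), pd1 Hbar j * moment 1 1 (Hbar j, j.2) = 1 ∧
      pd2 Hbar j * moment 1 1 (Hbar j, j.2) = j.2 / 2 * moment 1 2 (Hbar j, j.2) := by
  filter_upwards [h.right.eventually_nhds, h.tendsto.eventually eventually_isRegular,
    h.tendsto.eventually analyticAt_vanishingAction.eventually_analyticAt,
    h.analyticAt.eventually_analyticAt] with j h1 h2 h3 h4
  have hH := h4.differentiableAt.hasFDerivAt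
  have hF := (vanishingAction_hasFDerivAt h2 h3.differentiableAt).comp j
    (hH.prodMk hasFDerivAt_snd)
  have hid : HasFDerivAt (fun j : ℝ × ℝ => vanishingAction (Hbar j) j.2)
      (ContinuousLinearMap.fst ℝ ℝ ℝ) j := hasFDerivAt_fst.congr_of_eventuallyEq h1
  have key := hF.unique hid
  have k1 := DFunLike.congr_fun key ((1 : ℝ), (0 : ℝ))
  have k2 := DFunLike.congr_fun key ((0 : ℝ), (1 : ℝ))
  simp at k1 k2
  constructor
  · rw [pd1]; linarith
  · rw [pd2]; linarith

/-- In the quotient the factor `∂J/∂h` cancels: `A` is `-∂J/∂j₂` at constant `h`. -/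
theorem eventually_slope {Hbar : ℝ × ℝ → ℝ} (h : IsNormalHamiltonian Hbar) :
    ∀ᶠ j in 𝓝 (0 : ℝ × ℝ), slope Hbar j = j.2 / 2 * moment 1 2 (Hbar j, j.2) := by
  filter_upwards [h.eventually_pd] with j hj
  have h1 : moment 1 1 (Hbar j, j.2) ≠ 0 := fun h0 => by
    rw [h0, mul_zero] at hj; exact zero_ne_one hj.1
  have h2 : pd1 Hbar j ≠ 0 := fun h0 => by rw [h0, zero_mul] at hj; exact zero_ne_one hj.1
  rw [slope, div_eq_iff h2, ← hj.2, mul_right_comm]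
  rw [mul_assoc, hj.1, mul_one]

/-- The series of `J` is inverted by bootstrapping: solved for its linear term, with `J = j₁`
inserted, it bounds the remaining terms by what is already known of `H̄`. The next lemma repeats
this one order higher. -/
theorem sub_fst_isBigO {Hbar : ℝ × ℝ → ℝ} (h : IsNormalHamiltonian Hbar) :
    (fun j : ℝ × ℝ => Hbar j - j.1) =O[𝓝 0] fun j => ‖j‖ ^ 2 := by
  have hf : Hbar =O[𝓝 0] fun j => ‖j‖ := IsBigO.trans
    (isBigO_of_le _ fun j => by rw [norm_norm]; exact norm_fst_le (Hbar j, j.2)) h.norm_isBigO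
  have hn := h.norm_isBigO.pow 4
  have h1 := (vanishingAction_isBigO.comp_tendsto h.tendsto).trans hn
  simp only [Function.comp_def] at h1
  have h2 := h1.trans (isBigO_norm_pow_of_le (show 2 ≤ 4 by norm_num))
  have hs2 := isBigO_snd_norm.pow 2
  have hf2 := hf.pow 2
  have hf3 := (hf.pow 3).trans (isBigO_norm_pow_of_le (show 2 ≤ 3 by norm_num))
  have hfs := (hf.mul hs2).trans ((isBigO_norm_pow_of_le (show 2 ≤ 3 by norm_num)).congr_left
    fun p => by ring)
  refine IsBigO.congr' (((((hf2.const_mul_left (3 / 8)).sub (hf3.const_mul_left (35 / 64))).sub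
    (hfs.const_mul_left (15 / 64))).add (hs2.const_mul_left (1 / 8))).sub h2) ?_ .rfl
  filter_upwards [h.right] with j hj
  rw [hj]
  ring

theorem sub_quadratic_isBigO {Hbar : ℝ × ℝ → ℝ} (h : IsNormalHamiltonian Hbar) :
    (fun j : ℝ × ℝ => Hbar j - (j.1 + 3 / 8 * j.1 ^ 2 + j.2 ^ 2 / 8)) =O[𝓝 0]
      fun j => ‖j‖ ^ 3 := by
  have hf : Hbar =O[𝓝 0] fun j => ‖j‖ := IsBigO.trans
    (isBigO_of_le _ fun j => by rw [norm_norm]; exact norm_fst_le (Hbar j, j.2)) h.norm_isBigO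
  have hn := h.norm_isBigO.pow 4
  have h1 := (vanishingAction_isBigO.comp_tendsto h.tendsto).trans hn
  simp only [Function.comp_def] at h1
  have h2 := h1.trans (isBigO_norm_pow_of_le (show 3 ≤ 4 by norm_num))
  have hs2 := isBigO_snd_norm.pow 2
  have hf2 := (h.sub_fst_isBigO.mul (hf.add isBigO_fst_norm)).congr_right
    (g₂ := fun j : ℝ × ℝ => ‖j‖ ^ 3) fun p => by ring
  have hf3 := hf.pow 3
  have hfs := (hf.mul hs2).congr_right (g₂ := fun j : ℝ × ℝ => ‖j‖ ^ 3) fun p => by ring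
  refine IsBigO.congr' ((((hf2.const_mul_left (3 / 8)).sub (hf3.const_mul_left (35 / 64))).sub
    (hfs.const_mul_left (15 / 64))).sub h2) ?_ .rfl
  filter_upwards [h.right] with j hj
  rw [hj]
  ring

/-- The factor `j₂` of `A` gains one order, so a quadratic expansion of `moment 1 2`, with the
quadratic expansion of `H̄` inserted, leaves an error of order four. -/
theorem slope_isBigO {Hbar : ℝ × ℝ → ℝ} (h : IsNormalHamiltonian Hbar) :
    (fun j : ℝ × ℝ => slope Hbar j -
          (j.2 / 4 - 15 / 32 * j.1 * j.2 + j.2 * (135 * j.1 ^ 2 + 10 * j.2 ^ 2) / 128))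
        =O[𝓝 (0 : ℝ × ℝ)] fun j : ℝ × ℝ => (j.1 ^ 2 + j.2 ^ 2) ^ 2 := by
  have hf : Hbar =O[𝓝 0] fun j => ‖j‖ := IsBigO.trans
    (isBigO_of_le _ fun j => by rw [norm_norm]; exact norm_fst_le (Hbar j, j.2)) h.norm_isBigO
  have h1 := ((moment_sub_quadratic_isBigO 1 2).comp_tendsto h.tendsto).trans (h.norm_isBigO.pow 3)
  norm_num [moment_zero_succ, moment_one_zero, Function.comp_def] at h1
  have hf2 := (h.sub_fst_isBigO.mul (hf.add isBigO_fst_norm)).congr_right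
    (g₂ := fun j : ℝ × ℝ => ‖j‖ ^ 3) fun p => by ring
  have h2 := (h1.sub (h.sub_quadratic_isBigO.const_mul_left (15 / 16))).add
    (hf2.const_mul_left (315 / 128))
  have h3 := (isBigO_snd_norm.const_mul_left (1 / 2)).mul h2
  have h4 : (fun j : ℝ × ℝ => ‖j‖ * ‖j‖ ^ 3) =O[𝓝 0] fun j : ℝ × ℝ => (j.1 ^ 2 + j.2 ^ 2) ^ 2 := by
    refine isBigO_of_le _ fun j : ℝ × ℝ => ?_
    rw [← pow_succ', show 3 + 1 = 2 * 2 by norm_num, pow_mul, norm_pow (‖j‖ ^ 2),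
      norm_pow (j.1 ^ 2 + j.2 ^ 2)]
    refine pow_le_pow_left₀ (norm_nonneg _) ?_ 2
    rw [norm_pow, norm_norm j, Real.norm_of_nonneg (by positivity), Prod.norm_def]
    rcases max_choice ‖j.1‖ ‖j.2‖ with hm | hm <;> rw [hm, Real.norm_eq_abs, sq_abs]
    · nlinarith [sq_nonneg j.2]
    · nlinarith [sq_nonneg j.1]
  refine IsBigO.congr' (h3.trans h4) ?_ .rfl
  filter_upwards [h.eventually_slope] with j hj
  rw [hj]
  ring

end IsNormalHamiltonian

end ChampagneBottle

/-! ### Analytic branches of the action near a regular value -/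

namespace ChampagneBottle

theorem hasDerivAt_pd1 {f : ℝ × ℝ → ℝ} {p : ℝ × ℝ} (hf : DifferentiableAt ℝ f p) :
    HasDerivAt (fun t => f (t, p.2)) (pd1 f p) p.1 :=
  hf.hasFDerivAt.comp_hasDerivAt p.1 (f := fun t => (t, p.2))
    ((hasDerivAt_id p.1).prodMk (hasDerivAt_const p.1 p.2))

theorem hasDerivAt_pd2 {f : ℝ × ℝ → ℝ} {p : ℝ × ℝ} (hf : DifferentiableAt ℝ f p) :
    HasDerivAt (fun t => f (p.1, t)) (pd2 f p) p.2 :=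
  hf.hasFDerivAt.comp_hasDerivAt p.2 (f := fun t => (p.1, t))
    ((hasDerivAt_const p.2 p.1).prodMk (hasDerivAt_id p.2))

theorem analyticAt_pd1 {f : ℝ × ℝ → ℝ} {p : ℝ × ℝ} (hf : AnalyticAt ℝ f p) :
    AnalyticAt ℝ (pd1 f) p :=
  (ContinuousLinearMap.analyticAt (ContinuousLinearMap.apply ℝ ℝ ((1 : ℝ), (0 : ℝ))) _).comp hf.fderiv

theorem analyticAt_pd2 {f : ℝ × ℝ → ℝ} {p : ℝ × ℝ} (hf : AnalyticAt ℝ f p) :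
    AnalyticAt ℝ (pd2 f) p :=
  (ContinuousLinearMap.analyticAt (ContinuousLinearMap.apply ℝ ℝ ((0 : ℝ), (1 : ℝ))) _).comp hf.fderiv

theorem pd1_eq_of_hasFDerivAt {f : ℝ × ℝ → ℝ} {p : ℝ × ℝ} {f' : ℝ × ℝ →L[ℝ] ℝ}
    (h : HasFDerivAt f f' p) : pd1 f p = f' (1, 0) := by rw [pd1, h.fderiv]

theorem pd2_eq_of_hasFDerivAt {f : ℝ × ℝ → ℝ} {p : ℝ × ℝ} {f' : ℝ × ℝ →L[ℝ] ℝ}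
    (h : HasFDerivAt f f' p) : pd2 f p = f' (0, 1) := by rw [pd2, h.fderiv]

theorem pd2_congr {f g : ℝ × ℝ → ℝ} {p : ℝ × ℝ} (h : f =ᶠ[𝓝 p] g) : pd2 f p = pd2 g p := by
  rw [pd2, pd2, h.fderiv_eq]

theorem eventually_slice {P : ℝ × ℝ → Prop} {p : ℝ × ℝ} (h : ∀ᶠ q in 𝓝 p, P q) :
    ∀ᶠ t in 𝓝 p.2, P (p.1, t) := by
  have : Tendsto (fun t : ℝ => (p.1, t)) (𝓝 p.2) (𝓝 p) :=
    (Continuous.tendsto (by fun_prop) p.2)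
  exact this.eventually h

/-- The derivative of the polar angle of `(J, s)`. -/
noncomputable def angleDeriv (J : ℝ × ℝ → ℝ) (q : ℝ × ℝ) : ℝ × ℝ →L[ℝ] ℝ :=
  (J q ^ 2 + q.2 ^ 2)⁻¹ • (q.2 • fderiv ℝ J q - J q • ContinuousLinearMap.snd ℝ ℝ ℝ)

theorem hasFDerivAt_arctan_div {J : ℝ × ℝ → ℝ} {q : ℝ × ℝ} (hJ : DifferentiableAt ℝ J q)
    (hq : q.2 ≠ 0) (c : ℝ) :
    HasFDerivAt (fun q => c + Real.arctan (J q / q.2)) (angleDeriv J q) q := by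
  have h1 := (hJ.hasFDerivAt.mul ((hasDerivAt_inv hq).comp_hasFDerivAt q
    (hasFDerivAt_snd (𝕜 := ℝ) (E := ℝ) (F := ℝ) (p := q)))).arctan.const_add c
  refine (h1.congr_fderiv ?_).congr_of_eventuallyEq (Eventually.of_forall fun x => ?_)
  · have h2 : 1 + (J q * (q.2)⁻¹) ^ 2 ≠ 0 := by positivity
    have h3 : J q ^ 2 + q.2 ^ 2 ≠ 0 := by positivity
    ext
    · simp [angleDeriv]
      field_simp
      ring
    · simp [angleDeriv]
      field_simp
      ring
  · simp [div_eq_mul_inv]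

/-- A second chart of the polar angle, valid across `j₂ = 0`; it has the same differential as the
first. -/
theorem hasFDerivAt_arctan_div' {J : ℝ × ℝ → ℝ} {q : ℝ × ℝ} (hJ : DifferentiableAt ℝ J q)
    (hq : J q ≠ 0) (c : ℝ) :
    HasFDerivAt (fun q => c - Real.arctan (q.2 / J q)) (angleDeriv J q) q := by
  have h1 := ((hasFDerivAt_snd (𝕜 := ℝ) (E := ℝ) (F := ℝ) (p := q)).mul
    ((hasDerivAt_inv hq).comp_hasFDerivAt q hJ.hasFDerivAt)).arctan.const_sub c
  refine (h1.congr_fderiv ?_).congr_of_eventuallyEq (Eventually.of_forall fun x => ?_)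
  · have h2 : 1 + (q.2 * (J q)⁻¹) ^ 2 ≠ 0 := by positivity
    have h3 : J q ^ 2 + q.2 ^ 2 ≠ 0 := by positivity
    ext
    · simp [angleDeriv]
      field_simp
      try ring
    · simp [angleDeriv]
      field_simp
      ring
  · simp [div_eq_mul_inv]

/-- For `J > 0` the term with `|j₂|` is not analytic across `j₂ = 0`: it differs from its
continuation by `2π j₂`, the monodromy of the focus-focus point. The integer `k` records this jump.
The branch is chosen so that `k = 0` on the side `p.2 ≤ q.2`, the side that right derivatives see.
-/
theorem exists_angle {J : ℝ × ℝ → ℝ} {p : ℝ × ℝ} (hJ : AnalyticAt ℝ J p)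
    (hp : J p ≠ 0 ∨ p.2 ≠ 0) :
    ∃ Θ : ℝ × ℝ → ℝ, AnalyticAt ℝ Θ p ∧ (∀ᶠ q in 𝓝 p, HasFDerivAt Θ (angleDeriv J q) q) ∧
      ∀ᶠ q in 𝓝 p, ∃ k : ℤ, |q.2| * (Real.pi / 2 + Real.arctan (J q / |q.2|)) =
        q.2 * (Θ q + 2 * Real.pi * k) ∧ ((p.2 ≤ q.2 ∨ p.2 ≠ 0) → k = 0) := by
  have hJd : ∀ᶠ q in 𝓝 p, DifferentiableAt ℝ J q :=
    hJ.eventually_analyticAt.mono fun q hq => hq.differentiableAt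
  rcases lt_trichotomy p.2 0 with h | h | h
  · have hneg : ∀ᶠ q : ℝ × ℝ in 𝓝 p, q.2 < 0 := continuousAt_snd.eventually_lt_const h
    refine ⟨fun q => -(Real.pi / 2) + Real.arctan (J q / q.2),
      analyticAt_const.add (AnalyticAt.arctan (hJ.div analyticAt_snd h.ne)), ?_, ?_⟩
    · filter_upwards [hJd, hneg] with q h1 h2
      exact hasFDerivAt_arctan_div h1 h2.ne _
    · filter_upwards [hneg] with q h2
      refine ⟨0, ?_, fun _ => rfl⟩
      rw [abs_of_neg h2, div_neg, Real.arctan_neg]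
      push_cast
      ring
  · have hp' : J p ≠ 0 := hp.resolve_right (not_not.2 h)
    rcases lt_or_gt_of_ne hp' with h0 | h0
    · have hneg : ∀ᶠ q in 𝓝 p, J q < 0 := hJ.continuousAt.eventually_lt_const h0
      refine ⟨fun q => 0 - Real.arctan (q.2 / J q),
        analyticAt_const.sub (AnalyticAt.arctan (analyticAt_snd.div hJ hp')), ?_, ?_⟩
      · filter_upwards [hJd, hneg] with q h1 h2
        exact hasFDerivAt_arctan_div' h1 h2.ne _
      · filter_upwards [hneg] with q h2
        refine ⟨0, ?_, fun _ => rfl⟩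
        rcases lt_trichotomy q.2 0 with hq | hq | hq
        · rw [abs_of_neg hq, div_neg, Real.arctan_neg, ← inv_div q.2,
            Real.arctan_inv_of_pos (div_pos_of_neg_of_neg hq h2)]
          push_cast
          ring
        · simp [hq]
        · rw [abs_of_pos hq, ← inv_div q.2, Real.arctan_inv_of_neg (div_neg_of_pos_of_neg hq h2)]
          push_cast
          ring
    · have hneg : ∀ᶠ q in 𝓝 p, 0 < J q := hJ.continuousAt.eventually_const_lt h0
      refine ⟨fun q => Real.pi - Real.arctan (q.2 / J q),
        analyticAt_const.sub (AnalyticAt.arctan (analyticAt_snd.div hJ hp')), ?_, ?_⟩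
      · filter_upwards [hJd, hneg] with q h1 h2
        exact hasFDerivAt_arctan_div' h1 h2.ne' _
      · filter_upwards [hneg] with q h2
        rcases lt_trichotomy q.2 0 with hq | hq | hq
        -- The only case with a jump: `J > 0`, and `q` lies below the axis through `p`.
        · refine ⟨-1, ?_, fun hh => ?_⟩
          · rw [abs_of_neg hq, div_neg, Real.arctan_neg, ← inv_div q.2,
              Real.arctan_inv_of_neg (div_neg_of_neg_of_pos hq h2)]
            push_cast
            ring
          · rw [h] at hh
            rcases hh with hh | hh
            · exact absurd hq (not_lt.2 hh)
            · exact absurd rfl hh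
        · exact ⟨0, by simp [hq], fun _ => rfl⟩
        · refine ⟨0, ?_, fun _ => rfl⟩
          rw [abs_of_pos hq, ← inv_div q.2, Real.arctan_inv_of_pos (div_pos hq h2)]
          push_cast
          ring
  · have hpos : ∀ᶠ q : ℝ × ℝ in 𝓝 p, 0 < q.2 := continuousAt_snd.eventually_const_lt h
    refine ⟨fun q => Real.pi / 2 + Real.arctan (J q / q.2),
      analyticAt_const.add (AnalyticAt.arctan (hJ.div analyticAt_snd h.ne')), ?_, ?_⟩
    · filter_upwards [hJd, hpos] with q h1 h2
      exact hasFDerivAt_arctan_div h1 h2.ne' _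
    · filter_upwards [hpos] with q h2
      refine ⟨0, ?_, fun _ => rfl⟩
      rw [abs_of_pos h2]
      push_cast
      ring

theorem hasFDerivAt_half_log {J : ℝ × ℝ → ℝ} {q : ℝ × ℝ} (hJ : DifferentiableAt ℝ J q)
    (hq : 0 < J q ^ 2 + q.2 ^ 2) :
    HasFDerivAt (fun q => Real.log (J q ^ 2 + q.2 ^ 2) / 2)
      ((J q ^ 2 + q.2 ^ 2)⁻¹ • (J q • fderiv ℝ J q + q.2 • ContinuousLinearMap.snd ℝ ℝ ℝ)) q := by
  have h1 := ((hJ.hasFDerivAt.pow 2).add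
    ((hasFDerivAt_snd (𝕜 := ℝ) (E := ℝ) (F := ℝ) (p := q)).pow 2)).log hq.ne' |>.mul_const (1 / 2)
  refine (h1.congr_fderiv ?_).congr_of_eventuallyEq (Eventually.of_forall fun x => ?_)
  · ext <;> simp <;> ring
  · simp; ring

/-- A local branch of the action. -/
noncomputable def actionBranch (U J Θ : ℝ × ℝ → ℝ) (q : ℝ × ℝ) : ℝ :=
  U q - J q * (Real.log (J q ^ 2 + q.2 ^ 2) / 2) - q.2 * Θ q

/-- With `ρ² = J² + j₂²` and `θ` the angle, `J d(log ρ) + j₂ dθ = dJ`: the rational parts of the two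
differentials cancel, and only `log ρ + 1` and the angle remain as coefficients. -/
theorem hasFDerivAt_actionBranch {U J Θ : ℝ × ℝ → ℝ} {q : ℝ × ℝ} (hU : DifferentiableAt ℝ U q)
    (hJ : DifferentiableAt ℝ J q) (hΘ : HasFDerivAt Θ (angleDeriv J q) q)
    (hq : 0 < J q ^ 2 + q.2 ^ 2) :
    HasFDerivAt (actionBranch U J Θ) (fderiv ℝ U q -
      (Real.log (J q ^ 2 + q.2 ^ 2) / 2 + 1) • fderiv ℝ J q -
      Θ q • ContinuousLinearMap.snd ℝ ℝ ℝ) q := by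
  have h1 := (hU.hasFDerivAt.sub (hJ.hasFDerivAt.mul (hasFDerivAt_half_log hJ hq))).sub
    ((hasFDerivAt_snd (𝕜 := ℝ) (E := ℝ) (F := ℝ) (p := q)).mul hΘ)
  refine h1.congr_fderiv ?_
  ext
  · simp [angleDeriv]
    field_simp
    ring
  · simp [angleDeriv]
    field_simp
    ring

/-- The analytic expression of `2π𝒯`. -/
noncomputable def twistFormula (U J : ℝ × ℝ → ℝ) (q : ℝ × ℝ) : ℝ :=
  -pd2 (pd2 U) q + pd2 (pd2 J) q * (Real.log (J q ^ 2 + q.2 ^ 2) / 2 + 1) +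
    (J q * (pd2 J q ^ 2 - 1) + 2 * q.2 * pd2 J q) / (J q ^ 2 + q.2 ^ 2)

theorem eventually_actionBranch {U J Θ : ℝ × ℝ → ℝ} {p : ℝ × ℝ} (hU : AnalyticAt ℝ U p)
    (hJ : AnalyticAt ℝ J p) (hΘa : AnalyticAt ℝ Θ p)
    (hΘ : ∀ᶠ q in 𝓝 p, HasFDerivAt Θ (angleDeriv J q) q) (hp : 0 < J p ^ 2 + p.2 ^ 2) :
    AnalyticAt ℝ (actionBranch U J Θ) p ∧
      (∀ᶠ q in 𝓝 p, pd1 (actionBranch U J Θ) q =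
        pd1 U q - (Real.log (J q ^ 2 + q.2 ^ 2) / 2 + 1) * pd1 J q) ∧
      pd2 (pd2 (actionBranch U J Θ)) p = -twistFormula U J p := by
  have hρ : AnalyticAt ℝ (fun q => J q ^ 2 + q.2 ^ 2) p := by fun_prop
  have hpos : ∀ᶠ q in 𝓝 p, 0 < J q ^ 2 + q.2 ^ 2 := hρ.continuousAt.eventually_const_lt hp
  have hlog : AnalyticAt ℝ (fun q => Real.log (J q ^ 2 + q.2 ^ 2)) p := hρ.real_log hp.ne'
  have hF : ∀ᶠ q in 𝓝 p, HasFDerivAt (actionBranch U J Θ) (fderiv ℝ U q -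
      (Real.log (J q ^ 2 + q.2 ^ 2) / 2 + 1) • fderiv ℝ J q -
      Θ q • ContinuousLinearMap.snd ℝ ℝ ℝ) q := by
    filter_upwards [hU.eventually_analyticAt, hJ.eventually_analyticAt, hΘ, hpos] with q h1 h2 h3 h4
    exact hasFDerivAt_actionBranch h1.differentiableAt h2.differentiableAt h3 h4
  refine ⟨?_, ?_, ?_⟩
  · unfold actionBranch
    fun_prop (disch := norm_num)
  · filter_upwards [hF] with q hq
    rw [pd1_eq_of_hasFDerivAt hq]
    simp [pd1]
  · have h2 : pd2 (actionBranch U J Θ) =ᶠ[𝓝 p] fun q =>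
        pd2 U q - (Real.log (J q ^ 2 + q.2 ^ 2) / 2 + 1) * pd2 J q - Θ q := by
      filter_upwards [hF] with q hq
      rw [pd2_eq_of_hasFDerivAt hq]
      simp [pd2]
    rw [pd2_congr h2]
    have h3 := (((analyticAt_pd2 hU).differentiableAt.hasFDerivAt).sub
      (((hasFDerivAt_half_log hJ.differentiableAt hp).add_const 1).mul
      (analyticAt_pd2 hJ).differentiableAt.hasFDerivAt)).sub hΘ.self_of_nhds
    have h4 : HasFDerivAt (fun q =>
        pd2 U q - (Real.log (J q ^ 2 + q.2 ^ 2) / 2 + 1) * pd2 J q - Θ q) _ p := h3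
    rw [pd2_eq_of_hasFDerivAt h4]
    simp only [twistFormula, angleDeriv]
    simp
    simp only [← pd2.eq_def]
    field_simp
    ring

end ChampagneBottle

/-! ### Rotation number and twist -/

namespace ChampagneBottle

/-- The vanishing action as a function on the plane. -/
noncomputable def vAction (q : ℝ × ℝ) : ℝ := vanishingAction q.1 q.2

theorem analyticAt_vAction : AnalyticAt ℝ vAction 0 := analyticAt_vanishingAction

/-- `U` is the regular part of the action. -/
def IsRegularPart (U : ℝ × ℝ → ℝ) : Prop :=
  AnalyticAt ℝ U 0 ∧ ∀ᶠ q in 𝓝 (0 : ℝ × ℝ), q ≠ 0 →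
      2 * Real.pi * scaledAction q.1 q.2 =
        U q - vAction q * (Real.log (vAction q ^ 2 + q.2 ^ 2) / 2) -
          |q.2| * (Real.pi / 2 + Real.arctan (vAction q / |q.2|))

theorem exists_isRegularPart : ∃ U, IsRegularPart U := exists_scaledAction_eq

/-- `V` is an analytic continuation across `p` of `2π` times the scaled action. -/
def IsBranch (V : ℝ × ℝ → ℝ) (p : ℝ × ℝ) : Prop :=
  AnalyticAt ℝ V p ∧ ∀ᶠ q in 𝓝 p, ∃ k : ℤ,
    2 * Real.pi * scaledAction q.1 q.2 = V q - 2 * Real.pi * k * q.2 ∧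
      ((p.2 ≤ q.2 ∨ p.2 ≠ 0) → k = 0)

theorem eventually_sq_add_sq_pos :
    ∀ᶠ p in 𝓝 (0 : ℝ × ℝ), p ≠ 0 → 0 < vAction p ^ 2 + p.2 ^ 2 := by
  filter_upwards [eventually_action_ne_zero] with p hp h0
  rcases hp h0 with h | h
  · have : 0 < vAction p ^ 2 := by unfold vAction; positivity
    positivity
  · positivity

theorem IsRegularPart.eventually_exists_branch {U : ℝ × ℝ → ℝ} (hU : IsRegularPart U) :
    ∀ᶠ p in 𝓝 (0 : ℝ × ℝ), p ≠ 0 → ∃ V, IsBranch V p ∧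
      (∀ᶠ q in 𝓝 p, pd1 V q =
        pd1 U q - (Real.log (vAction q ^ 2 + q.2 ^ 2) / 2 + 1) * pd1 vAction q) ∧
      pd2 (pd2 V) p = -twistFormula U vAction p := by
  filter_upwards [hU.1.eventually_analyticAt, analyticAt_vAction.eventually_analyticAt,
    hU.2.eventually_nhds, eventually_action_ne_zero, eventually_sq_add_sq_pos]
    with p h1 h2 h3 h4 h5 h0
  obtain ⟨Θ, hΘa, hΘ, hk⟩ := exists_angle h2 (h4 h0)
  obtain ⟨ha, hb, hc⟩ := eventually_actionBranch h1 h2 hΘa hΘ (h5 h0)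
  refine ⟨actionBranch U vAction Θ, ⟨ha, ?_⟩, hb, hc⟩
  filter_upwards [h3, hk, eventually_ne_nhds h0] with q hq1 hq2 hq3
  obtain ⟨k, hk1, hk2⟩ := hq2
  refine ⟨k, ?_, hk2⟩
  rw [hq1 hq3, hk1, actionBranch]
  ring

/-- The right derivative sees only the side where the branch is the action itself, so the jump at
`j₂ = 0` does not enter. -/
theorem derivWithin_Ici_eq {f g : ℝ → ℝ} {a g' : ℝ} (h : ∀ᶠ t in 𝓝 a, a ≤ t → f t = g t)
    (hg : HasDerivAt g g' a) : derivWithin f (Set.Ici a) a = g' := by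
  have h1 : f =ᶠ[𝓝[Set.Ici a] a] g := eventually_nhdsWithin_iff.2 h
  rw [h1.derivWithin_eq (h.self_of_nhds le_rfl)]
  exact hg.hasDerivWithinAt.derivWithin (uniqueDiffOn_Ici a a Set.self_mem_Ici)

namespace IsBranch

theorem scaledAction_eq {V : ℝ × ℝ → ℝ} {p : ℝ × ℝ} (h : IsBranch V p) :
    ∀ᶠ q in 𝓝 p, (p.2 ≤ q.2 ∨ p.2 ≠ 0) → scaledAction q.1 q.2 = (2 * Real.pi)⁻¹ * V q := by
  filter_upwards [h.2] with q ⟨k, hk1, hk2⟩ hc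
  have hpi := Real.pi_ne_zero
  rw [hk2 hc] at hk1
  field_simp
  push_cast at hk1
  linarith

theorem rotationNumber_eq {V : ℝ × ℝ → ℝ} {p : ℝ × ℝ} (h : IsBranch V p) :
    ∀ᶠ q in 𝓝 p, (p.2 ≤ q.2 ∨ p.2 ≠ 0) →
      rotationNumber q.1 q.2 = -((2 * Real.pi)⁻¹ * pd2 V q) := by
  filter_upwards [h.scaledAction_eq.eventually_nhds, h.1.eventually_analyticAt] with q hq hV hc
  rw [rotationNumber]
  congr 1
  refine derivWithin_Ici_eq (g := fun t => (2 * Real.pi)⁻¹ * V (q.1, t)) ?_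
    ((hasDerivAt_pd2 hV.differentiableAt).const_mul _)
  filter_upwards [eventually_slice hq] with t ht hqt
  refine ht (hc.imp_left fun h => ?_)
  exact h.trans hqt

theorem twist_eq {V : ℝ × ℝ → ℝ} {p : ℝ × ℝ} (h : IsBranch V p) :
    2 * Real.pi * twist p.1 p.2 = -pd2 (pd2 V) p := by
  have h1 : twist p.1 p.2 = -((2 * Real.pi)⁻¹ * pd2 (pd2 V) p) := by
    refine derivWithin_Ici_eq (g := fun t => -((2 * Real.pi)⁻¹ * pd2 V (p.1, t))) ?_
      ((hasDerivAt_pd2 (analyticAt_pd2 h.1).differentiableAt).const_mul _).neg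
    filter_upwards [eventually_slice h.rotationNumber_eq] with t ht hqt
    exact ht (Or.inl hqt)
  have hpi := Real.pi_ne_zero
  rw [h1]
  field_simp

theorem hasDerivAt {V : ℝ × ℝ → ℝ} {p : ℝ × ℝ} (h : IsBranch V p) (hp : p.2 ≠ 0) :
    HasDerivAt (fun s => scaledAction p.1 s) (-rotationNumber p.1 p.2) p.2 ∧
      HasDerivAt (fun s => rotationNumber p.1 s) (twist p.1 p.2) p.2 := by
  constructor
  · rw [h.rotationNumber_eq.self_of_nhds (Or.inr hp), neg_neg]
    refine ((hasDerivAt_pd2 h.1.differentiableAt).const_mul _).congr_of_eventuallyEq ?_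
    filter_upwards [eventually_slice h.scaledAction_eq] with t ht
    exact ht (Or.inr hp)
  · have h1 : twist p.1 p.2 = -((2 * Real.pi)⁻¹ * pd2 (pd2 V) p) := by
      have := h.twist_eq
      have hpi := Real.pi_ne_zero
      field_simp
      linarith
    rw [h1]
    refine ((hasDerivAt_pd2 (analyticAt_pd2 h.1).differentiableAt).const_mul
      _).neg.congr_of_eventuallyEq ?_
    filter_upwards [eventually_slice h.rotationNumber_eq] with t ht
    exact ht (Or.inr hp)

end IsBranch

theorem eventually_hasDerivAt :
    ∀ᶠ p in 𝓝 (0 : ℝ × ℝ), p.2 ≠ 0 →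
      HasDerivAt (fun s => scaledAction p.1 s) (-rotationNumber p.1 p.2) p.2 ∧
      HasDerivAt (fun s => rotationNumber p.1 s) (twist p.1 p.2) p.2 := by
  obtain ⟨U, hU⟩ := exists_isRegularPart
  filter_upwards [hU.eventually_exists_branch] with p hp h0
  obtain ⟨V, hV, -⟩ := hp (fun h => h0 (by rw [h]; rfl))
  exact hV.hasDerivAt h0

theorem IsRegularPart.twist_eq {U : ℝ × ℝ → ℝ} (hU : IsRegularPart U) :
    ∀ᶠ p in 𝓝 (0 : ℝ × ℝ), p ≠ 0 → 2 * Real.pi * twist p.1 p.2 = twistFormula U vAction p := by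
  filter_upwards [hU.eventually_exists_branch] with p hp h0
  obtain ⟨V, hV, -, hV2⟩ := hp h0
  rw [hV.twist_eq, hV2, neg_neg]

theorem analyticAt_twistFormula {U J : ℝ × ℝ → ℝ} {p : ℝ × ℝ} (hU : AnalyticAt ℝ U p)
    (hJ : AnalyticAt ℝ J p) (hp : 0 < J p ^ 2 + p.2 ^ 2) : AnalyticAt ℝ (twistFormula U J) p := by
  have h1 := analyticAt_pd2 (analyticAt_pd2 hU)
  have h2 := analyticAt_pd2 hJ
  have h3 := analyticAt_pd2 h2
  have hρ : AnalyticAt ℝ (fun q => J q ^ 2 + q.2 ^ 2) p := by fun_prop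
  have hlog : AnalyticAt ℝ (fun q => Real.log (J q ^ 2 + q.2 ^ 2)) p := hρ.real_log hp.ne'
  unfold twistFormula
  refine AnalyticAt.add (by fun_prop (disch := norm_num)) (AnalyticAt.div (by fun_prop) hρ hp.ne')

theorem IsRegularPart.eventually_analyticAt_twist {U : ℝ × ℝ → ℝ} (hU : IsRegularPart U) :
    ∀ᶠ p in 𝓝 (0 : ℝ × ℝ), p ≠ 0 → AnalyticAt ℝ (fun q : ℝ × ℝ => twist q.1 q.2) p := by
  filter_upwards [hU.twist_eq.eventually_nhds, hU.1.eventually_analyticAt,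
    analyticAt_vAction.eventually_analyticAt, eventually_sq_add_sq_pos] with p h1 h2 h3 h4 h0
  have := (analyticAt_const (v := (2 * Real.pi)⁻¹)).mul (analyticAt_twistFormula h2 h3 (h4 h0))
  refine this.congr ?_
  filter_upwards [h1, eventually_ne_nhds h0] with q hq hq0
  have hpi := Real.pi_ne_zero
  simp only [Pi.mul_apply]
  rw [← hq hq0]
  field_simp

theorem eventually_continuousAt_twist :
    ∀ᶠ p in 𝓝[≠] (0 : ℝ × ℝ), ContinuousAt (fun q : ℝ × ℝ => twist q.1 q.2) p := by
  obtain ⟨U, hU⟩ := exists_isRegularPart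
  rw [eventually_nhdsWithin_iff]
  filter_upwards [hU.eventually_analyticAt_twist] with p hp h0
  exact (hp h0).continuousAt

theorem IsNormalHamiltonian.fst_zero {Hbar : ℝ × ℝ → ℝ} (h : IsNormalHamiltonian Hbar) :
    ∀ᶠ j in 𝓝 (0 : ℝ × ℝ), j ≠ 0 → (Hbar j, j.2) ≠ 0 := by
  filter_upwards [h.right] with j hj h0 h1
  have e1 : Hbar j = 0 := (Prod.ext_iff.1 h1).1
  have e2 : j.2 = 0 := (Prod.ext_iff.1 h1).2
  rw [e1, e2, vanishingAction_zero] at hj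
  exact h0 (Prod.ext hj.symm e2)

/-- The vector `(-A, 1)` is tangent to the curves `H̄ = const`, so the combination is the derivative
at constant `h`: the contributions of `∂/∂h` cancel. -/
theorem IsNormalHamiltonian.eventually_rotationNF {Hbar : ℝ × ℝ → ℝ} (h : IsNormalHamiltonian Hbar) :
    ∀ᶠ j in 𝓝 (0 : ℝ × ℝ), j.2 ≠ 0 →
        DifferentiableAt ℝ (rotationNF Hbar) j ∧
        twistNF Hbar j = -slope Hbar j * pd1 (rotationNF Hbar) j + pd2 (rotationNF Hbar) j := by
  obtain ⟨U, hU⟩ := exists_isRegularPart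
  filter_upwards [h.tendsto.eventually hU.eventually_exists_branch,
    h.analyticAt.eventually_analyticAt, h.eventually_pd] with j h1 h2 h3 h0
  obtain ⟨V, hV, -⟩ := h1 (fun hh => h0 (Prod.ext_iff.1 hh).2)
  have hH := h2.differentiableAt.hasFDerivAt
  have hψ := hH.prodMk (hasFDerivAt_snd (𝕜 := ℝ) (E := ℝ) (F := ℝ) (p := j))
  have hVd := (analyticAt_pd2 hV.1).differentiableAt.hasFDerivAt
  have hev : rotationNF Hbar =ᶠ[𝓝 j] fun i => -((2 * Real.pi)⁻¹ * pd2 V (Hbar i, i.2)) := by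
    filter_upwards [hψ.continuousAt.tendsto.eventually hV.rotationNumber_eq] with i hi
    exact hi (Or.inr h0)
  have hW := (((hVd.comp j hψ).const_mul (2 * Real.pi)⁻¹).fun_neg).congr_of_eventuallyEq hev
  have hd1 : pd1 Hbar j ≠ 0 := fun h0 => by
    rw [h0, zero_mul] at h3; exact zero_ne_one h3.1
  refine ⟨hW.differentiableAt, ?_⟩
  rw [pd1_eq_of_hasFDerivAt hW, pd2_eq_of_hasFDerivAt hW]
  have ht := hV.twist_eq
  have hpi := Real.pi_ne_zero
  have e : ∀ a b : ℝ, fderiv ℝ (pd2 V) (Hbar j, j.2) (a, b) =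
      a * fderiv ℝ (pd2 V) (Hbar j, j.2) (1, 0) + b * pd2 (pd2 V) (Hbar j, j.2) := by
    intro a b
    rw [pd2, ← smul_eq_mul, ← smul_eq_mul, ← map_smul, ← map_smul, ← map_add]
    simp
  simp only [neg_apply, smul_apply,
    ContinuousLinearMap.comp_apply, ContinuousLinearMap.prod_apply,
    ContinuousLinearMap.coe_snd', smul_eq_mul]
  rw [e (fderiv ℝ Hbar j (1, 0)) 0, e (fderiv ℝ Hbar j (0, 1)) 1, slope]
  simp only [← pd1.eq_def, ← pd2.eq_def]
  have : twistNF Hbar j = -((2 * Real.pi)⁻¹ * pd2 (pd2 V) (Hbar j, j.2)) := by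
    rw [twistNF]
    field_simp
    linarith
  rw [this]
  field_simp
  ring

end ChampagneBottle

/-! ### Complete elliptic integrals at the logarithmic singularity -/

open MeasureTheory

theorem hasDerivAt_intervalIntegral_of_analyticAt {f : ℝ × ℝ → ℝ} {f' : ℝ → ℝ} {t₀ a b : ℝ}
    (hf : ∀ x ∈ Set.uIcc a b, AnalyticAt ℝ f (t₀, x))
    (hf' : ∀ x ∈ Set.uIcc a b, HasDerivAt (fun t => f (t, x)) (f' x) t₀) :
    HasDerivAt (fun t => ∫ x in a..b, f (t, x)) (∫ x in a..b, f' x) t₀ := by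
  have key := (hasFDerivAt_intervalIntegral_of_analyticAt hf).hasDerivAt
  refine key.congr_deriv ?_
  rw [ContinuousLinearMap.intervalIntegral_apply]
  · refine intervalIntegral.integral_congr fun x hx => ?_
    have h1 := ((hf x hx).differentiableAt.hasFDerivAt.comp t₀
      (hasFDerivAt_prodMk_left (𝕜 := ℝ) t₀ x)).hasDerivAt
    exact h1.unique (hf' x hx)
  · refine ContinuousOn.intervalIntegrable fun x hx => ContinuousAt.continuousWithinAt ?_
    have h1 : ContinuousAt (fun x : ℝ => fderiv ℝ f (t₀, x)) x :=
      (hf x hx).fderiv.continuousAt.comp' (by fun_prop)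
    exact h1.clm_comp continuousAt_const

/-- The complete elliptic integral of the second kind, as a function of the complementary
parameter. -/
noncomputable def ellE (μ : ℝ) : ℝ :=
  ∫ θ in (0 : ℝ)..(Real.pi / 2), √(Real.sin θ ^ 2 + μ * Real.cos θ ^ 2)

/-- The complete elliptic integral of the first kind, as a function of the complementary
parameter. -/
noncomputable def ellK (μ : ℝ) : ℝ :=
  ∫ θ in (0 : ℝ)..(Real.pi / 2), (√(Real.sin θ ^ 2 + μ * Real.cos θ ^ 2))⁻¹

theorem sin_sq_add_mul_cos_sq_pos {μ : ℝ} (hμ : 0 < μ) (θ : ℝ) :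
    0 < Real.sin θ ^ 2 + μ * Real.cos θ ^ 2 := by
  rcases eq_or_ne (Real.sin θ) 0 with h | h
  · have : Real.cos θ ^ 2 = 1 := by have := Real.sin_sq_add_cos_sq θ; rw [h] at this; linarith
    rw [h, this]; linarith
  · positivity

theorem analyticAt_sqrt_sin_cos {μ : ℝ} (hμ : 0 < μ) (θ : ℝ) :
    AnalyticAt ℝ (fun q : ℝ × ℝ => √(Real.sin q.2 ^ 2 + q.1 * Real.cos q.2 ^ 2)) (μ, θ) := by
  have h1 : AnalyticAt ℝ (fun q : ℝ × ℝ => Real.sin q.2) (μ, θ) :=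
    (Real.analyticAt_sin (x := θ)).fun_comp (f := Prod.snd) (x := (μ, θ)) analyticAt_snd
  have h2 : AnalyticAt ℝ (fun q : ℝ × ℝ => Real.cos q.2) (μ, θ) :=
    (Real.analyticAt_cos (x := θ)).fun_comp (f := Prod.snd) (x := (μ, θ)) analyticAt_snd
  have h3 : AnalyticAt ℝ (fun q : ℝ × ℝ => Real.sin q.2 ^ 2 + q.1 * Real.cos q.2 ^ 2) (μ, θ) := by
    fun_prop
  have h4 : ContDiffAt ℝ ω (fun q : ℝ × ℝ => √(Real.sin q.2 ^ 2 + q.1 * Real.cos q.2 ^ 2)) (μ, θ) :=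
    h3.contDiffAt.sqrt (sin_sq_add_mul_cos_sq_pos hμ θ).ne'
  exact h4.analyticAt

theorem continuous_sqrt_sin_cos (μ : ℝ) :
    Continuous fun θ => √(Real.sin θ ^ 2 + μ * Real.cos θ ^ 2) := by fun_prop

theorem intervalIntegrable_sin_cos_pow {μ : ℝ} (hμ : 0 < μ) (n : ℕ) (a b : ℝ) :
    IntervalIntegrable (fun θ => (√(Real.sin θ ^ 2 + μ * Real.cos θ ^ 2) ^ n)⁻¹) volume a b :=
  (((continuous_sqrt_sin_cos μ).pow n).inv₀ fun θ =>
    (pow_pos (Real.sqrt_pos.2 (sin_sq_add_mul_cos_sq_pos hμ θ)) n).ne').intervalIntegrable _ _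

/-- `∫ D^(-3/2) = E / μ`. -/
theorem integral_inv_pow_three {μ : ℝ} (hμ : 0 < μ) :
    ∫ θ in (0 : ℝ)..(Real.pi / 2), (√(Real.sin θ ^ 2 + μ * Real.cos θ ^ 2) ^ 3)⁻¹ =
      ellE μ / μ := by
  -- An antiderivative that vanishes at both ends relates the integrals of `D ^ (-3/2)` and `D ^
  -- (1/2)`, where `D = sin² + μ cos²`.
  have hd : ∀ θ : ℝ, HasDerivAt
      (fun θ => (1 - μ) * (Real.sin θ * Real.cos θ) / √(Real.sin θ ^ 2 + μ * Real.cos θ ^ 2))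
      (μ * (√(Real.sin θ ^ 2 + μ * Real.cos θ ^ 2) ^ 3)⁻¹ -
        √(Real.sin θ ^ 2 + μ * Real.cos θ ^ 2)) θ := by
    intro θ
    have hD := sin_sq_add_mul_cos_sq_pos hμ θ
    have hs := Real.hasDerivAt_sin θ
    have hc := Real.hasDerivAt_cos θ
    have h1 := ((hs.mul hc).const_mul (1 - μ)).div
      (((hs.pow 2).add ((hc.pow 2).const_mul μ)).sqrt hD.ne') (Real.sqrt_pos.2 hD).ne'
    refine h1.congr_deriv ?_
    have hsq := Real.sq_sqrt hD.le
    have hsc := Real.sin_sq_add_cos_sq θ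
    have hpos := Real.sqrt_pos.2 hD
    simp only [Pi.mul_apply, Pi.add_apply, Pi.pow_apply, Nat.cast_ofNat, Nat.reduceSub, pow_one]
    set w := √(Real.sin θ ^ 2 + μ * Real.cos θ ^ 2) with hw
    have hs2 : Real.sin θ ^ 2 = 1 - Real.cos θ ^ 2 := by linarith
    have hw2 : w ^ 2 = 1 - (1 - μ) * Real.cos θ ^ 2 := by rw [hsq, hs2]; ring
    have hw4 : w ^ 4 = (1 - (1 - μ) * Real.cos θ ^ 2) ^ 2 := by rw [← hw2]; ring
    field_simp
    ring_nf
    simp only [hw4, hw2, hs2]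
    ring
  have h0 := intervalIntegral.integral_eq_sub_of_hasDerivAt (a := 0) (b := Real.pi / 2)
    (fun θ _ => hd θ) (((intervalIntegrable_sin_cos_pow hμ 3 _ _).const_mul μ).sub
      ((continuous_sqrt_sin_cos μ).intervalIntegrable _ _))
  rw [intervalIntegral.integral_sub ((intervalIntegrable_sin_cos_pow hμ 3 _ _).const_mul μ)
      ((continuous_sqrt_sin_cos μ).intervalIntegrable _ _),
    intervalIntegral.integral_const_mul] at h0
  simp only [Real.sin_zero, Real.cos_pi_div_two, mul_zero, zero_mul, zero_div, sub_zero] at h0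
  rw [eq_div_iff hμ.ne', ellE]
  linarith

/-- The derivative contains `cos²`, which is `(1 - D) / (1 - μ)`; this expresses it by the two
elliptic integrals again. -/
theorem hasDerivAt_ellE {μ : ℝ} (hμ : 0 < μ) (hμ1 : μ < 1) :
    HasDerivAt ellE ((ellK μ - ellE μ) * (2 * (1 - μ))⁻¹) μ := by
  have h1 := hasDerivAt_intervalIntegral_of_analyticAt (a := 0) (b := Real.pi / 2) (t₀ := μ)
    (f := fun q : ℝ × ℝ => √(Real.sin q.2 ^ 2 + q.1 * Real.cos q.2 ^ 2))
    (f' := fun θ => ((√(Real.sin θ ^ 2 + μ * Real.cos θ ^ 2))⁻¹ -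
      √(Real.sin θ ^ 2 + μ * Real.cos θ ^ 2)) * (2 * (1 - μ))⁻¹)
    (fun θ _ => analyticAt_sqrt_sin_cos hμ θ) (fun θ _ => by
      have hD := sin_sq_add_mul_cos_sq_pos hμ θ
      have h2 := (((hasDerivAt_id μ).mul_const (Real.cos θ ^ 2)).const_add
        (Real.sin θ ^ 2)).sqrt hD.ne'
      refine h2.congr_deriv ?_
      have hsq := Real.sq_sqrt hD.le
      have hsc := Real.sin_sq_add_cos_sq θ
      have hpos := Real.sqrt_pos.2 hD
      simp only [id]
      have : 1 - μ ≠ 0 := by linarith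
      set w := √(Real.sin θ ^ 2 + μ * Real.cos θ ^ 2) with hw
      field_simp
      linear_combination hsq + hsc)
  refine h1.congr_deriv ?_
  rw [intervalIntegral.integral_mul_const, intervalIntegral.integral_sub
    (by simpa using intervalIntegrable_sin_cos_pow hμ 1 0 (Real.pi / 2))
    ((continuous_sqrt_sin_cos μ).intervalIntegrable _ _)]
  rfl

theorem hasDerivAt_ellK {μ : ℝ} (hμ : 0 < μ) (hμ1 : μ < 1) :
    HasDerivAt ellK (-((ellE μ / μ - ellK μ) * (2 * (1 - μ))⁻¹)) μ := by
  have h1 := hasDerivAt_intervalIntegral_of_analyticAt (a := 0) (b := Real.pi / 2) (t₀ := μ)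
    (f := fun q : ℝ × ℝ => (√(Real.sin q.2 ^ 2 + q.1 * Real.cos q.2 ^ 2))⁻¹)
    (f' := fun θ => -(((√(Real.sin θ ^ 2 + μ * Real.cos θ ^ 2) ^ 3)⁻¹ -
      (√(Real.sin θ ^ 2 + μ * Real.cos θ ^ 2))⁻¹) * (2 * (1 - μ))⁻¹))
    (fun θ _ => (analyticAt_sqrt_sin_cos hμ θ).inv
      (Real.sqrt_pos.2 (sin_sq_add_mul_cos_sq_pos hμ θ)).ne') (fun θ _ => by
      have hD := sin_sq_add_mul_cos_sq_pos hμ θ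
      have hpos := Real.sqrt_pos.2 hD
      have h2 := ((((hasDerivAt_id μ).mul_const (Real.cos θ ^ 2)).const_add
        (Real.sin θ ^ 2)).sqrt hD.ne').inv hpos.ne'
      refine h2.congr_deriv ?_
      have hsq := Real.sq_sqrt hD.le
      have hsc := Real.sin_sq_add_cos_sq θ
      simp only [id]
      have : 1 - μ ≠ 0 := by linarith
      set w := √(Real.sin θ ^ 2 + μ * Real.cos θ ^ 2) with hw
      field_simp
      linear_combination (-1) * hsq - hsc)
  refine h1.congr_deriv ?_
  rw [intervalIntegral.integral_neg, intervalIntegral.integral_mul_const,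
    intervalIntegral.integral_sub (intervalIntegrable_sin_cos_pow hμ 3 _ _)
    (by simpa using intervalIntegrable_sin_cos_pow hμ 1 0 (Real.pi / 2)), integral_inv_pow_three hμ]
  rfl

theorem tendsto_ellE : Tendsto ellE (𝓝[>] 0) (𝓝 1) := by
  have h1 : Continuous ellE := by
    refine intervalIntegral.continuous_parametric_intervalIntegral_of_continuous'
      (f := fun μ θ => √(Real.sin θ ^ 2 + μ * Real.cos θ ^ 2)) ?_ _ _
    simp only [Function.uncurry_def]
    fun_prop
  have h2 : ellE 0 = 1 := by
    have : ellE 0 = ∫ θ in (0 : ℝ)..(Real.pi / 2), Real.sin θ := by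
      refine intervalIntegral.integral_congr fun θ hθ => ?_
      rw [Set.uIcc_of_le (by positivity)] at hθ
      simp only [zero_mul, add_zero]
      exact Real.sqrt_sq (Real.sin_nonneg_of_nonneg_of_le_pi hθ.1 (by linarith [hθ.2, Real.pi_pos]))
    rw [this, integral_sin]
    simp
  rw [← h2]
  exact h1.continuousAt.tendsto.mono_left nhdsWithin_le_nhds

/-- Inserting the weight `cos` keeps the whole logarithmic singularity of `ellK` at `θ = 0` and
makes the integral elementary in `sin θ`. -/
theorem integral_cos_div_sqrt {μ : ℝ} (hμ : 0 < μ) (hμ1 : μ < 1) :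
    ∫ θ in (0 : ℝ)..(Real.pi / 2), Real.cos θ * (√(Real.sin θ ^ 2 + μ * Real.cos θ ^ 2))⁻¹ =
      (√(1 - μ))⁻¹ * (Real.log (1 + √(1 - μ)) - Real.log μ / 2) := by
  have hk : 0 < 1 - μ := by linarith
  have hk' := Real.sqrt_pos.2 hk
  have hm' := Real.sqrt_pos.2 hμ
  have hd : ∀ θ : ℝ, HasDerivAt
      (fun θ => (√(1 - μ))⁻¹ * Real.arsinh (√(1 - μ) / √μ * Real.sin θ))
      (Real.cos θ * (√(Real.sin θ ^ 2 + μ * Real.cos θ ^ 2))⁻¹) θ := by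
    intro θ
    have h1 := (((Real.hasDerivAt_sin θ).const_mul (√(1 - μ) / √μ)).arsinh).const_mul (√(1 - μ))⁻¹
    refine h1.congr_deriv ?_
    have e : 1 + (√(1 - μ) / √μ * Real.sin θ) ^ 2 =
        (Real.sin θ ^ 2 + μ * Real.cos θ ^ 2) / μ := by
      rw [mul_pow, div_pow, Real.sq_sqrt hk.le, Real.sq_sqrt hμ.le, Real.cos_sq']
      field_simp
      ring
    rw [e, Real.sqrt_div' _ hμ.le, smul_eq_mul]
    field_simp
  have hc : Continuous fun θ => Real.cos θ * (√(Real.sin θ ^ 2 + μ * Real.cos θ ^ 2))⁻¹ :=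
    Real.continuous_cos.mul ((continuous_sqrt_sin_cos μ).inv₀ fun θ =>
      (Real.sqrt_pos.2 (sin_sq_add_mul_cos_sq_pos hμ θ)).ne')
  rw [intervalIntegral.integral_eq_sub_of_hasDerivAt (fun θ _ => hd θ) (hc.intervalIntegrable _ _)]
  simp only [Real.sin_pi_div_two, Real.sin_zero, mul_one, mul_zero, Real.arsinh_zero, sub_zero]
  congr 1
  have e : 1 + (√(1 - μ) / √μ) ^ 2 = 1 / μ := by
    rw [div_pow, Real.sq_sqrt hk.le, Real.sq_sqrt hμ.le]; field_simp; ring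
  rw [Real.arsinh, e, Real.sqrt_div zero_le_one, Real.sqrt_one, ← add_div, add_comm,
    Real.log_div (by positivity) hm'.ne', Real.log_sqrt hμ.le]

/-- The complementary weight `1 - cos` is at most `sin`, so the integrand is bounded by `1`
uniformly in `μ` and the limit may be taken inside. -/
theorem tendsto_integral_one_sub_cos :
    Tendsto (fun μ => ∫ θ in (0 : ℝ)..(Real.pi / 2),
      (1 - Real.cos θ) * (√(Real.sin θ ^ 2 + μ * Real.cos θ ^ 2))⁻¹) (𝓝[>] 0)
      (𝓝 (Real.log 2)) := by
  have hval : ∫ θ in (0 : ℝ)..(Real.pi / 2), Real.sin θ / (1 + Real.cos θ) = Real.log 2 := by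
    have hp : ∀ θ ∈ Set.uIcc 0 (Real.pi / 2), 0 < 1 + Real.cos θ := by
      intro θ hθ
      rw [Set.uIcc_of_le (by positivity)] at hθ
      have := Real.cos_nonneg_of_mem_Icc (x := θ) ⟨by linarith [hθ.1, Real.pi_pos], hθ.2⟩
      linarith
    have hc : ContinuousOn (fun θ => Real.sin θ / (1 + Real.cos θ)) (Set.uIcc 0 (Real.pi / 2)) :=
      ContinuousOn.div (by fun_prop) (by fun_prop) fun θ hθ => (hp θ hθ).ne'
    rw [intervalIntegral.integral_eq_sub_of_hasDerivAt (f := fun θ => -Real.log (1 + Real.cos θ))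
      (fun θ hθ => ((((Real.hasDerivAt_cos θ).const_add 1).log (hp θ hθ).ne').neg).congr_deriv
        (by ring)) hc.intervalIntegrable]
    simp
    norm_num
  rw [← hval]
  have hbase : ∀ θ ∈ Set.uIoc 0 (Real.pi / 2), 0 < Real.sin θ ∧ 0 ≤ Real.cos θ := by
    intro θ hθ
    rw [Set.uIoc_of_le (by positivity)] at hθ
    exact ⟨Real.sin_pos_of_pos_of_lt_pi hθ.1 (by linarith [hθ.2, Real.pi_pos]),
      Real.cos_nonneg_of_mem_Icc ⟨by linarith [hθ.1, Real.pi_pos], hθ.2⟩⟩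
  have hid : ∀ θ ∈ Set.uIoc 0 (Real.pi / 2),
      Real.sin θ / (1 + Real.cos θ) = (1 - Real.cos θ) * (√(Real.sin θ ^ 2 + 0 * Real.cos θ ^ 2))⁻¹ := by
    intro θ hθ
    obtain ⟨h1, h2⟩ := hbase θ hθ
    have h3 : 1 + Real.cos θ ≠ 0 := by linarith
    rw [zero_mul, add_zero, Real.sqrt_sq h1.le, div_eq_iff h3]
    field_simp
    rw [Real.sin_sq]
    ring
  refine intervalIntegral.tendsto_integral_filter_of_dominated_convergence (fun _ => 1) ?_ ?_ ?_ ?_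
  · filter_upwards [self_mem_nhdsWithin] with μ hμ
    exact ((continuous_const.sub Real.continuous_cos).mul ((continuous_sqrt_sin_cos μ).inv₀ fun θ =>
      (Real.sqrt_pos.2 (sin_sq_add_mul_cos_sq_pos hμ θ)).ne')).aestronglyMeasurable
  · filter_upwards [self_mem_nhdsWithin] with μ hμ
    refine Eventually.of_forall fun θ hθ => ?_
    obtain ⟨h1, h2⟩ := hbase θ hθ
    have h3 := Real.cos_le_one θ
    have h4 : Real.sin θ ≤ √(Real.sin θ ^ 2 + μ * Real.cos θ ^ 2) := by
      refine Real.le_sqrt_of_sq_le ?_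
      have : 0 ≤ μ * Real.cos θ ^ 2 := mul_nonneg (le_of_lt hμ) (sq_nonneg _)
      linarith
    have h5 : 1 - Real.cos θ ≤ Real.sin θ := by
      have := Real.sin_sq_add_cos_sq θ
      nlinarith
    rw [Real.norm_of_nonneg (mul_nonneg (by linarith) (inv_nonneg.2 (Real.sqrt_nonneg _))),
      ← div_eq_mul_inv, div_le_one (h1.trans_le h4)]
    linarith
  · exact intervalIntegrable_const
  · refine Eventually.of_forall fun θ hθ => ?_
    rw [hid θ hθ]
    obtain ⟨h1, h2⟩ := hbase θ hθ
    have : ContinuousAt (fun μ : ℝ => (1 - Real.cos θ) *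
        (√(Real.sin θ ^ 2 + μ * Real.cos θ ^ 2))⁻¹) 0 := by
      refine continuousAt_const.mul (ContinuousAt.inv₀ (by fun_prop) ?_)
      rw [zero_mul, add_zero, Real.sqrt_sq h1.le]
      exact h1.ne'
    exact this.tendsto.mono_left nhdsWithin_le_nhds

theorem tendsto_mul_log_nhdsGT : Tendsto (fun μ : ℝ => μ * Real.log (16 / μ)) (𝓝[>] 0) (𝓝 0) := by
  have h1 : ContinuousAt (fun μ : ℝ => μ * Real.log 16 - μ * Real.log μ) 0 :=
    (by fun_prop : Continuous fun μ : ℝ => μ * Real.log 16).continuousAt.sub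
      Real.continuous_mul_log.continuousAt
  have h2 := h1.tendsto.mono_left (nhdsWithin_le_nhds (s := Set.Ioi 0))
  simp only [zero_mul, sub_zero] at h2
  refine h2.congr' ?_
  filter_upwards [self_mem_nhdsWithin] with μ hμ
  rw [Real.log_div (by norm_num) (ne_of_gt hμ)]
  ring

theorem eventually_mem_Ioo_nhdsGT : ∀ᶠ μ : ℝ in 𝓝[>] 0, 0 < μ ∧ μ < 1 :=
  Ioo_mem_nhdsGT zero_lt_one

/-- The two contributions `log 2` and the `log 2` from `1 + √(1 - μ)` combine to the constant `(log
16) / 2`; the rest is an error of size `μ log μ`. -/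
theorem tendsto_ellK_sub :
    Tendsto (fun μ => ellK μ - Real.log (16 / μ) / 2) (𝓝[>] 0) (𝓝 0) := by
  have hs : ContinuousAt (fun μ : ℝ => √(1 - μ)) 0 := by fun_prop
  have h1 : ContinuousAt (fun μ : ℝ => (√(1 - μ))⁻¹ * Real.log (1 + √(1 - μ))) 0 :=
    (hs.inv₀ (by simp)).mul ((continuousAt_const.add hs).log (by simp))
  have h1' := h1.tendsto.mono_left (nhdsWithin_le_nhds (s := Set.Ioi 0))
  have h2 : ContinuousAt (fun μ : ℝ => (√(1 - μ) * (1 + √(1 - μ)))⁻¹) 0 :=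
    (hs.mul (continuousAt_const.add hs)).inv₀ (by simp)
  have h2' := h2.tendsto.mono_left (nhdsWithin_le_nhds (s := Set.Ioi 0))
  have hc : ContinuousAt (fun μ : ℝ => μ * (√(1 - μ) * (1 + √(1 - μ)))⁻¹) 0 :=
    continuousAt_id.mul h2
  have hc' := hc.tendsto.mono_left (nhdsWithin_le_nhds (s := Set.Ioi 0))
  have h3 := ((h1'.add tendsto_integral_one_sub_cos).sub_const (Real.log 16 / 2)).add
    (((tendsto_mul_log_nhdsGT.mul h2').div_const 2).sub (hc'.mul_const (Real.log 16 / 2)))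
  have e16 : Real.log 16 = 4 * Real.log 2 := by
    rw [show (16 : ℝ) = 2 ^ 4 by norm_num, Real.log_pow]; norm_num
  have hlim : (√(1 - 0 : ℝ))⁻¹ * Real.log (1 + √(1 - 0)) + Real.log 2 - Real.log 16 / 2 +
      (0 * (√(1 - 0) * (1 + √(1 - 0)))⁻¹ / 2 -
        0 * (√(1 - 0) * (1 + √(1 - 0)))⁻¹ * (Real.log 16 / 2)) = 0 := by
    rw [e16]; norm_num; ring
  rw [hlim] at h3
  refine h3.congr' ?_
  filter_upwards [eventually_mem_Ioo_nhdsGT] with μ hμ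
  have hk : 0 < 1 - μ := by linarith [hμ.2]
  have hk' := Real.sqrt_pos.2 hk
  have hk2 := Real.sq_sqrt hk.le
  have hi1 : IntervalIntegrable (fun θ => Real.cos θ *
      (√(Real.sin θ ^ 2 + μ * Real.cos θ ^ 2))⁻¹) volume 0 (Real.pi / 2) :=
    (Real.continuous_cos.mul ((continuous_sqrt_sin_cos μ).inv₀ fun θ =>
      (Real.sqrt_pos.2 (sin_sq_add_mul_cos_sq_pos hμ.1 θ)).ne')).intervalIntegrable _ _
  have hi2 : IntervalIntegrable (fun θ => (1 - Real.cos θ) *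
      (√(Real.sin θ ^ 2 + μ * Real.cos θ ^ 2))⁻¹) volume 0 (Real.pi / 2) :=
    ((continuous_const.sub Real.continuous_cos).mul ((continuous_sqrt_sin_cos μ).inv₀ fun θ =>
      (Real.sqrt_pos.2 (sin_sq_add_mul_cos_sq_pos hμ.1 θ)).ne')).intervalIntegrable _ _
  have hK : ellK μ = (√(1 - μ))⁻¹ * (Real.log (1 + √(1 - μ)) - Real.log μ / 2) +
      ∫ θ in (0 : ℝ)..(Real.pi / 2),
        (1 - Real.cos θ) * (√(Real.sin θ ^ 2 + μ * Real.cos θ ^ 2))⁻¹ := by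
    rw [← integral_cos_div_sqrt hμ.1 hμ.2, ← intervalIntegral.integral_add hi1 hi2, ellK]
    exact intervalIntegral.integral_congr fun θ _ => by ring
  rw [hK, Real.log_div (by norm_num) hμ.1.ne']
  generalize (∫ θ in (0 : ℝ)..(Real.pi / 2),
        (1 - Real.cos θ) * (√(Real.sin θ ^ 2 + μ * Real.cos θ ^ 2))⁻¹) = c
  have hμk : μ = 1 - √(1 - μ) ^ 2 := by rw [hk2]; ring
  have e : (√(1 - μ))⁻¹ - 1 = μ * (√(1 - μ) * (1 + √(1 - μ)))⁻¹ := by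
    have : μ * (√(1 - μ) * (1 + √(1 - μ)))⁻¹ = (1 - √(1 - μ) ^ 2) * (√(1 - μ) * (1 + √(1 - μ)))⁻¹ := by
      rw [← hμk]
    rw [this]
    field_simp
    ring
  linear_combination (Real.log μ / 2) * e


theorem hasDerivAt_log_const_div {x : ℝ} (hx : 0 < x) :
    HasDerivAt (fun μ : ℝ => Real.log (16 / μ)) (-x⁻¹) x := by
  have h1 := ((Real.hasDerivAt_log hx.ne').const_sub (Real.log 16))
  refine h1.congr_of_eventuallyEq ?_
  filter_upwards [eventually_ne_nhds hx.ne'] with μ hμ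
  rw [Real.log_div (by norm_num) hμ]

theorem tendsto_inv_two_mul_one_sub :
    Tendsto (fun μ : ℝ => (2 * (1 - μ))⁻¹) (𝓝[>] 0) (𝓝 (1 / 2)) := by
  have h : ContinuousAt (fun μ : ℝ => (2 * (1 - μ))⁻¹) 0 :=
    ContinuousAt.inv₀ (by fun_prop) (by norm_num)
  have := h.tendsto.mono_left (nhdsWithin_le_nhds (s := Set.Ioi 0))
  norm_num at this ⊢
  exact this

theorem tendsto_id_nhdsGT : Tendsto (fun μ : ℝ => μ) (𝓝[>] 0) (𝓝 0) :=
  tendsto_id.mono_left nhdsWithin_le_nhds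

/-- L'Hôpital's rule with the differential system for `ellE` and `ellK`. The orders improve
alternately: the leading term of `ellK` gives the first order of `ellE`, both give the first order
of `ellK`, and these give the second order of `ellE`. -/
theorem tendsto_ellE_sub_div :
    Tendsto (fun μ => (ellE μ - (1 + μ / 4 * (Real.log (16 / μ) - 1))) / μ) (𝓝[>] 0) (𝓝 0) := by
  have hc := tendsto_inv_two_mul_one_sub
  refine HasDerivAt.lhopital_zero_nhdsGT (g := fun μ => μ) (g' := fun _ => 1)
    (f' := fun μ => (ellK μ - ellE μ) * (2 * (1 - μ))⁻¹ - (Real.log (16 / μ) / 4 - 1 / 2))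
    ?_ (Eventually.of_forall fun x => hasDerivAt_id x) (by simp) ?_ tendsto_id_nhdsGT ?_
  · filter_upwards [eventually_mem_Ioo_nhdsGT] with μ hμ
    have h1 := (((hasDerivAt_id μ).div_const 4).mul
      ((hasDerivAt_log_const_div hμ.1).sub_const 1)).const_add 1
    refine ((hasDerivAt_ellE hμ.1 hμ.2).sub h1).congr_deriv ?_
    have := hμ.1.ne'
    simp only [id]
    field_simp
    ring
  · have h1 := tendsto_ellE.sub (((tendsto_mul_log_nhdsGT.sub tendsto_id_nhdsGT).div_const 4).const_add 1)
    norm_num at h1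
    refine h1.congr fun μ => by ring
  · have h1 := ((tendsto_ellK_sub.add (tendsto_ellE.const_sub 1)).mul hc).add
      ((((tendsto_mul_log_nhdsGT.mul hc).div_const 2)).add (hc.const_sub (1 / 2)))
    norm_num at h1
    refine h1.congr' ?_
    filter_upwards [eventually_mem_Ioo_nhdsGT] with μ hμ
    have : 1 - μ ≠ 0 := by linarith [hμ.2]
    field_simp
    ring

theorem tendsto_ellK_sub_div :
    Tendsto (fun μ => (ellK μ - (Real.log (16 / μ) / 2 + μ / 8 * (Real.log (16 / μ) - 2))) / μ)
      (𝓝[>] 0) (𝓝 0) := by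
  have hc := tendsto_inv_two_mul_one_sub
  refine HasDerivAt.lhopital_zero_nhdsGT (g := fun μ => μ) (g' := fun _ => 1)
    (f' := fun μ => -((ellE μ / μ - ellK μ) * (2 * (1 - μ))⁻¹) + (2 * μ)⁻¹ -
      Real.log (16 / μ) / 8 + 3 / 8)
    ?_ (Eventually.of_forall fun x => hasDerivAt_id x) (by simp) ?_ tendsto_id_nhdsGT ?_
  · filter_upwards [eventually_mem_Ioo_nhdsGT] with μ hμ
    have h1 := ((hasDerivAt_log_const_div hμ.1).div_const 2).add (((hasDerivAt_id μ).div_const 8).mul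
      ((hasDerivAt_log_const_div hμ.1).sub_const 2))
    refine ((hasDerivAt_ellK hμ.1 hμ.2).sub h1).congr_deriv ?_
    have := hμ.1.ne'
    simp only [id]
    field_simp
    ring
  · have h1 := tendsto_ellK_sub.sub
      ((tendsto_mul_log_nhdsGT.sub (tendsto_id_nhdsGT.const_mul 2)).div_const 8)
    norm_num at h1
    refine h1.congr fun μ => by ring
  · have h1 := ((((tendsto_ellK_sub.sub tendsto_ellE_sub_div).mul hc).add
      ((tendsto_mul_log_nhdsGT.mul hc).div_const 4)).sub (hc.const_mul (3 / 4))).add_const (3 / 8)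
    norm_num at h1
    refine h1.congr' ?_
    filter_upwards [eventually_mem_Ioo_nhdsGT] with μ hμ
    have : 1 - μ ≠ 0 := by linarith [hμ.2]
    have := hμ.1.ne'
    field_simp
    ring

/-- The expansion of the elliptic integral at the logarithmic singularity. -/
theorem tendsto_ellE_sub_div_sq :
    Tendsto (fun μ => (ellE μ - (1 + μ / 4 * (Real.log (16 / μ) - 1) +
      3 / 32 * μ ^ 2 * (Real.log (16 / μ) - 13 / 6))) / μ ^ 2) (𝓝[>] 0) (𝓝 0) := by
  have hc := tendsto_inv_two_mul_one_sub
  have hid := tendsto_id_nhdsGT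
  refine HasDerivAt.lhopital_zero_nhdsGT (g := fun μ => μ ^ 2) (g' := fun μ => 2 * μ)
    (f' := fun μ => (ellK μ - ellE μ) * (2 * (1 - μ))⁻¹ - (Real.log (16 / μ) / 4 - 1 / 2) -
      3 / 32 * μ * (2 * Real.log (16 / μ) - 16 / 3))
    ?_ (Eventually.of_forall fun x => by simpa using hasDerivAt_pow 2 x) ?_ ?_ ?_ ?_
  · filter_upwards [eventually_mem_Ioo_nhdsGT] with μ hμ
    have h1 := ((((hasDerivAt_id μ).div_const 4).mul
      ((hasDerivAt_log_const_div hμ.1).sub_const 1)).const_add 1).add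
      ((((hasDerivAt_id μ).pow 2).const_mul (3 / 32)).mul
      ((hasDerivAt_log_const_div hμ.1).sub_const (13 / 6)))
    refine ((hasDerivAt_ellE hμ.1 hμ.2).sub h1).congr_deriv ?_
    have := hμ.1.ne'
    simp
    field_simp
    ring
  · filter_upwards [eventually_mem_Ioo_nhdsGT] with μ hμ
    have := hμ.1
    positivity
  · have h1 := (tendsto_ellE.sub (((tendsto_mul_log_nhdsGT.sub hid).div_const 4).const_add 1)).sub
      (((hid.mul tendsto_mul_log_nhdsGT).sub ((hid.mul hid).mul_const (13 / 6))).const_mul (3 / 32))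
    norm_num at h1
    refine h1.congr fun μ => by ring
  · simpa using hid.pow 2
  · have h1 := ((((tendsto_mul_log_nhdsGT.mul hc).mul_const (3 / 8)).add (hc.const_sub (1 / 2))).add
      (hc.mul (tendsto_ellK_sub_div.sub tendsto_ellE_sub_div))).div_const 2
    norm_num at h1
    refine h1.congr' ?_
    filter_upwards [eventually_mem_Ioo_nhdsGT] with μ hμ
    have : 1 - μ ≠ 0 := by linarith [hμ.2]
    have := hμ.1.ne'
    field_simp
    ring

/-! ### The action near the half-axis `j₂ = 0`, `h < 0` -/

namespace ChampagneBottle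

open MeasureTheory

/-- For `j₂ = 0` and `h = -a (1 - a)` the radicand has the roots `a` and `1 - a`. The substitution
`z = a / (sin² θ + μ cos² θ)` gives Legendre form, and the weight `z⁻²` moves the root of `D` to the
numerator, which makes it an integral of the second kind. -/
theorem integral_inv_sqrt_cubic {a : ℝ} (ha : 0 < a) (ha1 : a < 1 / 3) :
    IntegrableOn (fun z => (z ^ 2)⁻¹ * (√((z - a) * (1 - a - z) / z))⁻¹) (Set.Ioo a (1 - a)) ∧
    ∫ z in Set.Ioo a (1 - a), (z ^ 2)⁻¹ * (√((z - a) * (1 - a - z) / z))⁻¹ =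
      2 * (a * √(1 - a))⁻¹ * ellE (a / (1 - a)) := by
  have he : 0 < 1 - a := by linarith
  set μ := a / (1 - a) with hμ
  have hμ0 : 0 < μ := div_pos ha he
  have hμ1 : μ < 1 := by rw [hμ, div_lt_one he]; linarith
  have hk : 0 < 1 - μ := by linarith
  have hpi := Real.pi_pos
  set D : ℝ → ℝ := fun θ => Real.sin θ ^ 2 + μ * Real.cos θ ^ 2 with hD
  have hD0 : ∀ θ, 0 < D θ := sin_sq_add_mul_cos_sq_pos hμ0
  have hDs : ∀ θ, D θ = μ + (1 - μ) * Real.sin θ ^ 2 := fun θ => by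
    simp only [hD]; rw [Real.cos_sq']; ring
  have hDc : ∀ θ, D θ = 1 - (1 - μ) * Real.cos θ ^ 2 := fun θ => by
    simp only [hD]; rw [Real.cos_sq']; ring
  set Z : ℝ → ℝ := fun θ => a / D θ with hZ
  have hsc : ∀ θ ∈ Set.Ioo 0 (Real.pi / 2), 0 < Real.sin θ ∧ 0 < Real.cos θ := fun θ hθ =>
    ⟨Real.sin_pos_of_pos_of_lt_pi hθ.1 (by linarith [hθ.2]),
      Real.cos_pos_of_mem_Ioo ⟨by linarith [hθ.1], hθ.2⟩⟩
  have hanti : StrictAntiOn Z (Set.Icc 0 (Real.pi / 2)) := by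
    intro u hu v hv huv
    have h1 : Real.sin u < Real.sin v :=
      Real.strictMonoOn_sin ⟨by linarith [hu.1], hu.2⟩ ⟨by linarith [hv.1], hv.2⟩ huv
    have h0 : 0 ≤ Real.sin u := Real.sin_nonneg_of_nonneg_of_le_pi hu.1 (by linarith [hu.2])
    have h2 : D u < D v := by
      rw [hDs, hDs]
      have : Real.sin u ^ 2 < Real.sin v ^ 2 := pow_lt_pow_left₀ h1 h0 two_ne_zero
      nlinarith
    exact div_lt_div_of_pos_left ha (hD0 u) h2
  have hZ0 : Z 0 = 1 - a := by
    simp only [hZ, hD, Real.sin_zero, Real.cos_zero, hμ]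
    field_simp
    simp
  have hZ1 : Z (Real.pi / 2) = a := by simp [hZ, hD]
  have hcont : Continuous Z := continuous_const.div (by fun_prop) fun θ => (hD0 θ).ne'
  have himg : Z '' Set.Ioo 0 (Real.pi / 2) = Set.Ioo a (1 - a) := by
    refine Set.Subset.antisymm ?_ ?_
    · rintro _ ⟨x, hx, rfl⟩
      rw [← hZ0]
      nth_rewrite 1 [← hZ1]
      exact ⟨hanti ⟨hx.1.le, hx.2.le⟩ ⟨by positivity, le_rfl⟩ hx.2,
        hanti ⟨le_rfl, by positivity⟩ ⟨hx.1.le, hx.2.le⟩ hx.1⟩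
    · have := intermediate_value_Ioo' (f := Z) (a := 0) (b := Real.pi / 2) (by positivity)
        hcont.continuousOn
      rwa [hZ0, hZ1] at this
  have hder : ∀ θ ∈ Set.Ioo 0 (Real.pi / 2), HasDerivWithinAt Z
      (-(2 * a * (1 - μ) * (Real.sin θ * Real.cos θ) / D θ ^ 2)) (Set.Ioo 0 (Real.pi / 2)) θ := by
    intro θ _
    have h1 := (((Real.hasDerivAt_sin θ).pow 2).add (((Real.hasDerivAt_cos θ).pow 2).const_mul μ))
    have h2 : HasDerivAt D (2 * (1 - μ) * (Real.sin θ * Real.cos θ)) θ := by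
      refine h1.congr_deriv ?_
      simp
      ring
    have h3 := (hasDerivAt_const θ a).div h2 (hD0 θ).ne'
    exact (h3.congr_deriv (by ring)).hasDerivWithinAt
  have hinj : Set.InjOn Z (Set.Ioo 0 (Real.pi / 2)) :=
    (hanti.mono Set.Ioo_subset_Icc_self).injOn
  have hkey : ∀ θ ∈ Set.Ioo 0 (Real.pi / 2),
      |-(2 * a * (1 - μ) * (Real.sin θ * Real.cos θ) / D θ ^ 2)| •
        ((Z θ ^ 2)⁻¹ * (√((Z θ - a) * (1 - a - Z θ) / Z θ))⁻¹) =
      2 * (a * √(1 - a))⁻¹ * √(D θ) := by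
    intro θ hθ
    obtain ⟨hs, hc⟩ := hsc θ hθ
    have hd := hD0 θ
    have e1 : Z θ - a = a * (1 - μ) * Real.cos θ ^ 2 / D θ := by
      simp only [hZ]
      rw [div_sub' hd.ne']
      congr 1
      rw [hDc]; ring
    have e2 : 1 - a - Z θ = (1 - a) * (1 - μ) * Real.sin θ ^ 2 / D θ := by
      simp only [hZ]
      rw [sub_div' hd.ne']
      congr 1
      rw [hDs]
      have : a = (1 - a) * μ := by rw [hμ]; field_simp
      linear_combination (-1) * this
    have e3 : (Z θ - a) * (1 - a - Z θ) / Z θ =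
        ((1 - μ) * Real.cos θ * Real.sin θ) ^ 2 * ((1 - a) / D θ) := by
      rw [e1, e2]
      simp only [hZ]
      field_simp
    rw [e3, Real.sqrt_mul (sq_nonneg _), Real.sqrt_sq (by positivity), Real.sqrt_div he.le, abs_neg,
      abs_of_pos (by positivity), smul_eq_mul]
    have hsd := Real.sqrt_pos.2 hd
    have hse := Real.sqrt_pos.2 he
    simp only [hZ]
    field_simp
  have hci : Continuous fun θ => 2 * (a * √(1 - a))⁻¹ * √(D θ) := by fun_prop
  rw [← himg]
  constructor
  · rw [integrableOn_image_iff_integrableOn_abs_deriv_smul measurableSet_Ioo hder hinj,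
      integrableOn_congr_fun hkey measurableSet_Ioo]
    exact (hci.integrableOn_Icc).mono_set Set.Ioo_subset_Icc_self
  · rw [integral_image_eq_integral_abs_deriv_smul measurableSet_Ioo hder hinj,
      setIntegral_congr_fun measurableSet_Ioo hkey, ← integral_Ioc_eq_integral_Ioo,
      ← intervalIntegral.integral_of_le (by positivity), intervalIntegral.integral_const_mul]
    rfl

/-- A bound that remains valid when `x - y` is negative and the root is `0`; this covers the points
that leave the allowed interval as `j₂` grows. -/
theorem abs_sqrt_sub_sub_sqrt_le {x y : ℝ} (hx : 0 < x) (hy : 0 ≤ y) :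
    |√(x - y) - √x| ≤ y * (√x)⁻¹ := by
  have hx' := Real.sqrt_pos.2 hx
  have h1 : √(x - y) ≤ √x := Real.sqrt_le_sqrt (by linarith)
  rw [abs_of_nonpos (by linarith), ← div_eq_mul_inv, le_div_iff₀ hx']
  have h2 := Real.mul_self_sqrt hx.le
  rcases le_or_gt y x with h | h
  · have h3 := Real.mul_self_sqrt (show 0 ≤ x - y by linarith)
    nlinarith [Real.sqrt_nonneg (x - y)]
  · rw [Real.sqrt_eq_zero'.2 (by linarith)]
    linarith

theorem tendsto_sqrt_quotient {x c : ℝ} (hx : 0 < x) :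
    Tendsto (fun t : ℝ => (√(x - t ^ 2 * c) - √x) / t ^ 2) (𝓝[>] 0) (𝓝 (-(c / 2) * (√x)⁻¹)) := by
  have hx' := Real.sqrt_pos.2 hx
  have hc : ContinuousAt (fun t : ℝ => -c / (√(x - t ^ 2 * c) + √x)) 0 := by
    refine ContinuousAt.div continuousAt_const (by fun_prop) ?_
    simp
    positivity
  have h1 := hc.tendsto.mono_left (nhdsWithin_le_nhds (s := Set.Ioi 0))
  have e : -c / (√(x - 0 ^ 2 * c) + √x) = -(c / 2) * (√x)⁻¹ := by
    simp; field_simp; ring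
  rw [e] at h1
  refine h1.congr' ?_
  have hpos : ∀ᶠ t : ℝ in 𝓝[>] 0, 0 < x - t ^ 2 * c := by
    have : ContinuousAt (fun t : ℝ => x - t ^ 2 * c) 0 := by fun_prop
    exact nhdsWithin_le_nhds (this.eventually_const_lt (by simpa using hx))
  filter_upwards [hpos, self_mem_nhdsWithin] with t ht ht0
  have ht0 : 0 < t := ht0
  have h2 := Real.sq_sqrt hx.le
  have h3 := Real.sq_sqrt ht.le
  have h4 := Real.sqrt_pos.2 ht
  rw [div_eq_div_iff (by positivity) (by positivity)]
  linear_combination h2 - h3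

/-- The second-order behaviour of the action integral across `j = 0`, below the singular value. -/
theorem tendsto_action_quotient {a : ℝ} (ha : 0 < a) (ha1 : a < 1 / 3) :
    Tendsto (fun t : ℝ => (2 * Real.pi * scaledAction (-a * (1 - a)) t -
      2 * Real.pi * scaledAction (-a * (1 - a)) 0) / t ^ 2) (𝓝[>] 0)
      (𝓝 (-(1 / 2) * ((a * √(1 - a))⁻¹ * ellE (a / (1 - a))))) := by
  obtain ⟨hint, hval⟩ := integral_inv_sqrt_cubic ha ha1
  have hr : ∀ z : ℝ, 0 < z → 1 - z + -a * (1 - a) / z = (z - a) * (1 - a - z) / z := by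
    intro z hz; field_simp; ring
  set r : ℝ → ℝ := fun z => 1 - z + -a * (1 - a) / z with hrdef
  have hneg : ∀ z : ℝ, 0 < z → z ∉ Set.Ioo a (1 - a) → r z ≤ 0 := by
    intro z hz hz'
    simp only [hrdef]
    rw [hr z hz]
    refine div_nonpos_of_nonpos_of_nonneg ?_ hz.le
    rcases le_or_gt z a with h | h
    · exact mul_nonpos_of_nonpos_of_nonneg (by linarith) (by linarith)
    · have : 1 - a ≤ z := by
        by_contra h'
        exact hz' ⟨h, not_le.1 h'⟩
      exact mul_nonpos_of_nonneg_of_nonpos (by linarith) (by linarith)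
  have hposr : ∀ z ∈ Set.Ioo a (1 - a), 0 < r z := by
    intro z hz
    have hz0 := ha.trans hz.1
    simp only [hrdef]
    rw [hr z hz0]
    exact div_pos (mul_pos (by linarith [hz.1]) (by linarith [hz.2])) hz0
  have hsubset : Set.Ioo a (1 - a) ⊆ Set.Ioi 0 := fun z hz => ha.trans hz.1
  -- integrability of the roots
  have hsqrt : ∀ t : ℝ, IntegrableOn (fun z => √(r z - t ^ 2 * (4 * z ^ 2)⁻¹)) (Set.Ioi 0) := by
    intro t
    have h1 : IntegrableOn (fun z => √(r z - t ^ 2 * (4 * z ^ 2)⁻¹)) (Set.Ioo a (1 - a)) := by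
      refine (ContinuousOn.integrableOn_Icc fun z hz => ?_).mono_set Set.Ioo_subset_Icc_self
      have hz0 : 0 < z := ha.trans_le hz.1
      refine ContinuousAt.continuousWithinAt ?_
      simp only [hrdef]
      refine Real.continuous_sqrt.continuousAt.comp' (ContinuousAt.sub (ContinuousAt.add (by fun_prop)
        (continuousAt_const.div continuousAt_id hz0.ne')) (continuousAt_const.mul
        (ContinuousAt.inv₀ (by fun_prop) (by positivity))))
    refine h1.of_forall_sdiff_eq_zero measurableSet_Ioi fun z hz => ?_
    have hz0 : 0 < z := hz.1
    refine Real.sqrt_eq_zero'.2 ?_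
    have h2 := hneg z hz0 hz.2
    have : 0 ≤ t ^ 2 * (4 * z ^ 2)⁻¹ := by positivity
    linarith
  have haction : ∀ t : ℝ, 2 * Real.pi * scaledAction (-a * (1 - a)) t =
      2 * ∫ z in Set.Ioi (0 : ℝ), √(r z - t ^ 2 * (4 * z ^ 2)⁻¹) := by
    intro t
    rw [two_pi_mul_scaledAction]
    simp only [hrdef, div_eq_mul_inv]
  have hquot : ∀ t : ℝ, (2 * Real.pi * scaledAction (-a * (1 - a)) t -
      2 * Real.pi * scaledAction (-a * (1 - a)) 0) / t ^ 2 =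
      2 * ∫ z in Set.Ioi (0 : ℝ), (√(r z - t ^ 2 * (4 * z ^ 2)⁻¹) - √(r z)) / t ^ 2 := by
    intro t
    have h0 := hsqrt 0
    simp only [ne_eq, OfNat.ofNat_ne_zero, not_false_eq_true, zero_pow, zero_mul, sub_zero] at h0
    rw [haction, haction, integral_div, integral_sub (hsqrt t) h0]
    simp only [ne_eq, OfNat.ofNat_ne_zero, not_false_eq_true, zero_pow, zero_mul, sub_zero]
    ring
  simp only [hquot]
  have hg : ∀ z ∈ Set.Ioi (0 : ℝ), z ∉ Set.Ioo a (1 - a) → (√(r z))⁻¹ = 0 := by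
    intro z hz hz'
    rw [Real.sqrt_eq_zero'.2 (hneg z hz hz'), inv_zero]
  have hgint : IntegrableOn (fun z => (z ^ 2)⁻¹ * (√(r z))⁻¹) (Set.Ioi 0) := by
    have h1 : IntegrableOn (fun z => (z ^ 2)⁻¹ * (√(r z))⁻¹) (Set.Ioo a (1 - a)) := by
      refine hint.congr_fun (fun z hz => ?_) measurableSet_Ioo
      simp only [hrdef]
      rw [hr z (ha.trans hz.1)]
    refine h1.of_forall_sdiff_eq_zero measurableSet_Ioi fun z hz => ?_
    rw [hg z hz.1 hz.2, mul_zero]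
  have hgval : ∫ z in Set.Ioi (0 : ℝ), -((4 * z ^ 2)⁻¹ / 2) * (√(r z))⁻¹ =
      -(1 / 4) * ((a * √(1 - a))⁻¹ * ellE (a / (1 - a))) := by
    have h1 : ∫ z in Set.Ioi (0 : ℝ), -((4 * z ^ 2)⁻¹ / 2) * (√(r z))⁻¹ =
        -(1 / 8) * ∫ z in Set.Ioi (0 : ℝ), (z ^ 2)⁻¹ * (√(r z))⁻¹ := by
      rw [← integral_const_mul]
      congr 1
      ext z
      rw [mul_inv]; ring
    rw [h1, setIntegral_eq_of_subset_of_forall_sdiff_eq_zero measurableSet_Ioi hsubset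
      fun z hz => by rw [hg z hz.1 hz.2, mul_zero]]
    have h2 : ∫ z in Set.Ioo a (1 - a), (z ^ 2)⁻¹ * (√(r z))⁻¹ =
        2 * (a * √(1 - a))⁻¹ * ellE (a / (1 - a)) := by
      rw [← hval]
      refine setIntegral_congr_fun measurableSet_Ioo fun z hz => ?_
      simp only [hrdef]
      rw [hr z (ha.trans hz.1)]
    rw [h2]
    ring
  have hlim : Tendsto (fun t : ℝ => ∫ z in Set.Ioi (0 : ℝ),
      (√(r z - t ^ 2 * (4 * z ^ 2)⁻¹) - √(r z)) / t ^ 2) (𝓝[>] 0)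
      (𝓝 (∫ z in Set.Ioi (0 : ℝ), -((4 * z ^ 2)⁻¹ / 2) * (√(r z))⁻¹)) := by
    -- The turning points move with `t`, but the roots are extended by zero to the fixed half-line
    -- and the quotients have one integrable majorant there.
    refine tendsto_integral_filter_of_dominated_convergence
      (fun z => (z ^ 2)⁻¹ * (√(r z))⁻¹) ?_ ?_ hgint ?_
    · refine Eventually.of_forall fun t => Measurable.aestronglyMeasurable ?_
      simp only [hrdef]
      fun_prop
    · filter_upwards [self_mem_nhdsWithin] with t ht
      have ht : 0 < t := ht
      refine (ae_restrict_iff' measurableSet_Ioi).2 (Eventually.of_forall fun z hz => ?_)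
      have hz0 : 0 < z := hz
      rw [norm_div, Real.norm_eq_abs, Real.norm_of_nonneg (sq_nonneg t), div_le_iff₀ (by positivity)]
      by_cases hm : z ∈ Set.Ioo a (1 - a)
      · refine (abs_sqrt_sub_sub_sqrt_le (hposr z hm) (by positivity)).trans ?_
        have h1 : 0 ≤ (√(r z))⁻¹ := by positivity
        have h2 : (4 * z ^ 2)⁻¹ ≤ (z ^ 2)⁻¹ := inv_anti₀ (by positivity) (by nlinarith [sq_nonneg z])
        calc t ^ 2 * (4 * z ^ 2)⁻¹ * (√(r z))⁻¹ ≤ t ^ 2 * (z ^ 2)⁻¹ * (√(r z))⁻¹ := by gcongr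
          _ = _ := by ring
      · have h1 := hneg z hz0 hm
        have : 0 ≤ t ^ 2 * (4 * z ^ 2)⁻¹ := by positivity
        rw [Real.sqrt_eq_zero'.2 (by linarith : r z - t ^ 2 * (4 * z ^ 2)⁻¹ ≤ 0),
          Real.sqrt_eq_zero'.2 h1]
        simp
    · refine (ae_restrict_iff' measurableSet_Ioi).2 (Eventually.of_forall fun z hz => ?_)
      have hz0 : 0 < z := hz
      by_cases hm : z ∈ Set.Ioo a (1 - a)
      · exact tendsto_sqrt_quotient (hposr z hm)
      · have h1 := hneg z hz0 hm
        rw [hg z hz hm, mul_zero]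
        refine tendsto_const_nhds.congr fun t => ?_
        have : 0 ≤ t ^ 2 * (4 * z ^ 2)⁻¹ := by positivity
        rw [Real.sqrt_eq_zero'.2 (by linarith : r z - t ^ 2 * (4 * z ^ 2)⁻¹ ≤ 0),
          Real.sqrt_eq_zero'.2 h1]
        simp
  rw [hgval] at hlim
  convert hlim.const_mul 2 using 2
  ring

end ChampagneBottle

/-! ### The twist on the half-axis -/

namespace ChampagneBottle

/-- Convergence of the second-order quotient forces the first derivative to vanish at `0`;
l'Hôpital's rule then identifies the limit with half of the second derivative. -/
theorem eq_two_mul_of_tendsto_quotient {v v₁ : ℝ → ℝ} {c L : ℝ}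
    (hv : ∀ᶠ t in 𝓝 (0 : ℝ), HasDerivAt v (v₁ t) t) (hv₁ : HasDerivAt v₁ c 0)
    (hL : Tendsto (fun t => (v t - v 0) / t ^ 2) (𝓝[>] 0) (𝓝 L)) : c = 2 * L := by
  have hid : Tendsto (fun t : ℝ => t) (𝓝[>] 0) (𝓝 0) := tendsto_id.mono_left nhdsWithin_le_nhds
  have h1 : v₁ 0 = 0 := by
    have h2 := (hv.self_of_nhds.tendsto_slope_zero_right)
    have h3 := hL.mul hid
    rw [mul_zero] at h3
    refine tendsto_nhds_unique h2 (h3.congr' ?_)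
    filter_upwards [self_mem_nhdsWithin] with t ht
    have ht : t ≠ 0 := ne_of_gt ht
    rw [zero_add, smul_eq_mul]
    field_simp
  have h2 : Tendsto (fun t => v₁ t / (2 * t)) (𝓝[>] 0) (𝓝 (c / 2)) := by
    have h3 := (hv₁.tendsto_slope_zero_right).div_const 2
    refine h3.congr' ?_
    filter_upwards [self_mem_nhdsWithin] with t ht
    have ht : t ≠ 0 := ne_of_gt ht
    rw [zero_add, smul_eq_mul, h1, sub_zero]
    field_simp
  have h3 : Tendsto (fun t => (v t - v 0) / t ^ 2) (𝓝[>] 0) (𝓝 (c / 2)) := by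
    refine HasDerivAt.lhopital_zero_nhdsGT (f' := v₁) (g' := fun t => 2 * t) ?_ ?_ ?_ ?_ ?_ h2
    · exact nhdsWithin_le_nhds (hv.mono fun t ht => ht.sub_const _)
    · exact Eventually.of_forall fun x => by simpa using hasDerivAt_pow 2 x
    · filter_upwards [self_mem_nhdsWithin] with t ht
      have ht : 0 < t := ht
      positivity
    · have h4 := (hv.self_of_nhds.continuousAt.tendsto.sub_const (v 0))
      rw [sub_self] at h4
      exact h4.mono_left nhdsWithin_le_nhds
    · simpa using hid.pow 2
  have := tendsto_nhds_unique hL h3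
  linarith

theorem tendsto_axis : Tendsto (fun a : ℝ => ((-a * (1 - a), 0) : ℝ × ℝ)) (𝓝[>] 0) (𝓝 0) := by
  have h : ContinuousAt (fun a : ℝ => ((-a * (1 - a), 0) : ℝ × ℝ)) 0 := by fun_prop
  have := h.tendsto.mono_left (nhdsWithin_le_nhds (s := Set.Ioi 0))
  rwa [show ((-0 * (1 - 0), 0) : ℝ × ℝ) = 0 by simp] at this

/-- The twist below the singular value. -/
theorem eventually_twist_axis :
    ∀ᶠ a : ℝ in 𝓝[>] 0, 2 * Real.pi * twist (-a * (1 - a)) 0 =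
      (a * √(1 - a))⁻¹ * ellE (a / (1 - a)) := by
  obtain ⟨U, hU⟩ := exists_isRegularPart
  filter_upwards [tendsto_axis.eventually hU.eventually_exists_branch,
    Ioo_mem_nhdsGT (show (0 : ℝ) < 1 / 3 by norm_num)] with a h1 ha
  obtain ⟨V, hV, -⟩ := h1 (fun h => by
    have := (Prod.ext_iff.1 h).1
    simp only [Prod.fst_zero] at this
    have h2 : 0 < a * (1 - a) := mul_pos ha.1 (by linarith [ha.2])
    linarith)
  have hs := eventually_slice hV.scaledAction_eq
  have hd : ∀ᶠ t in 𝓝 (0 : ℝ), HasDerivAt (fun t => V (-a * (1 - a), t))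
      (pd2 V (-a * (1 - a), t)) t := by
    filter_upwards [eventually_slice hV.1.eventually_analyticAt] with t ht
    exact hasDerivAt_pd2 ht.differentiableAt
  have hd2 := hasDerivAt_pd2 (analyticAt_pd2 hV.1).differentiableAt
  -- The branch is twice differentiable, so its second derivative can be read off from `t > 0`,
  -- where it is a multiple of the action.
  have key := eq_two_mul_of_tendsto_quotient hd hd2 (L := -(1 / 2) * ((a * √(1 - a))⁻¹ *
    ellE (a / (1 - a)))) (by
      refine (tendsto_action_quotient ha.1 ha.2).congr' ?_
      filter_upwards [nhdsWithin_le_nhds hs, self_mem_nhdsWithin] with t ht ht0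
      have ht0 : 0 < t := ht0
      have h0 := hs.self_of_nhds (Or.inl le_rfl)
      have h1 := ht (Or.inl ht0.le)
      simp only at h0 h1
      rw [h0, h1]
      have := Real.pi_ne_zero
      field_simp)
  have := hV.twist_eq
  simp only at this
  rw [this, key]
  ring

theorem eventually_pd2_vAction :
    ∀ᶠ q in 𝓝 (0 : ℝ × ℝ), pd2 vAction q = -(q.2 / 2) * moment 1 2 q := by
  filter_upwards [analyticAt_vAction.eventually_analyticAt, eventually_isRegular] with q h1 h2
  exact (hasDerivAt_pd2 h1.differentiableAt).unique (hasDerivAt_vanishingAction_snd h2)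

theorem eventually_pd1_vAction :
    ∀ᶠ q in 𝓝 (0 : ℝ × ℝ), pd1 vAction q = moment 1 1 q := by
  filter_upwards [analyticAt_vAction.eventually_analyticAt, eventually_isRegular] with q h1 h2
  exact (hasDerivAt_pd1 h1.differentiableAt).unique (hasDerivAt_vanishingAction_fst h2)

theorem eventually_pd2_pd2_vAction :
    ∀ᶠ q in 𝓝 (0 : ℝ × ℝ), pd2 (pd2 vAction) q =
      -(1 / 2) * moment 1 2 q - q.2 ^ 2 / 8 * moment 3 4 q := by
  filter_upwards [analyticAt_vAction.eventually_analyticAt, eventually_isRegular,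
    eventually_pd2_vAction.eventually_nhds] with q h1 h2 h3
  have h4 := (((hasDerivAt_id q.2).div_const 2).neg).mul (hasDerivAt_moment_snd 1 2 h2)
  have h5 := (hasDerivAt_pd2 (analyticAt_pd2 h1).differentiableAt).congr_of_eventuallyEq
    (f₁ := fun t => -(t / 2) * moment 1 2 (q.1, t)) ?_
  · rw [h5.unique h4]
    simp
    ring
  · filter_upwards [eventually_slice h3] with t ht
    exact ht.symm

/-- Squeeze with `1 - 1/w ≤ log w ≤ w - 1`. -/
theorem tendsto_log_quotient {w : ℝ → ℝ} {c : ℝ} (hw : Tendsto w (𝓝[>] 0) (𝓝 1))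
    (hc : Tendsto (fun a => (w a - 1) / a) (𝓝[>] 0) (𝓝 c)) :
    Tendsto (fun a => Real.log (w a) / a) (𝓝[>] 0) (𝓝 c) := by
  have h1 := hc.div hw one_ne_zero
  rw [div_one] at h1
  have hpos : ∀ᶠ a in 𝓝[>] (0 : ℝ), 0 < w a := hw.eventually_const_lt zero_lt_one
  refine tendsto_of_tendsto_of_tendsto_of_le_of_le' h1 hc ?_ ?_
  · filter_upwards [hpos, self_mem_nhdsWithin] with a h2 ha
    have ha : 0 < a := ha
    have h3 := Real.one_sub_inv_le_log_of_pos h2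
    simp only [Pi.div_apply]
    rw [div_div, mul_comm, ← div_div]
    refine div_le_div_of_nonneg_right ?_ ha.le
    refine le_trans (le_of_eq ?_) h3
    field_simp
  · filter_upwards [hpos, self_mem_nhdsWithin] with a h2 ha
    exact div_le_div_of_nonneg_right (Real.log_le_sub_one_of_pos h2) (le_of_lt ha)

theorem tendsto_inv_one_sub : Tendsto (fun a : ℝ => (1 - a)⁻¹) (𝓝[>] 0) (𝓝 1) := by
  have h : ContinuousAt (fun a : ℝ => (1 - a)⁻¹) 0 := ContinuousAt.inv₀ (by fun_prop) (by norm_num)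
  have := h.tendsto.mono_left (nhdsWithin_le_nhds (s := Set.Ioi 0))
  simpa using this

theorem tendsto_log_one_sub_div :
    Tendsto (fun a : ℝ => Real.log (1 - a) / a) (𝓝[>] 0) (𝓝 (-1)) := by
  refine tendsto_log_quotient ?_ (tendsto_const_nhds.congr' ?_)
  · simpa using tendsto_id_nhdsGT.const_sub 1
  · filter_upwards [self_mem_nhdsWithin] with a ha
    have : a ≠ 0 := ne_of_gt ha
    field_simp
    ring

theorem tendsto_inv_sqrt_sub_div :
    Tendsto (fun a : ℝ => ((√(1 - a))⁻¹ - 1 - a / 2) / a ^ 2) (𝓝[>] 0) (𝓝 (3 / 8)) := by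
  have h : ContinuousAt (fun a : ℝ => (√(1 - a) + 2) / (2 * √(1 - a) * (1 + √(1 - a)) ^ 2)) 0 :=
    ContinuousAt.div (by fun_prop) (by fun_prop) (by simp)
  have h1 := h.tendsto.mono_left (nhdsWithin_le_nhds (s := Set.Ioi 0))
  norm_num at h1
  refine h1.congr' ?_
  filter_upwards [eventually_mem_Ioo_nhdsGT] with a ha
  have h2 := Real.sqrt_pos.2 (show 0 < 1 - a by linarith [ha.2])
  have h3 := Real.sq_sqrt (show 0 ≤ 1 - a by linarith [ha.2])
  set s := √(1 - a) with hs
  have h4 : a = (1 - s) * (1 + s) := by linarith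
  have h5 : 1 - s ≠ 0 := fun h => by rw [h, zero_mul] at h4; linarith [ha.1]
  rw [h4]
  field_simp
  ring

/-- The expansion of the twist below the singular value. -/
theorem tendsto_twist_axis :
    Tendsto (fun a : ℝ => ((√(1 - a))⁻¹ * ellE (a / (1 - a)) -
      (1 + a * (Real.log (16 / a) / 4 + 1 / 4) + a ^ 2 * (15 / 32 * Real.log (16 / a) - 29 / 64))) /
      a ^ 2) (𝓝[>] 0) (𝓝 0) := by
  have hν := tendsto_inv_one_sub
  have hl := tendsto_mul_log_nhdsGT
  have hid := tendsto_id_nhdsGT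
  have hlg := tendsto_log_one_sub_div
  have hx := tendsto_inv_sqrt_sub_div
  have hμ : Tendsto (fun a : ℝ => a / (1 - a)) (𝓝[>] 0) (𝓝[>] 0) := by
    refine tendsto_nhdsWithin_iff.2 ⟨?_, ?_⟩
    · simpa [div_eq_mul_inv] using hid.mul hν
    · filter_upwards [eventually_mem_Ioo_nhdsGT] with a ha
      exact div_pos ha.1 (by linarith [ha.2])
  have hε := tendsto_ellE_sub_div_sq.comp hμ
  simp only [Function.comp_def] at hε
  have hE1 := ((((hν.mul hl).div_const 4).sub (hν.div_const 4)).add ((hν.mul hlg).div_const 4)).add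
    (((((hν.mul hl).mul (hν.add_const 1)).add ((hν.pow 2).mul (hid.mul hlg))).sub
      ((hν.pow 2).mul_const (13 / 6))).const_mul (3 / 32)) |>.add ((hν.pow 2).mul hε)
  have hE2 : Tendsto (fun a : ℝ => (ellE (a / (1 - a)) - (1 + a / 4 * (Real.log (16 / a) - 1))) /
      a ^ 2 - 11 / 32 * Real.log (16 / a)) (𝓝[>] 0) (𝓝 (-45 / 64)) := by
    norm_num at hE1
    refine (hE1.congr' ?_).trans_eq ?_
    · filter_upwards [eventually_mem_Ioo_nhdsGT] with a ha
      have h1 : 0 < 1 - a := by linarith [ha.2]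
      have h0 := ha.1
      -- The expansion of `ellE` is in `μ = a / (1 - a)` and must be rewritten in `a`.
      have e : Real.log (16 / (a / (1 - a))) = Real.log (16 / a) + Real.log (1 - a) := by
        rw [← Real.log_mul (by positivity) h1.ne']
        congr 1
        field_simp
      rw [e]
      field_simp
      ring
    · norm_num
  have hX := ((hx.add_const (-1 / 8 + 29 / 64)).add hE2).add
    ((((hl.const_mul (11 / 32)).add (hid.mul hE2)).const_mul (1 / 2)).add
      ((hx.mul (hl.sub hid)).div_const 4)) |>.add
      ((hid.mul hx).mul ((hl.const_mul (11 / 32)).add (hid.mul hE2)))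
  norm_num at hX
  refine hX.congr' ?_
  filter_upwards [eventually_mem_Ioo_nhdsGT] with a ha
  have h0 := ha.1.ne'
  generalize Real.log (16 / a) = l
  generalize ellE (a / (1 - a)) = E
  generalize (√(1 - a))⁻¹ = x
  field_simp
  ring

end ChampagneBottle

/-! ### First-order expansion of the regular part of the twist -/

namespace ChampagneBottle

theorem scaledAction_neg (h j : ℝ) : scaledAction h (-j) = scaledAction h j := by
  simp [scaledAction, radialAction, radialMomentum, neg_div]

theorem vAction_neg (q : ℝ × ℝ) : vAction (q.1, -q.2) = vAction q := by
  simp [vAction, vanishingAction, wBranch]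

theorem tendsto_reflect : Tendsto (fun q : ℝ × ℝ => (q.1, -q.2)) (𝓝 0) (𝓝 0) := by
  have h : ContinuousAt (fun q : ℝ × ℝ => (q.1, -q.2)) 0 := by fun_prop
  have := h.tendsto
  rwa [show (((0 : ℝ × ℝ).1, -(0 : ℝ × ℝ).2) : ℝ × ℝ) = 0 by simp] at this

/-- Each derivative in `j₂` exchanges even and odd functions of `j₂`. -/
theorem eventually_pd2_reflect {f : ℝ × ℝ → ℝ} {c : ℝ} (hf : AnalyticAt ℝ f 0)
    (h : ∀ᶠ q in 𝓝 (0 : ℝ × ℝ), f (q.1, -q.2) = c * f q) :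
    ∀ᶠ q in 𝓝 (0 : ℝ × ℝ), pd2 f (q.1, -q.2) = -c * pd2 f q := by
  filter_upwards [h.eventually_nhds, hf.eventually_analyticAt,
    tendsto_reflect.eventually hf.eventually_analyticAt] with q h1 h2 h3
  have e1 := (hasDerivAt_pd2 h3.differentiableAt).comp q.2 (hasDerivAt_neg q.2)
  have e2 := ((hasDerivAt_pd2 h2.differentiableAt).const_mul c).congr_of_eventuallyEq
    (eventually_slice h1)
  have := e1.unique e2
  linarith

theorem IsRegularPart.reflect {U : ℝ × ℝ → ℝ} (hU : IsRegularPart U) :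
    ∀ᶠ q in 𝓝 (0 : ℝ × ℝ), U (q.1, -q.2) = 1 * U q := by
  filter_upwards [hU.2, tendsto_reflect.eventually hU.2] with q h1 h2
  by_cases h0 : q = 0
  · rw [h0]; simp [Prod.mk_zero_zero]
  have e1 := h1 h0
  have e2 := h2 (fun h => h0 (Prod.ext (Prod.ext_iff.1 h).1 (neg_eq_zero.1 (Prod.ext_iff.1 h).2)))
  simp only [scaledAction_neg, vAction_neg, abs_neg, neg_sq] at e2
  linarith

/-- The analytic part of the twist, after the scale `16` is put into the logarithm. -/
noncomputable def twistRegular (U : ℝ × ℝ → ℝ) (q : ℝ × ℝ) : ℝ :=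
  -pd2 (pd2 U) q + pd2 (pd2 vAction) q * (1 + Real.log 16)

theorem analyticAt_twistRegular {U : ℝ × ℝ → ℝ} (hU : AnalyticAt ℝ U 0) :
    AnalyticAt ℝ (twistRegular U) 0 := by
  have h1 := analyticAt_pd2 (analyticAt_pd2 hU)
  have h2 := analyticAt_pd2 (analyticAt_pd2 analyticAt_vAction)
  unfold twistRegular
  fun_prop

/-- The action and the vanishing action are even in `j₂`, hence so is `U`. There is no linear term
in `j₂`, and the values on the half-axis determine the first-order expansion. -/
theorem IsRegularPart.pd2_twistRegular {U : ℝ × ℝ → ℝ} (hU : IsRegularPart U) :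
    pd2 (twistRegular U) 0 = 0 := by
  have h1 := eventually_pd2_reflect (analyticAt_pd2 hU.1) (eventually_pd2_reflect hU.1 hU.reflect)
  have h2 := eventually_pd2_reflect (analyticAt_pd2 analyticAt_vAction)
    (eventually_pd2_reflect analyticAt_vAction (c := 1)
      (Eventually.of_forall fun q => by rw [vAction_neg, one_mul]))
  have h3 : ∀ᶠ q in 𝓝 (0 : ℝ × ℝ), twistRegular U (q.1, -q.2) = 1 * twistRegular U q := by
    filter_upwards [h1, h2] with q e1 e2
    rw [twistRegular, e1, e2, twistRegular]
    ring
  have h4 := (eventually_pd2_reflect (analyticAt_twistRegular hU.1) h3).self_of_nhds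
  simp only [Prod.fst_zero, Prod.snd_zero, neg_zero, Prod.mk_zero_zero] at h4
  linarith

theorem isBigO_axis {f : ℝ × ℝ → ℝ} {n : ℕ} (hf : f =O[𝓝 0] fun p => ‖p‖ ^ n) :
    (fun a : ℝ => f (-a * (1 - a), 0)) =O[𝓝[>] 0] fun a => a ^ n := by
  refine (hf.comp_tendsto tendsto_axis).trans (IsBigO.of_bound 1 ?_)
  filter_upwards [eventually_mem_Ioo_nhdsGT] with a ha
  have h1 := ha.1
  have h2 : 0 < 1 - a := by linarith [ha.2]
  simp only [Function.comp_def, norm_pow, norm_norm, one_mul]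
  refine pow_le_pow_left₀ (norm_nonneg _) ?_ n
  rw [Prod.norm_def, norm_zero, max_eq_left (norm_nonneg _), norm_mul, norm_neg,
    Real.norm_of_nonneg h2.le]
  exact mul_le_of_le_one_right (norm_nonneg _) (by linarith)

theorem tendsto_div_pow_of_isBigO {f : ℝ → ℝ} {n : ℕ}
    (hf : f =O[𝓝[>] 0] fun a => a ^ (n + 1)) : Tendsto (fun a => f a / a ^ n) (𝓝[>] 0) (𝓝 0) := by
  have h1 : (fun a => f a / a ^ n) =O[𝓝[>] 0] fun a : ℝ => a := by
    refine (hf.mul (isBigO_refl (fun a : ℝ => (a ^ n)⁻¹) _)).congr' (.of_forall fun a => rfl) ?_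
    filter_upwards [self_mem_nhdsWithin] with a ha
    have ha : a ≠ 0 := ne_of_gt ha
    field_simp
    ring
  exact h1.trans_tendsto tendsto_id_nhdsGT

/-- The vanishing action on the axis, divided by `-a`. -/
noncomputable def axisRatio (a : ℝ) : ℝ := -vAction (-a * (1 - a), 0) / a

/-- Insert `h = -a + a²` in the cubic expansion of the vanishing action. -/
theorem tendsto_axisRatio_sub :
    Tendsto (fun a => (axisRatio a - 1 + 5 / 8 * a) / a ^ 2) (𝓝[>] 0) (𝓝 (-13 / 64)) := by
  have h1 := tendsto_div_pow_of_isBigO (isBigO_axis vanishingAction_isBigO)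
  have hid := tendsto_id_nhdsGT
  have h2 := (((hid.sub_const 2).const_mul (3 / 8)).add
    (((hid.const_sub 1).pow 3).const_mul (35 / 64))).sub h1
  norm_num at h2
  norm_num
  refine h2.congr' ?_
  filter_upwards [self_mem_nhdsWithin] with a ha
  have ha : a ≠ 0 := ne_of_gt ha
  have e : axisRatio a = -vanishingAction (-(a * (1 - a))) 0 / a := by
    rw [axisRatio, vAction, neg_mul]
  rw [e]
  generalize vanishingAction _ _ = v
  field_simp
  ring

theorem tendsto_axisRatio_sub_div :
    Tendsto (fun a => (axisRatio a - 1) / a) (𝓝[>] 0) (𝓝 (-5 / 8)) := by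
  have h := (tendsto_id_nhdsGT.mul tendsto_axisRatio_sub).sub_const (5 / 8)
  norm_num at h
  norm_num
  refine h.congr' ?_
  filter_upwards [self_mem_nhdsWithin] with a ha
  have ha : a ≠ 0 := ne_of_gt ha
  field_simp
  ring

theorem tendsto_axisRatio : Tendsto axisRatio (𝓝[>] 0) (𝓝 1) := by
  have h := (tendsto_id_nhdsGT.mul tendsto_axisRatio_sub_div).add_const 1
  norm_num at h
  refine h.congr' ?_
  filter_upwards [self_mem_nhdsWithin] with a ha
  have ha : a ≠ 0 := ne_of_gt ha
  field_simp
  ring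

theorem tendsto_inv_axisRatio_sub :
    Tendsto (fun a => ((axisRatio a)⁻¹ - (1 + 5 / 8 * a + 19 / 32 * a ^ 2)) / a ^ 2)
      (𝓝[>] 0) (𝓝 0) := by
  have hid := tendsto_id_nhdsGT
  have hw := tendsto_axisRatio_sub
  have h := ((((hw.add_const (13 / 64)).add (hid.mul ((hw.const_mul (5 / 8)).sub_const
    (5 / 8 * (19 / 32))))).add ((hid.pow 2).mul (hw.mul_const (19 / 32)))).neg).div
      tendsto_axisRatio one_ne_zero
  norm_num at h
  refine h.congr' ?_
  filter_upwards [self_mem_nhdsWithin, tendsto_axisRatio.eventually_const_lt zero_lt_one]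
    with a ha hw0
  have ha : a ≠ 0 := ne_of_gt ha
  simp only [Pi.div_apply]
  field_simp
  ring

theorem moment_axis_isBigO :
    (fun a : ℝ => moment 1 2 (-a * (1 - a), 0) - 1 / 2 - 15 / 16 * a) =O[𝓝[>] 0]
      fun a => a ^ 2 := by
  have h := isBigO_axis (moment_sub_linear_isBigO 1 2)
  norm_num [moment_zero_succ, moment_one_zero] at h
  refine (h.sub ((isBigO_refl (fun a : ℝ => a ^ 2) _).const_mul_left (15 / 16))).congr_left
    fun a => ?_
  ring_nf

/-- The error `O(a²)` of the period meets `log (16 / a)`; after division by `a` the product still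
tends to zero. -/
theorem tendsto_moment_axis_log :
    Tendsto (fun a : ℝ => (1 / 2 * moment 1 2 (-a * (1 - a), 0) *
        (Real.log (16 / a) - Real.log (axisRatio a)) -
      (1 / 4 * Real.log (16 / a) + 15 / 32 * a * Real.log (16 / a) + 5 / 32 * a)) / a)
      (𝓝[>] 0) (𝓝 0) := by
  have hid := tendsto_id_nhdsGT
  have hm := moment_axis_isBigO
  have hd := tendsto_div_pow_of_isBigO (n := 1) hm
  have hM : Tendsto (fun a : ℝ => moment 1 2 (-a * (1 - a), 0)) (𝓝[>] 0) (𝓝 (1 / 2)) := by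
    have h := ((hid.mul hd).add (hid.const_mul (15 / 16))).add_const (1 / 2)
    rw [mul_zero, mul_zero, zero_add, zero_add] at h
    refine h.congr' ?_
    filter_upwards [self_mem_nhdsWithin] with a ha
    have ha : a ≠ 0 := ne_of_gt ha
    field_simp
    ring
  have hl : Tendsto (fun a : ℝ => (moment 1 2 (-a * (1 - a), 0) - 1 / 2 - 15 / 16 * a) *
      (a⁻¹ * Real.log (16 / a))) (𝓝[>] 0) (𝓝 0) := by
    refine ((hm.mul (isBigO_refl (fun a : ℝ => a⁻¹ * Real.log (16 / a)) _)).congr' .rfl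
      ?_).trans_tendsto tendsto_mul_log_nhdsGT
    filter_upwards [self_mem_nhdsWithin] with a ha
    have ha : a ≠ 0 := ne_of_gt ha
    field_simp
  have h := ((hl.const_mul (1 / 2)).sub ((hM.mul (tendsto_log_quotient tendsto_axisRatio
    tendsto_axisRatio_sub_div)).const_mul (1 / 2))).sub_const (5 / 32)
  rw [show (1 / 2 * 0 - 1 / 2 * (1 / 2 * (-5 / 8)) - 5 / 32 : ℝ) = 0 by norm_num] at h
  refine h.congr' ?_
  filter_upwards [self_mem_nhdsWithin] with a ha
  have ha : a ≠ 0 := ne_of_gt ha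
  generalize Real.log (16 / a) = l
  generalize Real.log (axisRatio a) = lw
  generalize moment _ _ _ = m
  field_simp
  ring

/-- The expansion of the regular part of the twist on the axis below the singular value. -/
theorem IsRegularPart.tendsto_twistRegular {U : ℝ × ℝ → ℝ} (hU : IsRegularPart U) :
    Tendsto (fun a : ℝ => (twistRegular U (-a * (1 - a), 0) + 3 / 8 + 77 / 64 * a) / a)
      (𝓝[>] 0) (𝓝 0) := by
  have h := (tendsto_twist_axis.sub tendsto_moment_axis_log).sub tendsto_inv_axisRatio_sub
  rw [sub_zero, sub_zero] at h
  refine h.congr' ?_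
  filter_upwards [eventually_twist_axis, tendsto_axis.eventually hU.twist_eq,
    tendsto_axis.eventually eventually_pd2_vAction,
    tendsto_axis.eventually eventually_pd2_pd2_vAction, eventually_mem_Ioo_nhdsGT,
    tendsto_axisRatio.eventually_const_lt zero_lt_one] with a h1 h2 h3 h4 ha hw
  have ha0 := ha.1
  have h1a : 0 < 1 - a := by linarith [ha.2]
  have hne : ((-a * (1 - a), 0) : ℝ × ℝ) ≠ 0 := fun hh => by
    have h5 := (Prod.ext_iff.1 hh).1
    simp only [Prod.fst_zero] at h5
    have h2 : 0 < a * (1 - a) := mul_pos ha0 h1a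
    linarith
  have h5 := h2 hne
  rw [h1, twistFormula] at h5
  have hJ : vAction (-a * (1 - a), 0) = -(a * axisRatio a) := by
    rw [axisRatio]
    field_simp
  have hlog : Real.log ((a * axisRatio a) ^ 2) =
      2 * (Real.log 16 - Real.log (16 / a) + Real.log (axisRatio a)) := by
    rw [Real.log_pow, Real.log_mul ha0.ne' hw.ne', Real.log_div (by norm_num) ha0.ne']
    push_cast
    ring
  rw [h3, h4, hJ] at h5
  simp only [zero_div, neg_zero, zero_mul, ne_eq, OfNat.ofNat_ne_zero, not_false_eq_true, zero_pow,
    zero_sub, mul_zero, add_zero, neg_sq, hlog] at h5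
  rw [twistRegular, h4]
  -- The twist formula solved for the unknown `∂²U/∂j₂²`. On the axis `∂J/∂j₂ = 0`, so its rational
  -- term reduces to `-1/J`. The leading `1/a` and `log a` cancel against the elliptic integral.
  have h6 : -pd2 (pd2 U) (-a * (1 - a), 0) = (a * √(1 - a))⁻¹ * ellE (a / (1 - a)) +
      1 / 2 * moment 1 2 (-a * (1 - a), 0) *
        (Real.log 16 - Real.log (16 / a) + Real.log (axisRatio a) + 1) - (a * axisRatio a)⁻¹ := by
    rw [h5]
    generalize axisRatio a = w at hw
    field_simp
    ring
  rw [h6, mul_inv, mul_inv]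
  generalize (√(1 - a))⁻¹ = x
  generalize (axisRatio a)⁻¹ = y
  generalize Real.log (16 / a) = l
  generalize Real.log (axisRatio a) = lw
  field_simp
  ring

/-- Analyticity at the origin is already known, so value and derivative may be computed along the
half-axis alone. -/
theorem IsRegularPart.twistRegular_zero {U : ℝ × ℝ → ℝ} (hU : IsRegularPart U) :
    twistRegular U 0 = -(3 / 8) ∧ pd1 (twistRegular U) 0 = 77 / 64 := by
  have hG := analyticAt_twistRegular hU.1
  have hid := tendsto_id_nhdsGT
  have h1 := (hid.mul hU.tendsto_twistRegular).sub (hid.const_mul (77 / 64))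
  have h2 : twistRegular U 0 = -(3 / 8) := by
    refine tendsto_nhds_unique (hG.continuousAt.tendsto.comp tendsto_axis) ?_
    have h3 := h1.sub_const (3 / 8)
    norm_num at h3
    norm_num
    refine h3.congr' ?_
    filter_upwards [self_mem_nhdsWithin] with a ha
    have ha : a ≠ 0 := ne_of_gt ha
    simp only [Function.comp_def]
    generalize twistRegular U _ = v
    field_simp
    ring
  refine ⟨h2, ?_⟩
  -- The half-axis is traversed with `h` decreasing; the velocity `-1` accounts for the sign of `77
  -- / 64`.
  have hc : HasDerivAt (fun a : ℝ => -a * (1 - a)) (-1) 0 := by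
    have := ((hasDerivAt_id (0 : ℝ)).neg).mul ((hasDerivAt_id (0 : ℝ)).const_sub 1)
    refine this.congr_deriv ?_
    simp
  have hd : HasDerivAt (fun t => twistRegular U (t, (0 : ℝ × ℝ).2)) (pd1 (twistRegular U) 0)
      (-0 * (1 - 0)) := by
    have := hasDerivAt_pd1 hG.differentiableAt
    simpa using this
  have h3 := (hd.comp (0 : ℝ) hc).tendsto_slope_zero_right
  have h4 := hU.tendsto_twistRegular.sub_const (77 / 64)
  have h5 := tendsto_nhds_unique h3 (h4.congr' (by
    filter_upwards [self_mem_nhdsWithin] with a ha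
    have ha : a ≠ 0 := ne_of_gt ha
    simp only [Function.comp_def, zero_add, smul_eq_mul, Prod.snd_zero, neg_zero, zero_mul]
    rw [Prod.mk_zero_zero, h2]
    generalize twistRegular U _ = v
    field_simp
    ring))
  linarith

end ChampagneBottle

/-! ### The twist in the coordinates of the normal form -/

/-- The implicit function theorem in the plane. -/
theorem ContDiffAt.exists_solve_fst {f : ℝ × ℝ → ℝ} {p : ℝ × ℝ} {n : WithTop ℕ∞}
    (hf : ContDiffAt ℝ n f p) (hn : n ≠ 0) (hp : fderiv ℝ f p (1, 0) ≠ 0) :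
    ∃ G : ℝ × ℝ → ℝ, ContDiffAt ℝ n G (f p, p.2) ∧ (∀ᶠ q in 𝓝 p, G (f q, q.2) = q.1) ∧
      ∀ᶠ y in 𝓝 (f p, p.2), f (G y, y.2) = y.1 := by
  set a := fderiv ℝ f p (1, 0) with ha
  set b := fderiv ℝ f p (0, 1) with hb
  let e : (ℝ × ℝ) ≃L[ℝ] (ℝ × ℝ) := ContinuousLinearEquiv.equivOfInverse
    ((a • ContinuousLinearMap.fst ℝ ℝ ℝ + b • ContinuousLinearMap.snd ℝ ℝ ℝ).prod
      (ContinuousLinearMap.snd ℝ ℝ ℝ))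
    ((a⁻¹ • (ContinuousLinearMap.fst ℝ ℝ ℝ - b • ContinuousLinearMap.snd ℝ ℝ ℝ)).prod
      (ContinuousLinearMap.snd ℝ ℝ ℝ))
    (fun x => by ext <;> simp [hp])
    (fun x => by ext <;> simp [hp])
  have hd := (hf.differentiableAt hn).hasFDerivAt
  have he : HasFDerivAt (fun q => (f q, q.2)) (e : (ℝ × ℝ) →L[ℝ] ℝ × ℝ) p := by
    refine (hd.prodMk hasFDerivAt_snd).congr_fderiv ?_
    refine ContinuousLinearMap.ext fun x => ?_
    refine Prod.ext ?_ rfl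
    change fderiv ℝ f p x = a * x.1 + b * x.2
    rw [ha, hb, mul_comm, ← smul_eq_mul, mul_comm, ← smul_eq_mul, ← map_smul, ← map_smul, ← map_add]
    simp
  have hc : ContDiffAt ℝ n (fun q : ℝ × ℝ => (f q, q.2)) p := hf.prodMk contDiffAt_snd
  have hs : HasStrictFDerivAt (fun q : ℝ × ℝ => (f q, q.2)) (e : (ℝ × ℝ) →L[ℝ] ℝ × ℝ) p :=
    hc.hasStrictFDerivAt' he hn
  have hr := hs.eventually_right_inverse
  refine ⟨fun y => (hs.localInverse _ _ p y).1, (hc.to_localInverse he hn).fst, ?_, ?_⟩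
  · filter_upwards [hs.eventually_left_inverse] with q hq
    exact (Prod.ext_iff.1 hq).1
  · filter_upwards [hr] with y hy
    have h1 := (Prod.ext_iff.1 hy).1
    have h2 : (hs.localInverse _ _ p y).2 = y.2 := (Prod.ext_iff.1 hy).2
    change f ((hs.localInverse _ _ p y).1, y.2) = y.1
    rw [← h2]
    exact h1

namespace ChampagneBottle

theorem isBigO_norm_sq_add_sq :
    (fun j : ℝ × ℝ => ‖j‖ ^ 2) =O[𝓝 0] fun j : ℝ × ℝ => j.1 ^ 2 + j.2 ^ 2 := by
  refine isBigO_of_le _ fun j : ℝ × ℝ => ?_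
  rw [norm_pow, norm_norm j, Real.norm_of_nonneg (by positivity), Prod.norm_def]
  rcases max_choice ‖j.1‖ ‖j.2‖ with hm | hm <;> rw [hm, Real.norm_eq_abs, sq_abs]
  · nlinarith [sq_nonneg j.2]
  · nlinarith [sq_nonneg j.1]

theorem twistRegular_isBigO {U : ℝ × ℝ → ℝ} (hU : IsRegularPart U) :
    (fun q : ℝ × ℝ => twistRegular U q - (-(3 / 8) + 77 / 64 * q.1)) =O[𝓝 0]
      fun q => ‖q‖ ^ 2 := by
  have hG := analyticAt_twistRegular hU.1
  obtain ⟨h0, h1⟩ := hU.twistRegular_zero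
  refine AnalyticAt.isBigO_norm_pow_succ (n := 1) (a := fun q => pd1 (twistRegular U) q - 77 / 64)
    (b := pd2 (twistRegular U)) (hG.sub (by fun_prop)) (by simp [h0]) ?_ ?_ ?_ ?_
  · filter_upwards [hG.eventually_analyticAt] with q hq
    refine ((hasDerivAt_pd1 hq.differentiableAt).sub
      (((hasDerivAt_id q.1).const_mul (77 / 64)).const_add (-(3 / 8)))).congr_deriv ?_
    ring
  · filter_upwards [hG.eventually_analyticAt] with q hq
    exact (hasDerivAt_pd2 hq.differentiableAt).sub_const _
  · have := (analyticAt_pd1 hG).differentiableAt.isBigO_sub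
    simp only [sub_zero, h1] at this
    exact this.norm_right.congr_right fun q => (pow_one _).symm
  · have := (analyticAt_pd2 hG).differentiableAt.isBigO_sub
    simp only [sub_zero, hU.pd2_twistRegular] at this
    exact this.norm_right.congr_right fun q => (pow_one _).symm

theorem pd2_pd2_vAction_isBigO :
    (fun q : ℝ × ℝ => pd2 (pd2 vAction) q + (1 / 4 - 15 / 32 * q.1)) =O[𝓝 0]
      fun q => ‖q‖ ^ 2 := by
  have h1 := moment_sub_linear_isBigO 1 2
  norm_num [moment_zero_succ, moment_one_zero] at h1
  have h2 : (fun q : ℝ × ℝ => q.2 ^ 2 / 8 * moment 3 4 q) =O[𝓝 0] fun q => ‖q‖ ^ 2 := by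
    refine (((isBigO_snd_norm.pow 2).const_mul_left (1 / 8)).mul (moment_isBigO_one 3 4)).congr
      (fun q => by ring) fun q => by ring
  refine ((h1.const_mul_left (-(1 / 2))).sub h2).congr' ?_ .rfl
  filter_upwards [eventually_pd2_pd2_vAction] with q hq
  rw [hq]
  ring

namespace IsNormalHamiltonian

variable {Hbar : ℝ × ℝ → ℝ}

/-- To first order `H̄` is `j₁`, so a linear expansion in `h` is a linear expansion in `j₁` with the
same coefficients. -/
theorem sub_linear_isBigO (h : IsNormalHamiltonian Hbar) {G : ℝ × ℝ → ℝ} {a b : ℝ}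
    (hG : (fun q : ℝ × ℝ => G q - (a + b * q.1)) =O[𝓝 0] fun q => ‖q‖ ^ 2) :
    (fun j : ℝ × ℝ => G (Hbar j, j.2) - (a + b * j.1)) =O[𝓝 0]
      fun j : ℝ × ℝ => j.1 ^ 2 + j.2 ^ 2 := by
  have h1 := (hG.comp_tendsto h.tendsto).trans (h.norm_isBigO.pow 2)
  refine ((h1.add (h.sub_fst_isBigO.const_mul_left b)).trans isBigO_norm_sq_add_sq).congr_left
    fun j => ?_
  simp only [Function.comp_def]
  ring

/-- The analytic coefficient `R₁`. -/
noncomputable def coeffOne (U Hbar : ℝ × ℝ → ℝ) (j : ℝ × ℝ) : ℝ := twistRegular U (Hbar j, j.2)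

/-- The analytic coefficient `R₂`. -/
noncomputable def coeffTwo (Hbar : ℝ × ℝ → ℝ) (j : ℝ × ℝ) : ℝ := -pd2 (pd2 vAction) (Hbar j, j.2)

theorem analyticAt_comp (h : IsNormalHamiltonian Hbar) {G : ℝ × ℝ → ℝ} (hG : AnalyticAt ℝ G 0) :
    AnalyticAt ℝ (fun j : ℝ × ℝ => G (Hbar j, j.2)) 0 := by
  refine AnalyticAt.fun_comp (g := G) (f := fun j : ℝ × ℝ => (Hbar j, j.2)) ?_
    (h.analyticAt.prod analyticAt_snd)
  rwa [h.zero, Prod.snd_zero, Prod.mk_zero_zero]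

theorem analyticAt_coeffOne (h : IsNormalHamiltonian Hbar) {U : ℝ × ℝ → ℝ}
    (hU : IsRegularPart U) : AnalyticAt ℝ (coeffOne U Hbar) 0 :=
  h.analyticAt_comp (analyticAt_twistRegular hU.1)

theorem analyticAt_coeffTwo (h : IsNormalHamiltonian Hbar) : AnalyticAt ℝ (coeffTwo Hbar) 0 :=
  (h.analyticAt_comp (analyticAt_pd2 (analyticAt_pd2 analyticAt_vAction))).neg

theorem coeffOne_isBigO (h : IsNormalHamiltonian Hbar) {U : ℝ × ℝ → ℝ} (hU : IsRegularPart U) :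
    (fun j : ℝ × ℝ => coeffOne U Hbar j - (-(3 / 8) + 77 / 64 * j.1)) =O[𝓝 0]
      fun j : ℝ × ℝ => j.1 ^ 2 + j.2 ^ 2 :=
  h.sub_linear_isBigO (twistRegular_isBigO hU)

theorem coeffTwo_isBigO (h : IsNormalHamiltonian Hbar) :
    (fun j : ℝ × ℝ => coeffTwo Hbar j - (1 / 4 - 15 / 32 * j.1)) =O[𝓝 0]
      fun j : ℝ × ℝ => j.1 ^ 2 + j.2 ^ 2 := by
  refine (h.sub_linear_isBigO (G := fun q => -pd2 (pd2 vAction) q) (a := 1 / 4) (b := -(15 / 32))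
    (pd2_pd2_vAction_isBigO.neg_left.congr_left fun q => by ring)).congr_left fun j => ?_
  rw [coeffTwo]
  ring

/-- The twist in the coordinates of the normal form. -/
theorem eventually_twistNF (h : IsNormalHamiltonian Hbar) {U : ℝ × ℝ → ℝ} (hU : IsRegularPart U) :
    ∀ᶠ j in 𝓝 (0 : ℝ × ℝ), j ≠ 0 → 2 * Real.pi * twistNF Hbar j =
      j.1 * (slope Hbar j ^ 2 - 1) / (j.1 ^ 2 + j.2 ^ 2) -
        2 * j.2 * slope Hbar j / (j.1 ^ 2 + j.2 ^ 2) + coeffOne U Hbar j +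
        Real.log (16 / √(j.1 ^ 2 + j.2 ^ 2)) * coeffTwo Hbar j := by
  filter_upwards [h.tendsto.eventually hU.twist_eq, h.fst_zero, h.right,
    h.tendsto.eventually eventually_pd2_vAction, h.eventually_slope] with j h1 h2 h3 h4 h5 h0
  have hρ : 0 < j.1 ^ 2 + j.2 ^ 2 := by
    rcases not_and_or.1 (fun hh => h0 (Prod.ext_iff.2 hh)) with hc | hc
    · have : j.1 ≠ 0 := hc
      positivity
    · have : j.2 ≠ 0 := hc
      positivity
  have h6 : pd2 vAction (Hbar j, j.2) = -slope Hbar j := by rw [h4, h5]; ring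
  have h7 : vAction (Hbar j, j.2) = j.1 := h3
  have h8 := h1 (h2 h0)
  rw [twistFormula, h6, h7] at h8
  rw [twistNF, h8, coeffOne, coeffTwo, twistRegular,
    Real.log_div (by norm_num) (Real.sqrt_pos.2 hρ).ne', Real.log_sqrt hρ.le]
  ring

theorem analyticAt_slope (h : IsNormalHamiltonian Hbar) : AnalyticAt ℝ (slope Hbar) 0 := by
  refine (analyticAt_pd2 h.analyticAt).fun_div (analyticAt_pd1 h.analyticAt) fun h0 => ?_
  have := h.eventually_pd.self_of_nhds.1
  rw [h0, zero_mul] at this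
  exact zero_ne_one this

theorem pd2_zero (h : IsNormalHamiltonian Hbar) : pd2 Hbar 0 = 0 := by
  have := h.eventually_pd.self_of_nhds.2
  rw [h.zero, Prod.snd_zero, Prod.mk_zero_zero, moment_one_zero] at this
  simpa using this

end IsNormalHamiltonian

/-! ### The smoothness of `|j|² log |j|²` -/

/-- The derivative of `|j|²`. -/
noncomputable def sqNormDeriv (j : ℝ × ℝ) : ℝ × ℝ →L[ℝ] ℝ :=
  (2 * j.1) • ContinuousLinearMap.fst ℝ ℝ ℝ + (2 * j.2) • ContinuousLinearMap.snd ℝ ℝ ℝ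

theorem hasFDerivAt_sqNorm (j : ℝ × ℝ) :
    HasFDerivAt (fun j : ℝ × ℝ => j.1 ^ 2 + j.2 ^ 2) (sqNormDeriv j) j := by
  refine ((hasFDerivAt_fst.pow 2).add (hasFDerivAt_snd.pow 2)).congr_fderiv ?_
  ext <;> simp [sqNormDeriv]

/-- `|φ j| ≤ |j|`, and `x log x → 0`. -/
theorem tendsto_mul_log_sqNorm {φ : ℝ × ℝ → ℝ} (hφ : ∀ j, φ j ^ 2 ≤ j.1 ^ 2 + j.2 ^ 2) :
    Tendsto (fun j : ℝ × ℝ => φ j * Real.log (j.1 ^ 2 + j.2 ^ 2)) (𝓝 0) (𝓝 0) := by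
  have hc : Continuous fun j : ℝ × ℝ => 2 * |√(j.1 ^ 2 + j.2 ^ 2) *
      Real.log √(j.1 ^ 2 + j.2 ^ 2)| :=
    ((Real.continuous_mul_log.comp (show Continuous fun j : ℝ × ℝ => √(j.1 ^ 2 + j.2 ^ 2) by
      fun_prop)).abs).const_mul 2
  have h0 := hc.tendsto 0
  norm_num at h0
  refine squeeze_zero_norm (fun j => ?_) h0
  have hρ : 0 ≤ j.1 ^ 2 + j.2 ^ 2 := by positivity
  rw [norm_mul, Real.log_sqrt hρ, Real.norm_eq_abs, Real.norm_eq_abs, abs_div,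
    abs_of_nonneg (Real.sqrt_nonneg _), abs_two]
  have h1 : |φ j| ≤ √(j.1 ^ 2 + j.2 ^ 2) := Real.abs_le_sqrt (hφ j)
  nlinarith [abs_nonneg (Real.log (j.1 ^ 2 + j.2 ^ 2))]

/-- At the origin the formula persists because `sqNormDeriv 0 = 0`, whatever the value of `Real.log
0`, and because the function is `o(|j|)`. -/
theorem hasFDerivAt_sqNorm_mul_log (j : ℝ × ℝ) :
    HasFDerivAt (fun j : ℝ × ℝ => (j.1 ^ 2 + j.2 ^ 2) * Real.log (j.1 ^ 2 + j.2 ^ 2))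
      ((Real.log (j.1 ^ 2 + j.2 ^ 2) + 1) • sqNormDeriv j) j := by
  by_cases h0 : j = 0
  · have h1 := tendsto_mul_log_sqNorm (φ := Prod.fst) fun j => by nlinarith [sq_nonneg j.2]
    have h2 := tendsto_mul_log_sqNorm (φ := Prod.snd) fun j => by nlinarith [sq_nonneg j.1]
    have e1 := isBigO_fst_norm.mul_isLittleO ((isLittleO_one_iff ℝ).2 h1)
    have e2 := isBigO_snd_norm.mul_isLittleO ((isLittleO_one_iff ℝ).2 h2)
    rw [h0]
    refine HasFDerivAt.of_isLittleO ?_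
    refine (e1.add e2).norm_right.congr (fun j => ?_) (fun j => ?_) |>.of_norm_right
    · simp [sqNormDeriv]
      ring
    · simp
  · have hρ : j.1 ^ 2 + j.2 ^ 2 ≠ 0 := fun hh => h0 (Prod.ext (by
      simp only [Prod.fst_zero]; nlinarith [sq_nonneg j.1, sq_nonneg j.2]) (by
      simp only [Prod.snd_zero]; nlinarith [sq_nonneg j.1, sq_nonneg j.2]))
    have h1 := hasFDerivAt_sqNorm j
    refine (h1.mul (h1.log hρ)).congr_fderiv ?_
    rw [smul_smul, mul_inv_cancel₀ hρ, ← add_smul, add_comm]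

/-- The gradient is built from `j log |j|²`, which extends continuously by zero. This term alone
limits the regularity obtained for the vanishing-twist curve. -/
theorem contDiff_sqNorm_mul_log :
    ContDiffAt ℝ 1 (fun j : ℝ × ℝ => (j.1 ^ 2 + j.2 ^ 2) * Real.log (j.1 ^ 2 + j.2 ^ 2)) 0 := by
  refine contDiffAt_one_iff.2 ⟨_, Set.univ, univ_mem, ?_, fun j _ => hasFDerivAt_sqNorm_mul_log j⟩
  rw [continuousOn_univ]
  have hc : ∀ φ : ℝ × ℝ → ℝ, Continuous φ → (∀ j, φ j ^ 2 ≤ j.1 ^ 2 + j.2 ^ 2) →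
      Continuous fun j : ℝ × ℝ => φ j * Real.log (j.1 ^ 2 + j.2 ^ 2) := by
    intro φ hφ hb
    rw [continuous_iff_continuousAt]
    intro j
    by_cases h0 : j = 0
    · rw [h0]
      have := tendsto_mul_log_sqNorm hb
      rw [ContinuousAt]
      simpa using this
    · have hρ : j.1 ^ 2 + j.2 ^ 2 ≠ 0 := fun hh => h0 (Prod.ext (by
        simp only [Prod.fst_zero]; nlinarith [sq_nonneg j.1, sq_nonneg j.2]) (by
        simp only [Prod.snd_zero]; nlinarith [sq_nonneg j.1, sq_nonneg j.2]))
      exact hφ.continuousAt.mul (ContinuousAt.log (by fun_prop) hρ)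
  have h1 := hc Prod.fst continuous_fst fun j => by nlinarith [sq_nonneg j.2]
  have h2 := hc Prod.snd continuous_snd fun j => by nlinarith [sq_nonneg j.1]
  have e : (fun j : ℝ × ℝ => (Real.log (j.1 ^ 2 + j.2 ^ 2) + 1) • sqNormDeriv j) = fun j =>
      (2 * (j.1 * Real.log (j.1 ^ 2 + j.2 ^ 2)) + 2 * j.1) • ContinuousLinearMap.fst ℝ ℝ ℝ +
      (2 * (j.2 * Real.log (j.1 ^ 2 + j.2 ^ 2)) + 2 * j.2) • ContinuousLinearMap.snd ℝ ℝ ℝ := by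
    funext j
    ext <;> simp [sqNormDeriv] <;> ring
  rw [e]
  fun_prop

/-! ### The curve of vanishing twist -/

namespace IsNormalHamiltonian

variable {Hbar : ℝ × ℝ → ℝ}

/-- Multiplication by `|j|²` removes the poles; the result is an analytic function plus `|j|² log
|j|²` times an analytic one. -/
theorem eventually_twistTilde (h : IsNormalHamiltonian Hbar) {U : ℝ × ℝ → ℝ}
    (hU : IsRegularPart U) :
    twistTilde Hbar =ᶠ[𝓝 0] fun j => (j.1 * (slope Hbar j ^ 2 - 1) - 2 * j.2 * slope Hbar j +
      (j.1 ^ 2 + j.2 ^ 2) * (coeffOne U Hbar j + Real.log 16 * coeffTwo Hbar j)) -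
      (j.1 ^ 2 + j.2 ^ 2) * Real.log (j.1 ^ 2 + j.2 ^ 2) * (coeffTwo Hbar j / 2) := by
  filter_upwards [h.eventually_twistNF hU] with j h1
  by_cases h0 : j = 0
  · simp [h0, twistTilde]
  have hρ : 0 < j.1 ^ 2 + j.2 ^ 2 := by
    rcases not_and_or.1 (fun hh => h0 (Prod.ext_iff.2 hh)) with hc | hc
    · have : j.1 ≠ 0 := hc
      positivity
    · have : j.2 ≠ 0 := hc
      positivity
  rw [twistTilde, h1 h0, Real.log_div (by norm_num) (Real.sqrt_pos.2 hρ).ne', Real.log_sqrt hρ.le]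
  field_simp
  ring

theorem contDiffAt_twistTilde (h : IsNormalHamiltonian Hbar) :
    ContDiffAt ℝ 1 (twistTilde Hbar) 0 := by
  obtain ⟨U, hU⟩ := exists_isRegularPart
  have h1 := h.analyticAt_slope
  have h2 := h.analyticAt_coeffOne hU
  have h3 := h.analyticAt_coeffTwo
  have h4 : AnalyticAt ℝ (fun j => j.1 * (slope Hbar j ^ 2 - 1) - 2 * j.2 * slope Hbar j +
      (j.1 ^ 2 + j.2 ^ 2) * (coeffOne U Hbar j + Real.log 16 * coeffTwo Hbar j)) 0 := by fun_prop
  have h5 : AnalyticAt ℝ (fun j => coeffTwo Hbar j / 2) 0 := by fun_prop (disch := norm_num)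
  exact (h4.contDiffAt.sub (contDiff_sqNorm_mul_log.mul h5.contDiffAt)).congr_of_eventuallyEq
    (h.eventually_twistTilde hU)

theorem hasFDerivAt_twistTilde (h : IsNormalHamiltonian Hbar) :
    HasFDerivAt (twistTilde Hbar) (-ContinuousLinearMap.fst ℝ ℝ ℝ) 0 := by
  obtain ⟨U, hU⟩ := exists_isRegularPart
  have h1 := h.analyticAt_slope.differentiableAt.hasFDerivAt
  have hs0 : slope Hbar 0 = 0 := by rw [slope, h.pd2_zero, zero_div]
  have h2 := (h.analyticAt_coeffOne hU).differentiableAt.hasFDerivAt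
  have h3 := h.analyticAt_coeffTwo.differentiableAt.hasFDerivAt
  have hf : HasFDerivAt (fun j : ℝ × ℝ => j.1) (ContinuousLinearMap.fst ℝ ℝ ℝ) 0 := hasFDerivAt_fst
  have hg : HasFDerivAt (fun j : ℝ × ℝ => j.2) (ContinuousLinearMap.snd ℝ ℝ ℝ) 0 := hasFDerivAt_snd
  have key := (((hf.mul ((h1.pow 2).sub_const 1)).sub ((hg.const_mul 2).mul h1)).add
    ((hasFDerivAt_sqNorm 0).mul (h2.add (h3.const_mul (Real.log 16))))).sub
    ((hasFDerivAt_sqNorm_mul_log 0).mul (h3.mul_const (1 / 2)))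
  refine (key.congr_of_eventuallyEq ?_).congr_fderiv ?_
  · filter_upwards [h.eventually_twistTilde hU] with j hj
    rw [hj]
    simp only [Pi.sub_apply, Pi.add_apply, Pi.mul_apply]
    ring
  · ext <;> simp [hs0, sqNormDeriv]

theorem twistTilde_zero : twistTilde Hbar 0 = 0 := by simp [twistTilde]

/-- The curve of vanishing twist in the coordinates of the normal form. -/
theorem exists_curve (h : IsNormalHamiltonian Hbar) :
    ∃ g : ℝ → ℝ, ContDiffAt ℝ 1 g 0 ∧ g 0 = 0 ∧ deriv g 0 = 0 ∧
      ∀ᶠ j in 𝓝 (0 : ℝ × ℝ), j ≠ 0 → (twistNF Hbar j = 0 ↔ j.1 = g j.2) := by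
  have hT := h.hasFDerivAt_twistTilde
  obtain ⟨G, hG, hl, hr⟩ := h.contDiffAt_twistTilde.exists_solve_fst one_ne_zero
    (by rw [hT.fderiv]; simp)
  rw [twistTilde_zero, Prod.snd_zero, Prod.mk_zero_zero] at hG hr
  have hin : ContDiffAt ℝ 1 (fun s : ℝ => ((0 : ℝ), s)) 0 := by fun_prop
  have hg : ContDiffAt ℝ 1 (fun s : ℝ => G (0, s)) 0 := by
    refine ContDiffAt.comp (g := G) (f := fun s : ℝ => ((0 : ℝ), s)) 0 ?_ hin
    rwa [Prod.mk_zero_zero]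
  have hG0 : G (0, 0) = 0 := by
    have := hl.self_of_nhds
    rwa [twistTilde_zero, Prod.snd_zero] at this
  have hin0 : Tendsto (fun s : ℝ => ((0 : ℝ), s)) (𝓝 0) (𝓝 0) := by
    have := hin.continuousAt.tendsto
    rwa [Prod.mk_zero_zero] at this
  have hev : ∀ᶠ s in 𝓝 (0 : ℝ), twistTilde Hbar (G (0, s), s) = 0 := hin0.eventually hr
  have hd : HasDerivAt (fun s => G (0, s)) (deriv (fun s => G (0, s)) 0) 0 :=
    (hg.differentiableAt one_ne_zero).hasDerivAt
  refine ⟨fun s => G (0, s), hg, hG0, ?_, ?_⟩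
  -- Differentiating `twistTilde (g s, s) = 0` at `s = 0`, where the gradient is `(-1, 0)`, gives
  -- `g' = 0`.
  · have hT' : HasFDerivAt (twistTilde Hbar) (-ContinuousLinearMap.fst ℝ ℝ ℝ) (G (0, 0), 0) := by
      rwa [hG0, Prod.mk_zero_zero]
    have h1 := hT'.comp_hasDerivAt (0 : ℝ) (f := fun s => (G (0, s), s))
      (hd.prodMk (hasDerivAt_id (0 : ℝ)))
    have h2 := h1.unique ((hasDerivAt_const (0 : ℝ) (0 : ℝ)).congr_of_eventuallyEq hev)
    simpa using h2
  · filter_upwards [hl, continuousAt_snd.tendsto.eventually hev] with j h1 h2 h0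
    have hρ : j.1 ^ 2 + j.2 ^ 2 ≠ 0 := fun hh => h0 (Prod.ext (by
        simp only [Prod.fst_zero]; nlinarith [sq_nonneg j.1, sq_nonneg j.2]) (by
        simp only [Prod.snd_zero]; nlinarith [sq_nonneg j.1, sq_nonneg j.2]))
    have hiff : twistNF Hbar j = 0 ↔ twistTilde Hbar j = 0 := by
      simp [twistTilde, hρ, Real.pi_ne_zero]
    rw [hiff]
    constructor
    · intro hh
      rw [hh] at h1
      exact h1.symm
    · intro hh
      rw [← hh] at h2
      exact h2

/-- The curve of vanishing twist in the plane of the values. -/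
theorem exists_value_curve (h : IsNormalHamiltonian Hbar) :
    ∃ c : ℝ → ℝ, ContDiffAt ℝ 1 c 0 ∧ c 0 = 0 ∧ deriv c 0 = 0 ∧
      ∀ᶠ p in 𝓝 (0 : ℝ × ℝ), p ≠ 0 → (twist p.1 p.2 = 0 ↔ p.1 = c p.2) := by
  obtain ⟨g, hg, hg0, hg1, hiff⟩ := h.exists_curve
  have hin : ContDiffAt ℝ 1 (fun s : ℝ => (g s, s)) 0 := hg.prodMk contDiffAt_id
  have hin0 : Tendsto (fun s : ℝ => (g s, s)) (𝓝 0) (𝓝 0) := by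
    have := hin.continuousAt.tendsto
    rwa [hg0, Prod.mk_zero_zero] at this
  have hH : ContDiffAt ℝ 1 Hbar (g 0, 0) := by
    rw [hg0, Prod.mk_zero_zero]
    exact h.analyticAt.contDiffAt
  have hJ : Tendsto (fun p : ℝ × ℝ => (vAction p, p.2)) (𝓝 0) (𝓝 0) := by
    have := (analyticAt_vAction.continuousAt.prodMk continuousAt_snd).tendsto
    rwa [show vAction 0 = 0 from vanishingAction_zero, Prod.snd_zero, Prod.mk_zero_zero] at this
  refine ⟨fun s => Hbar (g s, s), ContDiffAt.comp (g := Hbar) (f := fun s : ℝ => (g s, s)) 0 hH hin, ?_, ?_, ?_⟩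
  · simp only [hg0, Prod.mk_zero_zero, h.zero]
  -- The derivative of `H̄ (g s, s)` at `0` is `∂H̄/∂j₂`, since `g' = 0`, and this vanishes at the
  -- origin.
  · have hd := (hg.differentiableAt one_ne_zero).hasDerivAt
    rw [hg1] at hd
    have h1 := (hH.differentiableAt one_ne_zero).hasFDerivAt.comp_hasDerivAt (0 : ℝ)
      (f := fun s => (g s, s)) (hd.prodMk (hasDerivAt_id (0 : ℝ)))
    have h2 := h1.deriv
    rw [hg0, Prod.mk_zero_zero] at h2
    exact h2.trans h.pd2_zero
  · filter_upwards [hJ.eventually hiff, h.left, hJ.eventually h.left,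
      continuousAt_snd.tendsto.eventually (hin0.eventually h.right)] with p h1 h2 h3 h4 h0
    have h5 : ((vAction p, p.2) : ℝ × ℝ) ≠ 0 := fun hh => h0 (by
      have e1 : vanishingAction p.1 p.2 = 0 := (Prod.ext_iff.1 hh).1
      have e2 : p.2 = 0 := (Prod.ext_iff.1 hh).2
      rw [e1, e2, Prod.mk_zero_zero, h.zero] at h2
      exact Prod.ext h2.symm e2)
    have h6 := h1 h5
    have h7 : Hbar (vAction p, p.2) = p.1 := h2
    rw [twistNF, h7] at h6
    rw [h6]
    constructor
    · intro hh
      rw [← hh, h7]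
    · intro hh
      rw [← hh] at h4
      exact h4

end IsNormalHamiltonian

end ChampagneBottle

/-! ### Complexification of real-analytic functions -/

/-- The complexification of a power series in finitely many variables. -/
noncomputable def FormalMultilinearSeries.complexify {ι : Type*} [Fintype ι] [DecidableEq ι]
    (p : FormalMultilinearSeries ℝ (ι → ℝ) ℝ) : FormalMultilinearSeries ℂ (ι → ℂ) ℂ := fun n =>
  ∑ i : Fin n → ι, ((p n fun k => Pi.single (i k) 1 : ℝ) : ℂ) •
    (ContinuousMultilinearMap.mkPiAlgebra ℂ (Fin n) ℂ).compContinuousLinearMap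
      fun k => ContinuousLinearMap.proj (i k)

theorem FormalMultilinearSeries.complexify_apply {ι : Type*} [Fintype ι] [DecidableEq ι]
    (p : FormalMultilinearSeries ℝ (ι → ℝ) ℝ) (n : ℕ) (x : ι → ℝ) :
    p.complexify n (fun _ => fun i => (x i : ℂ)) = ((p n fun _ => x : ℝ) : ℂ) := by
  have hx : x = ∑ i, x i • (Pi.single i (1 : ℝ) : ι → ℝ) := by
    rw [← pi_eq_sum_univ' x]
  have h1 : (p n fun _ => x) = ∑ i : Fin n → ι, (∏ k, x (i k)) *
      p n fun k => Pi.single (i k) 1 := by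
    conv_lhs => rw [hx]
    have := (p n).toMultilinearMap.map_sum (fun (_ : Fin n) i => x i • (Pi.single i (1 : ℝ) : ι → ℝ))
    refine this.trans (Finset.sum_congr rfl fun i _ => ?_)
    exact (p n).toMultilinearMap.map_smul_univ (fun k => x (i k)) fun k => Pi.single (i k) 1
  rw [h1]
  simp only [complexify, _root_.sum_apply, _root_.smul_apply,
    ContinuousMultilinearMap.compContinuousLinearMap_apply,
    ContinuousMultilinearMap.mkPiAlgebra_apply, ContinuousLinearMap.proj_apply, smul_eq_mul]
  push_cast
  exact Finset.sum_congr rfl fun i _ => mul_comm _ _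

/-- Expanding in basis vectors costs a factor `(card ι) ^ n`: the radius may shrink by a constant
factor but stays positive. -/
theorem FormalMultilinearSeries.complexify_norm_le {ι : Type*} [Fintype ι] [DecidableEq ι]
    (p : FormalMultilinearSeries ℝ (ι → ℝ) ℝ) (n : ℕ) :
    ‖p.complexify n‖ ≤ (Fintype.card ι : ℝ) ^ n * ‖p n‖ := by
  refine (norm_sum_le _ _).trans ((Finset.sum_le_card_nsmul _ _ ‖p n‖ fun i _ => ?_).trans
    (le_of_eq ?_))
  · rw [norm_smul, Complex.norm_real]
    have h1 : ‖p n fun k => Pi.single (i k) (1 : ℝ)‖ ≤ ‖p n‖ := by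
      refine ((p n).le_opNorm _).trans (mul_le_of_le_one_right (norm_nonneg _) ?_)
      refine Finset.prod_le_one (fun k _ => norm_nonneg _) fun k _ => ?_
      rw [Pi.norm_single, norm_one]
    have h2 : ‖(ContinuousMultilinearMap.mkPiAlgebra ℂ (Fin n) ℂ).compContinuousLinearMap
        fun k => ContinuousLinearMap.proj (R := ℂ) (φ := fun _ : ι => ℂ) (i k)‖ ≤ 1 := by
      refine ContinuousMultilinearMap.opNorm_le_bound zero_le_one fun m => ?_
      rw [one_mul, ContinuousMultilinearMap.compContinuousLinearMap_apply,
        ContinuousMultilinearMap.mkPiAlgebra_apply, norm_prod]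
      exact Finset.prod_le_prod (fun k _ => norm_nonneg _) fun k _ => norm_le_pi_norm (m k) (i k)
    calc _ ≤ ‖p n‖ * 1 := mul_le_mul h1 h2 (norm_nonneg _) (norm_nonneg _)
      _ = ‖p n‖ := mul_one _
  · simp

/-- A real-analytic function of finitely many variables extends to the complex domain. -/
theorem AnalyticAt.exists_complexification {ι : Type*} [Fintype ι] {f : (ι → ℝ) → ℝ}
    (hf : AnalyticAt ℝ f 0) :
    ∃ F : (ι → ℂ) → ℂ, AnalyticAt ℂ F 0 ∧ ∀ᶠ x in 𝓝 (0 : ι → ℝ), F (fun i => (x i : ℂ)) = f x := by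
  classical
  obtain ⟨p, r, hp⟩ := hf
  have hrad : 0 < p.complexify.radius := by
    obtain ⟨s, hs0, hs⟩ := ENNReal.lt_iff_exists_nnreal_btwn.1 hp.r_pos
    have hs0 : 0 < s := by exact_mod_cast hs0
    obtain ⟨C, hC, hb⟩ := p.norm_mul_pow_le_of_lt_radius (hs.trans_le hp.r_le)
    have hle : ((s / (Fintype.card ι + 1) : NNReal) : ENNReal) ≤ p.complexify.radius := by
      refine p.complexify.le_radius_of_bound C fun n => ?_
      refine le_trans ?_ (hb n)
      have hc : (0 : ℝ) < (Fintype.card ι : ℝ) + 1 := by positivity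
      push_cast
      rw [div_pow, mul_div_assoc', div_le_iff₀ (pow_pos hc n)]
      calc _ ≤ (Fintype.card ι : ℝ) ^ n * ‖p n‖ * (s : ℝ) ^ n := by
            gcongr
            exact p.complexify_norm_le n
        _ ≤ ((Fintype.card ι : ℝ) + 1) ^ n * ‖p n‖ * (s : ℝ) ^ n := by
            gcongr
            linarith
        _ = _ := by ring
    refine lt_of_lt_of_le ?_ hle
    exact_mod_cast div_pos hs0 (by positivity)
  have hF := p.complexify.hasFPowerSeriesOnBall hrad
  refine ⟨p.complexify.sum, hF.analyticAt, ?_⟩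
  have hcont : Continuous fun (x : ι → ℝ) (i : ι) => (x i : ℂ) := by fun_prop
  have ht : Tendsto (fun (x : ι → ℝ) (i : ι) => (x i : ℂ)) (𝓝 0) (𝓝 0) := by
    have := hcont.tendsto 0
    simpa [Pi.zero_def] using this
  filter_upwards [ht.eventually (Metric.eball_mem_nhds 0 hrad),
    Metric.eball_mem_nhds 0 hp.r_pos] with x h1 h2
  have e1 := hF.hasSum h1
  have e2 := hp.hasSum h2
  rw [zero_add] at e1 e2
  have e3 := e2.mapL Complex.ofRealCLM
  refine e1.unique ?_
  refine e3.congr_fun ?_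
  intro n
  exact p.complexify_apply n x

/-- Complex linearity reduces the claim to the basis vectors, along which both functions may be
compared on the real line. -/
theorem fderiv_complexification {ι : Type*} [Fintype ι] [DecidableEq ι] {f : (ι → ℝ) → ℝ}
    {F : (ι → ℂ) → ℂ} (hF : DifferentiableAt ℂ F 0) (hf : DifferentiableAt ℝ f 0)
    (h : ∀ᶠ x in 𝓝 (0 : ι → ℝ), F (fun i => (x i : ℂ)) = f x) (z : ι → ℂ) :
    fderiv ℂ F 0 z = ∑ i, z i * (fderiv ℝ f 0 (Pi.single i 1) : ℝ) := by
  have key : ∀ i, fderiv ℂ F 0 (Pi.single i 1) = (fderiv ℝ f 0 (Pi.single i 1) : ℝ) := by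
    intro i
    have h1 : HasDerivAt (fun t : ℝ => t • (Pi.single i 1 : ι → ℝ)) (Pi.single i 1) 0 := by
      simpa using (hasDerivAt_id (0 : ℝ)).smul_const (Pi.single i 1 : ι → ℝ)
    have h2 : HasDerivAt (fun t : ℝ => ((t : ℂ)) • (Pi.single i 1 : ι → ℂ)) (Pi.single i 1) 0 := by
      simpa using (Complex.ofRealCLM.hasDerivAt (x := (0 : ℝ))).smul_const (Pi.single i 1 : ι → ℂ)
    have e1 := (show HasFDerivAt f (fderiv ℝ f 0) ((0 : ℝ) • (Pi.single i 1 : ι → ℝ)) by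
      rw [zero_smul]; exact hf.hasFDerivAt).comp_hasDerivAt (0 : ℝ) h1
    have e2 := (show HasFDerivAt F ((fderiv ℂ F 0).restrictScalars ℝ)
      (((0 : ℝ) : ℂ) • (Pi.single i 1 : ι → ℂ)) by
        rw [Complex.ofReal_zero, zero_smul]
        exact hF.hasFDerivAt.restrictScalars ℝ).comp_hasDerivAt (0 : ℝ) h2
    have ht : Tendsto (fun t : ℝ => t • (Pi.single i 1 : ι → ℝ)) (𝓝 0) (𝓝 0) := by
      have := h1.continuousAt.tendsto
      rwa [zero_smul] at this
    refine e2.unique (e1.ofReal_comp.congr_of_eventuallyEq ?_)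
    filter_upwards [ht.eventually h] with t ht
    simp only [Function.comp_def]
    rw [← ht]
    congr 1
    funext k
    by_cases hk : k = i
    · subst hk; simp
    · simp [hk]
  conv_lhs => rw [pi_eq_sum_univ' z, map_sum]
  refine Finset.sum_congr rfl fun i _ => ?_
  rw [map_smul, key, smul_eq_mul]

/-! ### Symplectic maps and the Liouville form -/

namespace ChampagneBottle

/-- The difference of the Liouville form pulled back by `T` and the Liouville form. -/
noncomputable def liouvilleDefect (T : Phase → Phase) (m : Phase) : Phase →L[ℝ] ℝ :=
  ∑ i, ((T m).2 i • ((ContinuousLinearMap.proj i : (Fin 2 → ℝ) →L[ℝ] ℝ) ∘L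
    ContinuousLinearMap.fst ℝ (Fin 2 → ℝ) (Fin 2 → ℝ) ∘L fderiv ℝ T m) -
    m.2 i • ((ContinuousLinearMap.proj i : (Fin 2 → ℝ) →L[ℝ] ℝ) ∘L
      ContinuousLinearMap.fst ℝ (Fin 2 → ℝ) (Fin 2 → ℝ)))

theorem liouvilleDefect_apply (T : Phase → Phase) (m v : Phase) :
    liouvilleDefect T m v =
      ∑ i, ((T m).2 i * (fderiv ℝ T m v).1 i - m.2 i * v.1 i) := by
  simp [liouvilleDefect]

theorem analyticAt_liouvilleDefect {T : Phase → Phase} {m : Phase} (hT : AnalyticAt ℝ T m) :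
    AnalyticAt ℝ (liouvilleDefect T) m := by
  have h1 : AnalyticAt ℝ (fderiv ℝ T) m := hT.fderiv
  have h2 : ∀ i, AnalyticAt ℝ (fun m => (T m).2 i) m := fun i =>
    ((ContinuousLinearMap.proj i : (Fin 2 → ℝ) →L[ℝ] ℝ) ∘L
      ContinuousLinearMap.snd ℝ (Fin 2 → ℝ) (Fin 2 → ℝ)).analyticAt _ |>.comp hT
  have h3 : ∀ i, AnalyticAt ℝ (fun m : Phase => m.2 i) m := fun i =>
    ((ContinuousLinearMap.proj i : (Fin 2 → ℝ) →L[ℝ] ℝ) ∘L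
      ContinuousLinearMap.snd ℝ (Fin 2 → ℝ) (Fin 2 → ℝ)).analyticAt _
  have h4 : ∀ i, AnalyticAt ℝ (fun m : Phase => (ContinuousLinearMap.proj i :
      (Fin 2 → ℝ) →L[ℝ] ℝ) ∘L ContinuousLinearMap.fst ℝ (Fin 2 → ℝ) (Fin 2 → ℝ) ∘L
      fderiv ℝ T m) m := fun i =>
    ((ContinuousLinearMap.compL ℝ Phase Phase ℝ ((ContinuousLinearMap.proj i :
      (Fin 2 → ℝ) →L[ℝ] ℝ) ∘L ContinuousLinearMap.fst ℝ (Fin 2 → ℝ) (Fin 2 → ℝ))).analyticAt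
        _).comp h1
  exact Finset.analyticAt_fun_sum _ fun i _ => ((h2 i).smul (h4 i)).sub ((h3 i).smul analyticAt_const)

/-- Symplecticity says that the defect is a closed form: the terms with second derivatives of `T`
are symmetric, and the rest is the difference of the two symplectic forms. -/
theorem fderiv_liouvilleDefect_symm {T : Phase → Phase} {m : Phase} (hT : AnalyticAt ℝ T m)
    (hs : ∀ u v : Phase, sympl (fderiv ℝ T m u) (fderiv ℝ T m v) = sympl u v) (u v : Phase) :
    fderiv ℝ (liouvilleDefect T) m u v = fderiv ℝ (liouvilleDefect T) m v u := by
  have hsymm : ∀ u v : Phase, fderiv ℝ (fderiv ℝ T) m u v = fderiv ℝ (fderiv ℝ T) m v u :=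
    fun u v => (hT.contDiffAt (n := ω)).isSymmSndFDerivAt_of_omega u v
  have hD : HasFDerivAt (fderiv ℝ T) (fderiv ℝ (fderiv ℝ T) m) m :=
    hT.fderiv.differentiableAt.hasFDerivAt
  have hT1 := hT.differentiableAt.hasFDerivAt
  have key : ∀ u v : Phase, fderiv ℝ (liouvilleDefect T) m u v =
      ∑ i, ((fderiv ℝ T m u).2 i * (fderiv ℝ T m v).1 i +
        (T m).2 i * (fderiv ℝ (fderiv ℝ T) m u v).1 i - u.2 i * v.1 i) := by
    intro u v
    have h1 := (analyticAt_liouvilleDefect hT).differentiableAt.hasFDerivAt.clm_apply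
      (hasFDerivAt_const v m)
    have h2 : ∀ i, HasFDerivAt (fun m => (T m).2 i) ((ContinuousLinearMap.proj i :
        (Fin 2 → ℝ) →L[ℝ] ℝ) ∘L ContinuousLinearMap.snd ℝ (Fin 2 → ℝ) (Fin 2 → ℝ) ∘L
        fderiv ℝ T m) m := fun i =>
      ((ContinuousLinearMap.proj i : (Fin 2 → ℝ) →L[ℝ] ℝ) ∘L
        ContinuousLinearMap.snd ℝ (Fin 2 → ℝ) (Fin 2 → ℝ)).hasFDerivAt.comp m hT1
    have h3 : ∀ i, HasFDerivAt (fun m : Phase => m.2 i) ((ContinuousLinearMap.proj i :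
        (Fin 2 → ℝ) →L[ℝ] ℝ) ∘L ContinuousLinearMap.snd ℝ (Fin 2 → ℝ) (Fin 2 → ℝ)) m := fun i =>
      ((ContinuousLinearMap.proj i : (Fin 2 → ℝ) →L[ℝ] ℝ) ∘L
        ContinuousLinearMap.snd ℝ (Fin 2 → ℝ) (Fin 2 → ℝ)).hasFDerivAt
    have h4 : ∀ i, HasFDerivAt (fun m : Phase => (fderiv ℝ T m v).1 i) _ m := fun i =>
      ((ContinuousLinearMap.proj i : (Fin 2 → ℝ) →L[ℝ] ℝ) ∘L
        ContinuousLinearMap.fst ℝ (Fin 2 → ℝ) (Fin 2 → ℝ)).hasFDerivAt.comp m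
          (hD.clm_apply (hasFDerivAt_const v m))
    have h5 := HasFDerivAt.fun_sum (u := Finset.univ)
      fun (i : Fin 2) _ => ((h2 i).mul (h4 i)).sub ((h3 i).mul_const (v.1 i))
    have h6 : (fun m => liouvilleDefect T m v) = fun m =>
        ∑ i, ((T m).2 i * (fderiv ℝ T m v).1 i - m.2 i * v.1 i) :=
      funext fun m => liouvilleDefect_apply T m v
    have h7 := DFunLike.congr_fun ((h6 ▸ h1).unique h5) u
    simp at h7
    rw [h7]
    simp
    ring
  have := hs u v
  rw [key, key, hsymm u v]
  simp only [sympl, Fin.sum_univ_two] at this ⊢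
  linarith

/-- A symplectic map changes the Liouville form by an exact form. -/
theorem exists_primitive_liouvilleDefect {T : Phase → Phase} (hT : AnalyticAt ℝ T 0)
    (hs : ∀ᶠ m in 𝓝 (0 : Phase), ∀ u v : Phase,
      sympl (fderiv ℝ T m u) (fderiv ℝ T m v) = sympl u v) :
    ∃ S : Phase → ℝ, AnalyticAt ℝ S 0 ∧
      ∀ᶠ m in 𝓝 (0 : Phase), HasFDerivAt S (liouvilleDefect T m) m := by
  obtain ⟨r, hr, hball⟩ := Metric.eventually_nhds_iff_ball.1 (hT.eventually_analyticAt.and hs)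
  have hη : ∀ m ∈ Metric.ball (0 : Phase) r, AnalyticAt ℝ (liouvilleDefect T) m := fun m hm =>
    analyticAt_liouvilleDefect (hball m hm).1
  obtain ⟨S, hS⟩ := (convex_ball (0 : Phase) r).exists_forall_hasFDerivAt_of_fderiv_symmetric
    Metric.isOpen_ball (fun m hm => (hη m hm).differentiableAt.differentiableWithinAt)
    fun m hm u v => fderiv_liouvilleDefect_symm (hball m hm).1 (hball m hm).2 u v
  refine ⟨S, ?_, eventually_of_mem (Metric.ball_mem_nhds 0 hr) hS⟩
  -- The Poincaré lemma yields some primitive; the radial integral formula shows that it is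
  -- analytic.
  have ha : AnalyticAt ℝ (fun m : Phase => ∫ t in (0 : ℝ)..1, liouvilleDefect T (t • m) m) 0 := by
    refine AnalyticAt.intervalIntegral (f := fun q : Phase × ℝ => liouvilleDefect T (q.2 • q.1) q.1)
      fun t _ => ?_
    have h1 : AnalyticAt ℝ (fun q : Phase × ℝ => liouvilleDefect T (q.2 • q.1)) (0, t) := by
      refine AnalyticAt.fun_comp (g := liouvilleDefect T) (f := fun q : Phase × ℝ => q.2 • q.1) ?_
        (by fun_prop)
      rw [smul_zero]
      exact hη 0 (Metric.mem_ball_self hr)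
    have h2 : AnalyticAt ℝ (fun q : Phase × ℝ => q.1) (0, t) := analyticAt_fst
    exact ((h1.contDiffAt (n := ω)).clm_apply h2.contDiffAt).analyticAt
  refine (ha.add (analyticAt_const (v := S 0))).congr ?_
  filter_upwards [Metric.ball_mem_nhds (0 : Phase) hr] with m hm
  have hmem : ∀ t ∈ Set.uIcc (0 : ℝ) 1, t • m ∈ Metric.ball (0 : Phase) r := by
    intro t ht
    rw [Set.uIcc_of_le zero_le_one] at ht
    rw [mem_ball_zero_iff] at hm ⊢
    rw [norm_smul, Real.norm_of_nonneg ht.1]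
    exact (mul_le_of_le_one_left (norm_nonneg _) ht.2).trans_lt hm
  have hd : ∀ t ∈ Set.uIcc (0 : ℝ) 1, HasDerivAt (fun t : ℝ => S (t • m))
      (liouvilleDefect T (t • m) m) t := by
    intro t ht
    have h1 : HasDerivAt (fun t : ℝ => t • m) m t := by
      simpa using (hasDerivAt_id t).smul_const m
    exact (hS _ (hmem t ht)).comp_hasDerivAt t h1
  have hc : ContinuousOn (fun t : ℝ => liouvilleDefect T (t • m) m) (Set.uIcc 0 1) := by
    intro t ht
    refine ContinuousAt.continuousWithinAt ?_
    refine ContinuousAt.clm_apply ?_ continuousAt_const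
    exact ContinuousAt.comp (f := fun t : ℝ => t • m) (hη _ (hmem t ht)).continuousAt (by fun_prop)
  have := intervalIntegral.integral_eq_sub_of_hasDerivAt hd hc.intervalIntegrable
  simp only [Pi.add_apply]
  rw [this, one_smul, zero_smul, sub_add_cancel]

end ChampagneBottle

/-! ### Loops in the complexified fibre -/

namespace ChampagneBottle

open Complex in
/-- A logarithm along a loop near a circle. -/
theorem exists_log_lift {p p' : ℝ → ℂ} {r : ℝ} (hr : 0 < r)
    (hp : ∀ θ, HasDerivAt p (p' θ) θ) (hper : p (2 * Real.pi) = p 0)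
    (hn : ∀ θ : ℝ, ‖p θ - r * exp (θ * I)‖ ≤ r / 5) :
    ∃ s : ℝ → ℂ, (∀ θ, HasDerivAt s (p' θ / p θ) θ) ∧ (∀ θ, exp (s θ) = p θ) ∧
      s (2 * Real.pi) = s 0 + 2 * Real.pi * I := by
  have hr' : (r : ℂ) ≠ 0 := by exact_mod_cast hr.ne'
  -- The loop divided by the circle stays within `1/5` of `1`, where the principal logarithm is
  -- available.
  set A : ℝ → ℂ := fun θ => p θ / (r * exp (θ * I)) with hA
  have hA1 : ∀ θ, ‖A θ - 1‖ ≤ 1 / 5 := by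
    intro θ
    have h1 : A θ - 1 = (p θ - r * exp (θ * I)) / (r * exp (θ * I)) := by
      rw [hA]
      field_simp
    rw [h1, norm_div, norm_mul, norm_exp_ofReal_mul_I, mul_one, norm_real, Real.norm_of_nonneg hr.le,
      div_le_iff₀ hr]
    linarith [hn θ]
  have hslit : ∀ θ, A θ ∈ slitPlane := fun θ => Or.inl (by
    have h1 := (abs_le.1 ((abs_re_le_norm _).trans (hA1 θ))).1
    rw [sub_re, one_re] at h1
    linarith)
  have hA0 : ∀ θ, A θ ≠ 0 := fun θ => slitPlane_ne_zero (hslit θ)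
  have hp0 : ∀ θ, p θ ≠ 0 := fun θ h => hA0 θ (by rw [hA]; simp [h])
  have hE : ∀ θ : ℝ, HasDerivAt (fun θ : ℝ => exp (θ * I)) (exp (θ * I) * I) θ := fun θ =>
    (((hasDerivAt_id (θ : ℂ)).mul_const I).cexp.comp_ofReal).congr_deriv (by simp)
  refine ⟨fun θ => Real.log r + θ * I + log (A θ), fun θ => ?_, fun θ => ?_, ?_⟩
  · have h1 := ((hp θ).div ((hE θ).const_mul (r : ℂ))
      (mul_ne_zero hr' (exp_ne_zero _))).clog_real (hslit θ)
    have h2 : HasDerivAt (fun θ : ℝ => (Real.log r : ℂ) + θ * I) I θ := by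
      have := ((hasDerivAt_id (θ : ℂ)).mul_const I).comp_ofReal.const_add (Real.log r : ℂ)
      simpa using this
    refine (h2.add h1).congr_deriv ?_
    have h3 := exp_ne_zero (θ * I)
    have h4 := hp0 θ
    simp only [Pi.div_apply]
    field_simp
    ring
  · rw [exp_add, exp_add, exp_log (hA0 θ), ← ofReal_exp, Real.exp_log hr, hA]
    field_simp
  · have h1 : A (2 * Real.pi) = A 0 := by
      simp only [hA, hper]
      push_cast
      rw [exp_two_pi_mul_I]
      simp
    simp only [h1]
    push_cast
    ring

theorem re_div_pos_of_near_one {u v : ℂ} (hu : ‖u - 1‖ ≤ 1 / 4) (hv : ‖v - 1‖ ≤ 1 / 4) :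
    0 < (u / v).re := by
  have h1 := abs_le.1 ((Complex.abs_re_le_norm _).trans hu)
  have h2 := abs_le.1 ((Complex.abs_im_le_norm _).trans hu)
  have h3 := abs_le.1 ((Complex.abs_re_le_norm _).trans hv)
  have h4 := abs_le.1 ((Complex.abs_im_le_norm _).trans hv)
  simp only [Complex.sub_re, Complex.sub_im, Complex.one_re, Complex.one_im, sub_zero] at h1 h2 h3 h4
  have hv0 : 0 < Complex.normSq v := by
    rw [Complex.normSq_apply]
    nlinarith
  rw [Complex.div_re, ← add_div]
  refine div_pos ?_ hv0
  nlinarith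

theorem norm_mul_add_mul_sub_one {a b c d : ℂ} (ha : ‖a - 1‖ ≤ 1 / 10) (hb : ‖b‖ ≤ 1 / 10)
    (hc : ‖c - 1‖ ≤ 1 / 10) (hd : ‖d‖ ≤ 1 / 10) : ‖a * c + b * d - 1‖ ≤ 1 / 4 := by
  have e : a * c + b * d - 1 = (a - 1) * (c - 1) + (a - 1) + (c - 1) + b * d := by ring
  rw [e]
  refine (norm_add_le _ _).trans ?_
  have h1 := (norm_add_le ((a - 1) * (c - 1) + (a - 1)) (c - 1))
  have h2 := (norm_add_le ((a - 1) * (c - 1)) (a - 1))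
  rw [norm_mul] at h2 ⊢
  have h3 := mul_le_mul ha hc (norm_nonneg _) (by norm_num)
  have h4 := mul_le_mul hb hd (norm_nonneg _) (by norm_num)
  linarith

open Complex in
/-- The vanishing action is `√2` times the action over any loop in the complexified fibre that is
close to the circle traced by the linear flow. -/
theorem vanishingAction_eq_of_loop {h j J r : ℝ} {x₁ x₂ y₁ y₂ σ x₁' x₂' σ' : ℝ → ℂ} (hr : 0 < r)
    (hr2 : 2 * r ^ 2 ≤ 3 / 5)
    (hrad : ∀ z : ℂ, r ^ 2 / 2 ≤ ‖z‖ → ‖z‖ ≤ 3 / 5 → 0 < (radicand h (√2 * j) z).re)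
    (hx₁ : ∀ θ, HasDerivAt x₁ (x₁' θ) θ) (hx₂ : ∀ θ, HasDerivAt x₂ (x₂' θ) θ)
    (hσ : ∀ θ, HasDerivAt σ (σ' θ) θ) (hx₁' : Continuous x₁') (hx₂' : Continuous x₂')
    (hσ' : Continuous σ')
    (hp₁ : x₁ (2 * Real.pi) = x₁ 0) (hp₂ : x₂ (2 * Real.pi) = x₂ 0)
    (hpσ : σ (2 * Real.pi) = σ 0)
    (henergy : ∀ θ, (y₁ θ ^ 2 + y₂ θ ^ 2) / 2 - (x₁ θ ^ 2 + x₂ θ ^ 2) +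
      (x₁ θ ^ 2 + x₂ θ ^ 2) ^ 2 = h)
    (hmom : ∀ θ, x₁ θ * y₂ θ - x₂ θ * y₁ θ = j)
    (hact : ∀ θ, y₁ θ * x₁' θ + y₂ θ * x₂' θ = J * I + σ' θ)
    (hx₁n : ∀ θ : ℝ, ‖x₁ θ - r * exp (θ * I)‖ ≤ r / 10) (hx₂n : ∀ θ, ‖x₂ θ‖ ≤ r / 10)
    (hy₁n : ∀ θ : ℝ, ‖y₁ θ - √2 * r * exp (θ * I)‖ ≤ √2 * r / 10)
    (hy₂n : ∀ θ, ‖y₂ θ‖ ≤ √2 * r / 10) :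
    vanishingAction h (√2 * j) = √2 * J := by
  have h2 : (0 : ℝ) < √2 := Real.sqrt_pos.2 two_pos
  have h2' : ((√2 : ℝ) : ℂ) ≠ 0 := by exact_mod_cast h2.ne'
  have h2s : ((√2 : ℝ) : ℂ) ^ 2 = 2 := by exact_mod_cast Real.sq_sqrt zero_le_two
  have hr' : (r : ℂ) ≠ 0 := by exact_mod_cast hr.ne'
  have hI2 : ∀ θ, ‖x₂ θ * I‖ ≤ r / 10 := fun θ => by rw [norm_mul, norm_I, mul_one]; exact hx₂n θ
  -- Complex polar coordinates: `x₁ ± i x₂` are the exponentials of `s` and `u`, so `z = exp (s +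
  -- u)` and the angle is `(s - u) / (2i)`.
  obtain ⟨s, hs, hse, hsp⟩ := exists_log_lift (p := fun θ => x₁ θ + x₂ θ * I)
    (p' := fun θ => x₁' θ + x₂' θ * I) hr (fun θ => (hx₁ θ).add ((hx₂ θ).mul_const I))
    (by simp only [hp₁, hp₂]) (fun θ => by
      rw [add_sub_right_comm]
      refine (norm_add_le _ _).trans ?_
      linarith [hx₁n θ, hI2 θ])
  obtain ⟨u, hu, hue, hup⟩ := exists_log_lift (p := fun θ => x₁ θ - x₂ θ * I)
    (p' := fun θ => x₁' θ - x₂' θ * I) hr (fun θ => (hx₁ θ).sub ((hx₂ θ).mul_const I))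
    (by simp only [hp₁, hp₂]) (fun θ => by
      rw [sub_right_comm]
      refine (norm_sub_le _ _).trans ?_
      linarith [hx₁n θ, hI2 θ])
  have hP0 : ∀ θ, x₁ θ + x₂ θ * I ≠ 0 := fun θ => by rw [← hse]; exact exp_ne_zero _
  have hQ0 : ∀ θ, x₁ θ - x₂ θ * I ≠ 0 := fun θ => by rw [← hue]; exact exp_ne_zero _
  have hz : ∀ θ, exp (s θ + u θ) = x₁ θ ^ 2 + x₂ θ ^ 2 := fun θ => by
    rw [exp_add, hse, hue]
    linear_combination -x₂ θ ^ 2 * I_sq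
  have hz0 : ∀ θ, x₁ θ ^ 2 + x₂ θ ^ 2 ≠ 0 := fun θ => by rw [← hz]; exact exp_ne_zero _
  have hE : ∀ θ : ℝ, exp (θ * I) ≠ 0 := fun θ => exp_ne_zero _
  have hEn : ∀ θ : ℝ, ‖exp (θ * I)‖ = 1 := fun θ => norm_exp_ofReal_mul_I θ
  have n1 : ∀ (R : ℝ), 0 < R → ∀ (v : ℂ) (θ : ℝ), ‖v‖ ≤ R / 10 →
      ‖v / (R * exp (θ * I))‖ ≤ 1 / 10 := by
    intro R hR v θ hv
    rw [norm_div, norm_mul, hEn, mul_one, norm_real, Real.norm_of_nonneg hR.le, div_le_iff₀ hR]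
    linarith
  have n2 : ∀ (R : ℝ), 0 < R → ∀ (v : ℂ) (θ : ℝ), ‖v - R * exp (θ * I)‖ ≤ R / 10 →
      ‖v / (R * exp (θ * I)) - 1‖ ≤ 1 / 10 := by
    intro R hR v θ hv
    have hR' : (R : ℂ) ≠ 0 := by exact_mod_cast hR.ne'
    have e : v / (R * exp (θ * I)) - 1 = (v - R * exp (θ * I)) / (R * exp (θ * I)) := by
      field_simp
    rw [e]
    exact n1 R hR _ θ hv
  have h2r : 0 < √2 * r := mul_pos h2 hr
  have hz1 : ∀ θ, ‖x₁ θ / (r * exp (θ * I)) * (x₁ θ / (r * exp (θ * I))) +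
      x₂ θ / (r * exp (θ * I)) * (x₂ θ / (r * exp (θ * I))) - 1‖ ≤ 1 / 4 := fun θ =>
    norm_mul_add_mul_sub_one (n2 r hr _ θ (hx₁n θ)) (n1 r hr _ θ (hx₂n θ))
      (n2 r hr _ θ (hx₁n θ)) (n1 r hr _ θ (hx₂n θ))
  have hw1 : ∀ θ, ‖x₁ θ / (r * exp (θ * I)) * (y₁ θ / (((√2 * r : ℝ) : ℂ) * exp (θ * I))) +
      x₂ θ / (r * exp (θ * I)) * (y₂ θ / (((√2 * r : ℝ) : ℂ) * exp (θ * I))) - 1‖ ≤ 1 / 4 :=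
    fun θ => norm_mul_add_mul_sub_one (n2 r hr _ θ (hx₁n θ)) (n1 r hr _ θ (hx₂n θ))
      (n2 _ h2r _ θ (by push_cast; exact hy₁n θ)) (n1 _ h2r _ θ (hy₂n θ))
  have hzn : ∀ θ, r ^ 2 / 2 < ‖x₁ θ ^ 2 + x₂ θ ^ 2‖ ∧ ‖x₁ θ ^ 2 + x₂ θ ^ 2‖ < 3 / 5 := by
    intro θ
    have e : x₁ θ ^ 2 + x₂ θ ^ 2 = r ^ 2 * exp (θ * I) ^ 2 *
        (x₁ θ / (r * exp (θ * I)) * (x₁ θ / (r * exp (θ * I))) +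
        x₂ θ / (r * exp (θ * I)) * (x₂ θ / (r * exp (θ * I)))) := by
      have := hE θ
      field_simp
    have h3 := hz1 θ
    rw [e, norm_mul, norm_mul, norm_pow, norm_pow, hEn, one_pow, mul_one, norm_real,
      Real.norm_of_nonneg hr.le]
    generalize x₁ θ / (r * exp (θ * I)) * (x₁ θ / (r * exp (θ * I))) +
        x₂ θ / (r * exp (θ * I)) * (x₂ θ / (r * exp (θ * I))) = v at h3
    have h4 := norm_sub_norm_le v 1
    have h5 := norm_sub_norm_le 1 v
    rw [norm_sub_rev 1 v] at h5
    rw [norm_one] at h4 h5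
    have h6 : 0 < r ^ 2 := pow_pos hr 2
    constructor <;> nlinarith
  set f : ℂ → ℂ := fun z => radicand h (√2 * j) z ^ (1 / 2 : ℂ) with hf
  -- From `(x·y)² = |x|² |y|² - (x₁ y₂ - x₂ y₁)²`, energy and momentum give `(x·y)² = 2 z²` times
  -- the radicand. Nearness to the linear orbit fixes the sign of the root.
  have hfz : ∀ θ, f (x₁ θ ^ 2 + x₂ θ ^ 2) =
      (x₁ θ * y₁ θ + x₂ θ * y₂ θ) / (√2 * (x₁ θ ^ 2 + x₂ θ ^ 2)) := by
    intro θ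
    refine cpow_half_eq_of_sq_eq ?_ ?_
    · have h3 := hz0 θ
      have h4 := henergy θ
      have h5 := hmom θ
      rw [radicand, div_pow, mul_pow, h2s]
      push_cast
      rw [mul_pow, h2s]
      rw [← h4, ← h5]
      field_simp
      ring
    · have e : (x₁ θ * y₁ θ + x₂ θ * y₂ θ) / (√2 * (x₁ θ ^ 2 + x₂ θ ^ 2)) =
        (x₁ θ / (r * exp (θ * I)) * (y₁ θ / (((√2 * r : ℝ) : ℂ) * exp (θ * I))) +
          x₂ θ / (r * exp (θ * I)) * (y₂ θ / (((√2 * r : ℝ) : ℂ) * exp (θ * I)))) /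
        (x₁ θ / (r * exp (θ * I)) * (x₁ θ / (r * exp (θ * I))) +
          x₂ θ / (r * exp (θ * I)) * (x₂ θ / (r * exp (θ * I)))) := by
        have h3 := hE θ
        have h4 := hz0 θ
        push_cast
        have e1 : x₁ θ / (r * exp (θ * I)) * (y₁ θ / (√2 * r * exp (θ * I))) +
          x₂ θ / (r * exp (θ * I)) * (y₂ θ / (√2 * r * exp (θ * I))) =
          (x₁ θ * y₁ θ + x₂ θ * y₂ θ) / (√2 * (r * exp (θ * I)) ^ 2) := by
          field_simp
        have e2 : x₁ θ / (r * exp (θ * I)) * (x₁ θ / (r * exp (θ * I))) +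
          x₂ θ / (r * exp (θ * I)) * (x₂ θ / (r * exp (θ * I))) =
          (x₁ θ ^ 2 + x₂ θ ^ 2) / (r * exp (θ * I)) ^ 2 := by
          field_simp
        rw [e1, e2]
        field_simp
      rw [e]
      exact re_div_pos_of_near_one (hw1 θ) (hz1 θ)
  have hdiff : ∀ z : ℂ, r ^ 2 / 2 < ‖z‖ → ‖z‖ < 3 / 5 → DifferentiableAt ℂ f z := by
    intro z h3 h4
    have hz : z ≠ 0 := norm_pos_iff.1 ((by positivity : (0 : ℝ) < r ^ 2 / 2).trans h3)
    have h5 : DifferentiableAt ℂ (radicand h (√2 * j)) z := by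
      unfold radicand
      refine DifferentiableAt.sub (DifferentiableAt.add (by fun_prop) ?_) ?_
      · exact (differentiableAt_const _).div differentiableAt_id hz
      · exact (differentiableAt_const _).div (by fun_prop) (by simp [hz])
    exact h5.cpow_const (Or.inl (hrad z h3.le h4.le))
  have hcx : Continuous x₁ := continuous_iff_continuousAt.2 fun θ => (hx₁ θ).continuousAt
  have hcx2 : Continuous x₂ := continuous_iff_continuousAt.2 fun θ => (hx₂ θ).continuousAt
  have hcs : Continuous fun θ => (x₁' θ + x₂' θ * I) / (x₁ θ + x₂ θ * I) :=
    (by fun_prop : Continuous fun θ => x₁' θ + x₂' θ * I).div (by fun_prop) hP0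
  have hcu : Continuous fun θ => (x₁' θ - x₂' θ * I) / (x₁ θ - x₂ θ * I) :=
    (by fun_prop : Continuous fun θ => x₁' θ - x₂' θ * I).div (by fun_prop) hQ0
  -- Each of `s` and `u` grows by `2πi`, so `z` winds twice around the circle.
  have key := integral_exp_lift_eq_circleIntegral (R := 1 / 2) (by positivity : 0 < r ^ 2 / 2)
    (by nlinarith) (by norm_num) hdiff (s := fun θ => s θ + u θ) (fun θ => (hs θ).add (hu θ))
    (hcs.add hcu) (fun θ => by simp only [hz]; exact hzn θ) 2
    (by simp only [hsp, hup]; push_cast; ring)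
  simp only [hz, hfz] at key
  -- The Liouville form splits into a radial part, which is the integrand of the vanishing action,
  -- and `j` times the differential of the angle.
  have hpt : ∀ θ, (x₁ θ * y₁ θ + x₂ θ * y₂ θ) / (√2 * (x₁ θ ^ 2 + x₂ θ ^ 2)) *
      ((x₁ θ ^ 2 + x₂ θ ^ 2) * ((x₁' θ + x₂' θ * I) / (x₁ θ + x₂ θ * I) +
        (x₁' θ - x₂' θ * I) / (x₁ θ - x₂ θ * I))) =
      √2 * (J * I + σ' θ) - √2 * (j / (2 * I)) * ((x₁' θ + x₂' θ * I) / (x₁ θ + x₂ θ * I) -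
        (x₁' θ - x₂' θ * I) / (x₁ θ - x₂ θ * I)) := by
    intro θ
    rw [← hact, ← hmom θ]
    have h3 := hP0 θ
    have h4 := hQ0 θ
    have h5 := hz0 θ
    have hI := I_ne_zero
    have e : (x₁ θ * y₁ θ + x₂ θ * y₂ θ) / (√2 * (x₁ θ ^ 2 + x₂ θ ^ 2)) *
      ((x₁ θ ^ 2 + x₂ θ ^ 2) * ((x₁' θ + x₂' θ * I) / (x₁ θ + x₂ θ * I) +
        (x₁' θ - x₂' θ * I) / (x₁ θ - x₂ θ * I))) = √2 / 2 * ((x₁ θ * y₁ θ + x₂ θ * y₂ θ) *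
        ((x₁' θ + x₂' θ * I) / (x₁ θ + x₂ θ * I) +
        (x₁' θ - x₂' θ * I) / (x₁ θ - x₂ θ * I))) := by
      rw [div_mul_eq_mul_div, div_eq_iff (mul_ne_zero h2' h5)]
      linear_combination (-(1 / 2) * ((x₁ θ * y₁ θ + x₂ θ * y₂ θ) *
        ((x₁' θ + x₂' θ * I) / (x₁ θ + x₂ θ * I) +
        (x₁' θ - x₂' θ * I) / (x₁ θ - x₂ θ * I))) * (x₁ θ ^ 2 + x₂ θ ^ 2)) * h2s
    rw [e]
    generalize (√2 : ℂ) = w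
    generalize x₁ θ = X1 at *
    generalize x₂ θ = X2 at *
    generalize y₁ θ = Y1 at *
    generalize y₂ θ = Y2 at *
    generalize x₁' θ = D1 at *
    generalize x₂' θ = D2 at *
    field_simp
    ring_nf
    simp only [show I ^ 3 = -I by rw [pow_succ, I_sq]; ring]
    ring
  -- The exact term and the angle return to their values, because `s` and `u` have equal increments;
  -- only `J` survives.
  have hint : ∫ θ in (0 : ℝ)..2 * Real.pi, (√2 * (J * I + σ' θ) - √2 * (j / (2 * I)) *
      ((x₁' θ + x₂' θ * I) / (x₁ θ + x₂ θ * I) - (x₁' θ - x₂' θ * I) / (x₁ θ - x₂ θ * I))) =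
      √2 * (J * I * (2 * Real.pi)) := by
    have hd : ∀ θ ∈ Set.uIcc 0 (2 * Real.pi), HasDerivAt (fun θ : ℝ => √2 * (J * I * θ + σ θ) -
        √2 * (j / (2 * I)) * (s θ - u θ)) (√2 * (J * I + σ' θ) - √2 * (j / (2 * I)) *
      ((x₁' θ + x₂' θ * I) / (x₁ θ + x₂ θ * I) - (x₁' θ - x₂' θ * I) / (x₁ θ - x₂ θ * I))) θ := by
      intro θ _
      have h3 : HasDerivAt (fun θ : ℝ => (J * I * θ : ℂ)) (J * I) θ := by
        simpa using ((hasDerivAt_id (θ : ℂ)).const_mul (J * I : ℂ)).comp_ofReal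
      exact ((h3.add (hσ θ)).const_mul _).sub (((hs θ).sub (hu θ)).const_mul _)
    rw [intervalIntegral.integral_eq_sub_of_hasDerivAt hd
      (Continuous.intervalIntegrable (by fun_prop) _ _), hpσ, hsp, hup]
    push_cast
    ring
  simp only [hpt] at key
  rw [hint] at key
  rw [vanishingAction_eq]
  have hpi : (Real.pi : ℂ) ≠ 0 := by exact_mod_cast Real.pi_ne_zero
  have e : (Real.pi * I : ℂ)⁻¹ * ∮ z in C(0, 1 / 2), radicand h (√2 * j) z ^ (1 / 2 : ℂ) =
      ((√2 * J : ℝ) : ℂ) := by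
    have hI := I_ne_zero
    rw [inv_mul_eq_iff_eq_mul₀ (mul_ne_zero hpi hI)]
    push_cast at key ⊢
    have h3 : (2 : ℂ) ≠ 0 := two_ne_zero
    refine mul_left_cancel₀ h3 (key.symm.trans ?_)
    ring
  rw [e, ofReal_re]

end ChampagneBottle

/-! ### The linear flow and its complexified orbits -/

namespace ChampagneBottle

/-- The scale of the positions in the linear change of coordinates. -/
noncomputable def posScale : ℝ := (2 : ℝ) ^ (-(1 / 4) : ℝ) / √2

theorem posScale_pos : 0 < posScale := by unfold posScale; positivity

theorem momScale_eq : (2 : ℝ) ^ (1 / 4 : ℝ) / √2 = √2 * posScale := by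
  have h : (2 : ℝ) ^ (1 / 4 : ℝ) = √2 * (2 : ℝ) ^ (-(1 / 4) : ℝ) := by
    rw [Real.sqrt_eq_rpow, ← Real.rpow_add two_pos]
    norm_num
  rw [h, posScale, mul_div_assoc]

theorem posScale_sq : √2 * posScale ^ 2 = 1 / 2 := by
  have h : (2 : ℝ) ^ (1 / 4 : ℝ) * (2 : ℝ) ^ (-(1 / 4) : ℝ) = 1 := by
    rw [← Real.rpow_add two_pos]
    norm_num
  have h2 : √2 ^ 2 = 2 := Real.sq_sqrt zero_le_two
  calc √2 * posScale ^ 2 = (√2 * posScale) * posScale := by ring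
    _ = (2 : ℝ) ^ (1 / 4 : ℝ) * (2 : ℝ) ^ (-(1 / 4) : ℝ) / √2 ^ 2 := by
      rw [← momScale_eq, posScale]; ring
    _ = 1 / 2 := by rw [h, h2]

theorem williamson_fst (m : Phase) (i : Fin 2) :
    (williamson m).1 i = posScale * (m.1 i - m.2 i) := by
  simp only [williamson, posScale]
  ring

theorem williamson_snd (m : Phase) (i : Fin 2) :
    (williamson m).2 i = √2 * posScale * (m.1 i + m.2 i) := by
  rw [← momScale_eq]
  simp only [williamson]
  ring

/-- The map `williamson` as a continuous linear map. -/
noncomputable def williamsonL : Phase →L[ℝ] Phase :=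
  (posScale • (ContinuousLinearMap.fst ℝ (Fin 2 → ℝ) (Fin 2 → ℝ) -
    ContinuousLinearMap.snd ℝ (Fin 2 → ℝ) (Fin 2 → ℝ))).prod
  ((√2 * posScale) • (ContinuousLinearMap.fst ℝ (Fin 2 → ℝ) (Fin 2 → ℝ) +
    ContinuousLinearMap.snd ℝ (Fin 2 → ℝ) (Fin 2 → ℝ)))

theorem williamsonL_apply (m : Phase) : williamsonL m = williamson m := by
  refine Prod.ext (funext fun i => ?_) (funext fun i => ?_)
  · rw [williamson_fst]; rfl
  · rw [williamson_snd]; rfl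

theorem sympl_williamson (u v : Phase) : sympl (williamson u) (williamson v) = sympl u v := by
  simp only [sympl, williamson_fst, williamson_snd, Fin.sum_univ_two]
  linear_combination (2 * (u.1 0 * v.2 0 - u.2 0 * v.1 0 + (u.1 1 * v.2 1 - u.2 1 * v.1 1))) *
    posScale_sq

theorem J₂_williamson (m : Phase) : J₂ (williamson m) = J₂ m := by
  simp only [J₂, williamson_fst, williamson_snd]
  linear_combination (2 * (m.1 0 * m.2 1 - m.1 1 * m.2 0)) * posScale_sq

/-- The embedding of the slice `q₂ = 0`. -/
noncomputable def sliceL : (Fin 3 → ℝ) →L[ℝ] Phase :=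
  (ContinuousLinearMap.pi ![ContinuousLinearMap.proj 0, 0]).prod
    (ContinuousLinearMap.pi ![ContinuousLinearMap.proj 1, ContinuousLinearMap.proj 2])

theorem sliceL_apply (v : Fin 3 → ℝ) : sliceL v = (![v 0, 0], ![v 1, v 2]) := by
  refine Prod.ext (funext fun i => ?_) (funext fun i => ?_) <;> fin_cases i <;> simp [sliceL]

open Complex in
/-- The complexified orbit of the linear flow. -/
noncomputable def orbit (e a b : ℝ) (t : ℂ) : Fin 3 → ℂ := ![e * exp t, a * exp (-t), b * exp (-t)]

/-- The orbit of the linear flow. -/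
noncomputable def realOrbit (e a b t : ℝ) : Fin 3 → ℝ :=
  ![e * Real.exp t, a * Real.exp (-t), b * Real.exp (-t)]

theorem orbit_ofReal (e a b t : ℝ) : orbit e a b t = fun i => (realOrbit e a b t i : ℂ) := by
  funext i
  fin_cases i <;> simp [orbit, realOrbit]

theorem hasDerivAt_realOrbit (e a b t : ℝ) :
    HasDerivAt (realOrbit e a b)
      ![e * Real.exp t, -(a * Real.exp (-t)), -(b * Real.exp (-t))] t := by
  refine hasDerivAt_pi.2 fun i => ?_
  have h := (Real.hasDerivAt_exp (-t)).comp t (hasDerivAt_neg t)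
  fin_cases i
  · exact (Real.hasDerivAt_exp t).const_mul e
  · exact (h.const_mul a).congr_deriv (by simp)
  · exact (h.const_mul b).congr_deriv (by simp)

theorem differentiable_orbit (e a b : ℝ) : Differentiable ℂ (orbit e a b) := by
  refine differentiable_pi.2 fun i => ?_
  fin_cases i <;> simp [orbit] <;> fun_prop

theorem orbit_add (e a b : ℝ) (t : ℂ) :
    orbit e a b (t + 2 * Real.pi * Complex.I) = orbit e a b t := by
  have h1 : Complex.exp (t + 2 * Real.pi * Complex.I) = Complex.exp t :=
    Complex.exp_periodic t
  have h2 : Complex.exp (-(t + 2 * Real.pi * Complex.I)) = Complex.exp (-t) := by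
    rw [Complex.exp_neg, h1, Complex.exp_neg]
  simp only [orbit, h1, h2]

/-- The strip on which the orbit stays small. -/
def strip : Set ℂ := {t | |t.re| < 1}

theorem isOpen_strip : IsOpen strip := isOpen_lt (by fun_prop) continuous_const

theorem isPreconnected_strip : IsPreconnected strip := by
  have : Convex ℝ strip := by
    have h : strip = Complex.reLm ⁻¹' Set.Ioo (-1) 1 := by
      ext t
      simp [strip, abs_lt]
    rw [h]
    exact (convex_Ioo (-1 : ℝ) 1).linear_preimage Complex.reLm
  exact this.isPreconnected

theorem norm_orbit_le {e a b : ℝ} (he : 0 < e) (ha : |a| ≤ e) (hb : |b| ≤ e) {t : ℂ}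
    (ht : t ∈ strip) : ‖orbit e a b t‖ < 3 * e := by
  have ht' := abs_lt.1 (show |t.re| < 1 from ht)
  have h1 : Real.exp t.re < 3 := (Real.exp_lt_exp.2 ht'.2).trans Real.exp_one_lt_three
  have h2 : Real.exp (-t.re) < 3 :=
    (Real.exp_lt_exp.2 (by linarith [ht'.1])).trans Real.exp_one_lt_three
  have h3 := Real.exp_pos (-t.re)
  refine (pi_norm_lt_iff (by positivity)).2 fun i => ?_
  fin_cases i
  · simp [orbit, Complex.norm_exp, abs_of_pos he]
    nlinarith
  · simp [orbit, Complex.norm_exp]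
    nlinarith [abs_nonneg a]
  · simp [orbit, Complex.norm_exp]
    nlinarith [abs_nonneg b]

/-- The values of a complexified function along the orbit. -/
theorem orbit_extension {F : (Fin 3 → ℂ) → ℂ} {f : (Fin 3 → ℝ) → ℝ} {e a b : ℝ}
    {f' : (Fin 3 → ℝ) → (Fin 3 → ℝ) →L[ℝ] ℝ}
    (hF : ∀ t ∈ strip, AnalyticAt ℂ F (orbit e a b t))
    (hFf : ∀ t : ℝ, (t : ℂ) ∈ strip → F (orbit e a b t) = f (realOrbit e a b t))
    (hf : ∀ t : ℝ, (t : ℂ) ∈ strip → HasFDerivAt f (f' (realOrbit e a b t)) (realOrbit e a b t)) :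
    AnalyticOnNhd ℂ (fun t => F (orbit e a b t)) strip ∧
    AnalyticOnNhd ℂ (deriv fun t => F (orbit e a b t)) strip ∧
    ∀ t : ℝ, (t : ℂ) ∈ strip → deriv (fun t => F (orbit e a b t)) t =
      (f' (realOrbit e a b t)
        ![e * Real.exp t, -(a * Real.exp (-t)), -(b * Real.exp (-t))] : ℝ) := by
  have h1 : AnalyticOnNhd ℂ (fun t => F (orbit e a b t)) strip := fun t ht =>
    AnalyticAt.fun_comp (hF t ht) ((differentiable_orbit e a b).analyticAt t)
  refine ⟨h1, fun t ht => (h1 t ht).deriv, fun t ht => ?_⟩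
  have h2 := (h1 t ht).differentiableAt.hasDerivAt.comp_ofReal
  have h3 := ((hf t ht).comp_hasDerivAt t (hasDerivAt_realOrbit e a b t)).ofReal_comp
  refine h2.unique (h3.congr_of_eventuallyEq ?_)
  have h4 : ∀ᶠ s : ℝ in 𝓝 t, (s : ℂ) ∈ strip :=
    Complex.continuous_ofReal.continuousAt.eventually (isOpen_strip.mem_nhds ht)
  filter_upwards [h4] with s hs
  exact hFf s hs

/-- The identity theorem: relations known along real orbits at real times are continued to imaginary
times, where the orbits close up. -/
theorem eqOn_strip {X Y : ℂ → ℂ} (hX : AnalyticOnNhd ℂ X strip) (hY : AnalyticOnNhd ℂ Y strip)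
    (h : ∀ t : ℝ, (t : ℂ) ∈ strip → X t = Y t) : Set.EqOn X Y strip := by
  have h0 : (0 : ℂ) ∈ strip := by simp [strip]
  refine hX.eqOn_of_preconnected_of_frequently_eq hY isPreconnected_strip h0 ?_
  have h1 : ∀ᶠ t : ℝ in 𝓝[≠] 0, X (t : ℂ) = Y t := by
    have : ∀ᶠ s : ℝ in 𝓝 0, (s : ℂ) ∈ strip :=
      Complex.continuous_ofReal.continuousAt.eventually (isOpen_strip.mem_nhds (by simpa using h0))
    filter_upwards [nhdsWithin_le_nhds this] with s hs
    exact h s hs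
  have h2 : Tendsto (fun t : ℝ => (t : ℂ)) (𝓝[≠] 0) (𝓝[≠] 0) := by
    refine tendsto_nhdsWithin_iff.2 ⟨?_, ?_⟩
    · exact (Complex.continuous_ofReal.tendsto' 0 0 (by simp)).mono_left nhdsWithin_le_nhds
    · filter_upwards [self_mem_nhdsWithin] with t ht
      simpa using ht
  exact h2.frequently h1.frequently

end ChampagneBottle

namespace ChampagneBottle

/-- A real-analytic function on the phase space, continued along the complexified orbits. -/
theorem exists_orbit_extension {f : Phase → ℝ} (hf : AnalyticAt ℝ f 0) :
    ∃ F : (Fin 3 → ℂ) → ℂ,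
      (∀ᶠ ε : ℝ in 𝓝[>] 0, ∀ a b, |a| ≤ ε → |b| ≤ ε →
        AnalyticOnNhd ℂ (fun t => F (orbit ε a b t)) strip ∧
        AnalyticOnNhd ℂ (deriv fun t => F (orbit ε a b t)) strip ∧
        ∀ t : ℝ, (t : ℂ) ∈ strip → F (orbit ε a b t) = f (sliceL (realOrbit ε a b t)) ∧
          deriv (fun t => F (orbit ε a b t)) t = (fderiv ℝ f (sliceL (realOrbit ε a b t))
            (sliceL ![ε * Real.exp t, -(a * Real.exp (-t)), -(b * Real.exp (-t))]) : ℝ)) ∧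
      ∀ κ > 0, ∀ᶠ z in 𝓝 (0 : Fin 3 → ℂ),
        ‖F z - (f 0 + ∑ k, z k * (fderiv ℝ f 0 (sliceL (Pi.single k 1)) : ℝ))‖ ≤ κ * ‖z‖ := by
  have hs0 : sliceL 0 = 0 := map_zero _
  have hg : AnalyticAt ℝ (fun v => f (sliceL v)) 0 :=
    AnalyticAt.fun_comp (by rwa [hs0]) (sliceL.analyticAt 0)
  obtain ⟨F, hF, hFf⟩ := hg.exists_complexification
  refine ⟨F, ?_, fun κ hκ => ?_⟩
  · have hd : ∀ᶠ v in 𝓝 (0 : Fin 3 → ℝ), HasFDerivAt (fun v => f (sliceL v))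
        (fderiv ℝ f (sliceL v) ∘L sliceL) v := by
      have h1 : Tendsto sliceL (𝓝 0) (𝓝 0) := by
        have := sliceL.continuous.tendsto 0
        rwa [hs0] at this
      filter_upwards [h1.eventually hf.eventually_analyticAt] with v hv
      exact hv.differentiableAt.hasFDerivAt.comp v sliceL.hasFDerivAt
    obtain ⟨r₁, hr₁, h1⟩ := Metric.eventually_nhds_iff_ball.1 hF.eventually_analyticAt
    obtain ⟨r₂, hr₂, h2⟩ := Metric.eventually_nhds_iff_ball.1 (hFf.and hd)
    filter_upwards [Ioo_mem_nhdsGT (show 0 < r₁ / 3 by positivity),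
      Ioo_mem_nhdsGT (show 0 < r₂ / 3 by positivity)] with ε he1 he2 a b ha hb
    have hm : ∀ t ∈ strip, orbit ε a b t ∈ Metric.ball (0 : Fin 3 → ℂ) r₁ := fun t ht => by
      rw [mem_ball_zero_iff]
      linarith [norm_orbit_le he1.1 ha hb ht, he1.2]
    have hm2 : ∀ t : ℝ, (t : ℂ) ∈ strip → realOrbit ε a b t ∈ Metric.ball (0 : Fin 3 → ℝ) r₂ := by
      intro t ht
      have h3 := norm_orbit_le he1.1 ha hb ht
      rw [orbit_ofReal, pi_norm_lt_iff (by linarith [he1.1])] at h3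
      rw [mem_ball_zero_iff, pi_norm_lt_iff hr₂]
      intro i
      have h4 := h3 i
      rw [Complex.norm_real] at h4
      linarith [he2.2]
    have h3 := orbit_extension (F := F) (f := fun v => f (sliceL v))
      (f' := fun v => fderiv ℝ f (sliceL v) ∘L sliceL) (e := ε) (a := a) (b := b)
      (fun t ht => h1 _ (hm t ht))
      (fun t ht => by rw [orbit_ofReal]; exact (h2 _ (hm2 t ht)).1) fun t ht => (h2 _ (hm2 t ht)).2
    refine ⟨h3.1, h3.2.1, fun t ht => ⟨?_, h3.2.2 t ht⟩⟩
    rw [orbit_ofReal]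
    exact (h2 _ (hm2 t ht)).1
  · have hF0 : F 0 = f 0 := by
      have := hFf.self_of_nhds
      simp only [Pi.zero_apply, Complex.ofReal_zero, hs0] at this
      exact this
    filter_upwards [hF.differentiableAt.hasFDerivAt.isLittleO.def hκ] with z hz
    rw [sub_zero, fderiv_complexification hF.differentiableAt hg.differentiableAt hFf, hF0,
      sub_sub] at hz
    have h3 : fderiv ℝ (fun v => f (sliceL v)) 0 = fderiv ℝ f 0 ∘L sliceL := by
      have h4 : HasFDerivAt f (fderiv ℝ f 0) (sliceL 0) := by
        rw [hs0]; exact hf.differentiableAt.hasFDerivAt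
      exact (h4.comp 0 sliceL.hasFDerivAt).fderiv
    rw [h3] at hz
    exact hz

theorem mul_I_mem_strip (θ : ℝ) : (θ * Complex.I : ℂ) ∈ strip := by simp [strip]

theorem hasDerivAt_imaginary {G : ℂ → ℂ} (hG : AnalyticOnNhd ℂ G strip) (θ : ℝ) :
    HasDerivAt (fun θ : ℝ => G (θ * Complex.I)) (deriv G (θ * Complex.I) * Complex.I) θ := by
  have h1 := (hG _ (mul_I_mem_strip θ)).differentiableAt.hasDerivAt
  have h2 : HasDerivAt (fun z : ℂ => z * Complex.I) Complex.I (θ : ℂ) := by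
    simpa using (hasDerivAt_id (θ : ℂ)).mul_const Complex.I
  exact (h1.comp (θ : ℂ) h2).comp_ofReal

theorem continuous_imaginary {G : ℂ → ℂ} (hG : AnalyticOnNhd ℂ G strip) :
    Continuous fun θ : ℝ => G (θ * Complex.I) :=
  continuous_iff_continuousAt.2 fun θ => (hasDerivAt_imaginary hG θ).continuousAt

theorem orbit_two_pi (e a b : ℝ) :
    orbit e a b (((2 * Real.pi : ℝ) : ℂ) * Complex.I) =
      orbit e a b (((0 : ℝ) : ℂ) * Complex.I) := by
  have := orbit_add e a b 0
  rw [zero_add] at this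
  push_cast
  rw [this, zero_mul]

theorem norm_orbit_imaginary {e a b : ℝ} (he : 0 < e) (ha : |a| ≤ e) (hb : |b| ≤ e) (θ : ℝ) :
    ‖orbit e a b (θ * Complex.I)‖ ≤ e := by
  refine (pi_norm_le_iff_of_nonneg he.le).2 fun i => ?_
  fin_cases i <;> simp [orbit, Complex.norm_exp, abs_of_pos he, ha, hb]

end ChampagneBottle

/-! ### Uniqueness of the Birkhoff normal form -/

namespace ChampagneBottle

/-- Orbits with `q = (e, 0)` and `p = (a, b)` already realise all small values of the two quadratic
invariants, so the slice `q₂ = 0` suffices. -/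
theorem realOrbit_quadratic (e a b t : ℝ) :
    J₁ (sliceL (realOrbit e a b t)) = e * a ∧ J₂ (sliceL (realOrbit e a b t)) = e * b := by
  have h : Real.exp t * Real.exp (-t) = 1 := by rw [← Real.exp_add, add_neg_cancel, Real.exp_zero]
  rw [sliceL_apply]
  constructor
  · simp [J₁, realOrbit]
    linear_combination e * a * h
  · simp [J₂, realOrbit]
    linear_combination e * b * h

theorem realOrbit_pairing (e a b t : ℝ) :
    ∑ i, (sliceL (realOrbit e a b t)).2 i *
      (sliceL ![e * Real.exp t, -(a * Real.exp (-t)), -(b * Real.exp (-t))]).1 i = e * a := by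
  have h : Real.exp t * Real.exp (-t) = 1 := by rw [← Real.exp_add, add_neg_cancel, Real.exp_zero]
  rw [sliceL_apply, sliceL_apply]
  simp [realOrbit]
  linear_combination e * a * h

/-- The conjugation `T` of the linear flow to the flow in the fibres, with its primitive. -/
structure IsConjugation (K : ℝ × ℝ → ℝ) (T : Phase → Phase) (S : Phase → ℝ) : Prop where
  analyticAt : AnalyticAt ℝ T 0
  zero : T 0 = 0
  fderiv_zero : fderiv ℝ T 0 = williamsonL
  energy : ∀ᶠ m in 𝓝 (0 : Phase), hamiltonian (T m) = K (√2 * J₁ m, √2 * J₂ m)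
  momentum : ∀ᶠ m in 𝓝 (0 : Phase), J₂ (T m) = J₂ m
  analyticAt_primitive : AnalyticAt ℝ S 0
  primitive : ∀ᶠ m in 𝓝 (0 : Phase), HasFDerivAt S (liouvilleDefect T m) m

theorem IsBirkhoffNormalForm.exists_isConjugation {K : ℝ × ℝ → ℝ} (hK : IsBirkhoffNormalForm K) :
    ∃ T S, IsConjugation K T S := by
  obtain ⟨-, Φ, hΦ, hΦ0, hΦ', hs, hJ, hH⟩ := hK
  set T : Phase → Phase := fun m => williamson (Φ m) with hT
  have hTL : T = fun m => williamsonL (Φ m) := funext fun m => (williamsonL_apply _).symm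
  have hTa : AnalyticAt ℝ T 0 := by
    rw [hTL]
    exact AnalyticAt.fun_comp (williamsonL.analyticAt _) hΦ
  have hTd : ∀ᶠ m in 𝓝 (0 : Phase), fderiv ℝ T m = williamsonL ∘L fderiv ℝ Φ m := by
    filter_upwards [hΦ.eventually_analyticAt] with m hm
    rw [hTL]
    exact (williamsonL.hasFDerivAt.comp m hm.differentiableAt.hasFDerivAt).fderiv
  obtain ⟨S, hSa, hS⟩ := exists_primitive_liouvilleDefect hTa (by
    filter_upwards [hTd, hs] with m h1 h2 u v
    rw [h1]
    simp only [ContinuousLinearMap.comp_apply, williamsonL_apply, sympl_williamson]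
    exact h2 u v)
  refine ⟨T, S, hTa, ?_, ?_, hH, ?_, hSa, hS⟩
  · rw [hTL]
    simp [hΦ0]
  · rw [hTd.self_of_nhds, hΦ']
    exact ContinuousLinearMap.comp_id _
  · filter_upwards [hJ] with m hm
    rw [hT]
    simp only [J₂_williamson, hm]

theorem IsConjugation.map_zero {K : ℝ × ℝ → ℝ} {T : Phase → Phase} {S : Phase → ℝ}
    (h : IsConjugation K T S) : K 0 = 0 := by
  have := h.energy.self_of_nhds
  rw [h.zero] at this
  simpa [hamiltonian, J₁, J₂, Prod.mk_zero_zero] using this.symm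

theorem norm_sub_le_of_linear {w L M : ℂ} {x e : ℝ} (h1 : ‖w - L‖ ≤ x / 40 * e)
    (h2 : ‖L - M‖ ≤ x * (e / 40)) (hx : 0 ≤ x) (he : 0 ≤ e) : ‖w - M‖ ≤ x * e / 10 := by
  have e1 : w - M = (w - L) + (L - M) := by ring
  rw [e1]
  refine (norm_add_le _ _).trans ?_
  nlinarith [mul_nonneg hx he]

set_option maxHeartbeats 1000000 in
/-- The first action of the normal form is the vanishing action. -/
theorem IsConjugation.vanishingAction_eq {K : ℝ × ℝ → ℝ} {T : Phase → Phase} {S : Phase → ℝ}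
    (h : IsConjugation K T S) (hK : ContinuousAt K 0) :
    ∀ᶠ j in 𝓝 (0 : ℝ × ℝ), vanishingAction (K j) j.2 = j.1 := by
  have hc := posScale_pos
  have h2 : (0 : ℝ) < √2 := Real.sqrt_pos.2 two_pos
  have hT1 : ∀ i, AnalyticAt ℝ (fun m => (T m).1 i) 0 := fun i =>
    ((ContinuousLinearMap.proj i : (Fin 2 → ℝ) →L[ℝ] ℝ) ∘L
      ContinuousLinearMap.fst ℝ (Fin 2 → ℝ) (Fin 2 → ℝ)).analyticAt _ |>.comp h.analyticAt
  have hT2 : ∀ i, AnalyticAt ℝ (fun m => (T m).2 i) 0 := fun i =>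
    ((ContinuousLinearMap.proj i : (Fin 2 → ℝ) →L[ℝ] ℝ) ∘L
      ContinuousLinearMap.snd ℝ (Fin 2 → ℝ) (Fin 2 → ℝ)).analyticAt _ |>.comp h.analyticAt
  have hd1 : ∀ i, ∀ m, DifferentiableAt ℝ T m → ∀ v,
      fderiv ℝ (fun m => (T m).1 i) m v = (fderiv ℝ T m v).1 i := fun i m hm v =>
    DFunLike.congr_fun (((ContinuousLinearMap.proj i : (Fin 2 → ℝ) →L[ℝ] ℝ) ∘L
      ContinuousLinearMap.fst ℝ (Fin 2 → ℝ) (Fin 2 → ℝ)).hasFDerivAt.comp m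
        hm.hasFDerivAt).fderiv v
  have hd2 : ∀ i, ∀ m, DifferentiableAt ℝ T m → ∀ v,
      fderiv ℝ (fun m => (T m).2 i) m v = (fderiv ℝ T m v).2 i := fun i m hm v =>
    DFunLike.congr_fun (((ContinuousLinearMap.proj i : (Fin 2 → ℝ) →L[ℝ] ℝ) ∘L
      ContinuousLinearMap.snd ℝ (Fin 2 → ℝ) (Fin 2 → ℝ)).hasFDerivAt.comp m
        hm.hasFDerivAt).fderiv v
  choose X hX hXn using fun i => exists_orbit_extension (hT1 i)
  choose Y hY hYn using fun i => exists_orbit_extension (hT2 i)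
  obtain ⟨G, hG, -⟩ := exists_orbit_extension h.analyticAt_primitive
  -- The conjugation has the linear part `williamson`; its nonlinear part is negligible on a small
  -- ball. This keeps the image loop near a circle.
  have hXl : ∀ i, ∀ᶠ z in 𝓝 (0 : Fin 3 → ℂ), ‖X i z - posScale * (![z 0 - z 1, -z 2] i)‖ ≤
      posScale / 40 * ‖z‖ := by
    intro i
    filter_upwards [hXn i (posScale / 40) (by positivity)] with z hz
    refine le_trans (le_of_eq ?_) hz
    congr 2
    simp only [hd1 i 0 h.analyticAt.differentiableAt, h.fderiv_zero, h.zero, williamsonL_apply,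
      williamson_fst, sliceL_apply, Fin.sum_univ_three]
    fin_cases i <;> simp <;> ring
  have hYl : ∀ i, ∀ᶠ z in 𝓝 (0 : Fin 3 → ℂ),
      ‖Y i z - √2 * posScale * (![z 0 + z 1, z 2] i)‖ ≤ √2 * posScale / 40 * ‖z‖ := by
    intro i
    filter_upwards [hYn i (√2 * posScale / 40) (by positivity)] with z hz
    refine le_trans (le_of_eq ?_) hz
    congr 2
    simp only [hd2 i 0 h.analyticAt.differentiableAt, h.fderiv_zero, h.zero, williamsonL_apply,
      williamson_snd, sliceL_apply, Fin.sum_univ_three]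
    fin_cases i <;> simp <;> ring
  obtain ⟨δ, hδ, hlin⟩ := Metric.eventually_nhds_iff_ball.1
    ((eventually_all.2 hXl).and (eventually_all.2 hYl))
  obtain ⟨ρ, hρ, hreal⟩ := Metric.eventually_nhds_iff_ball.1
    ((sliceL.continuous.tendsto' 0 0 (_root_.map_zero _)).eventually
      (h.energy.and (h.momentum.and (h.primitive.and h.analyticAt.eventually_analyticAt))))
  have hsmall : ∀ᶠ ε : ℝ in 𝓝[>] 0, 2 * (posScale * ε) ^ 2 ≤ 3 / 5 := by
    have h1 : ContinuousAt (fun ε : ℝ => 2 * (posScale * ε) ^ 2) 0 := by fun_prop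
    have h3 := h1.eventually_lt continuousAt_const (show 2 * (posScale * 0) ^ 2 < 3 / 5 by norm_num)
    exact nhdsWithin_le_nhds (h3.mono fun ε h => h.le)
  obtain ⟨ε, ⟨hXε, hYε, hGε⟩, hε3, hεδ, hερ⟩ := (((eventually_all.2 hX).and
    ((eventually_all.2 hY).and hG)).and (hsmall.and
      ((eventually_mem_set.2 (Ioo_mem_nhdsGT hδ)).and
        (eventually_mem_set.2 (Ioo_mem_nhdsGT (show 0 < ρ / 3 by positivity)))))).exists
  have hε := hεδ.1
  have hcε : 0 < posScale * ε := mul_pos hc hε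
  -- The size `ε` of the loop is fixed once, and `a`, `b` vary. The nonlinear part and the terms in
  -- `a`, `b` each cost a fortieth of the radius, within the tenth allowed by
  -- `vanishingAction_eq_of_loop`.
  have key : ∀ a b : ℝ, |a| ≤ ε / 40 → |b| ≤ ε / 40 →
      (∀ z : ℂ, (posScale * ε) ^ 2 / 2 ≤ ‖z‖ → ‖z‖ ≤ 3 / 5 →
        0 < (radicand (K (√2 * (ε * a), √2 * (ε * b))) (√2 * (ε * b)) z).re) →
      vanishingAction (K (√2 * (ε * a), √2 * (ε * b))) (√2 * (ε * b)) = √2 * (ε * a) := by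
    intro a b ha hb hrad
    have ha' : |a| ≤ ε := ha.trans (by linarith)
    have hb' : |b| ≤ ε := hb.trans (by linarith)
    have hXab := fun i => hXε i a b ha' hb'
    have hYab := fun i => hYε i a b ha' hb'
    obtain ⟨hG1, hG2, hG3⟩ := hGε a b ha' hb'
    have hm : ∀ t : ℝ, (t : ℂ) ∈ strip → realOrbit ε a b t ∈ Metric.ball (0 : Fin 3 → ℝ) ρ := by
      intro t ht
      have h3 := norm_orbit_le hε ha' hb' ht
      rw [orbit_ofReal, pi_norm_lt_iff (by linarith)] at h3
      rw [mem_ball_zero_iff, pi_norm_lt_iff hρ]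
      intro i
      have h4 := h3 i
      rw [Complex.norm_real] at h4
      linarith [hερ.2]
    have hen : Set.EqOn (fun t => (Y 0 (orbit ε a b t) ^ 2 + Y 1 (orbit ε a b t) ^ 2) / 2 -
        (X 0 (orbit ε a b t) ^ 2 + X 1 (orbit ε a b t) ^ 2) +
        (X 0 (orbit ε a b t) ^ 2 + X 1 (orbit ε a b t) ^ 2) ^ 2)
        (fun _ => (K (√2 * (ε * a), √2 * (ε * b)) : ℂ)) strip := by
      refine eqOn_strip ?_ analyticOnNhd_const fun t ht => ?_
      · intro t ht
        have e1 := (hXab 0).1 t ht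
        have e2 := (hXab 1).1 t ht
        have e3 := (hYab 0).1 t ht
        have e4 := (hYab 1).1 t ht
        exact ((((e3.pow 2).add (e4.pow 2)).div analyticAt_const two_ne_zero).sub
          ((e1.pow 2).add (e2.pow 2))).add (((e1.pow 2).add (e2.pow 2)).pow 2)
      · have e1 := (hreal _ (hm t ht)).1
        rw [(realOrbit_quadratic ε a b t).1, (realOrbit_quadratic ε a b t).2] at e1
        simp only [((hXab _).2.2 t ht).1, ((hYab _).2.2 t ht).1]
        rw [← e1, hamiltonian]
        push_cast
        rfl
    have hmo : Set.EqOn (fun t => X 0 (orbit ε a b t) * Y 1 (orbit ε a b t) -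
        X 1 (orbit ε a b t) * Y 0 (orbit ε a b t)) (fun _ => ((ε * b : ℝ) : ℂ)) strip := by
      refine eqOn_strip ?_ analyticOnNhd_const fun t ht => ?_
      · intro t ht
        have e1 := (hXab 0).1 t ht
        have e2 := (hXab 1).1 t ht
        have e3 := (hYab 0).1 t ht
        have e4 := (hYab 1).1 t ht
        exact (e1.mul e4).sub (e2.mul e3)
      · have e1 := (hreal _ (hm t ht)).2.1
        rw [(realOrbit_quadratic ε a b t).2] at e1
        simp only [((hXab _).2.2 t ht).1, ((hYab _).2.2 t ht).1]
        rw [← e1, J₂]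
        push_cast
        rfl
    -- The Liouville form along the image orbit is its value `ε a` on the linear orbit plus the
    -- derivative of the primitive.
    have hac : Set.EqOn (fun t => Y 0 (orbit ε a b t) * deriv (fun t => X 0 (orbit ε a b t)) t +
        Y 1 (orbit ε a b t) * deriv (fun t => X 1 (orbit ε a b t)) t)
        (fun t => ((ε * a : ℝ) : ℂ) + deriv (fun t => G (orbit ε a b t)) t) strip := by
      refine eqOn_strip ?_ ?_ fun t ht => ?_
      · intro t ht
        have e1 := (hXab 0).2.1 t ht
        have e2 := (hXab 1).2.1 t ht
        have e3 := (hYab 0).1 t ht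
        have e4 := (hYab 1).1 t ht
        exact (e3.mul e1).add (e4.mul e2)
      · intro t ht
        exact analyticAt_const.add (hG2 t ht)
      · have e1 := (hreal _ (hm t ht)).2.2.1
        have e2 := (hreal _ (hm t ht)).2.2.2.differentiableAt
        rw [((hXab 0).2.2 t ht).2, ((hXab 1).2.2 t ht).2, ((hYab 0).2.2 t ht).1,
          ((hYab 1).2.2 t ht).1, (hG3 t ht).2, hd1 0 _ e2, hd1 1 _ e2, e1.fderiv,
          liouvilleDefect_apply, Finset.sum_sub_distrib, realOrbit_pairing, Fin.sum_univ_two]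
        push_cast
        ring
    have hnorm : ∀ θ : ℝ, ‖orbit ε a b (θ * Complex.I)‖ ≤ ε := norm_orbit_imaginary hε ha' hb'
    have hball : ∀ θ : ℝ, orbit ε a b (θ * Complex.I) ∈ Metric.ball (0 : Fin 3 → ℂ) δ := fun θ =>
      mem_ball_zero_iff.2 ((hnorm θ).trans_lt hεδ.2)
    have hXb : ∀ (θ : ℝ) i, ‖X i (orbit ε a b (θ * Complex.I)) - posScale *
        (![ε * Complex.exp (θ * Complex.I) - a * Complex.exp (-(θ * Complex.I)),
          -(b * Complex.exp (-(θ * Complex.I)))] i)‖ ≤ posScale / 40 * ε := fun (θ : ℝ) i =>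
      ((hlin _ (hball θ)).1 i).trans (mul_le_mul_of_nonneg_left (hnorm θ) (by positivity))
    have hYb : ∀ (θ : ℝ) i, ‖Y i (orbit ε a b (θ * Complex.I)) - √2 * posScale *
        (![ε * Complex.exp (θ * Complex.I) + a * Complex.exp (-(θ * Complex.I)),
          b * Complex.exp (-(θ * Complex.I))] i)‖ ≤ √2 * posScale / 40 * ε := fun (θ : ℝ) i =>
      ((hlin _ (hball θ)).2 i).trans (mul_le_mul_of_nonneg_left (hnorm θ) (by positivity))
    have hexp : ∀ (x c : ℝ) (θ : ℝ), 0 ≤ x → |c| ≤ ε / 40 →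
        ‖(x : ℂ) * (c * Complex.exp (-(θ * Complex.I)))‖ ≤ x * (ε / 40) := by
      intro x c θ hx hcc
      rw [norm_mul, norm_mul, ← neg_mul, ← Complex.ofReal_neg, Complex.norm_exp_ofReal_mul_I,
        mul_one, Complex.norm_real, Complex.norm_real, Real.norm_of_nonneg hx]
      exact mul_le_mul_of_nonneg_left hcc hx
    have h2c : 0 ≤ √2 * posScale := by positivity
    refine vanishingAction_eq_of_loop (r := posScale * ε)
      (x₁ := fun θ => X 0 (orbit ε a b (θ * Complex.I)))
      (x₂ := fun θ => X 1 (orbit ε a b (θ * Complex.I)))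
      (y₁ := fun θ => Y 0 (orbit ε a b (θ * Complex.I)))
      (y₂ := fun θ => Y 1 (orbit ε a b (θ * Complex.I)))
      (σ := fun θ => G (orbit ε a b (θ * Complex.I))) hcε hε3 hrad
      (hasDerivAt_imaginary (hXab 0).1) (hasDerivAt_imaginary (hXab 1).1)
      (hasDerivAt_imaginary hG1) ((continuous_imaginary (hXab 0).2.1).mul continuous_const)
      ((continuous_imaginary (hXab 1).2.1).mul continuous_const)
      ((continuous_imaginary hG2).mul continuous_const)
      (by simp only [orbit_two_pi]) (by simp only [orbit_two_pi]) (by simp only [orbit_two_pi])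
      (fun θ => hen (mul_I_mem_strip θ)) (fun θ => hmo (mul_I_mem_strip θ)) (fun θ => ?_)
      (fun θ => ?_) (fun θ => ?_) (fun θ => ?_) fun θ => ?_
    · have e1 := hac (mul_I_mem_strip θ)
      simp only at e1
      linear_combination Complex.I * e1
    · refine norm_sub_le_of_linear (hXb θ 0) ?_ hc.le hε.le
      refine le_trans (le_of_eq ?_) (hexp posScale a θ hc.le ha)
      rw [← norm_neg]
      congr 1
      simp
      ring
    · have := norm_sub_le_of_linear (M := 0) (hXb θ 1) ?_ hc.le hε.le
      · rwa [sub_zero] at this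
      · refine le_trans (le_of_eq ?_) (hexp posScale b θ hc.le hb)
        rw [← norm_neg]
        congr 1
        simp
    · have := norm_sub_le_of_linear
        (M := √2 * ((posScale * ε : ℝ) : ℂ) * Complex.exp (θ * Complex.I)) (hYb θ 0) ?_ h2c hε.le
      · rwa [mul_assoc √2 posScale ε] at this
      · refine le_trans (le_of_eq ?_) (hexp (√2 * posScale) a θ h2c ha)
        congr 1
        simp
        ring
    · have := norm_sub_le_of_linear (M := 0) (hYb θ 1) ?_ h2c hε.le
      · rwa [sub_zero, mul_assoc √2 posScale ε] at this
      · refine le_trans (le_of_eq ?_) (hexp (√2 * posScale) b θ h2c hb)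
        congr 1
        simp
  have hKt : Tendsto (fun j : ℝ × ℝ => (K j, j.2)) (𝓝 0) (𝓝 0) := by
    have := (hK.prodMk continuousAt_snd).tendsto
    rwa [h.map_zero, Prod.snd_zero, Prod.mk_zero_zero] at this
  have hb1 : ∀ᶠ j : ℝ × ℝ in 𝓝 0, |j.1 / (√2 * ε)| < ε / 40 ∧ |j.2 / (√2 * ε)| < ε / 40 := by
    have c1 : ContinuousAt (fun j : ℝ × ℝ => |j.1 / (√2 * ε)|) 0 := by fun_prop
    have c2 : ContinuousAt (fun j : ℝ × ℝ => |j.2 / (√2 * ε)|) 0 := by fun_prop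
    refine (c1.eventually_lt continuousAt_const ?_).and (c2.eventually_lt continuousAt_const ?_)
    · simp; positivity
    · simp; positivity
  filter_upwards [hb1, hKt.eventually (eventually_re_radicand_pos
    (show 0 < (posScale * ε) ^ 2 / 2 by positivity))] with j h1 h3
  -- The orbit parameters `a = j₁ / (√2 ε)`, `b = j₂ / (√2 ε)` realise the given scaled actions.
  have e1 : √2 * (ε * (j.1 / (√2 * ε))) = j.1 := by field_simp
  have e2 : √2 * (ε * (j.2 / (√2 * ε))) = j.2 := by field_simp
  have h4 := key _ _ h1.1.le h1.2.le
  rw [e1, e2] at h4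
  exact h4 h3

/-- `K` and `H̄` both invert the vanishing action at fixed `j₂`. -/
theorem IsNormalHamiltonian.eq_of_isBirkhoffNormalForm {Hbar K : ℝ × ℝ → ℝ}
    (h : IsNormalHamiltonian Hbar) (hK : IsBirkhoffNormalForm K) : K =ᶠ[𝓝 0] Hbar := by
  obtain ⟨T, S, hc⟩ := hK.exists_isConjugation
  have hKt : Tendsto (fun j : ℝ × ℝ => (K j, j.2)) (𝓝 0) (𝓝 0) := by
    have := (hK.1.continuousAt.prodMk continuousAt_snd).tendsto
    rwa [hc.map_zero, Prod.snd_zero, Prod.mk_zero_zero] at this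
  filter_upwards [hc.vanishingAction_eq hK.1.continuousAt, hKt.eventually h.left] with j h1 h2
  rw [← h2, h1]

end ChampagneBottle

/-! ### The iso-energetic non-degeneracy condition -/

namespace ChampagneBottle

theorem two_le_infty : (2 : WithTop ℕ∞) ≤ ∞ :=
  WithTop.coe_le_coe.2 (le_top : (2 : ℕ∞) ≤ ⊤)

theorem contDiffAt_pd1 {f : ℝ × ℝ → ℝ} {p : ℝ × ℝ} (hf : ContDiffAt ℝ 2 f p) :
    ContDiffAt ℝ 1 (pd1 f) p :=
  (hf.fderiv_right (m := 1) (by norm_num)).clm_apply contDiffAt_const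

theorem contDiffAt_pd2 {f : ℝ × ℝ → ℝ} {p : ℝ × ℝ} (hf : ContDiffAt ℝ 2 f p) :
    ContDiffAt ℝ 1 (pd2 f) p :=
  (hf.fderiv_right (m := 1) (by norm_num)).clm_apply contDiffAt_const

theorem fderiv_pair_apply (f : ℝ × ℝ → ℝ) (p : ℝ × ℝ) (a b : ℝ) :
    fderiv ℝ f p (a, b) = a * pd1 f p + b * pd2 f p := by
  rw [pd1, pd2, ← smul_eq_mul, ← smul_eq_mul, ← map_smul, ← map_smul, ← map_add]
  simp

/-- Differentiating `F (A, j₂) = h` gives `F₂ = -F₁ ∂A/∂j₂`; once more, the Hessian of `F` on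
`(∂A/∂j₂, 1)` equals `-F₁ ∂²A/∂j₂²`. With this `F₂` the bordered determinant is `-F₁²` times that
Hessian value. -/
theorem isoenergeticDet_eq {A F : ℝ × ℝ → ℝ} {p : ℝ × ℝ} (hA : ContDiffAt ℝ 2 A p)
    (hF : ContDiffAt ℝ 2 F (A p, p.2)) (h : ∀ᶠ q in 𝓝 p, F (A q, q.2) = q.1) :
    pd1 F (A p, p.2) * pd1 A p = 1 ∧
      isoenergeticDet F (A p, p.2) = pd1 F (A p, p.2) ^ 3 * pd2 (pd2 A) p := by
  have hψ : ContinuousAt (fun q : ℝ × ℝ => (A q, q.2)) p := hA.continuousAt.prodMk continuousAt_snd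
  have hchain : ∀ {G : ℝ × ℝ → ℝ} {q : ℝ × ℝ}, DifferentiableAt ℝ G (A q, q.2) →
      DifferentiableAt ℝ A q → HasFDerivAt (fun q : ℝ × ℝ => G (A q, q.2))
        (fderiv ℝ G (A q, q.2) ∘L ((fderiv ℝ A q).prod (ContinuousLinearMap.snd ℝ ℝ ℝ))) q :=
    fun {G q} hG hA => hG.hasFDerivAt.comp q (hA.hasFDerivAt.prodMk hasFDerivAt_snd)
  have hchain2 : ∀ {G : ℝ × ℝ → ℝ} {q : ℝ × ℝ}, DifferentiableAt ℝ G (A q, q.2) →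
      DifferentiableAt ℝ A q → pd2 (fun q : ℝ × ℝ => G (A q, q.2)) q =
        pd2 A q * pd1 G (A q, q.2) + pd2 G (A q, q.2) := fun {G q} hG hA => by
    rw [pd2_eq_of_hasFDerivAt (hchain hG hA)]
    simp only [ContinuousLinearMap.comp_apply, ContinuousLinearMap.prod_apply,
      ContinuousLinearMap.coe_snd', fderiv_pair_apply, one_mul, zero_mul, zero_add]
  have h1 : pd1 F (A p, p.2) * pd1 A p = 1 := by
    have e1 := hchain (hF.differentiableAt two_ne_zero) (hA.differentiableAt two_ne_zero)
    have e2 := e1.unique (hasFDerivAt_fst.congr_of_eventuallyEq h)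
    have e3 := DFunLike.congr_fun e2 ((1 : ℝ), (0 : ℝ))
    simp only [ContinuousLinearMap.comp_apply, ContinuousLinearMap.prod_apply,
      ContinuousLinearMap.coe_snd', ContinuousLinearMap.coe_fst', fderiv_pair_apply, zero_mul,
      add_zero, one_mul] at e3
    linarith
  have hev : ∀ᶠ q in 𝓝 p, pd2 A q * pd1 F (A q, q.2) + pd2 F (A q, q.2) = 0 := by
    filter_upwards [h.eventually_nhds, hA.eventually (by simp),
      hψ.tendsto.eventually (hF.eventually (by simp))] with q e1 e2 e3
    rw [← hchain2 (e3.differentiableAt two_ne_zero) (e2.differentiableAt two_ne_zero),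
      pd2_eq_of_hasFDerivAt (hasFDerivAt_fst.congr_of_eventuallyEq e1)]
    simp
  have e0 := hev.self_of_nhds
  have hA1 := hA.differentiableAt two_ne_zero
  have d1 := (contDiffAt_pd1 hF).differentiableAt one_ne_zero
  have d2 := (contDiffAt_pd2 hF).differentiableAt one_ne_zero
  have d3 := (contDiffAt_pd2 hA).differentiableAt one_ne_zero
  have hsum := ((d3.hasFDerivAt.mul (hchain d1 hA1)).add (hchain d2 hA1)).unique
    ((hasFDerivAt_const (0 : ℝ) p).congr_of_eventuallyEq hev)
  have e1 := DFunLike.congr_fun hsum ((0 : ℝ), (1 : ℝ))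
  simp only [_root_.add_apply, _root_.smul_apply, smul_eq_mul, ContinuousLinearMap.comp_apply,
    ContinuousLinearMap.prod_apply, ContinuousLinearMap.coe_snd', fderiv_pair_apply, one_mul,
    zero_mul, zero_add, _root_.zero_apply] at e1
  refine ⟨h1, ?_⟩
  rw [isoenergeticDet, Matrix.det_fin_three]
  simp
  generalize pd1 F (A p, p.2) = F1 at *
  generalize pd2 F (A p, p.2) = F2 at *
  have e2 : F2 = -(pd2 A p * F1) := by linarith
  rw [e2]
  linear_combination (-F1 ^ 2) * e1

theorem exists_int_eq_on_Ioo {f : ℝ → ℝ} {a b : ℝ} (hab : a < b)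
    (hf : ContinuousOn f (Set.Ioo a b)) (h : ∀ t ∈ Set.Ioo a b, ∃ k : ℤ, f t = k) :
    ∃ n : ℤ, ∀ t ∈ Set.Ioo a b, f t = n := by
  have hm : (a + b) / 2 ∈ Set.Ioo a b := ⟨by linarith, by linarith⟩
  obtain ⟨n, hn⟩ := h _ hm
  refine ⟨n, fun t ht => ?_⟩
  have : DiscreteTopology (Set.range ((↑) : ℤ → ℝ)) :=
    Int.isClosedEmbedding_coe_real.isEmbedding.toHomeomorph.symm.isEmbedding.discreteTopology
  rw [← hn]
  exact isPreconnected_Ioo.constant_of_mapsTo (T := Set.range ((↑) : ℤ → ℝ)) ⟨this⟩ hf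
    (fun s hs => by obtain ⟨k, hk⟩ := h s hs; exact ⟨k, hk.symm⟩) ht hm

/-- Vanishing on one side suffices, as the derivatives at `a` are two-sided. This avoids the side of
`j₂ = 0` on which the cycle may change. -/
theorem second_deriv_eq_zero_of_right {φ φ' : ℝ → ℝ} {a c : ℝ}
    (hφ : ∀ᶠ t in 𝓝 a, HasDerivAt φ (φ' t) t) (hφ' : HasDerivAt φ' c a)
    (h : ∀ᶠ t in 𝓝[>] a, φ t = 0) : c = 0 := by
  obtain ⟨b, hb, hab⟩ := mem_nhdsGT_iff_exists_Ioo_subset.1 h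
  have h1 : ∀ᶠ t in 𝓝[>] a, φ' t = 0 := by
    filter_upwards [Ioo_mem_nhdsGT hb, nhdsWithin_le_nhds hφ] with t ht h2
    refine h2.unique ((hasDerivAt_const t (0 : ℝ)).congr_of_eventuallyEq ?_)
    filter_upwards [Ioo_mem_nhds ht.1 ht.2] with s hs
    exact hab hs
  have h2 : φ' a = 0 := tendsto_nhds_unique
    (hφ'.continuousAt.tendsto.mono_left (nhdsWithin_le_nhds (s := Set.Ioi a)))
    (tendsto_const_nhds.congr' (h1.mono fun t ht => ht.symm))
  have h3 := hφ'.hasDerivWithinAt (s := Set.Ici a)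
  have h4 : HasDerivWithinAt φ' 0 (Set.Ici a) a := by
    refine (hasDerivWithinAt_const a (Set.Ici a) (0 : ℝ)).congr_of_eventuallyEq ?_ h2
    rw [← Set.Ioi_insert, nhdsWithin_insert]
    exact ⟨h2, h1⟩
  exact (uniqueDiffOn_Ici a a Set.self_mem_Ici).eq_deriv _ h3 h4

theorem scaledAction_sqrt_two_mul (h j : ℝ) : scaledAction h (√2 * j) = √2 * radialAction h j := by
  have h2 : √2 ≠ 0 := (Real.sqrt_pos.2 two_pos).ne'
  rw [scaledAction, mul_div_cancel_left₀ j h2]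

/-- The unscaled action that belongs to a branch. -/
noncomputable def branchAction (V : ℝ × ℝ → ℝ) (x : ℝ × ℝ) : ℝ :=
  V (x.1, √2 * x.2) / (2 * Real.pi * √2)

theorem hasFDerivAt_branchAction {V : ℝ × ℝ → ℝ} {x : ℝ × ℝ}
    (hV : DifferentiableAt ℝ V (x.1, √2 * x.2)) :
    pd1 (branchAction V) x = pd1 V (x.1, √2 * x.2) / (2 * Real.pi * √2) ∧
      pd2 (branchAction V) x = pd2 V (x.1, √2 * x.2) / (2 * Real.pi) := by
  have h2 : √2 ≠ 0 := (Real.sqrt_pos.2 two_pos).ne'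
  have h1 := (hV.hasFDerivAt.comp x ((hasFDerivAt_fst (𝕜 := ℝ) (E := ℝ) (F := ℝ) (p := x)).prodMk
    ((hasFDerivAt_snd (𝕜 := ℝ) (E := ℝ) (F := ℝ) (p := x)).const_mul √2))).mul_const
      (2 * Real.pi * √2)⁻¹
  have h3 : HasFDerivAt (branchAction V) _ x := h1
  have hpi := Real.pi_ne_zero
  rw [pd1_eq_of_hasFDerivAt h3, pd2_eq_of_hasFDerivAt h3]
  simp only [_root_.smul_apply, smul_eq_mul, ContinuousLinearMap.comp_apply,
    ContinuousLinearMap.prod_apply, ContinuousLinearMap.coe_snd', ContinuousLinearMap.coe_fst',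
    fderiv_pair_apply]
  constructor <;> field_simp <;> ring

namespace IsBranch

theorem tendsto_scale (p : ℝ × ℝ) :
    Tendsto (fun x : ℝ × ℝ => (x.1, √2 * x.2)) (𝓝 p) (𝓝 (p.1, √2 * p.2)) := by
  have h : ContinuousAt (fun x : ℝ × ℝ => (x.1, √2 * x.2)) p := by fun_prop
  exact h.tendsto

theorem contDiffAt_branchAction {V : ℝ × ℝ → ℝ} {p : ℝ × ℝ} (h : IsBranch V (p.1, √2 * p.2))
    {n : WithTop ℕ∞} : ContDiffAt ℝ n (branchAction V) p := by
  have h1 : ContDiffAt ℝ n (fun x : ℝ × ℝ => V (x.1, √2 * x.2)) p :=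
    ContDiffAt.comp (g := V) (f := fun x : ℝ × ℝ => (x.1, √2 * x.2)) p h.1.contDiffAt
      (by fun_prop)
  exact h1.div_const _

theorem eventually_branchAction {V : ℝ × ℝ → ℝ} {p : ℝ × ℝ} (h : IsBranch V (p.1, √2 * p.2)) :
    ∀ᶠ x in 𝓝 p, ∃ k : ℤ, branchAction V x = radialAction x.1 x.2 + k * x.2 ∧
      (p.2 ≤ x.2 → k = 0) := by
  have h2 : 0 < √2 := Real.sqrt_pos.2 two_pos
  filter_upwards [(tendsto_scale p).eventually h.2] with x hx
  obtain ⟨k, hk, hk0⟩ := hx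
  refine ⟨k, ?_, fun hle => hk0 (Or.inl (mul_le_mul_of_nonneg_left hle h2.le))⟩
  rw [scaledAction_sqrt_two_mul] at hk
  have hpi := Real.pi_pos
  rw [branchAction, div_eq_iff (by positivity)]
  linarith

theorem isLocalAction {V : ℝ × ℝ → ℝ} {p : ℝ × ℝ} (h : IsBranch V (p.1, √2 * p.2)) :
    IsLocalAction (branchAction V) p :=
  ⟨h.contDiffAt_branchAction, h.eventually_branchAction.mono fun _ ⟨k, hk, _⟩ => ⟨k, hk⟩⟩

theorem pd2_pd2_branchAction {V : ℝ × ℝ → ℝ} {p : ℝ × ℝ} (h : IsBranch V (p.1, √2 * p.2)) :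
    pd2 (pd2 (branchAction V)) p = -(√2 * twist p.1 (√2 * p.2)) := by
  have hpi := Real.pi_pos
  have h1 : pd2 (branchAction V) =ᶠ[𝓝 p] fun x => √2 * branchAction (pd2 V) x := by
    filter_upwards [(tendsto_scale p).eventually h.1.eventually_analyticAt] with x hx
    rw [(hasFDerivAt_branchAction hx.differentiableAt).2, branchAction]
    have h2 : √2 ≠ 0 := (Real.sqrt_pos.2 two_pos).ne'
    field_simp
  have h3 := (analyticAt_pd2 h.1).differentiableAt
  have h4 : DifferentiableAt ℝ (branchAction (pd2 V)) p := by
    have h5 : DifferentiableAt ℝ (fun x : ℝ × ℝ => pd2 V (x.1, √2 * x.2)) p :=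
      DifferentiableAt.comp (g := pd2 V) (f := fun x : ℝ × ℝ => (x.1, √2 * x.2)) p h3
        (by fun_prop)
    exact h5.mul_const (2 * Real.pi * √2)⁻¹
  rw [pd2_congr h1, pd2_eq_of_hasFDerivAt (h4.hasFDerivAt.const_mul √2)]
  have h5 := (hasFDerivAt_branchAction h3).2
  rw [_root_.smul_apply, smul_eq_mul, ← pd2.eq_def, h5]
  have h6 := h.twist_eq
  simp only at h6
  rw [← neg_eq_iff_eq_neg.2 h6]
  field_simp

/-- All local actions have the same second derivative in the second action. -/
theorem pd2_pd2_eq {V A : ℝ × ℝ → ℝ} {p : ℝ × ℝ} (h : IsBranch V (p.1, √2 * p.2))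
    (hA : IsLocalAction A p) : pd2 (pd2 A) p = pd2 (pd2 (branchAction V)) p := by
  set B := branchAction V with hB
  have hB2 : ContDiffAt ℝ 2 B p := h.contDiffAt_branchAction
  have hA2 : ContDiffAt ℝ 2 A p := hA.1.of_le two_le_infty
  have hev : ∀ᶠ t in 𝓝[>] p.2, t ≠ 0 ∧ ContDiffAt ℝ 2 A (p.1, t) ∧ ContDiffAt ℝ 2 B (p.1, t) ∧
      ∃ k : ℤ, A (p.1, t) - B (p.1, t) = k * t := by
    have hne : ∀ᶠ t in 𝓝[>] p.2, t ≠ 0 := by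
      rcases eq_or_ne p.2 0 with h0 | h0
      · filter_upwards [self_mem_nhdsWithin] with t ht
        rw [h0] at ht
        exact ne_of_gt ht
      · exact nhdsWithin_le_nhds (eventually_ne_nhds h0)
    filter_upwards [hne, nhdsWithin_le_nhds (eventually_slice (hA2.eventually (by simp))),
      nhdsWithin_le_nhds (eventually_slice (hB2.eventually (by simp))),
      nhdsWithin_le_nhds (eventually_slice h.eventually_branchAction),
      nhdsWithin_le_nhds (eventually_slice hA.2)] with t e1 e2 e3 e4 e5
    obtain ⟨k, hk, -⟩ := e4
    obtain ⟨l, hl⟩ := e5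
    refine ⟨e1, e2, e3, l - k, ?_⟩
    rw [hl, hB, hk]
    push_cast
    ring
  obtain ⟨b, hb, hab⟩ := mem_nhdsGT_iff_exists_Ioo_subset.1 hev
  -- To the right of `p.2` and away from `0`, the difference of the two actions divided by `j₂` is
  -- continuous and integer valued, hence constant.
  obtain ⟨n, hn⟩ := exists_int_eq_on_Ioo (f := fun t => (A (p.1, t) - B (p.1, t)) / t) hb
    (fun t ht => by
      obtain ⟨e1, e2, e3, -⟩ := hab ht
      have c : ContinuousAt (fun t : ℝ => (p.1, t)) t := by fun_prop
      have c1 : ContinuousAt (fun t : ℝ => A (p.1, t)) t :=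
        ContinuousAt.comp (g := A) (f := fun t : ℝ => (p.1, t)) e2.continuousAt c
      have c2 : ContinuousAt (fun t : ℝ => B (p.1, t)) t :=
        ContinuousAt.comp (g := B) (f := fun t : ℝ => (p.1, t)) e3.continuousAt c
      exact ((c1.sub c2).div continuousAt_id e1).continuousWithinAt)
    (fun t ht => by
      obtain ⟨e1, -, -, k, hk⟩ := hab ht
      exact ⟨k, by rw [hk, mul_div_cancel_right₀ _ e1]⟩)
  have hd : ∀ {G : ℝ × ℝ → ℝ}, ContDiffAt ℝ 2 G p →
      (∀ᶠ t in 𝓝 p.2, HasDerivAt (fun t => G (p.1, t)) (pd2 G (p.1, t)) t) ∧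
      HasDerivAt (fun t => pd2 G (p.1, t)) (pd2 (pd2 G) p) p.2 := by
    intro G hG
    refine ⟨?_, hasDerivAt_pd2 ((contDiffAt_pd2 hG).differentiableAt one_ne_zero)⟩
    filter_upwards [eventually_slice (hG.eventually (by simp))] with t ht
    exact hasDerivAt_pd2 (ht.differentiableAt two_ne_zero)
  have key := second_deriv_eq_zero_of_right
    (φ := fun t => A (p.1, t) - B (p.1, t) - n * t)
    (φ' := fun t => pd2 A (p.1, t) - pd2 B (p.1, t) - n * 1)
    (by
      filter_upwards [(hd hA2).1, (hd hB2).1] with t e1 e2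
      exact (e1.sub e2).sub ((hasDerivAt_id t).const_mul (n : ℝ)))
    (((hd hA2).2.sub (hd hB2).2).sub_const (n * 1 : ℝ))
    (by
      filter_upwards [Ioo_mem_nhdsGT hb] with t ht
      have e1 := hn t ht
      have e2 := (hab ht).1
      rw [div_eq_iff e2] at e1
      rw [e1, sub_self])
  linarith

end IsBranch

/-- Near the focus-focus value the derivative of the action by the energy is positive. -/
theorem IsRegularPart.eventually_pd1_pos {U : ℝ × ℝ → ℝ} (hU : IsRegularPart U) :
    ∀ᶠ q in 𝓝[≠] (0 : ℝ × ℝ),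
      0 < pd1 U q - (Real.log (vAction q ^ 2 + q.2 ^ 2) / 2 + 1) * pd1 vAction q := by
  have hρ : Tendsto (fun q : ℝ × ℝ => vAction q ^ 2 + q.2 ^ 2) (𝓝[≠] 0) (𝓝[>] 0) := by
    refine tendsto_nhdsWithin_iff.2 ⟨?_, ?_⟩
    · have h1 := ((analyticAt_vAction.continuousAt.pow 2).add (continuousAt_snd.pow 2)).tendsto
      simp only [Pi.add_apply, Pi.pow_apply, show vAction 0 = 0 from vanishingAction_zero,
        Prod.snd_zero, ne_eq, OfNat.ofNat_ne_zero, not_false_eq_true, zero_pow, add_zero] at h1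
      exact h1.mono_left nhdsWithin_le_nhds
    · exact eventually_nhdsWithin_iff.2 eventually_sq_add_sq_pos
  have hlog := Real.tendsto_log_nhdsGT_zero.comp hρ
  have h1 : Tendsto (pd1 vAction) (𝓝[≠] 0) (𝓝 1) := by
    have := (analyticAt_pd1 analyticAt_vAction).continuousAt.tendsto
    rw [eventually_pd1_vAction.self_of_nhds, moment_one_zero] at this
    exact this.mono_left nhdsWithin_le_nhds
  have h2 : Tendsto (pd1 U) (𝓝[≠] 0) (𝓝 (pd1 U 0)) :=
    (analyticAt_pd1 hU.1).continuousAt.tendsto.mono_left nhdsWithin_le_nhds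
  have h3 : Tendsto (fun q : ℝ × ℝ => -(Real.log (vAction q ^ 2 + q.2 ^ 2) / 2 + 1))
      (𝓝[≠] 0) atTop :=
    tendsto_neg_atBot_atTop.comp (tendsto_atBot_add_const_right _ 1
      (hlog.atBot_div_const two_pos))
  -- `∂J/∂h` tends to `1` and the logarithm to `-∞`: the period of the motion blows up at the
  -- singular fibre.
  have h4 := h2.add_atTop (h3.atTop_mul_pos one_pos h1)
  filter_upwards [h4.eventually_gt_atTop 0] with q hq
  linarith

/-- The positive derivative of the action by the energy permits solving for `h`, which gives `F`.
For any local action the determinant is a nonzero factor times `∂²A/∂j₂²`, and this derivative is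
`-√2` times the twist for every choice of the cycle. -/
theorem eventually_isoenergetic :
    ∀ᶠ p in 𝓝[≠] (0 : ℝ × ℝ), (∃ A F : ℝ × ℝ → ℝ, IsActionHamiltonian A F p) ∧
      ∀ A F : ℝ × ℝ → ℝ, IsActionHamiltonian A F p →
        (isoenergeticDet F (A p, p.2) = 0 ↔ twist p.1 (√2 * p.2) = 0) := by
  have h2 : 0 < √2 := Real.sqrt_pos.2 two_pos
  have hpi := Real.pi_pos
  obtain ⟨U, hU⟩ := exists_isRegularPart
  have ht : Tendsto (fun x : ℝ × ℝ => (x.1, √2 * x.2)) (𝓝[≠] 0) (𝓝[≠] 0) := by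
    refine tendsto_nhdsWithin_iff.2 ⟨?_, ?_⟩
    · have := (IsBranch.tendsto_scale 0).mono_left (nhdsWithin_le_nhds (s := {0}ᶜ))
      simpa [Prod.mk_zero_zero] using this
    · filter_upwards [self_mem_nhdsWithin] with x hx h0
      refine hx (Prod.ext (Prod.ext_iff.1 h0).1 ?_)
      have := (Prod.ext_iff.1 h0).2
      simpa [h2.ne'] using this
  filter_upwards [ht.eventually (eventually_nhdsWithin_iff.2 hU.eventually_exists_branch),
    ht.eventually hU.eventually_pd1_pos] with p h3 h4
  obtain ⟨V, hV, hV1, -⟩ := h3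
  have hpd : pd1 (branchAction V) p ≠ 0 := by
    rw [(hasFDerivAt_branchAction hV.1.differentiableAt).1, hV1.self_of_nhds]
    exact (div_pos h4 (by positivity)).ne'
  refine ⟨?_, fun A F hAF => ?_⟩
  · obtain ⟨F, hF, hl, -⟩ := (hV.contDiffAt_branchAction (n := ∞)).exists_solve_fst (by simp) hpd
    exact ⟨branchAction V, F, hV.isLocalAction, hF, hl⟩
  · obtain ⟨hA, hF, hl⟩ := hAF
    obtain ⟨e1, e2⟩ := isoenergeticDet_eq (hA.1.of_le two_le_infty)
      (hF.of_le two_le_infty) hl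
    have e3 : pd1 F (A p, p.2) ≠ 0 := fun h0 => by
      rw [h0, zero_mul] at e1
      exact zero_ne_one e1
    rw [e2, hV.pd2_pd2_eq hA, hV.pd2_pd2_branchAction]
    simp [e3]

end ChampagneBottle

/-! ### The main theorem -/

theorem mainTheorem6 :
    -- away from `j₂ = 0` the rotation number and the twist are ordinary derivatives,
    -- and the twist is continuous at every value near the focus-focus value
    (∀ᶠ p in 𝓝 (0 : ℝ × ℝ), p.2 ≠ 0 →
      HasDerivAt (fun s => ChampagneBottle.scaledAction p.1 s)
        (-ChampagneBottle.rotationNumber p.1 p.2) p.2 ∧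
      HasDerivAt (fun s => ChampagneBottle.rotationNumber p.1 s)
        (ChampagneBottle.twist p.1 p.2) p.2) ∧
    (∀ᶠ p in 𝓝[≠] (0 : ℝ × ℝ),
      ContinuousAt (fun q : ℝ × ℝ => ChampagneBottle.twist q.1 q.2) p) ∧
    -- in the coordinates `(j₁, j₂)` of the Birkhoff normal form
    (∃ Hbar : ℝ × ℝ → ℝ,
      AnalyticAt ℝ Hbar 0 ∧
      (∀ᶠ p in 𝓝 (0 : ℝ × ℝ), Hbar (ChampagneBottle.vanishingAction p.1 p.2, p.2) = p.1) ∧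
      (∀ K : ℝ × ℝ → ℝ, ChampagneBottle.IsBirkhoffNormalForm K →
        K =ᶠ[𝓝 (0 : ℝ × ℝ)] Hbar) ∧
      -- the expansion of `A`
      ((fun j : ℝ × ℝ => ChampagneBottle.slope Hbar j -
          (j.2 / 4 - 15 / 32 * j.1 * j.2 + j.2 * (135 * j.1 ^ 2 + 10 * j.2 ^ 2) / 128))
        =O[𝓝 (0 : ℝ × ℝ)] fun j : ℝ × ℝ => (j.1 ^ 2 + j.2 ^ 2) ^ 2) ∧
      -- `𝒯 = -A ∂W/∂j₁ + ∂W/∂j₂`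
      (∀ᶠ j in 𝓝 (0 : ℝ × ℝ), j.2 ≠ 0 →
        DifferentiableAt ℝ (ChampagneBottle.rotationNF Hbar) j ∧
        ChampagneBottle.twistNF Hbar j =
          -ChampagneBottle.slope Hbar j *
              ChampagneBottle.pd1 (ChampagneBottle.rotationNF Hbar) j +
            ChampagneBottle.pd2 (ChampagneBottle.rotationNF Hbar) j) ∧
      -- the expansion of the twist
      (∃ R₁ R₂ : ℝ × ℝ → ℝ,
        AnalyticAt ℝ R₁ 0 ∧ AnalyticAt ℝ R₂ 0 ∧
        ((fun j : ℝ × ℝ => R₁ j - (-(3 / 8) + 77 / 64 * j.1))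
          =O[𝓝 (0 : ℝ × ℝ)] fun j : ℝ × ℝ => j.1 ^ 2 + j.2 ^ 2) ∧
        ((fun j : ℝ × ℝ => R₂ j - (1 / 4 - 15 / 32 * j.1))
          =O[𝓝 (0 : ℝ × ℝ)] fun j : ℝ × ℝ => j.1 ^ 2 + j.2 ^ 2) ∧
        ∀ᶠ j in 𝓝[≠] (0 : ℝ × ℝ),
          2 * Real.pi * ChampagneBottle.twistNF Hbar j =
            j.1 * (ChampagneBottle.slope Hbar j ^ 2 - 1) / (j.1 ^ 2 + j.2 ^ 2) -
              2 * j.2 * ChampagneBottle.slope Hbar j / (j.1 ^ 2 + j.2 ^ 2) + R₁ j +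
              Real.log (16 / √(j.1 ^ 2 + j.2 ^ 2)) * R₂ j) ∧
      -- the value and the derivatives of `|j|² 2π𝒯` at the origin
      ContDiffAt ℝ 1 (ChampagneBottle.twistTilde Hbar) 0 ∧
      ChampagneBottle.twistTilde Hbar 0 = 0 ∧
      ChampagneBottle.pd1 (ChampagneBottle.twistTilde Hbar) 0 = -1 ∧
      ChampagneBottle.pd2 (ChampagneBottle.twistTilde Hbar) 0 = 0 ∧
      -- the vanishing-twist set is a `C¹` curve through the origin, tangent to `j₁ = 0`
      (∃ g : ℝ → ℝ, ContDiffAt ℝ 1 g 0 ∧ g 0 = 0 ∧ deriv g 0 = 0 ∧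
        ∀ᶠ j in 𝓝[≠] (0 : ℝ × ℝ),
          (ChampagneBottle.twistNF Hbar j = 0 ↔ j.1 = g j.2))) ∧
    -- the same curve in the plane of the values `(h, j₂)`
    (∃ c : ℝ → ℝ, ContDiffAt ℝ 1 c 0 ∧ c 0 = 0 ∧ deriv c 0 = 0 ∧
      ∀ᶠ p in 𝓝[≠] (0 : ℝ × ℝ), (ChampagneBottle.twist p.1 p.2 = 0 ↔ p.1 = c p.2)) ∧
    -- near the focus-focus value the iso-energetic non-degeneracy condition fails exactly where
    -- the twist vanishes (here `p` is the unscaled value of `(H, J₂)`)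
    (∀ᶠ p in 𝓝[≠] (0 : ℝ × ℝ),
      (∃ A F : ℝ × ℝ → ℝ, ChampagneBottle.IsActionHamiltonian A F p) ∧
      ∀ A F : ℝ × ℝ → ℝ, ChampagneBottle.IsActionHamiltonian A F p →
        (ChampagneBottle.isoenergeticDet F (A p, p.2) = 0 ↔
          ChampagneBottle.twist p.1 (√2 * p.2) = 0)) := by
  refine ⟨ChampagneBottle.eventually_hasDerivAt, ChampagneBottle.eventually_continuousAt_twist, ?_⟩
  obtain ⟨Hbar, h⟩ := ChampagneBottle.exists_isNormalHamiltonian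
  obtain ⟨U, hU⟩ := ChampagneBottle.exists_isRegularPart
  have hT := h.hasFDerivAt_twistTilde
  refine ⟨⟨Hbar, h.analyticAt, h.left, fun K hK => h.eq_of_isBirkhoffNormalForm hK, h.slope_isBigO,
    h.eventually_rotationNF, ⟨_, _, h.analyticAt_coeffOne hU, h.analyticAt_coeffTwo,
      h.coeffOne_isBigO hU, h.coeffTwo_isBigO,
      eventually_nhdsWithin_iff.2 (h.eventually_twistNF hU)⟩,
    h.contDiffAt_twistTilde, ChampagneBottle.IsNormalHamiltonian.twistTilde_zero, ?_, ?_, ?_⟩,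
    ?_, ChampagneBottle.eventually_isoenergetic⟩
  · rw [ChampagneBottle.pd1_eq_of_hasFDerivAt hT]
    simp
  · rw [ChampagneBottle.pd2_eq_of_hasFDerivAt hT]
    simp
  · obtain ⟨g, hg, hg0, hg1, hiff⟩ := h.exists_curve
    exact ⟨g, hg, hg0, hg1, eventually_nhdsWithin_iff.2 hiff⟩
  · obtain ⟨c, hc, hc0, hc1, hiff⟩ := h.exists_value_curve
    exact ⟨c, hc, hc0, hc1, eventually_nhdsWithin_iff.2 hiff⟩
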